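/- **Setting.** All parameters depend on a security parameter $k$. Let $n$ be a power of $2$, $\mathcal R=\mathbb Z[x]/(x^n+1)$ (elements are identified with coefficient vectors), $Q=pq$ with integers $p,q\ge 1$, and $\mathcal R_Q=\mathcal R/Q\mathcal R$; representatives modulo $N$ are taken in $\{-\lfloor N/2\rfloor,\dots,N-\lfloor N/2\rfloor-1\}$. Let $\mathcal T$ be the set of $v\in\mathcal R$ with exactly $w_+$ coefficients $1$, exactly $w_-$ coefficients $-1$ and all others $0$, and let $\chi=U(\mathcal T)$. Let $\mathcal M(a)$ be the matrix of multiplication by $a$, $\bar a=a(x^{-1})$, $\sigma_j(a)=a(x^j)$, $s_1$ the largest singular value, $D_{L,\sqrt\Sigma}$ the discrete Gaussian on $L$ with weights $\exp(-\pi x^t\Sigma^{-1}x)$, $\eta_\epsilon(\mathbb Z^n)$ the smoothing parameter, and $\gamma=\sqrt{s^2+(p^2-1)/12}\,/s$. Let $H:\{0,1\}^*\times\{0,1\}^{\ell}\to\mathcal R_Q$ and $\mathsf{Expand}:\{0,1\}^{\ell'}\to\mathcal R_Q$ be random oracles. **The scheme Eagle.** *Key generation.* Sample a uniform $\mathsf{seed}\in\{0,1\}^{\ell'}$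 and put $a=\mathsf{Expand}(\mathsf{seed})$. Sample $f_1,\dots,f_5,g_1,\dots,g_5$ uniformly from $\mathcal T$. Run through the pairs $(i,j)$ in lexicographic order; for each choose $\kappa\in\mathbb Z_n^*$ (represented in $\{0,\dots,n-1\}$, least minimizer) minimizing $s_1(\mathcal M(f_i\bar f_i+\sigma_\kappa(g_j)\overline{\sigma_\kappa(g_j)}))$ and put $(f,g)=(f_i,\sigma_\kappa(g_j))$; stop at the first pair with $\sqrt{s_1(\mathcal M(f\bar f+g\bar g))}\le\alpha\sqrt{2(w_++w_-)}$. If there is none, restart. The secret key is $(f,g)$, the public key is $(\mathsf{seed},b)$ with $b=p-(af+g)\bmod Q$. *Signing $\mathsf{msg}$.* Sample a uniform $\mathsf{salt}\in\{0,1\}^{\ell}$, let $u=H(\mathsf{msg},\mathsf{salt})$, $A=[I\mid\mathcal M(a)\mid\mathcal M(b)]$ and $T=\left[\begin{smallmatrix}\mathcal M(g)\\ \mathcal M(f)\\ I\end{smallmatrix}\right]$. Sample $y\leftarrow D_{\mathbb Z^{3n},\sqrt{s^2I-r^2TT^t}}$, put $u'=u-Ay\bmod Q$, decode $u'=e+pc$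 with $e=u'\bmod p$ coefficientwise, sample $x'\leftarrow D_{q\mathbb Z^n+c,\,r}$ and put $(z_0,z_1,z_2)=y+Tx'$. If $\|(z_0+e,\gamma z_1,\gamma z_2)\|>\beta$, restart; otherwise output $(\mathsf{salt},(z_1,z_2))$. *Verification.* Accept iff $\|(z',\gamma z_1,\gamma z_2)\|\le\beta$, where $z'=H(\mathsf{msg},\mathsf{salt})-az_1-bz_2\bmod Q$. **Conventions.** Algorithms (adversaries, solvers, distinguishers) are non-uniform probabilistic polynomial-time, i.e. families of probabilistic (oracle) circuits of polynomial size. "Negligible" is with respect to $k$. * $\mathsf{RSIS}^{\|\cdot\|_\gamma}_{\mathcal R,3,Q,2\beta}$ is hard if every algorithm that is given a uniform $A\in\mathcal R_Q^3$ finds only with negligible probability a nonzero $(x_0,x_1,x_2)\in\mathcal R^3$ with $\sum_iA_ix_i=0\bmod Q$ and $\|(x_0,\gamma x_1,\gamma x_2)\|\le2\beta$. * $\mathsf{RLWE}_{\mathcal R,1,Q,\chi}$ (decision version) is hard if every algorithm distinguishes $(a,as+e)$, for uniform $a\in\mathcal R_Q$ and independent $s,e\leftarrow\chi$, from a uniform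 element of $\mathcal R_Q^2$ only with negligible advantage. **Theorem.** Assume that 1. $n$ and the bit length of $Q$ are polynomially bounded and $2^{-\ell}$ is negligible; 2. $0<w_++w_-\le n$ and $|w_+-w_-|\le1$; 3. for some negligible $\epsilon>0$: $r\ge q\,\eta_\epsilon(\mathbb Z^n)$, $s>0$ and $s^2\ge\bigl(r^2+\eta_\epsilon(\mathbb Z^n)^2\bigr)\bigl(2\alpha^2(w_++w_-)+2\bigr)$; 4. one round of the key generation succeeds with probability at least the inverse of a polynomial in $k$; 5. for $(z_0,z_1,z_2)\leftarrow D_{\mathbb Z^{3n},s}$ and a uniform $e\in\{-\lfloor p/2\rfloor,\dots,p-\lfloor p/2\rfloor-1\}^n$, the probability that $\|(z_0+e,\gamma z_1,\gamma z_2)\|>\beta$ is negligible. If $\mathsf{RSIS}^{\|\cdot\|_\gamma}_{\mathcal R,3,Q,2\beta}$ and $\mathsf{RLWE}_{\mathcal R,1,Q,\chi}$ are hard, then Eagle is strongly existentially unforgeable under chosen-message attacks in the random oracle model: every adversary that is given the public key and access to $H$, $\mathsf{Expand}$ and a signing oracle outputs only with negligible probability a pair of a message and a valid signature on it that was not issued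 by the signing oracle. -/

import Mathlib

open scoped ENNReal

namespace Eagle

/-! ### Asymptotics -/

/-- `f` is negligible: it decays faster than the inverse of every polynomial. -/
def Negligible (f : ℕ → ℝ) : Prop :=
  Asymptotics.SuperpolynomialDecay Filter.atTop (fun k : ℕ => (k : ℝ)) f

/-- `f` is bounded by a polynomial in the security parameter. -/
def PolyBounded (f : ℕ → ℕ) : Prop :=
  ∃ B : Polynomial ℕ, ∀ k, f k ≤ B.eval k

/-! ### Algorithms: probabilistic integer circuits with oracle gates

A non-uniform algorithm is a straight-line program over a growing memory of integer words.  Each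
instruction appends its result to the memory.  Every value that enters the memory must fit the word
length `word` (otherwise it is replaced by `0`), and both the word length and the number of
instructions count towards the size of the program, so that families of programs of polynomial size
are the non-uniform probabilistic polynomial-time oracle algorithms. -/

/-- Instructions. Arguments are memory addresses; `query o args` calls the oracle `o`. -/
inductive Instr (O : Type) where
  | const (c : ℤ)
  | plus (i j : ℕ)
  | minus (i j : ℕ)
  | times (i j : ℕ)
  | quot (i j : ℕ)
  | rem (i j : ℕ)
  | less (i j : ℕ)
  | coin
  | query (o : O) (args : List ℕ)

/-- The cost of one instruction. -/
def Instr.cost {O : Type} : Instr O → ℕ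
  | .query _ args => 1 + args.length
  | _ => 1

/-- A program: word length, code, and the addresses of the output words. -/
structure Program (O : Type) where
  word : ℕ
  code : List (Instr O)
  out : List ℕ

/-- The size of a program; it bounds the word length, the number of steps and of oracle calls. -/
def Program.size {O : Type} (A : Program O) : ℕ :=
  A.word + (A.code.map Instr.cost).sum + A.out.length

/-- Words of length `w`: integers of absolute value below `2 ^ w`. -/
def fit (w : ℕ) (v : ℤ) : ℤ := if |v| < 2 ^ w then v else 0

/-- The words produced by one instruction on the memory `mem`. -/
noncomputable def Instr.eval {O σ : Type} (oracle : O → List ℤ → StateT σ PMF (List ℤ))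
    (mem : List ℤ) : Instr O → StateT σ PMF (List ℤ)
  | .const c => pure [c]
  | .plus i j => pure [mem.getD i 0 + mem.getD j 0]
  | .minus i j => pure [mem.getD i 0 - mem.getD j 0]
  | .times i j => pure [mem.getD i 0 * mem.getD j 0]
  | .quot i j => pure [mem.getD i 0 / mem.getD j 0]
  | .rem i j => pure [mem.getD i 0 % mem.getD j 0]
  | .less i j => pure [if mem.getD i 0 < mem.getD j 0 then 1 else 0]
  | .coin => do
      let c ← PMF.uniformOfFintype Bool
      pure [if c then 1 else 0]
  | .query o args => oracle o (args.map fun i => mem.getD i 0)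

/-- Execution of a list of instructions; returns the final memory. -/
noncomputable def exec {O σ : Type} (w : ℕ) (oracle : O → List ℤ → StateT σ PMF (List ℤ)) :
    List (Instr O) → List ℤ → StateT σ PMF (List ℤ)
  | [], mem => pure mem
  | i :: is, mem => do
      let ans ← i.eval oracle mem
      exec w oracle is (mem ++ ans.map (fit w))

/-- Run a program on a list of input words; returns the list of output words. -/
noncomputable def Program.run {O σ : Type} (A : Program O)
    (oracle : O → List ℤ → StateT σ PMF (List ℤ)) (input : List ℤ) : StateT σ PMF (List ℤ) := do
  let mem ← exec A.word oracle A.code (input.map (fit A.word))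
  pure (A.out.map fun i => mem.getD i 0)

/-- Run a program that has no oracle. -/
noncomputable def Program.runPlain (A : Program Empty) (input : List ℤ) : PMF (List ℤ) := do
  let res ← (A.run (σ := Unit) (fun o _ => o.elim) input).run ()
  pure res.1

/-! ### Distributions -/

/-- The uniform distribution on a finite set (which is nonempty wherever this is used). -/
noncomputable def uniformOn {α : Type} [Inhabited α] (S : Finset α) : PMF α :=
  open Classical in if h : S.Nonempty then PMF.uniformOfFinset S h else PMF.pure default

/-- `m` independent samples. -/
noncomputable def iid {α : Type} (μ : PMF α) : ℕ → PMF (List α)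
  | 0 => pure []
  | m + 1 => do
      let x ← μ
      let xs ← iid μ m
      pure (x :: xs)

/-- The Gaussian function `exp (-π xᵗ S⁻¹ x)` of covariance parameter `S`. -/
noncomputable def gaussianWeight {ι : Type} [Fintype ι] [DecidableEq ι] (S : Matrix ι ι ℝ)
    (x : ι → ℤ) : ℝ :=
  Real.exp (-Real.pi * ((fun i => (x i : ℝ)) ⬝ᵥ (S⁻¹).mulVec fun i => (x i : ℝ)))

/-- The discrete Gaussian distribution on the set `L` (a coset of a lattice in `ℤ^ι`) with covariance
parameter `S`.  For positive definite `S` and nonempty `L` the weights have a finite positive sum. -/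
noncomputable def discreteGaussian {ι : Type} [Fintype ι] [DecidableEq ι] (L : Set (ι → ℤ))
    (S : Matrix ι ι ℝ) : PMF (ι → ℤ) :=
  let w : (ι → ℤ) → ℝ≥0∞ := L.indicator fun x => ENNReal.ofReal (gaussianWeight S x)
  open Classical in
  if h : (∑' x, w x) ≠ 0 ∧ (∑' x, w x) ≠ ⊤ then PMF.normalize w h.1 h.2 else PMF.pure 0

/-- The smoothing parameter `η_ε(ℤⁿ)`, the least `t > 0` such that `ρ(t • (ℤⁿ)*) ≤ 1 + ε`; the lattice
`ℤⁿ` is its own dual. -/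
noncomputable def smoothing (n : ℕ) (ε : ℝ) : ℝ :=
  sInf {t : ℝ | 0 < t ∧ ∑' z : Fin n → ℤ, Real.exp (-Real.pi * ∑ i, (t * z i) ^ 2) ≤ 1 + ε}

/-! ### The ring `ℤ[x] / (xⁿ + 1)`

An element is identified with its vector of coefficients. -/

/-- The anticirculant matrix of `a`, whose `j`-th column is the coefficient vector of `a * x ^ j`. -/
def anticirculant {S : Type} [Neg S] {n : ℕ} (a : Fin n → S) : Matrix (Fin n) (Fin n) S :=
  Matrix.of fun i j => if j ≤ i then a (i - j) else -a (i - j)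

/-- The product in `S[x] / (xⁿ + 1)`. -/
def ringMul {S : Type} [CommRing S] {n : ℕ} (a b : Fin n → S) : Fin n → S :=
  (anticirculant a).mulVec b

/-- The conjugate `a(x⁻¹) = a₀ - ∑_{i ≠ 0} a_{n-i} xⁱ` (the negation of indices is modulo `n`). -/
def conj {n : ℕ} (a : Fin n → ℤ) : Fin n → ℤ :=
  fun i => if (i : ℕ) = 0 then a i else -a (-i)

/-- The automorphism `σ_k(a) = a(x ^ k)`, where `x ^ (i k) = (-1) ^ ⌊i k / n⌋ x ^ (i k mod n)`. -/
def galois {n : ℕ} (k : ℕ) (a : Fin n → ℤ) : Fin n → ℤ :=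
  fun j => ∑ i : Fin n, if (i * k) % n = (j : ℕ) then (-1) ^ (i * k / n) * a i else 0

/-- Reduction of an integer vector modulo `Q`. -/
def modQ {ι : Type} (Q : ℕ) (x : ι → ℤ) : ι → ZMod Q := fun i => (x i : ZMod Q)

/-- The representative with coefficients in `{-⌊Q/2⌋, …, Q - ⌊Q/2⌋ - 1}`. -/
def centered {ι : Type} {Q : ℕ} (u : ι → ZMod Q) : ι → ℤ := fun i => Int.bmod (u i).val Q

/-- The words of an element of the ring modulo `Q`. -/
def words {n Q : ℕ} (u : Fin n → ZMod Q) : List ℤ := List.ofFn fun i => ((u i).val : ℤ)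

/-- The largest singular value of an integer matrix. -/
noncomputable def s1 {n : ℕ} (M : Matrix (Fin n) (Fin n) ℤ) : ℝ :=
  ‖Matrix.toEuclideanCLM (𝕜 := ℝ) (M.map fun t => (t : ℝ))‖

/-- The ternary vectors with exactly `a` coefficients `1`, exactly `b` coefficients `-1` and all
other coefficients `0`. -/
def ternary (n a b : ℕ) : Finset (Fin n → ℤ) :=
  (Fintype.piFinset fun _ => ({-1, 0, 1} : Finset ℤ)).filter fun v =>
    (Finset.univ.filter fun i => v i = 1).card = a ∧
      (Finset.univ.filter fun i => v i = -1).card = b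

/-- The twisted norm `‖(x₀, γ x₁, …, γ x_{m-1})‖` of `m` ring elements. -/
noncomputable def twistedNorm {m n : ℕ} (γ : ℝ) (x : Fin m × Fin n → ℤ) : ℝ :=
  Real.sqrt (∑ c : Fin m × Fin n, ((if (c.1 : ℕ) = 0 then 1 else γ) * (x c : ℝ)) ^ 2)

/-! ### Ring-SIS in the twisted norm -/

/-- `∑ᵢ Aᵢ xᵢ` in the ring modulo `Q`. -/
def applyRow {m n Q : ℕ} (A : Fin m → Fin n → ZMod Q) (x : Fin m × Fin n → ℤ) : Fin n → ZMod Q :=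
  ∑ i, ringMul (A i) (modQ Q fun j => x (i, j))

open Classical in
/-- The solver gets a uniformly random row of `m` ring elements modulo `Q`, and wins if it outputs a
nonzero integral `x` with `A x = 0 mod Q` and twisted norm at most `β`. -/
noncomputable def rsisExperiment (n m Q : ℕ) [NeZero Q] (γ β : ℝ) (S : Program Empty) :
    PMF Bool := do
  let A ← PMF.uniformOfFintype (Fin m → Fin n → ZMod Q)
  let out ← S.runPlain (List.ofFn fun i => words (A i)).flatten
  let x : Fin m × Fin n → ℤ := fun c => out.getD (c.1 * n + c.2) 0
  pure (decide (x ≠ 0 ∧ applyRow A x = 0 ∧ twistedNorm γ x ≤ β))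

/-- Hardness of Ring-SIS in the twisted norm for a family of parameters. -/
def RSISHard (n : ℕ → ℕ) (m : ℕ) (Q : ℕ → ℕ) [∀ k, NeZero (Q k)] (γ β : ℕ → ℝ) : Prop :=
  ∀ S : ℕ → Program Empty, (PolyBounded fun k => (S k).size) →
    Negligible fun k => (rsisExperiment (n k) m (Q k) (γ k) (β k) (S k) true).toReal

/-! ### Decision Ring-LWE -/

/-- One sample `(a, a s + e)` with uniform `a` and `e` drawn from `χ`. -/
noncomputable def rlweSample {n : ℕ} (Q : ℕ) [NeZero Q] (χ : PMF (Fin n → ℤ))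
    (s : Fin n → ZMod Q) : PMF ((Fin n → ZMod Q) × (Fin n → ZMod Q)) := do
  let a ← PMF.uniformOfFintype (Fin n → ZMod Q)
  let e ← χ
  pure (a, ringMul a s + modQ Q e)

/-- `m` Ring-LWE samples with one secret drawn from `χ`. -/
noncomputable def rlweReal {n : ℕ} (m Q : ℕ) [NeZero Q] (χ : PMF (Fin n → ℤ)) :
    PMF (List ((Fin n → ZMod Q) × (Fin n → ZMod Q))) := do
  let s ← χ
  iid (rlweSample Q χ (modQ Q s)) m

/-- `m` uniform samples. -/
noncomputable def rlweUniform (n m Q : ℕ) [NeZero Q] :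
    PMF (List ((Fin n → ZMod Q) × (Fin n → ZMod Q))) :=
  iid (PMF.uniformOfFintype ((Fin n → ZMod Q) × (Fin n → ZMod Q))) m

/-- The probability that the distinguisher outputs `1`. -/
noncomputable def acceptProb {n Q : ℕ}
    (μ : PMF (List ((Fin n → ZMod Q) × (Fin n → ZMod Q)))) (D : Program Empty) : ℝ :=
  ((do
    let l ← μ
    let out ← D.runPlain (l.map fun t => words t.1 ++ words t.2).flatten
    pure (decide (out.getD 0 0 = 1)) : PMF Bool) true).toReal

/-- Hardness of decision Ring-LWE for a family of parameters. -/
def RLWEHard (n : ℕ → ℕ) (m : ℕ) (Q : ℕ → ℕ) [∀ k, NeZero (Q k)]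
    (χ : ∀ k, PMF (Fin (n k) → ℤ)) : Prop :=
  ∀ D : ℕ → Program Empty, (PolyBounded fun k => (D k).size) →
    Negligible fun k => |acceptProb (rlweReal m (Q k) (χ k)) (D k) -
      acceptProb (rlweUniform (n k) m (Q k)) (D k)|

/-! ### Approximate preimage sampling with the gadget `p I` -/

/-- The decoding error of `u`: its coefficients reduced to `{-⌊p/2⌋, …, p - ⌊p/2⌋ - 1}`. -/
def gadgetError {n Q : ℕ} (p : ℕ) (u : Fin n → ZMod Q) : Fin n → ℤ :=
  fun i => Int.bmod (u i).val p

/-- The semi-random gadget sampler: decode `u - e = p c`, then sample from `q ℤⁿ + c`. -/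
noncomputable def gadgetSample {n Q : ℕ} (p q : ℕ) (r : ℝ) (u : Fin n → ZMod Q) :
    PMF (Fin n → ℤ) :=
  let c : Fin n → ℤ := fun i => (((u i).val : ℤ) - gadgetError p u i) / p
  discreteGaussian {x | ∀ i, (q : ℤ) ∣ x i - c i} (r ^ 2 • (1 : Matrix (Fin n) (Fin n) ℝ))

/-- Approximate preimage sampling for a matrix `A` modulo `Q` with trapdoor `T`. -/
noncomputable def preSample {ι : Type} [Fintype ι] [DecidableEq ι] {n Q : ℕ} (p q : ℕ) (r s : ℝ)
    (A : Matrix (Fin n) ι (ZMod Q)) (T : Matrix ι (Fin n) ℤ) (u : Fin n → ZMod Q) :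
    PMF (ι → ℤ) := do
  let TR : Matrix ι (Fin n) ℝ := T.map fun t => (t : ℝ)
  let y ← discreteGaussian Set.univ (s ^ 2 • (1 : Matrix ι ι ℝ) - r ^ 2 • (TR * TR.transpose))
  let x ← gadgetSample p q r (u - A.mulVec (modQ Q y))
  pure (y + T.mulVec x)

/-! ### The signature scheme -/

/-- Parameters of the scheme. The ring is `ℤ[x] / (xⁿ + 1)` with `n = 2 ^ logn`, and `Q = p q`. -/
structure Params where
  logn : ℕ
  p : ℕ
  q : ℕ
  p_pos : 0 < p
  q_pos : 0 < q
  /-- number of coefficients `1` of a secret -/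
  a : ℕ
  /-- number of coefficients `-1` of a secret -/
  b : ℕ
  /-- quality of the trapdoor -/
  α : ℝ
  /-- width of the gadget sampler -/
  r : ℝ
  /-- width of the approximate preimages -/
  s : ℝ
  /-- acceptance bound -/
  β : ℝ
  seedLen : ℕ
  saltLen : ℕ

namespace Params

variable (P : Params)

/-- The degree of the ring. -/
abbrev n : ℕ := 2 ^ P.logn

/-- The modulus. -/
abbrev Q : ℕ := P.p * P.q

instance : NeZero P.p := ⟨P.p_pos.ne'⟩

instance : NeZero P.Q := ⟨(Nat.mul_pos P.p_pos P.q_pos).ne'⟩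

/-- Elements of `ℤ[x] / (xⁿ + 1)`. -/
abbrev R : Type := Fin P.n → ℤ

/-- Elements of the ring modulo `Q`. -/
abbrev RQ : Type := Fin P.n → ZMod P.Q

/-- The scaling factor of the twisted norm. -/
noncomputable def γ : ℝ := Real.sqrt (P.s ^ 2 + ((P.p : ℝ) ^ 2 - 1) / 12) / P.s

/-- The uniform distribution on the ternary polynomials of the given weights. -/
noncomputable def χ : PMF P.R := uniformOn (ternary P.n P.a P.b)

/-- `s₁(M(f f̄ + g ḡ))`. -/
noncomputable def quality (f g : P.R) : ℝ :=
  s1 (anticirculant (ringMul f (conj f) + ringMul g (conj g)))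

/-- The index `k` in `(ℤ/n)ˣ` for which `(f, σ_k(g))` has the best quality. -/
noncomputable def bestIndex (f g : P.R) : ℕ :=
  open Classical in
  (((List.range P.n).filter fun k => Nat.Coprime k P.n).argmin
    fun k => P.quality f (galois k g)).getD 1

/-- One trial of the key generation on `5 + 5` ternary polynomials: the first pair
`(f_i, σ_k(g_j))`, in lexicographic order of `(i, j)`, that passes the quality test. -/
noncomputable def keyTrial (F G : Fin 5 → P.R) : Option (P.R × P.R) :=
  ((List.finRange 5).product (List.finRange 5)).findSome? fun t =>
    let f := F t.1
    let g := galois (P.bestIndex f (G t.2)) (G t.2)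
    open Classical in
    if Real.sqrt (P.quality f g) ≤ P.α * Real.sqrt (2 * (P.a + P.b)) then some (f, g) else none

/-- All inputs of a trial. -/
def trials : Finset ((Fin 5 → P.R) × (Fin 5 → P.R)) :=
  (Fintype.piFinset fun _ => ternary P.n P.a P.b) ×ˢ
    (Fintype.piFinset fun _ => ternary P.n P.a P.b)

/-- The inputs on which the trial succeeds. -/
noncomputable def goodTrials : Finset ((Fin 5 → P.R) × (Fin 5 → P.R)) :=
  P.trials.filter fun t => (P.keyTrial t.1 t.2).isSome

/-- The probability that a trial of the key generation succeeds. -/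
noncomputable def trialProb : ℝ := P.goodTrials.card / P.trials.card

/-- The secret key `(f, g)`: trials with fresh randomness are repeated until one succeeds, so that the
input of the successful trial is uniform among the good ones. -/
noncomputable def secretKey : PMF (P.R × P.R) := do
  let t ← uniformOn P.goodTrials
  pure ((P.keyTrial t.1 t.2).getD (0, 0))

/-- The public row `[1 | a | b]` as a matrix modulo `Q`. -/
def pubMatrix (a b : P.RQ) : Matrix (Fin P.n) (Fin 3 × Fin P.n) (ZMod P.Q) :=
  Matrix.of fun i c => (![1, anticirculant a, anticirculant b] c.1) i c.2

/-- The trapdoor with blocks `g`, `f`, `1`. -/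
def trapdoor (f g : P.R) : Matrix (Fin 3 × Fin P.n) (Fin P.n) ℤ :=
  Matrix.of fun c j => (![anticirculant g, anticirculant f, 1] c.1) c.2 j

/-- Messages: every finite binary string is coded by an integer. -/
abbrev Msg : Type := ℤ

/-- Signatures `(salt, (z₁, z₂))`. -/
abbrev Sig : Type := BitVec P.saltLen × (P.R × P.R)

/-- State of the security experiment: the lazily sampled random oracles `H` and `Expand`, the
signatures that were issued, and a flag recording that a signing query did not terminate. -/
structure State where
  hash : Msg × BitVec P.saltLen → Option P.RQ
  expand : BitVec P.seedLen → Option P.RQ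
  signed : List (Msg × P.Sig)
  stuck : Bool

/-- The state before the experiment. -/
def State.start : P.State := ⟨fun _ => none, fun _ => none, [], false⟩

/-- The random oracle `H` on a message and a salt. -/
noncomputable def hash (m : Msg) (salt : BitVec P.saltLen) : StateT P.State PMF P.RQ := do
  let st ← get
  match st.hash (m, salt) with
  | some u => pure u
  | none => do
      let u ← PMF.uniformOfFintype P.RQ
      set { st with hash := Function.update st.hash (m, salt) (some u) }
      pure u

/-- The random oracle `Expand` on a seed. -/
noncomputable def expand (seed : BitVec P.seedLen) : StateT P.State PMF P.RQ := do
  let st ← get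
  match st.expand seed with
  | some u => pure u
  | none => do
      let u ← PMF.uniformOfFintype P.RQ
      set { st with expand := Function.update st.expand seed (some u) }
      pure u

open Classical in
/-- One attempt at signing; `none` means restart. -/
noncomputable def signAttempt (seed : BitVec P.seedLen) (b : P.RQ) (f g : P.R) (m : Msg) :
    StateT P.State PMF (Option P.Sig) := do
  let a ← P.expand seed
  let salt ← PMF.uniformOfFintype (BitVec P.saltLen)
  let u ← P.hash m salt
  let z ← preSample P.p P.q P.r P.s (P.pubMatrix a b) (P.trapdoor f g) u
  let e : P.R := centered (u - (P.pubMatrix a b).mulVec (modQ P.Q z))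
  let v : Fin 3 × Fin P.n → ℤ := fun c => if c.1 = 0 then z c + e c.2 else z c
  if twistedNorm P.γ v ≤ P.β then pure (some (salt, (fun i => z (1, i)), fun i => z (2, i)))
  else pure none

/-- Signing with at most `fuel` attempts. -/
noncomputable def sign (seed : BitVec P.seedLen) (b : P.RQ) (f g : P.R) (m : Msg) :
    ℕ → StateT P.State PMF (Option P.Sig)
  | 0 => pure none
  | fuel + 1 => do
      match ← P.signAttempt seed b f g m with
      | some sig => pure (some sig)
      | none => sign seed b f g m fuel

open Classical in
/-- Verification under the public key `(seed, b)`. -/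
noncomputable def verify (seed : BitVec P.seedLen) (b : P.RQ) (m : Msg) (sig : P.Sig) :
    StateT P.State PMF Bool := do
  let u ← P.hash m sig.1
  let a ← P.expand seed
  let z' : P.R := centered
    (u - ringMul a (modQ P.Q sig.2.1) - ringMul b (modQ P.Q sig.2.2))
  let v : Fin 3 × Fin P.n → ℤ := fun c => (![z', sig.2.1, sig.2.2] c.1) c.2
  pure (decide (twistedNorm P.γ v ≤ P.β))

open Classical in
/-- The probability that an ideal approximate preimage, `(z₀, z₁, z₂)` from the discrete Gaussian of
width `s` with uniform error `e`, exceeds the acceptance bound. -/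
noncomputable def restartProb : ℝ :=
  ((do
    let z ← discreteGaussian (ι := Fin 3 × Fin P.n) Set.univ (P.s ^ 2 • 1)
    let t ← PMF.uniformOfFintype (Fin P.n → ZMod P.p)
    let v : Fin 3 × Fin P.n → ℤ := fun c => if c.1 = 0 then z c + centered t c.2 else z c
    pure (decide (P.β < twistedNorm P.γ v)) : PMF Bool) true).toReal

end Params

/-! ### Strong unforgeability under chosen-message attacks in the random oracle model -/

/-- The oracles of the adversary: the two random oracles and the signing oracle. -/
inductive Oracle where
  | hash
  | expand
  | sign

namespace Params

variable (P : Params)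

/-- The answers of the oracles. A hash query consists of a message and a salt, an expansion query of a
seed, and a signing query of a message. Issued signatures are recorded. -/
noncomputable def answer (seed : BitVec P.seedLen) (b : P.RQ) (f g : P.R) (fuel : ℕ) :
    Oracle → List ℤ → StateT P.State PMF (List ℤ)
  | .hash, args => do
      let u ← P.hash (args.getD 0 0) (BitVec.ofInt P.saltLen (args.getD 1 0))
      pure (words u)
  | .expand, args => do
      let a ← P.expand (BitVec.ofInt P.seedLen (args.getD 0 0))
      pure (words a)
  | .sign, args => do
      let m : Msg := args.getD 0 0
      match ← P.sign seed b f g m fuel with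
      | some sig => do
          modify fun st => { st with signed := (m, sig) :: st.signed }
          pure ((sig.1.toNat : ℤ) :: (List.ofFn sig.2.1 ++ List.ofFn sig.2.2))
      | none => do
          modify fun st => { st with stuck := true }
          pure []

/-- The security experiment, in which a signing query makes at most `fuel` attempts. The adversary gets
the public key `(seed, b)` with `b = p - (a f + g)`, and wins if it outputs a message with a valid
signature on it such that the pair was not issued by the signing oracle. It loses if a signing query ran
out of fuel. -/
noncomputable def forgeExperiment (A : Program Oracle) (fuel : ℕ) : PMF Bool := do
  let res ← StateT.run (s := State.start P) (m := PMF) (σ := P.State) (α := Bool) do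
    let seed ← PMF.uniformOfFintype (BitVec P.seedLen)
    let a ← P.expand seed
    let fg ← P.secretKey
    let b : P.RQ := modQ P.Q (fun i : Fin P.n => if (i : ℕ) = 0 then (P.p : ℤ) else 0) -
      (ringMul a (modQ P.Q fg.1) + modQ P.Q fg.2)
    let out ← A.run (P.answer seed b fg.1 fg.2 fuel) ((seed.toNat : ℤ) :: words b)
    let m : Msg := out.getD 0 0
    let sig : P.Sig := (BitVec.ofInt P.saltLen (out.getD 1 0),
      (fun i => out.getD (2 + i) 0), fun i => out.getD (2 + P.n + i) 0)
    let ok ← P.verify seed b m sig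
    let st ← get
    pure (decide (ok = true ∧ (m, sig) ∉ st.signed ∧ st.stuck = false))
  pure res.1

/-- The success probability of the adversary. Signing restarts until it succeeds, which is the limit
of the (increasing) success probabilities as the number of attempts grows. -/
noncomputable def forgeProb (A : Program Oracle) : ℝ :=
  (⨆ fuel, P.forgeExperiment A fuel true).toReal

end Params

/-- Strong existential unforgeability under chosen-message attacks in the random oracle model. -/
def StronglyUnforgeable (P : ℕ → Params) : Prop :=
  ∀ A : ℕ → Program Oracle, (PolyBounded fun k => (A k).size) →
    Negligible fun k => (P k).forgeProb (A k)

/-- `f` is at least the inverse of a polynomial. -/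
def Noticeable (f : ℕ → ℝ) : Prop :=
  ∃ B : Polynomial ℕ, ∀ k, 1 ≤ ((B.eval k : ℕ) : ℝ) * f k

end Eagle

set_option linter.unusedSectionVars false

namespace Eagle

/-! ### Expectations -/

/-! The proof is the hash-and-sign argument for an approximate trapdoor, carried out with explicit
programs and with nonnegative expectations `ex` instead of couplings.

Put `A = [1 | a | b]`, so that `A T = p`. Decoding modulo `p q` splits a uniform target into a
uniform coset of `q ℤⁿ` and an independent uniform error modulo `p`. Hence a uniform hash value
together with its signature vector has exactly the law of `(A z + e, z)`, where `z = y + T x` and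
`x` is Gaussian on a uniformly random coset (`ex_preSample`, `ex_target`). A simulator without the
trapdoor can therefore draw the short vector `h = (z₀ + e, z₁, z₂)` first and program `H` with
`target a b h`. The covariances of `y` and `T x` add up to `s² I`. Completing the square shows that
the law of `z` is pointwise at most `exp (6 ε + 3 √(8 n ε))` times the spherical Gaussian
(`realLaw_le`). A pointwise ratio can be raised to the number of steps, and since `ε` is negligible
the power is eventually at most 3.

`ex_exec_le` is the hybrid argument: the real success probability is at most the simulated one plus
a loss per step. The losses are repeated salts, rejections at the first attempt, and the event that
the adversary outputs exactly the preimage hidden behind a hash value it received directly. The last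
event has probability at most `(60 / r) ^ n`: the combination `z₁ - f z₂` does not depend on `x`,
and the perturbation `y` alone makes it unpredictable (`ex_preSample_block_le`). Otherwise a new
valid forgery and the programmed preimage are distinct short vectors with the same image, and their
difference solves Ring-SIS for the row `(1, a, b)` (`Forges.solution`).

The secret key is neither independent nor of the law `χ`: it is selected among 25 pairs, one member
is twisted by an automorphism that depends on both, and the trial is conditioned to succeed. Since
all quantities are nonnegative, summing over all possibilities costs only a polynomial factor. An
automorphism may spoil the balance of signs, but each image is `± x ^ t` times a ternary vector of
the right weights (`exists_monomialUnit_ringMul`; this needs the weights to differ by at most one).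
So `b` is `p` minus a rotated Ring-LWE sample (`ex_pubKey_le`), and Ring-LWE makes it uniform. A row
with invertible first entry can be divided to the form `(1, a, b)`; invertible elements have density
at least `1 / (2 (n log Q + 1))` up to rounding (`card_isUnit_ge`).

Two further facts come from the hardness of Ring-SIS itself. If `Q ≤ 2 β`, then `(Q, 0, 0)` is a
solution. Moreover `(60 / r) ^ n ≤ q ^ (-n)`, while a uniform ring element `u` makes `(u, 1, 0)`
short with probability at least `q ^ (-n) / 2`, which gives a guessing solver
(`exists_guess_solver`); so the unpredictability error is bounded by its success probability.

The reductions are compiled into straight-line programs. Non-uniformity is used throughout: the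
seed, the rotation and the whole random tape are fixed to good values and become constants. The norm
test involves arbitrary reals `γ` and `β` and is replaced by an equivalent inequality between
bounded integers (`exists_integral_halfPlane`). -/

/-- The expectation of a nonnegative function. -/
noncomputable def ex {α : Type} (μ : PMF α) (f : α → ℝ≥0∞) : ℝ≥0∞ := ∑' x, μ x * f x

section Ex
variable {α β : Type}

theorem ex_pure (x : α) (f : α → ℝ≥0∞) : ex (pure x) f = f x := by
  classical
  have h : ∀ y, (pure x : PMF α) y * f y = if y = x then f x else 0 := by
    intro y
    show (PMF.pure x) y * f y = _
    rw [PMF.pure_apply]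
    split_ifs with h
    · subst h; simp
    · simp
  unfold ex
  simp_rw [h]
  exact tsum_ite_eq x _

theorem ex_bind (μ : PMF α) (g : α → PMF β) (f : β → ℝ≥0∞) :
    ex (μ >>= g) f = ex μ fun x => ex (g x) f := by
  unfold ex
  have h : ∀ y, (μ >>= g) y = ∑' x, μ x * g x y := fun y => PMF.bind_apply μ g y
  simp_rw [h, ← ENNReal.tsum_mul_right, ← ENNReal.tsum_mul_left]
  rw [ENNReal.tsum_comm]
  simp_rw [mul_assoc]

theorem ex_mono_support (μ : PMF α) {f g : α → ℝ≥0∞} (h : ∀ x ∈ μ.support, f x ≤ g x) :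
    ex μ f ≤ ex μ g := by
  refine ENNReal.tsum_le_tsum fun x => ?_
  by_cases hx : μ x = 0
  · simp [hx]
  · exact mul_le_mul_right (h x ((PMF.mem_support_iff _ _).2 hx)) _

theorem ex_mono (μ : PMF α) {f g : α → ℝ≥0∞} (h : ∀ x, f x ≤ g x) : ex μ f ≤ ex μ g :=
  ex_mono_support μ fun x _ => h x

theorem ex_congr_support (μ : PMF α) {f g : α → ℝ≥0∞} (h : ∀ x ∈ μ.support, f x = g x) :
    ex μ f = ex μ g :=
  le_antisymm (ex_mono_support μ fun x hx => (h x hx).le)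
    (ex_mono_support μ fun x hx => (h x hx).ge)

theorem ex_const (μ : PMF α) (c : ℝ≥0∞) : ex μ (fun _ => c) = c := by
  unfold ex
  rw [ENNReal.tsum_mul_right, μ.tsum_coe, one_mul]

theorem ex_add (μ : PMF α) (f g : α → ℝ≥0∞) : ex μ (fun x => f x + g x) = ex μ f + ex μ g := by
  unfold ex
  simp_rw [mul_add]
  exact ENNReal.tsum_add

theorem ex_mul_left (μ : PMF α) (c : ℝ≥0∞) (f : α → ℝ≥0∞) : ex μ (fun x => c * f x) = c * ex μ f := by
  unfold ex
  rw [← ENNReal.tsum_mul_left]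
  exact tsum_congr fun x => by ring

theorem ex_finset_sum {ι : Type} (μ : PMF α) (s : Finset ι) (f : ι → α → ℝ≥0∞) :
    ex μ (fun x => ∑ i ∈ s, f i x) = ∑ i ∈ s, ex μ (f i) := by
  classical
  induction s using Finset.induction_on with
  | empty => simpa using ex_const μ 0
  | insert i s hi ih => simp_rw [Finset.sum_insert hi]; rw [ex_add, ih]

theorem ex_list_sum {ι : Type} (μ : PMF α) (l : List ι) (f : ι → α → ℝ≥0∞) :
    ex μ (fun x => (l.map fun i => f i x).sum) = (l.map fun i => ex μ (f i)).sum := by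
  induction l with
  | nil => simpa using ex_const μ 0
  | cons i s ih => simp only [List.map_cons, List.sum_cons]; rw [ex_add, ih]

theorem ex_le_of_le (μ : PMF α) {f : α → ℝ≥0∞} {c : ℝ≥0∞} (h : ∀ x, f x ≤ c) : ex μ f ≤ c :=
  (ex_mono μ h).trans_eq (ex_const μ c)

theorem ex_comm (μ : PMF α) (ν : PMF β) (f : α → β → ℝ≥0∞) :
    ex μ (fun x => ex ν (f x)) = ex ν fun y => ex μ fun x => f x y := by
  unfold ex
  simp_rw [← ENNReal.tsum_mul_left]
  rw [ENNReal.tsum_comm]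
  exact tsum_congr fun y => tsum_congr fun x => by ring

theorem ex_map (μ : PMF α) (g : α → β) (f : β → ℝ≥0∞) :
    ex (μ >>= fun x => pure (g x)) f = ex μ fun x => f (g x) := by rw [ex_bind]; simp_rw [ex_pure]

/-- Some outcome has at least the average difference of two functions. -/
theorem exists_ex_sub_le (μ : PMF α) {f g : α → ℝ≥0∞} (hf : ex μ f ≠ ⊤) (hg : ex μ g ≠ ⊤) :
    ∃ x ∈ μ.support, ex μ f + g x ≤ ex μ g + f x := by
  by_contra! h
  obtain ⟨x₀, hx₀⟩ := μ.support_nonempty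
  have hL : ex μ (fun x => ex μ g + f x) = ex μ g + ex μ f := by rw [ex_add, ex_const]
  have hR : ex μ (fun x => ex μ f + g x) = ex μ f + ex μ g := by rw [ex_add, ex_const]
  have hlt : ex μ (fun x => ex μ g + f x) < ex μ (fun x => ex μ f + g x) := by
    unfold ex at hL ⊢
    refine ENNReal.tsum_lt_tsum (i := x₀) (hL ▸ ENNReal.add_ne_top.2 ⟨hg, hf⟩) (fun x => ?_) ?_
    · by_cases hx : μ x = 0
      · simp [hx]
      · exact mul_le_mul_right (h x ((PMF.mem_support_iff _ _).2 hx)).le _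
    · exact ENNReal.mul_lt_mul_right ((PMF.mem_support_iff _ _).1 hx₀) (μ.apply_ne_top x₀) (h x₀ hx₀)
  rw [hL, hR, add_comm] at hlt
  exact lt_irrefl _ hlt

theorem ex_uniformOfFintype [Fintype α] [Nonempty α] (f : α → ℝ≥0∞) :
    ex (PMF.uniformOfFintype α) f = (Fintype.card α : ℝ≥0∞)⁻¹ * ∑ x, f x := by
  unfold ex
  simp_rw [PMF.uniformOfFintype_apply, tsum_fintype, Finset.mul_sum]

theorem ex_uniformOn [Inhabited α] {S : Finset α} (hS : S.Nonempty) (f : α → ℝ≥0∞) :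
    ex (uniformOn S) f = (S.card : ℝ≥0∞)⁻¹ * ∑ x ∈ S, f x := by
  classical
  unfold ex uniformOn
  rw [dif_pos hS, tsum_eq_sum (s := S), Finset.mul_sum]
  · refine Finset.sum_congr rfl fun x hx => ?_
    rw [PMF.uniformOfFinset_apply_of_mem _ hx]
  · intro x hx
    rw [PMF.uniformOfFinset_apply_of_notMem _ hx, zero_mul]

theorem uniformOfFintype_map_equiv [Fintype α] [Nonempty α] [Fintype β] [Nonempty β]
    (e : α ≃ β) (f : β → ℝ≥0∞) :
    ex (PMF.uniformOfFintype α) (fun x => f (e x)) = ex (PMF.uniformOfFintype β) f := by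
  rw [ex_uniformOfFintype, ex_uniformOfFintype, Fintype.card_congr e, Equiv.sum_comp e]

theorem ex_uniform_prod [Fintype α] [Nonempty α] [Fintype β] [Nonempty β]
    (f : α × β → ℝ≥0∞) : ex (PMF.uniformOfFintype (α × β)) f =
      ex (PMF.uniformOfFintype α) fun x => ex (PMF.uniformOfFintype β) fun y => f (x, y) := by
  simp_rw [ex_uniformOfFintype, Fintype.card_prod, Fintype.sum_prod_type, Finset.mul_sum]
  refine Finset.sum_congr rfl fun x _ => Finset.sum_congr rfl fun y _ => ?_
  rw [← mul_assoc, Nat.cast_mul, ENNReal.mul_inv (Or.inr (by simp)) (Or.inl (by simp))]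

theorem ex_iid_zero (μ : PMF α) (f : List α → ℝ≥0∞) : ex (iid μ 0) f = f [] := ex_pure _ _

theorem ex_iid_succ (μ : PMF α) (m : ℕ) (f : List α → ℝ≥0∞) :
    ex (iid μ (m + 1)) f = ex μ fun x => ex (iid μ m) fun xs => f (x :: xs) := by
  show ex (μ >>= fun x => iid μ m >>= fun xs => pure (x :: xs)) f = _
  rw [ex_bind]
  simp_rw [ex_map]

/-- A change of measure for independent samples. -/
theorem ex_iid_le (μ ν : PMF α) (κ : ℝ≥0∞) (h : ∀ f : α → ℝ≥0∞, ex μ f ≤ κ * ex ν f) (m : ℕ)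
    (f : List α → ℝ≥0∞) : ex (iid μ m) f ≤ κ ^ m * ex (iid ν m) f := by
  induction m generalizing f with
  | zero => simp [ex_iid_zero]
  | succ m ih =>
    rw [ex_iid_succ, ex_iid_succ]
    refine (ex_mono μ fun x => ih _).trans ?_
    rw [ex_mul_left, pow_succ, mul_assoc]
    gcongr
    exact h _

/-- The union bound for independent samples. -/
theorem ex_iid_exists (μ : PMF α) (p : α → Prop) (m : ℕ) :
    (open Classical in ex (iid μ m) fun l => if ∃ x ∈ l, p x then 1 else 0) ≤
      m * (open Classical in ex μ fun x => if p x then 1 else 0) := by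
  classical
  induction m with
  | zero => simp [ex_iid_zero]
  | succ m ih =>
    rw [ex_iid_succ]
    have h : ∀ x, ∀ xs : List α, (if ∃ y ∈ x :: xs, p y then (1 : ℝ≥0∞) else 0) ≤
        (if p x then 1 else 0) + (if ∃ y ∈ xs, p y then 1 else 0) := by
      intro x xs
      by_cases h1 : p x
      · simp [h1]
      · simp [h1]
    refine (ex_mono μ fun x => (ex_mono _ (h x)).trans_eq (ex_add _ _ _)).trans ?_
    rw [ex_add]
    simp_rw [ex_const]
    push_cast
    rw [add_mul, one_mul, add_comm]
    gcongr

theorem prob_true_eq_ex (μ : PMF Bool) : μ true = ex μ fun b => if b = true then 1 else 0 := by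
  unfold ex
  rw [tsum_bool]
  simp

end Ex

/-! ### The ring `S[x] / (xⁿ + 1)` -/

section Ring
open Polynomial

variable {S : Type} [CommRing S] {n : ℕ}

/-- The ring `S[x] / (xⁿ + 1)` as a quotient. -/
abbrev NegaRing (S : Type) [CommRing S] (n : ℕ) : Type := AdjoinRoot (X ^ n + C 1 : S[X])

/-- The polynomial with given coefficients. -/
noncomputable def toPoly (a : Fin n → S) : S[X] := ∑ i : Fin n, C (a i) * X ^ (i : ℕ)

/-- The residue class with given coefficients. -/
noncomputable def toQuot (a : Fin n → S) : NegaRing S n := AdjoinRoot.mk _ (toPoly a)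

theorem coeff_toPoly (a : Fin n → S) (i : Fin n) : (toPoly a).coeff i = a i := by
  simp only [toPoly, finsetSum_coeff, coeff_C_mul_X_pow]
  rw [Finset.sum_eq_single i]
  · simp
  · intro j _ hj
    rw [if_neg]
    exact fun h => hj (Fin.ext h.symm)
  · simp

theorem degree_toPoly_lt (a : Fin n → S) : (toPoly a).degree < n := by
  refine (degree_sum_le _ _).trans_lt ?_
  refine (Finset.sup_lt_iff (WithBot.bot_lt_coe n)).2 fun i _ => ?_
  exact (degree_C_mul_X_pow_le _ _).trans_lt (Nat.cast_lt.2 i.2)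

theorem toPoly_add (a b : Fin n → S) : toPoly (a + b) = toPoly a + toPoly b := by
  simp [toPoly, add_mul, Finset.sum_add_distrib]

theorem toPoly_neg (a : Fin n → S) : toPoly (-a) = -toPoly a := by simp [toPoly, Finset.sum_neg_distrib]

theorem toQuot_add (a b : Fin n → S) : toQuot (a + b) = toQuot a + toQuot b := by
  simp [toQuot, toPoly_add]

theorem toQuot_neg (a : Fin n → S) : toQuot (-a) = -toQuot a := by simp [toQuot, toPoly_neg]

theorem toQuot_sub (a b : Fin n → S) : toQuot (a - b) = toQuot a - toQuot b := by
  rw [sub_eq_add_neg, toQuot_add, toQuot_neg, sub_eq_add_neg]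

theorem root_pow_eq : (AdjoinRoot.root (X ^ n + C 1 : S[X])) ^ n = -1 := by
  have h : AdjoinRoot.mk (X ^ n + C 1 : S[X]) (X ^ n + C 1) = 0 := AdjoinRoot.mk_self
  rw [map_add, map_pow, AdjoinRoot.mk_X, AdjoinRoot.mk_C, map_one] at h
  exact eq_neg_of_add_eq_zero_left h

theorem toQuot_eq_sum (a : Fin n → S) :
    toQuot a = ∑ i, AdjoinRoot.of (X ^ n + C 1 : S[X]) (a i) * AdjoinRoot.root _ ^ (i : ℕ) := by
  simp [toQuot, toPoly, map_sum]

variable [NeZero n]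

theorem toQuot_injective [Nontrivial S] : Function.Injective (toQuot : (Fin n → S) → NegaRing S n) := by
  intro a b h
  have hm : (X ^ n + C 1 : S[X]).Monic := monic_X_pow_add_C 1 (NeZero.ne n)
  have hd : (X ^ n + C 1 : S[X]) ∣ toPoly (a - b) := by
    rw [← AdjoinRoot.mk_eq_zero]
    change toQuot (a - b) = 0
    rw [toQuot_sub, h, sub_self]
  have h0 : toPoly (a - b) = 0 := by
    by_contra hne
    refine hm.not_dvd_of_degree_lt hne ?_ hd
    rw [degree_X_pow_add_C (Nat.pos_of_ne_zero (NeZero.ne n))]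
    exact degree_toPoly_lt _
  funext i
  have := coeff_toPoly (a - b) i
  rw [h0, coeff_zero] at this
  exact (sub_eq_zero.1 this.symm)

theorem toQuot_surjective [Nontrivial S] :
    Function.Surjective (toQuot : (Fin n → S) → NegaRing S n) := by
  intro y
  obtain ⟨f, rfl⟩ := AdjoinRoot.mk_surjective y
  have hm : (X ^ n + C 1 : S[X]).Monic := monic_X_pow_add_C 1 (NeZero.ne n)
  have hdeg : (f %ₘ (X ^ n + C 1)).degree < n := by
    have := degree_modByMonic_lt f hm
    rwa [degree_X_pow_add_C (Nat.pos_of_ne_zero (NeZero.ne n))] at this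
  refine ⟨fun i => (f %ₘ (X ^ n + C 1)).coeff i, ?_⟩
  have h1 : toPoly (fun i : Fin n => (f %ₘ (X ^ n + C 1)).coeff i) = f %ₘ (X ^ n + C 1) := by
    rw [toPoly, Fin.sum_univ_eq_sum_range (fun i => C ((f %ₘ (X ^ n + C 1)).coeff i) * X ^ i) n]
    refine (as_sum_range_C_mul_X_pow' _ ?_).symm
    by_cases h0 : f %ₘ (X ^ n + C 1) = 0
    · rw [h0, natDegree_zero]; exact Nat.pos_of_ne_zero (NeZero.ne n)
    · exact (natDegree_lt_iff_degree_lt h0).2 hdeg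
  unfold toQuot
  rw [h1, AdjoinRoot.mk_eq_mk]
  refine ⟨-(f /ₘ (X ^ n + C 1)), ?_⟩
  have := modByMonic_add_div f (X ^ n + C 1)
  linear_combination this

/-- With the row index written as `l + j`, column `j` of the anticirculant matrix becomes `a * r ^
j`; the entries that wrap around carry the sign of `r ^ n = -1`. -/
theorem toQuot_ringMul (a b : Fin n → S) : toQuot (ringMul a b) = toQuot a * toQuot b := by
  simp only [toQuot_eq_sum]
  set r := AdjoinRoot.root (X ^ n + C 1 : S[X])
  have hr : r ^ n = -1 := root_pow_eq
  have key : ∀ j : Fin n, ∑ i : Fin n, AdjoinRoot.of (X ^ n + C 1 : S[X]) (anticirculant a i j) * r ^ (i : ℕ) =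
      (∑ l : Fin n, AdjoinRoot.of (X ^ n + C 1 : S[X]) (a l) * r ^ (l : ℕ)) * r ^ (j : ℕ) := by
    intro j
    rw [← Equiv.sum_comp (Equiv.addRight j), Finset.sum_mul]
    refine Finset.sum_congr rfl fun l _ => ?_
    simp only [Equiv.coe_addRight, anticirculant, Matrix.of_apply, add_sub_cancel_right]
    have hv := Fin.val_add_eq_ite l j
    by_cases h : n ≤ (l : ℕ) + j
    · rw [if_pos h] at hv
      have hlt : ¬ j ≤ l + j := by
        rw [Fin.le_def, hv]; have := l.2; omega
      rw [if_neg hlt, hv, mul_assoc, ← pow_add, map_neg]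
      have : r ^ ((l : ℕ) + j) = r ^ ((l : ℕ) + j - n) * r ^ n := by
        rw [← pow_add]; congr 1; omega
      rw [this, hr]; ring
    · rw [if_neg h] at hv
      have hle : j ≤ l + j := by rw [Fin.le_def, hv]; omega
      rw [if_pos hle, hv, mul_assoc, ← pow_add]
  calc ∑ i, AdjoinRoot.of (X ^ n + C 1 : S[X]) (ringMul a b i) * r ^ (i : ℕ)
      = ∑ i, ∑ j, AdjoinRoot.of (X ^ n + C 1 : S[X]) (anticirculant a i j) * r ^ (i : ℕ) *
          AdjoinRoot.of (X ^ n + C 1 : S[X]) (b j) := by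
        refine Finset.sum_congr rfl fun i _ => ?_
        simp only [ringMul, Matrix.mulVec, dotProduct, map_sum, map_mul, Finset.sum_mul]
        exact Finset.sum_congr rfl fun j _ => by ring
    _ = _ := by
        rw [Finset.sum_comm, Finset.mul_sum]
        refine Finset.sum_congr rfl fun j _ => ?_
        rw [← Finset.sum_mul, key]; ring

/-- The ring laws are pulled back from the quotient along the injection `toQuot`. The zero ring is
treated apart because `toQuot` is injective only over nontrivial coefficients, and the modulus may
be 1. -/
theorem ringMul_comm (a b : Fin n → S) : ringMul a b = ringMul b a := by
  cases subsingleton_or_nontrivial S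
  · exact Subsingleton.elim _ _
  · exact toQuot_injective (by rw [toQuot_ringMul, toQuot_ringMul, mul_comm])

theorem ringMul_assoc (a b c : Fin n → S) : ringMul (ringMul a b) c = ringMul a (ringMul b c) := by
  cases subsingleton_or_nontrivial S
  · exact Subsingleton.elim _ _
  · exact toQuot_injective (by simp only [toQuot_ringMul, mul_assoc])

omit [NeZero n] in
theorem ringMul_add (a b c : Fin n → S) : ringMul a (b + c) = ringMul a b + ringMul a c :=
  Matrix.mulVec_add _ _ _

omit [NeZero n] in
theorem ringMul_sub (a b c : Fin n → S) : ringMul a (b - c) = ringMul a b - ringMul a c :=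
  Matrix.mulVec_sub _ _ _

omit [NeZero n] in
theorem ringMul_zero (a : Fin n → S) : ringMul a 0 = 0 := Matrix.mulVec_zero _

omit [NeZero n] in
theorem ringMul_single (a : Fin n → S) (j : Fin n) (s : S) :
    ringMul a (Pi.single j s) = fun i => anticirculant a i j * s := by
  funext i
  simp [ringMul]

omit [NeZero n] in
theorem toQuot_single (j : Fin n) (s : S) :
    toQuot (Pi.single j s) = AdjoinRoot.of (X ^ n + C 1 : S[X]) s * AdjoinRoot.root _ ^ (j : ℕ) := by
  rw [toQuot_eq_sum, Finset.sum_eq_single j]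
  · simp
  · intro i _ hi; simp [hi]
  · simp

theorem single_zero_ringMul (a : Fin n → S) (s : S) : ringMul (Pi.single 0 s) a = s • a := by
  rw [ringMul_comm, ringMul_single]
  funext i
  simp [anticirculant, mul_comm]

theorem one_ringMul (a : Fin n → S) : ringMul (Pi.single 0 1) a = a := by
  rw [single_zero_ringMul, one_smul]

theorem ringMul_one (a : Fin n → S) : ringMul a (Pi.single 0 1) = a := by rw [ringMul_comm, one_ringMul]

omit [NeZero n] in
theorem anticirculant_add (a b : Fin n → S) :
    anticirculant (a + b) = anticirculant a + anticirculant b := by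
  ext i j
  simp only [anticirculant, Matrix.of_apply, Matrix.add_apply, Pi.add_apply]
  split_ifs <;> ring

theorem anticirculant_ringMul (a b : Fin n → S) :
    anticirculant (ringMul a b) = anticirculant a * anticirculant b := by
  refine Matrix.ext_of_mulVec_single fun j => ?_
  rw [← Matrix.mulVec_mulVec]
  exact ringMul_assoc a b _

theorem anticirculant_single_zero (s : S) : anticirculant (Pi.single (0 : Fin n) s) = s • 1 := by
  refine Matrix.ext_of_mulVec_single fun j => ?_
  rw [Matrix.smul_mulVec, Matrix.one_mulVec]
  exact single_zero_ringMul _ _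

/-- Conjugation is transposition, so the quality of a key is the norm of the Gram matrix `Fᵀ F + Gᵀ
G`. -/
theorem conj_anticirculant (a : Fin n → ℤ) : anticirculant (conj a) = (anticirculant a).transpose := by
  ext i j
  simp only [anticirculant, Matrix.of_apply, Matrix.transpose_apply, conj]
  rcases lt_trichotomy i j with h | h | h
  · have h1 : ¬ j ≤ i := not_le.2 h
    have h2 : ((i - j : Fin n) : ℕ) ≠ 0 := by
      intro h0
      have : i - j = 0 := Fin.ext h0
      exact h.ne (sub_eq_zero.1 this)
    rw [if_neg h1, if_pos h.le, if_neg h2, neg_sub, neg_neg]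
  · subst h; simp
  · have h1 : ¬ i ≤ j := not_le.2 h
    have h2 : ((i - j : Fin n) : ℕ) ≠ 0 := by
      intro h0
      have : i - j = 0 := Fin.ext h0
      exact h.ne' (sub_eq_zero.1 this)
    rw [if_pos h.le, if_neg h1, if_neg h2, neg_sub]

omit [NeZero n] in
theorem modQ_anticirculant (Q : ℕ) (a : Fin n → ℤ) :
    anticirculant (modQ Q a) = (anticirculant a).map (Int.cast : ℤ → ZMod Q) := by
  ext i j
  simp only [anticirculant, Matrix.of_apply, Matrix.map_apply, modQ]
  split_ifs <;> simp

omit [NeZero n] in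
theorem modQ_mulVec {ι κ : Type} [Fintype κ] (Q : ℕ) (M : Matrix ι κ ℤ) (x : κ → ℤ) :
    modQ Q (M.mulVec x) = (M.map (Int.cast : ℤ → ZMod Q)).mulVec (modQ Q x) := by
  funext i
  simp [modQ, Matrix.mulVec, dotProduct]

omit [NeZero n] in
theorem modQ_ringMul (Q : ℕ) (a b : Fin n → ℤ) :
    modQ Q (ringMul a b) = ringMul (modQ Q a) (modQ Q b) := by
  rw [ringMul, modQ_mulVec, ringMul, modQ_anticirculant]

theorem modQ_add {ι : Type} (Q : ℕ) (a b : ι → ℤ) : modQ Q (a + b) = modQ Q a + modQ Q b := by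
  funext i; simp [modQ]

theorem modQ_sub {ι : Type} (Q : ℕ) (a b : ι → ℤ) : modQ Q (a - b) = modQ Q a - modQ Q b := by
  funext i; simp [modQ]

end Ring

/-! ### Representatives -/

section Centered
variable {ι : Type} {Q : ℕ}

theorem modQ_centered [NeZero Q] (u : ι → ZMod Q) : modQ Q (centered u) = u := by
  funext i
  simp only [modQ, centered]
  have h : ((Int.bmod ((u i).val : ℤ) Q : ℤ) : ZMod Q) = (((u i).val : ℤ) : ZMod Q) := by
    rw [ZMod.intCast_eq_intCast_iff]
    exact Int.bmod_emod
  rw [h]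
  simp

theorem bmod_eq_self_of_bounds {x : ℤ} {Q : ℕ} (h1 : -((Q / 2 : ℕ) : ℤ) ≤ x)
    (h2 : x < Q - (Q / 2 : ℕ)) : Int.bmod x Q = x := by
  apply Int.bmod_eq_of_le <;> push_cast at * <;> omega

theorem bmod_bounds (x : ℤ) {Q : ℕ} (hQ : 0 < Q) :
    -((Q / 2 : ℕ) : ℤ) ≤ Int.bmod x Q ∧ Int.bmod x Q < Q - (Q / 2 : ℕ) := by
  have h1 := Int.le_bmod (x := x) hQ
  have h2 := Int.bmod_lt (x := x) hQ
  push_cast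
  omega

theorem centered_modQ [NeZero Q] {x : ι → ℤ} (h1 : ∀ i, -((Q / 2 : ℕ) : ℤ) ≤ x i)
    (h2 : ∀ i, x i < Q - (Q / 2 : ℕ)) : centered (modQ Q x) = x := by
  funext i
  simp only [modQ, centered]
  rw [ZMod.val_intCast, Int.emod_bmod]
  exact bmod_eq_self_of_bounds (h1 i) (h2 i)

end Centered

/-! ### Ternary polynomials, rotations and automorphisms -/

section Ternary
variable {n : ℕ}

theorem mem_ternary {a b : ℕ} {v : Fin n → ℤ} : v ∈ ternary n a b ↔
    (∀ i, v i = -1 ∨ v i = 0 ∨ v i = 1) ∧ (Finset.univ.filter fun i => v i = 1).card = a ∧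
      (Finset.univ.filter fun i => v i = -1).card = b := by
  simp [ternary, Fintype.mem_piFinset]

theorem sum_of_ternary {v : Fin n → ℤ} (hv : ∀ i, v i = -1 ∨ v i = 0 ∨ v i = 1) :
    ∑ i, v i = (Finset.univ.filter fun i => v i = 1).card -
      (Finset.univ.filter fun i => v i = -1).card := by
  rw [Finset.card_filter, Finset.card_filter]
  push_cast
  rw [← Finset.sum_sub_distrib]
  refine Finset.sum_congr rfl fun i _ => ?_
  rcases hv i with h | h | h <;> simp [h]

theorem sum_abs_of_ternary {v : Fin n → ℤ} (hv : ∀ i, v i = -1 ∨ v i = 0 ∨ v i = 1) :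
    ∑ i, |v i| = (Finset.univ.filter fun i => v i = 1).card +
      (Finset.univ.filter fun i => v i = -1).card := by
  rw [Finset.card_filter, Finset.card_filter]
  push_cast
  rw [← Finset.sum_add_distrib]
  refine Finset.sum_congr rfl fun i _ => ?_
  rcases hv i with h | h | h <;> simp [h]

/-- Signed permutations of the coordinates preserve the sum of absolute values, so in this form only
the plain sum has to be controlled under rotations and automorphisms. -/
theorem mem_ternary_iff_sums {a b : ℕ} {v : Fin n → ℤ} : v ∈ ternary n a b ↔
    (∀ i, v i = -1 ∨ v i = 0 ∨ v i = 1) ∧ ∑ i, |v i| = a + b ∧ ∑ i, v i = a - b := by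
  rw [mem_ternary]
  refine and_congr_right fun hv => ?_
  rw [sum_of_ternary hv, sum_abs_of_ternary hv]
  omega

/-- A discrete intermediate value theorem: steps of size at most 2 cannot lead from values `≥ 2` to
values `≤ -2` without meeting `{-1, 0, 1}`, and the sequence must change sign because it ends at
minus its start. -/
theorem exists_abs_le_one_of_antiperiodic {D : ℕ → ℤ} (hn : 0 < n)
    (hstep : ∀ t < n, |D (t + 1) - D t| ≤ 2) (hend : D n = -D 0) : ∃ t < n, |D t| ≤ 1 := by
  by_contra! h
  have h0 := h 0 hn
  rcases le_total 0 (D 0) with hp | hp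
  · have hpos : ∀ t < n, 2 ≤ D t := by
      intro t
      induction t with
      | zero => intro _; rw [abs_of_nonneg hp] at h0; omega
      | succ t ih =>
        intro ht
        have h1 := ih (by omega)
        have h2 := abs_le.1 (hstep t (by omega))
        have h3 := h (t + 1) ht
        rw [lt_abs] at h3
        omega
    have h1 := hpos (n - 1) (by omega)
    have h2 := abs_le.1 (hstep (n - 1) (by omega))
    have h3 := hpos 0 hn
    rw [Nat.sub_add_cancel hn] at h2
    omega
  · have hneg : ∀ t < n, D t ≤ -2 := by
      intro t
      induction t with
      | zero => intro _; rw [abs_of_nonpos hp] at h0; omega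
      | succ t ih =>
        intro ht
        have h1 := ih (by omega)
        have h2 := abs_le.1 (hstep t (by omega))
        have h3 := h (t + 1) ht
        rw [lt_abs] at h3
        omega
    have h1 := hneg (n - 1) (by omega)
    have h2 := abs_le.1 (hstep (n - 1) (by omega))
    have h3 := hneg 0 hn
    rw [Nat.sub_add_cancel hn] at h2
    omega

/-- The units `± x ^ t` of the ring. -/
def monomialUnit {S : Type} [CommRing S] (t : Fin n × Bool) : Fin n → S :=
  Pi.single t.1 (if t.2 then 1 else -1)

theorem modQ_monomialUnit (Q : ℕ) (t : Fin n × Bool) : modQ Q (monomialUnit t) = monomialUnit t := by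
  funext i
  simp only [modQ, monomialUnit, Pi.single_apply]
  split_ifs <;> simp

variable [NeZero n]

/-- Every ternary vector is a monomial unit times a balanced one of the same weight. -/
theorem exists_monomialUnit_ringMul {a b : ℕ} (hab : a ≤ b + 1) (hba : b ≤ a + 1)
    {v : Fin n → ℤ} (hv : ∀ i, v i = -1 ∨ v i = 0 ∨ v i = 1) (hw : ∑ i, |v i| = a + b) :
    ∃ t, ∃ h ∈ ternary n a b, v = ringMul (monomialUnit t) h := by
  have hn : 0 < n := Nat.pos_of_ne_zero (NeZero.ne n)
  -- `D t` is the coefficient sum of `x ^ (-t) * v`: dividing by `x ^ t` moves the first `t`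
  -- coefficients around the end and flips their signs.
  let D : ℕ → ℤ := fun t => ∑ i : Fin n, if (i : ℕ) < t then -v i else v i
  have hD0 : D 0 = ∑ i, v i := by simp [D]
  have hDn : D n = -D 0 := by simp [D, Finset.sum_neg_distrib]
  have hstep : ∀ t < n, |D (t + 1) - D t| ≤ 2 := by
    intro t ht
    have : D (t + 1) - D t = -2 * v ⟨t, ht⟩ := by
      simp only [D]
      rw [← Finset.sum_sub_distrib, Finset.sum_eq_single (⟨t, ht⟩ : Fin n)]
      · simp; ring
      · intro i _ hi
        have : (i : ℕ) ≠ t := fun h => hi (Fin.ext h)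
        by_cases h : (i : ℕ) < t
        · rw [if_pos (by omega), if_pos h, sub_self]
        · rw [if_neg (by omega), if_neg h, sub_self]
      · simp
    rw [this]
    rcases hv ⟨t, ht⟩ with h | h | h <;> rw [h] <;> norm_num
  obtain ⟨t, ht, hDt⟩ := exists_abs_le_one_of_antiperiodic hn hstep hDn
  -- `D t` has the parity of `a + b`. Together with `|D t| ≤ 1` and `|a - b| ≤ 1` this leaves only
  -- `D t = ±(a - b)`, and the sign is absorbed into the unit.
  have hpar : ∃ k : ℤ, D t = a + b - 2 * k := by
    refine ⟨∑ i : Fin n, if (if (i : ℕ) < t then -v i else v i) = -1 then 1 else 0, ?_⟩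
    rw [← hw, Finset.mul_sum, ← Finset.sum_sub_distrib]
    refine Finset.sum_congr rfl fun i _ => ?_
    rcases hv i with h | h | h <;> by_cases h' : (i : ℕ) < t <;> simp [h, h']
  obtain ⟨k, hk⟩ := hpar
  have hs : ∃ s : Bool, (if s then 1 else -1) * D t = a - b := by
    rw [abs_le] at hDt
    by_cases h : D t = a - b
    · exact ⟨true, by simp [h]⟩
    · refine ⟨false, ?_⟩
      simp only [Bool.false_eq_true, if_false]
      omega
  obtain ⟨s, hs⟩ := hs
  set σ : ℤ := if s then 1 else -1 with hσ
  have hσ2 : σ * σ = 1 := by rw [hσ]; split_ifs <;> norm_num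
  have hσ' : σ = 1 ∨ σ = -1 := by rw [hσ]; split_ifs <;> simp
  let τ : Fin n := ⟨t, ht⟩
  let h : Fin n → ℤ := fun l => σ * if l + τ < τ then -v (l + τ) else v (l + τ)
  have hh : ∀ i, h (i - τ) = σ * if i < τ then -v i else v i := by
    intro i; simp [h]
  refine ⟨(τ, s), h, ?_, ?_⟩
  · rw [mem_ternary_iff_sums]
    refine ⟨fun i => ?_, ?_, ?_⟩
    · simp only [h]
      rcases hσ' with h1 | h1 <;> rcases hv (i + τ) with h2 | h2 | h2 <;> rw [h1, h2] <;>
        split_ifs <;> simp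
    · rw [← hw, ← Equiv.sum_comp (Equiv.subRight τ)]
      refine Finset.sum_congr rfl fun i _ => ?_
      simp only [Equiv.subRight_apply, hh]
      rw [abs_mul]
      have : |σ| = 1 := by rcases hσ' with h1 | h1 <;> simp [h1]
      rw [this, one_mul]
      split_ifs <;> simp
    · rw [← hs, ← Equiv.sum_comp (Equiv.subRight τ)]
      simp only [Equiv.subRight_apply, hh, ← Finset.mul_sum]
      rfl
  · funext i
    rw [monomialUnit, ringMul_comm, ringMul_single]
    simp only [anticirculant, Matrix.of_apply, hh, ← hσ]
    by_cases hi : τ ≤ i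
    · rw [if_pos hi, if_neg (not_lt.2 hi)]
      linear_combination (-v i) * hσ2
    · rw [if_neg hi, if_pos (not_le.1 hi)]
      linear_combination (-v i) * hσ2

/-- Since `x ^ (2 n) = 1`, the inverse of `± x ^ t` is `± x ^ (2 n - t)`. -/
theorem exists_monomialUnit_inv {S : Type} [CommRing S] (t : Fin n × Bool) :
    ∃ u : Fin n → S, ringMul u (monomialUnit t) = Pi.single 0 1 := by
  cases subsingleton_or_nontrivial S
  · exact ⟨0, Subsingleton.elim _ _⟩
  · obtain ⟨u, hu⟩ := toQuot_surjective (n := n) (S := S)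
      ((AdjoinRoot.root _ ^ (2 * n - (t.1 : ℕ))) * AdjoinRoot.of _ (if t.2 then 1 else -1))
    refine ⟨u, toQuot_injective ?_⟩
    have hr := root_pow_eq (S := S) (n := n)
    rw [toQuot_ringMul, hu, monomialUnit, toQuot_single, toQuot_single]
    have h1 : (AdjoinRoot.root (Polynomial.X ^ n + Polynomial.C (1 : S))) ^ (2 * n - (t.1 : ℕ)) *
        AdjoinRoot.root _ ^ (t.1 : ℕ) = 1 := by
      rw [← pow_add, Nat.sub_add_cancel (by have := t.1.2; omega), mul_comm, pow_mul, hr]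
      ring
    simp only [Fin.val_zero, pow_zero, mul_one, map_one]
    cases t.2 <;> simp <;> linear_combination h1

/-- Multiplication by a monomial unit as a permutation. -/
theorem monomialUnit_bijective {S : Type} [CommRing S] (t : Fin n × Bool) :
    Function.Bijective (ringMul (monomialUnit t : Fin n → S)) := by
  obtain ⟨u, hu⟩ := exists_monomialUnit_inv (S := S) t
  refine ⟨fun x y h => ?_, fun y => ⟨ringMul u y, ?_⟩⟩
  · have := congrArg (ringMul u) h
    simpa only [← ringMul_assoc, hu, one_ringMul] using this
  · rw [← ringMul_assoc, ringMul_comm _ u, hu, one_ringMul]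

/-- The permutation of exponents under `x ↦ x ^ k`. -/
theorem exponent_bijective {k : ℕ} (hk : Nat.Coprime k n) : Function.Bijective fun i : Fin n =>
      (⟨i * k % n, Nat.mod_lt _ (Nat.pos_of_ne_zero (NeZero.ne n))⟩ : Fin n) := by
  refine (Fintype.bijective_iff_injective_and_card _).2 ⟨fun i j h => ?_, rfl⟩
  have h1 : (i * k) ≡ (j * k) [MOD n] := Fin.mk.inj h
  have h2 : (i : ℕ) ≡ j [MOD n] := Nat.ModEq.cancel_right_of_coprime (by rwa [Nat.gcd_comm]) h1
  exact Fin.ext (by simpa [Nat.ModEq, Nat.mod_eq_of_lt i.2, Nat.mod_eq_of_lt j.2] using h2)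

theorem galois_apply {k : ℕ} (hk : Nat.Coprime k n) (a : Fin n → ℤ) (i : Fin n) :
    galois k a ⟨i * k % n, Nat.mod_lt _ (Nat.pos_of_ne_zero (NeZero.ne n))⟩ =
      (-1) ^ ((i : ℕ) * k / n) * a i := by
  unfold galois
  rw [Finset.sum_eq_single i]
  · simp
  · intro j _ hj
    rw [if_neg]
    intro h
    exact hj ((exponent_bijective hk).1 (Fin.ext h))
  · simp

theorem galois_injective {k : ℕ} (hk : Nat.Coprime k n) : Function.Injective (galois (n := n) k) := by
  intro a b h
  funext i
  have := congrFun h ⟨i * k % n, Nat.mod_lt _ (Nat.pos_of_ne_zero (NeZero.ne n))⟩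
  rw [galois_apply hk, galois_apply hk] at this
  exact mul_left_cancel₀ (pow_ne_zero _ (by norm_num)) this

/-- An automorphism permutes the coefficients up to sign. The support size survives, but the numbers
of `1` and `-1` need not; this defect is what the rotations repair. -/
theorem galois_ternary {k a b : ℕ} (hk : Nat.Coprime k n) {v : Fin n → ℤ}
    (hv : v ∈ ternary n a b) : (∀ i, galois k v i = -1 ∨ galois k v i = 0 ∨ galois k v i = 1) ∧
      ∑ i, |galois k v i| = a + b := by
  rw [mem_ternary_iff_sums] at hv
  obtain ⟨h1, h2, -⟩ := hv
  constructor
  · intro j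
    obtain ⟨i, rfl⟩ := (exponent_bijective hk).2 j
    rw [galois_apply hk]
    rcases neg_one_pow_eq_or ℤ ((i : ℕ) * k / n) with h | h <;> rcases h1 i with h' | h' | h' <;>
      simp [h, h']
  · rw [← h2, ← (exponent_bijective hk).sum_comp]
    refine Finset.sum_congr rfl fun i _ => ?_
    rw [galois_apply hk, abs_mul, abs_pow]
    simp

end Ternary

/-! ### One-dimensional Gaussian sums -/

section OneDim

/-- Expanding the square identifies each term, up to the constant factor `exp (-π c v²)`, with the
norm of a term of a Jacobi theta series. -/
theorem summable_gaussian_shift {c : ℝ} (hc : 0 < c) (v : ℝ) :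
    Summable fun j : ℤ => Real.exp (-Real.pi * (c * (j - v) ^ 2)) := by
  have h := (summable_jacobiTheta₂_term_iff (-(Complex.I * (c * v : ℝ))) (Complex.I * (c : ℝ))).2
    (by simpa using hc)
  have h2 := (h.norm).mul_left (Real.exp (-Real.pi * (c * v ^ 2)))
  refine h2.congr fun j => ?_
  rw [jacobiTheta₂_term, Complex.norm_exp, ← Real.exp_add]
  congr 1
  have : (2 * (Real.pi : ℂ) * Complex.I * j * -(Complex.I * ((c * v : ℝ) : ℂ)) +
      Real.pi * Complex.I * (j : ℂ) ^ 2 * (Complex.I * (c : ℝ))) =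
      ((2 * Real.pi * j * (c * v) - Real.pi * j ^ 2 * c : ℝ) : ℂ) := by
    push_cast
    linear_combination (-2 * Real.pi * j * c * v + Real.pi * j ^ 2 * c : ℂ) * Complex.I_sq
  rw [this, Complex.ofReal_re]
  ring

/-- The mass of the nonzero integers under the dual Gaussian of width `1 / τ`. -/
noncomputable def dualTail (τ : ℝ) : ℝ := ∑' j : ℤ, Real.exp (-Real.pi * (τ ^ 2 * (j : ℝ) ^ 2)) - 1

theorem summable_dual {τ : ℝ} (hτ : 0 < τ) :
    Summable fun j : ℤ => Real.exp (-Real.pi * (τ ^ 2 * (j : ℝ) ^ 2)) := by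
  simpa using summable_gaussian_shift (pow_pos hτ 2) 0

/-- Poisson summation turns the shift `v` into phases of modulus one on the dual side. The zero
frequency contributes `τ`, and the others are bounded by the tail whatever the phases are. -/
theorem abs_gaussian_sum_sub_le {τ : ℝ} (hτ : 0 < τ) (v : ℝ) :
    |∑' j : ℤ, Real.exp (-Real.pi * ((τ ^ 2)⁻¹ * (j - v) ^ 2)) - τ| ≤ τ * dualTail τ := by
  have hs := summable_dual hτ
  set a : ℂ := ((τ ^ 2 : ℝ) : ℂ) with ha
  have hare : 0 < a.re := by rw [ha, Complex.ofReal_re]; positivity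
  have hP := Complex.tsum_exp_neg_quadratic hare (Complex.I * v)
  have hroot : a ^ (1 / 2 : ℂ) = (τ : ℂ) := by
    have : (1 / 2 : ℂ) = ((1 / 2 : ℝ) : ℂ) := by norm_num
    rw [ha, this, ← Complex.ofReal_cpow (by positivity), ← Real.sqrt_eq_rpow,
      Real.sqrt_sq hτ.le]
  have hR : ∀ j : ℤ, Complex.exp (-Real.pi / a * (j + Complex.I * (Complex.I * v)) ^ 2) =
      ((Real.exp (-Real.pi * ((τ ^ 2)⁻¹ * (j - v) ^ 2)) : ℝ) : ℂ) := by
    intro j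
    rw [Complex.ofReal_exp]
    congr 1
    push_cast [ha]
    have : (j : ℂ) + Complex.I * (Complex.I * v) = j - v := by
      linear_combination (v : ℂ) * Complex.I_sq
    rw [this]; ring
  have hτ' : (τ : ℂ) ≠ 0 := by exact_mod_cast hτ.ne'
  simp_rw [hR] at hP
  rw [hroot, ← Complex.ofReal_tsum] at hP
  set F := ∑' j : ℤ, Real.exp (-Real.pi * ((τ ^ 2)⁻¹ * (j - v) ^ 2))
  set t : ℤ → ℂ := fun j => Complex.exp (-Real.pi * a * j ^ 2 + 2 * Real.pi * (Complex.I * v) * j)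
  have hnorm : ∀ j, ‖t j‖ = Real.exp (-Real.pi * (τ ^ 2 * (j : ℝ) ^ 2)) := by
    intro j
    rw [Complex.norm_exp]
    congr 1
    have : (-Real.pi * a * (j : ℂ) ^ 2 + 2 * Real.pi * (Complex.I * v) * j) =
      ((-Real.pi * (τ ^ 2 * (j : ℝ) ^ 2) : ℝ) : ℂ) + ((2 * Real.pi * v * j : ℝ) : ℂ) * Complex.I := by
      rw [ha]; push_cast; ring
    rw [this, Complex.add_re, Complex.ofReal_re, Complex.re_ofReal_mul, Complex.I_re, mul_zero, add_zero]
  have hts : Summable t := Summable.of_norm (by simpa only [hnorm] using hs)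
  have hF : (F : ℂ) - τ = τ * (∑' j, t j - 1) := by
    rw [hP]; field_simp
  have ht0 : t 0 = 1 := by simp [t]
  have hsplit : ∑' j, t j - 1 = ∑' j, if j = 0 then 0 else t j := by
    rw [hts.tsum_eq_add_tsum_ite 0, ht0]; ring
  have hsplit' : dualTail τ = ∑' j : ℤ, if j = 0 then 0 else Real.exp (-Real.pi * (τ ^ 2 * (j : ℝ) ^ 2)) := by
    rw [dualTail, hs.tsum_eq_add_tsum_ite 0]; simp
  have hite : ∀ j, ‖(if j = 0 then 0 else t j : ℂ)‖ =
      if j = 0 then 0 else Real.exp (-Real.pi * (τ ^ 2 * (j : ℝ) ^ 2)) := by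
    intro j; split_ifs
    · simp
    · exact hnorm j
  have hle : ‖∑' j, t j - 1‖ ≤ dualTail τ := by
    rw [hsplit, hsplit']
    refine (norm_tsum_le_tsum_norm ?_).trans_eq (tsum_congr hite)
    simp_rw [hite]
    refine Summable.of_nonneg_of_le (fun j => ?_) (fun j => ?_) hs
    · split_ifs <;> positivity
    · split_ifs <;> [positivity; exact le_rfl]
  have hfin : ‖((F - τ : ℝ) : ℂ)‖ ≤ τ * dualTail τ := by
    push_cast
    rw [hF, norm_mul, Complex.norm_real, Real.norm_of_nonneg hτ.le]
    gcongr
  simpa only [Complex.norm_real, Real.norm_eq_abs] using hfin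

theorem dualTail_nonneg {τ : ℝ} (hτ : 0 < τ) : 0 ≤ dualTail τ := by
  have h := (summable_dual hτ).le_tsum 0 fun j _ => (Real.exp_pos _).le
  simp only [Int.cast_zero, ne_eq, OfNat.ofNat_ne_zero, not_false_eq_true, zero_pow, mul_zero, Real.exp_zero] at h
  unfold dualTail
  linarith

theorem dualTail_anti {τ τ' : ℝ} (hτ : 0 < τ) (h : τ ≤ τ') : dualTail τ' ≤ dualTail τ := by
  unfold dualTail
  refine sub_le_sub_right (Summable.tsum_le_tsum (fun j => ?_) (summable_dual (hτ.trans_le h))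
    (summable_dual hτ)) _
  refine Real.exp_le_exp.2 ?_
  have : τ ^ 2 * (j : ℝ) ^ 2 ≤ τ' ^ 2 * (j : ℝ) ^ 2 := by gcongr
  nlinarith [Real.pi_pos]

/-- These are the two terms `j = ±1`. The bound turns a smoothing condition into an upper bound for
`exp (-π τ²)`, from which the tail at other widths is controlled. -/
theorem two_exp_le_dualTail {τ : ℝ} (hτ : 0 < τ) : 2 * Real.exp (-Real.pi * τ ^ 2) ≤ dualTail τ := by
  have h := (summable_dual hτ).sum_le_tsum {0, 1, -1} fun j _ => (Real.exp_pos _).le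
  rw [Finset.sum_insert (by decide), Finset.sum_insert (by decide), Finset.sum_singleton] at h
  simp only [Int.cast_zero, Int.cast_one, Int.cast_neg] at h
  norm_num at h
  unfold dualTail
  have e1 : -(Real.pi * τ ^ 2) = -Real.pi * τ ^ 2 := by ring
  simp only [neg_mul] at h ⊢
  linarith

/-- A geometric bound for the dual tail. -/
theorem dualTail_le {τ : ℝ} (hτ : 0 < τ) (h2 : Real.exp (-Real.pi * τ ^ 2) ≤ 1 / 2) :
    dualTail τ ≤ 4 * Real.exp (-Real.pi * τ ^ 2) := by
  set x := Real.exp (-Real.pi * τ ^ 2) with hx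
  have hx0 : 0 < x := Real.exp_pos _
  have hg : Summable fun m : ℕ => x ^ (m + 1) := by
    simp_rw [pow_succ]
    exact (summable_geometric_of_lt_one hx0.le (by linarith)).mul_right _
  have hgs : ∑' m : ℕ, x ^ (m + 1) ≤ 2 * x := by
    simp_rw [pow_succ]
    rw [tsum_mul_right, tsum_geometric_of_lt_one hx0.le (by linarith)]
    gcongr
    rw [inv_le_comm₀ (by linarith) two_pos]; linarith
  have hterm : ∀ m : ℕ, Real.exp (-Real.pi * (τ ^ 2 * ((m : ℝ) + 1) ^ 2)) ≤ x ^ (m + 1) := by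
    intro m
    rw [hx, ← Real.exp_nat_mul]
    refine Real.exp_le_exp.2 ?_
    push_cast
    have : τ ^ 2 * ((m : ℝ) + 1) ≤ τ ^ 2 * ((m : ℝ) + 1) ^ 2 := by
      have : (1 : ℝ) ≤ m + 1 := by linarith [(Nat.cast_nonneg m : (0 : ℝ) ≤ m)]
      gcongr
      nlinarith
    nlinarith [Real.pi_pos]
  have hs := summable_dual hτ
  have hsplit := tsum_of_add_one_of_neg_add_one (f := fun j : ℤ => Real.exp (-Real.pi * (τ ^ 2 * (j : ℝ) ^ 2)))
    (by
      refine Summable.of_nonneg_of_le (fun _ => (Real.exp_pos _).le) (fun m => ?_) hg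
      simpa using hterm m)
    (by
      refine Summable.of_nonneg_of_le (fun _ => (Real.exp_pos _).le) (fun m => ?_) hg
      have := hterm m
      have e : ((-((m : ℤ) + 1) : ℤ) : ℝ) ^ 2 = ((m : ℝ) + 1) ^ 2 := by push_cast; ring
      simpa only [e] using this)
  have b1 : ∑' m : ℕ, Real.exp (-Real.pi * (τ ^ 2 * (((m : ℤ) + 1 : ℤ) : ℝ) ^ 2)) ≤ 2 * x := by
    refine (Summable.tsum_le_tsum (fun m => ?_) ?_ hg).trans hgs
    · simpa using hterm m
    · refine Summable.of_nonneg_of_le (fun _ => (Real.exp_pos _).le) (fun m => ?_) hg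
      simpa using hterm m
  have b2 : ∑' m : ℕ, Real.exp (-Real.pi * (τ ^ 2 * ((-((m : ℤ) + 1) : ℤ) : ℝ) ^ 2)) ≤ 2 * x := by
    refine le_trans (le_of_eq (tsum_congr fun m => ?_)) b1
    push_cast; congr 2; ring
  unfold dualTail
  rw [hsplit]
  simp only [Int.cast_zero, ne_eq, OfNat.ofNat_ne_zero, not_false_eq_true, zero_pow, mul_zero, Real.exp_zero]
  linarith

/-- A Gaussian of width `σ` has mass at least `σ / 60` on the integers. -/
theorem le_sixty_gaussian_sum {σ : ℝ} (hσ : 0 < σ) :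
    σ ≤ 60 * ∑' j : ℤ, Real.exp (-Real.pi * ((σ ^ 2)⁻¹ * (j : ℝ) ^ 2)) := by
  have hs : Summable fun j : ℤ => Real.exp (-Real.pi * ((σ ^ 2)⁻¹ * (j : ℝ) ^ 2)) := by
    simpa using summable_gaussian_shift (inv_pos.2 (pow_pos hσ 2)) 0
  set m := ⌊σ⌋₊
  -- Each integer in `[0, σ]` contributes at least `exp (-π)`, and there are `⌊σ⌋₊ + 1 > σ` of them.
  -- The constant 60 is an upper bound for `exp 4`.
  have hexp : (1 : ℝ) / 60 ≤ Real.exp (-Real.pi) := by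
    have h1 : Real.exp Real.pi ≤ 60 := by
      calc Real.exp Real.pi ≤ Real.exp 4 := Real.exp_le_exp.2 Real.pi_le_four
        _ = Real.exp 1 ^ 4 := by rw [← Real.exp_nat_mul]; norm_num
        _ ≤ 2.7182818286 ^ 4 := by gcongr; exact Real.exp_one_lt_d9.le
        _ ≤ 60 := by norm_num
    rw [Real.exp_neg, one_div]
    exact inv_anti₀ (Real.exp_pos _) h1
  have h1 := hs.sum_le_tsum (Finset.Icc (0 : ℤ) m) fun j _ => (Real.exp_pos _).le
  have h2 : ∑ j ∈ Finset.Icc (0 : ℤ) m, (1 / 60 : ℝ) ≤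
      ∑ j ∈ Finset.Icc (0 : ℤ) m, Real.exp (-Real.pi * ((σ ^ 2)⁻¹ * (j : ℝ) ^ 2)) := by
    refine Finset.sum_le_sum fun j hj => hexp.trans (Real.exp_le_exp.2 ?_)
    rw [Finset.mem_Icc] at hj
    have hj0 : (0 : ℝ) ≤ j := by exact_mod_cast hj.1
    have hjm : (j : ℝ) ≤ σ := by
      have : (j : ℝ) ≤ (m : ℝ) := by exact_mod_cast hj.2
      exact this.trans (Nat.floor_le hσ.le)
    have : (σ ^ 2)⁻¹ * (j : ℝ) ^ 2 ≤ 1 := by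
      rw [inv_mul_le_iff₀ (by positivity), mul_one]
      gcongr
    nlinarith [Real.pi_pos]
  rw [Finset.sum_const, Int.card_Icc, nsmul_eq_mul] at h2
  have h3 : (((m : ℤ) + 1 - 0).toNat : ℝ) = m + 1 := by
    rw [sub_zero]
    norm_cast
  rw [h3] at h2
  have h4 := Nat.lt_floor_add_one σ
  linarith

end OneDim

/-! ### Isotropic Gaussian sums and the smoothing parameter -/

section Isotropic

theorem tsum_fin_prod (n : ℕ) (f : Fin n → ℤ → ℝ≥0∞) :
    ∑' x : Fin n → ℤ, ∏ i, f i (x i) = ∏ i, ∑' j, f i j := by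
  induction n with
  | zero => simp [tsum_fintype]
  | succ n ih =>
    rw [← (Fin.consEquiv fun _ : Fin (n + 1) => ℤ).tsum_eq, ENNReal.tsum_prod', Fin.prod_univ_succ,
      ← ih, ← ENNReal.tsum_mul_right]
    refine tsum_congr fun a => ?_
    rw [← ENNReal.tsum_mul_left]
    refine tsum_congr fun x => ?_
    simp [Fin.consEquiv, Fin.prod_univ_succ]

theorem tsum_pi_prod {ι : Type} [Fintype ι] (f : ι → ℤ → ℝ≥0∞) :
    ∑' x : ι → ℤ, ∏ i, f i (x i) = ∏ i, ∑' j, f i j := by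
  have e := Fintype.equivFin ι
  rw [← (Equiv.arrowCongr e (Equiv.refl ℤ)).symm.tsum_eq, ← e.symm.prod_comp, ← tsum_fin_prod]
  refine tsum_congr fun x => ?_
  rw [← e.symm.prod_comp]
  simp

variable {ι : Type} [Fintype ι]

theorem tsum_isotropic {c : ℝ} (hc : 0 < c) (v : ι → ℝ) :
    ∑' x : ι → ℤ, ENNReal.ofReal (Real.exp (-Real.pi * (c * ∑ i, ((x i : ℝ) - v i) ^ 2))) =
      ∏ i, ENNReal.ofReal (∑' j : ℤ, Real.exp (-Real.pi * (c * ((j : ℝ) - v i) ^ 2))) := by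
  have h : ∀ i, ENNReal.ofReal (∑' j : ℤ, Real.exp (-Real.pi * (c * ((j : ℝ) - v i) ^ 2))) =
      ∑' j : ℤ, ENNReal.ofReal (Real.exp (-Real.pi * (c * ((j : ℝ) - v i) ^ 2))) := fun i =>
    ENNReal.ofReal_tsum_of_nonneg (fun _ => (Real.exp_pos _).le) (summable_gaussian_shift hc _)
  simp_rw [h]
  rw [← tsum_pi_prod fun i j => ENNReal.ofReal (Real.exp (-Real.pi * (c * ((j : ℝ) - v i) ^ 2)))]
  refine tsum_congr fun x => ?_
  rw [← ENNReal.ofReal_prod_of_nonneg fun _ _ => (Real.exp_pos _).le, ← Real.exp_sum]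
  congr 2
  rw [Finset.mul_sum, Finset.mul_sum]

theorem tsum_isotropic_ne_top {c : ℝ} (hc : 0 < c) (v : ι → ℝ) :
    ∑' x : ι → ℤ, ENNReal.ofReal (Real.exp (-Real.pi * (c * ∑ i, ((x i : ℝ) - v i) ^ 2))) ≠ ⊤ := by
  rw [tsum_isotropic hc]
  exact ENNReal.prod_ne_top fun _ _ => ENNReal.ofReal_ne_top

/-- Shifted isotropic Gaussian sums are nearly independent of the shift. -/
theorem tsum_isotropic_le {τ : ℝ} (hτ : 0 < τ) (hy : dualTail τ ≤ 1 / 2) (v v' : ι → ℝ) :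
    ∑' x : ι → ℤ, ENNReal.ofReal (Real.exp (-Real.pi * ((τ ^ 2)⁻¹ * ∑ i, ((x i : ℝ) - v i) ^ 2))) ≤
      ENNReal.ofReal (Real.exp (3 * (Fintype.card ι * dualTail τ))) *
      ∑' x : ι → ℤ,
        ENNReal.ofReal (Real.exp (-Real.pi * ((τ ^ 2)⁻¹ * ∑ i, ((x i : ℝ) - v' i) ^ 2))) := by
  have hc : 0 < (τ ^ 2)⁻¹ := by positivity
  rw [tsum_isotropic hc, tsum_isotropic hc]
  set y := dualTail τ
  have hy0 : 0 ≤ y := dualTail_nonneg hτ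
  have h1 : ENNReal.ofReal (Real.exp (3 * (Fintype.card ι * y))) =
      ∏ _i : ι, ENNReal.ofReal (Real.exp (3 * y)) := by
    rw [Finset.prod_const, ← ENNReal.ofReal_pow (Real.exp_pos _).le, ← Real.exp_nat_mul]
    congr 2
    rw [Finset.card_univ]
    ring
  rw [h1, ← Finset.prod_mul_distrib]
  refine Finset.prod_le_prod' fun i _ => ?_
  rw [← ENNReal.ofReal_mul (Real.exp_pos _).le]
  refine ENNReal.ofReal_le_ofReal ?_
  have a1 := (abs_le.1 (abs_gaussian_sum_sub_le hτ (v i))).2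
  have a2 := (abs_le.1 (abs_gaussian_sum_sub_le hτ (v' i))).1
  -- Each one-dimensional sum lies between `τ (1 - y)` and `τ (1 + y)`, and `(1 + y) / (1 - y) ≤ exp
  -- (3 y)` for `0 ≤ y ≤ 1/2`.
  have e1 : 1 + y ≤ Real.exp y := by linarith [Real.add_one_le_exp y]
  have e2 : 1 ≤ Real.exp (2 * y) * (1 - y) := by
    have := Real.add_one_le_exp (2 * y)
    nlinarith
  calc _ ≤ τ * (1 + y) := by linarith
    _ ≤ τ * (Real.exp y * (Real.exp (2 * y) * (1 - y))) := by
        gcongr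
        calc 1 + y ≤ Real.exp y * 1 := by linarith
          _ ≤ _ := by gcongr
    _ = Real.exp (3 * y) * (τ * (1 - y)) := by
        rw [show 3 * y = y + 2 * y by ring, Real.exp_add]; ring
    _ ≤ _ := by gcongr; linarith

theorem le_tsum_isotropic {σ : ℝ} (hσ : 0 < σ) : ENNReal.ofReal ((σ / 60) ^ Fintype.card ι) ≤
      ∑' x : ι → ℤ, ENNReal.ofReal (Real.exp (-Real.pi * ((σ ^ 2)⁻¹ * ∑ i, (x i : ℝ) ^ 2))) := by
  have h := tsum_isotropic (ι := ι) (inv_pos.2 (pow_pos hσ 2)) 0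
  simp only [Pi.zero_apply, sub_zero] at h
  rw [h, Finset.prod_const, Finset.card_univ, ENNReal.ofReal_pow (by positivity)]
  gcongr
  have := le_sixty_gaussian_sum hσ
  linarith

/-- The dual sum factors over the coordinates, which reduces the smoothing condition to one
dimension. -/
theorem smoothing_sum_eq {n : ℕ} {t : ℝ} (ht : 0 < t) :
    ∑' z : Fin n → ℤ, Real.exp (-Real.pi * ∑ i, (t * z i) ^ 2) = (1 + dualTail t) ^ n := by
  have h := tsum_isotropic (ι := Fin n) (pow_pos ht 2) 0
  simp only [Pi.zero_apply, sub_zero] at h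
  have e : ∀ z : Fin n → ℤ, Real.exp (-Real.pi * ∑ i, (t * z i) ^ 2) =
      Real.exp (-Real.pi * (t ^ 2 * ∑ i, (z i : ℝ) ^ 2)) := by
    intro z; congr 2; rw [Finset.mul_sum]; exact Finset.sum_congr rfl fun i _ => by ring
  simp_rw [e]
  have h2 : ∀ z : Fin n → ℤ, Real.exp (-Real.pi * (t ^ 2 * ∑ i, (z i : ℝ) ^ 2)) =
      (ENNReal.ofReal (Real.exp (-Real.pi * (t ^ 2 * ∑ i, (z i : ℝ) ^ 2)))).toReal := fun z =>
    (ENNReal.toReal_ofReal (Real.exp_pos _).le).symm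
  have h3 : 1 + dualTail t = ∑' j : ℤ, Real.exp (-Real.pi * (t ^ 2 * (j : ℝ) ^ 2)) := by
    rw [dualTail]; ring
  rw [tsum_congr h2]
  rw [← ENNReal.tsum_toReal_eq fun _ => ENNReal.ofReal_ne_top, h, Finset.prod_const, ← h3,
    ENNReal.toReal_pow, ENNReal.toReal_ofReal (by linarith [dualTail_nonneg ht]), Finset.card_univ,
    Fintype.card_fin]

variable {n : ℕ} {ε : ℝ}

theorem smoothing_set_nonempty (n : ℕ) (hε : 0 < ε) : ∃ t : ℝ, 0 < t ∧ (1 + dualTail t) ^ n ≤ 1 + ε := by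
  have hc : Filter.Tendsto (fun u : ℝ => (1 + u) ^ n) (nhds 0) (nhds 1) := by
    have : Continuous fun u : ℝ => (1 + u) ^ n := by fun_prop
    have h := this.tendsto 0
    rwa [add_zero, one_pow] at h
  have hx : Filter.Tendsto (fun t : ℝ => Real.exp (-Real.pi * t ^ 2)) Filter.atTop (nhds 0) := by
    refine Real.tendsto_exp_atBot.comp ?_
    exact (Filter.tendsto_pow_atTop two_ne_zero).const_mul_atTop_of_neg (by linarith [Real.pi_pos])
  have hx4 : Filter.Tendsto (fun t : ℝ => 4 * Real.exp (-Real.pi * t ^ 2)) Filter.atTop (nhds 0) := by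
    have := hx.const_mul 4
    rwa [mul_zero] at this
  have h1 := (hc.comp hx4).eventually (gt_mem_nhds (show (1 : ℝ) < 1 + ε by linarith))
  have h2 := hx.eventually (gt_mem_nhds (show (0 : ℝ) < 1 / 2 by norm_num))
  obtain ⟨t, ht1, ht2, ht3⟩ := (h1.and (h2.and (Filter.eventually_gt_atTop 0))).exists
  refine ⟨t, ht3, le_trans ?_ ht1.le⟩
  have := dualTail_le ht3 ht2.le
  have h0 := dualTail_nonneg ht3
  simp only [Function.comp]
  gcongr

/-- Bernoulli's inequality gives the bound at every width above the infimum. It passes to the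
infimum through finite partial sums, which are continuous in the width. The infimum is positive
because at width zero every term equals one, so the partial sums would be unbounded. -/
theorem smoothing_spec [NeZero n] (hε : 0 < ε) :
    0 < smoothing n ε ∧ n * dualTail (smoothing n ε) ≤ ε := by
  set η := smoothing n ε with hη
  have hn : (0 : ℝ) < n := by exact_mod_cast Nat.pos_of_ne_zero (NeZero.ne n)
  obtain ⟨t₀, ht₀, ht₀'⟩ := smoothing_set_nonempty n hε
  have hne : {t : ℝ | 0 < t ∧ ∑' z : Fin n → ℤ, Real.exp (-Real.pi * ∑ i, (t * z i) ^ 2) ≤ 1 + ε}.Nonempty :=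
    ⟨t₀, ht₀, by rwa [smoothing_sum_eq ht₀]⟩
  have hη0 : 0 ≤ η := le_csInf hne fun t ht => ht.1.le
  have hbound : ∀ t, η < t → n * dualTail t ≤ ε := by
    intro t ht
    obtain ⟨t', ht', hlt⟩ := exists_lt_of_csInf_lt hne ht
    rw [Set.mem_ofPred_eq, smoothing_sum_eq ht'.1] at ht'
    have h1 := one_add_mul_le_pow (a := dualTail t') (by linarith [dualTail_nonneg ht'.1]) n
    have h2 := dualTail_anti ht'.1 hlt.le
    have : n * dualTail t ≤ n * dualTail t' := by gcongr
    linarith [ht'.2]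
  have hfin : ∀ s : Finset ℤ, (0 : ℤ) ∉ s →
      n * ∑ j ∈ s, Real.exp (-Real.pi * (η ^ 2 * (j : ℝ) ^ 2)) ≤ ε := by
    intro s hs
    have hc : Continuous fun t : ℝ => n * ∑ j ∈ s, Real.exp (-Real.pi * (t ^ 2 * (j : ℝ) ^ 2)) := by
      fun_prop
    have ht := (hc.tendsto η).mono_left (nhdsWithin_le_nhds (s := Set.Ioi η))
    refine le_of_tendsto ht ?_
    filter_upwards [self_mem_nhdsWithin] with t ht
    have htpos : 0 < t := hη0.trans_lt ht
    refine le_trans ?_ (hbound t ht)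
    gcongr
    have h1 := (summable_dual htpos).sum_le_tsum (insert 0 s) fun j _ => (Real.exp_pos _).le
    rw [Finset.sum_insert hs] at h1
    simp only [Int.cast_zero, ne_eq, OfNat.ofNat_ne_zero, not_false_eq_true, zero_pow, mul_zero,
      Real.exp_zero] at h1
    unfold dualTail
    linarith
  have hpos : 0 < η := by
    refine lt_of_le_of_ne hη0 fun h0 => ?_
    obtain ⟨M, hM⟩ := exists_nat_gt (ε / n)
    have := hfin (Finset.Icc 1 (M : ℤ)) (by simp)
    rw [← h0] at this
    simp only [ne_eq, OfNat.ofNat_ne_zero, not_false_eq_true, zero_pow, zero_mul, mul_zero,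
      Real.exp_zero, Finset.sum_const, Int.card_Icc, nsmul_eq_mul, mul_one] at this
    rw [show ((M : ℤ) + 1 - 1).toNat = M by simp] at this
    rw [div_lt_iff₀ hn] at hM
    linarith
  refine ⟨hpos, ?_⟩
  rw [← le_div_iff₀' hn, dualTail, sub_le_iff_le_add]
  refine (summable_dual hpos).tsum_le_of_sum_le fun s => ?_
  have h1 := hfin (s.erase 0) (by simp)
  rw [← le_div_iff₀' hn] at h1
  have h2 : ∑ j ∈ s, Real.exp (-Real.pi * (η ^ 2 * (j : ℝ) ^ 2)) ≤
      ∑ j ∈ insert 0 (s.erase 0), Real.exp (-Real.pi * (η ^ 2 * (j : ℝ) ^ 2)) := by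
    refine Finset.sum_le_sum_of_subset_of_nonneg ?_ fun _ _ _ => (Real.exp_pos _).le
    intro j hj
    by_cases h : j = 0 <;> simp [h, hj]
  rw [Finset.sum_insert (by simp)] at h2
  simp only [Int.cast_zero, ne_eq, OfNat.ofNat_ne_zero, not_false_eq_true, zero_pow, mul_zero,
    Real.exp_zero] at h2
  linarith

theorem exp_smoothing_le [NeZero n] (hε : 0 < ε) :
    Real.exp (-Real.pi * smoothing n ε ^ 2) ≤ ε / (2 * n) := by
  have hn : (0 : ℝ) < n := by exact_mod_cast Nat.pos_of_ne_zero (NeZero.ne n)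
  obtain ⟨h1, h2⟩ := smoothing_spec (n := n) hε
  have h3 := two_exp_le_dualTail h1
  rw [le_div_iff₀ (by positivity)]
  have : (n : ℝ) * (2 * Real.exp (-Real.pi * smoothing n ε ^ 2)) ≤ ε := le_trans (by gcongr) h2
  linarith

/-- The smoothing parameter divided by `√2` still smooths, with error `√(8 n ε)`. -/
theorem dualTail_smoothing_div_sqrt_two [NeZero n] (hε : 0 < ε) (hε' : ε ≤ 1 / 2) :
    n * dualTail (smoothing n ε / Real.sqrt 2) ≤ Real.sqrt (8 * n * ε) := by
  have hn1 : (1 : ℝ) ≤ n := by exact_mod_cast Nat.pos_of_ne_zero (NeZero.ne n)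
  have hn : (0 : ℝ) < n := by linarith
  obtain ⟨h1, -⟩ := smoothing_spec (n := n) hε
  have h2 := exp_smoothing_le (n := n) hε
  set η := smoothing n ε
  -- Dividing the width by `√2` halves the exponent, which replaces the bound `ε / (2 n)` by its
  -- square root.
  have e : Real.exp (-Real.pi * (η / Real.sqrt 2) ^ 2) = Real.sqrt (Real.exp (-Real.pi * η ^ 2)) := by
    rw [Real.sqrt_eq_rpow (Real.exp _), ← Real.exp_mul, div_pow, Real.sq_sqrt (by norm_num)]
    congr 1; ring
  have h3 : Real.exp (-Real.pi * (η / Real.sqrt 2) ^ 2) ≤ Real.sqrt (ε / (2 * n)) := by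
    rw [e]; exact Real.sqrt_le_sqrt h2
  have h4 : Real.sqrt (ε / (2 * n)) ≤ 1 / 2 := by
    rw [show (1 / 2 : ℝ) = Real.sqrt (1 / 4) by
      rw [show (1 / 4 : ℝ) = (1 / 2) ^ 2 by norm_num, Real.sqrt_sq (by norm_num)]]
    refine Real.sqrt_le_sqrt ?_
    rw [div_le_iff₀ (by positivity)]; nlinarith
  have h5 := dualTail_le (τ := η / Real.sqrt 2) (by positivity) (h3.trans h4)
  calc n * dualTail (η / Real.sqrt 2) ≤ n * (4 * Real.sqrt (ε / (2 * n))) := by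
        gcongr; exact h5.trans (by gcongr)
    _ = Real.sqrt ((4 * n) ^ 2 * (ε / (2 * n))) := by
        rw [Real.sqrt_mul (by positivity), Real.sqrt_sq (by positivity)]; ring
    _ = _ := by congr 1; field_simp; norm_num

end Isotropic

/-! ### Quadratic forms and anisotropic Gaussian sums -/

section Quad
open Matrix
variable {ι κ : Type} [Fintype ι] [DecidableEq ι] [Fintype κ] [DecidableEq κ]

/-- The quadratic form of a matrix. -/
def quad (A : Matrix ι ι ℝ) (x : ι → ℝ) : ℝ := x ⬝ᵥ A *ᵥ x

omit [DecidableEq ι] in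
theorem dot_mulVec_comm {A : Matrix ι ι ℝ} (hA : Aᵀ = A) (x y : ι → ℝ) : x ⬝ᵥ A *ᵥ y = y ⬝ᵥ A *ᵥ x := by
  rw [dotProduct_mulVec, ← mulVec_transpose, hA, dotProduct_comm]

theorem quad_smul_one (c : ℝ) (x : ι → ℝ) : quad (c • (1 : Matrix ι ι ℝ)) x = c * (x ⬝ᵥ x) := by
  rw [quad, smul_mulVec, one_mulVec, dotProduct_smul, smul_eq_mul]

omit [DecidableEq ι] in
theorem quad_sub (A B : Matrix ι ι ℝ) (x : ι → ℝ) : quad (A - B) x = quad A x - quad B x := by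
  rw [quad, sub_mulVec, dotProduct_sub]; rfl

omit [DecidableEq ι] in
theorem quad_add (A B : Matrix ι ι ℝ) (x : ι → ℝ) : quad (A + B) x = quad A x + quad B x := by
  rw [quad, add_mulVec, dotProduct_add]; rfl

omit [DecidableEq ι] in
theorem quad_smul (c : ℝ) (A : Matrix ι ι ℝ) (x : ι → ℝ) : quad (c • A) x = c * quad A x := by
  rw [quad, smul_mulVec, dotProduct_smul, smul_eq_mul]; rfl

omit [DecidableEq ι] [DecidableEq κ] in
theorem quad_conj (A : Matrix ι ι ℝ) (T : Matrix ι κ ℝ) (x : κ → ℝ) :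
    quad (Tᵀ * A * T) x = quad A (T *ᵥ x) := by
  rw [quad, quad, ← mulVec_mulVec, ← mulVec_mulVec, dotProduct_mulVec, vecMul_transpose]

omit [DecidableEq ι] in
theorem quad_neg_vec (A : Matrix ι ι ℝ) (x : ι → ℝ) : quad A (-x) = quad A x := by
  simp [quad, mulVec_neg]

omit [DecidableEq ι] in
theorem quad_add_vec {A : Matrix ι ι ℝ} (hA : Aᵀ = A) (x y : ι → ℝ) :
    quad A (x + y) = quad A x + 2 * (x ⬝ᵥ A *ᵥ y) + quad A y := by
  simp only [quad, mulVec_add, dotProduct_add, add_dotProduct]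
  rw [dot_mulVec_comm hA y x]; ring

omit [DecidableEq ι] in
theorem quad_sub_vec {A : Matrix ι ι ℝ} (hA : Aᵀ = A) (x y : ι → ℝ) :
    quad A (x - y) = quad A x - 2 * (x ⬝ᵥ A *ᵥ y) + quad A y := by
  rw [sub_eq_add_neg, quad_add_vec hA, quad_neg_vec, mulVec_neg, dotProduct_neg]; ring

omit [DecidableEq ι] in
theorem continuous_quad (A : Matrix ι ι ℝ) : Continuous (quad A) := by
  unfold quad dotProduct mulVec dotProduct
  fun_prop

omit [DecidableEq ι] in
/-- Completing the square. -/
theorem quad_complete {A : Matrix ι ι ℝ} (hA : Aᵀ = A) (T : Matrix ι κ ℝ) {c : ℝ}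
    {R : Matrix κ κ ℝ} (hK : (c • (1 : Matrix κ κ ℝ) + Tᵀ * A * T) * R = 1) (z : ι → ℝ) (x : κ → ℝ) :
    quad A (z - T *ᵥ x) + c * (x ⬝ᵥ x) =
      quad (A - A * T * R * Tᵀ * A) z +
        quad (c • (1 : Matrix κ κ ℝ) + Tᵀ * A * T) (x - R *ᵥ (Tᵀ *ᵥ (A *ᵥ z))) := by
  set K := c • (1 : Matrix κ κ ℝ) + Tᵀ * A * T with hKdef
  have hKs : Kᵀ = K := by
    simp [hKdef, transpose_mul, hA, Matrix.mul_assoc]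
  set u := Tᵀ *ᵥ (A *ᵥ z) with hu
  have h1 : z ⬝ᵥ A *ᵥ (T *ᵥ x) = x ⬝ᵥ u := by
    rw [dot_mulVec_comm hA, hu, dotProduct_mulVec x Tᵀ, vecMul_transpose]
  have h2 : quad K x = c * (x ⬝ᵥ x) + quad A (T *ᵥ x) := by
    rw [hKdef, quad_add, quad_smul_one, quad_conj]
  have h3 : K *ᵥ (R *ᵥ u) = u := by rw [mulVec_mulVec, hK, one_mulVec]
  have h4 : quad (A * T * R * Tᵀ * A) z = R *ᵥ u ⬝ᵥ u := by
    rw [quad]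
    have : (A * T * R * Tᵀ * A) *ᵥ z = A *ᵥ (T *ᵥ (R *ᵥ u)) := by
      simp only [hu, mulVec_mulVec, Matrix.mul_assoc]
    rw [this, dot_mulVec_comm hA, hu, dotProduct_mulVec _ Tᵀ, vecMul_transpose]
  rw [quad_sub_vec hA, quad_sub_vec hKs, quad_sub, h1, h2, h4, h3]
  have h5 : quad K (R *ᵥ u) = R *ᵥ u ⬝ᵥ u := by rw [quad, h3]
  rw [h5]; ring

omit [DecidableEq ι] in
theorem sum_sq_eq_dot (x : ι → ℝ) : ∑ i, x i ^ 2 = x ⬝ᵥ x := by simp [dotProduct, sq]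

omit [DecidableEq ι] in
theorem gaussian_lintegral_ne_top {c : ℝ} (hc : 0 < c) :
    ∫⁻ w : ι → ℝ, ENNReal.ofReal (Real.exp (-Real.pi * (c * (w ⬝ᵥ w)))) ≠ ⊤ := by
  have h : MeasureTheory.Integrable (fun w : ι → ℝ => Real.exp (-Real.pi * (c * (w ⬝ᵥ w)))) := by
    have := MeasureTheory.Integrable.fintype_prod (ι := ι) (𝕜 := ℝ) (E := ℝ)
      (f := fun _ x => Real.exp (-(Real.pi * c) * x ^ 2)) (μ := fun _ => MeasureTheory.volume)
      fun _ => integrable_exp_neg_mul_sq (by positivity)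
    refine this.congr (Filter.Eventually.of_forall fun w => ?_)
    simp only [← Real.exp_sum, ← Finset.mul_sum, sum_sq_eq_dot]
    congr 1; ring
  exact h.lintegral_lt_top.ne

/-- Shifted Gaussian sums are nearly independent of the shift once the covariance exceeds `τ² I`. -/
theorem tsum_quad_le {K R : Matrix κ κ ℝ} (hR : Rᵀ = R) (hKR : K * R = 1) {τ : ℝ}
    (hτ : 0 < τ) (hlt : ∀ x : κ → ℝ, x ≠ 0 → τ ^ 2 * (x ⬝ᵥ x) < quad R x)
    (hy : dualTail τ ≤ 1 / 2) (v v' : κ → ℝ) :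
    ∑' x : κ → ℤ, ENNReal.ofReal (Real.exp (-Real.pi * quad K ((fun i => (x i : ℝ)) - v))) ≤
      ENNReal.ofReal (Real.exp (3 * (Fintype.card κ * dualTail τ))) *
      ∑' x : κ → ℤ, ENNReal.ofReal (Real.exp (-Real.pi * quad K ((fun i => (x i : ℝ)) - v'))) := by
  -- The Gaussian of covariance `R = R₁ + τ² I` is a continuous mixture of Gaussians of covariance
  -- `τ² I` whose centres are Gaussian of covariance `R₁`. The dependence on the shift then sits in
  -- isotropic sums, where it is already known to be small.
  set R₁ := R - τ ^ 2 • (1 : Matrix κ κ ℝ) with hR₁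
  have hR₁s : R₁ᵀ = R₁ := by simp [hR₁, hR]
  have hPD : R₁.PosDef := by
    refine PosDef.of_dotProduct_mulVec_pos ?_ fun x hx => ?_
    · rw [IsHermitian, conjTranspose_eq_transpose_of_trivial, hR₁s]
    · have := hlt x hx
      have e : star x ⬝ᵥ R₁ *ᵥ x = quad R₁ x := by simp [quad]
      rw [e, hR₁, quad_sub, quad_smul_one]; linarith
  set A := R₁⁻¹ with hAdef
  have hdet : IsUnit R₁.det := (isUnit_iff_isUnit_det _).1 hPD.isUnit
  have hAR : A * R₁ = 1 := nonsing_inv_mul _ hdet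
  have hRA : R₁ * A = 1 := mul_nonsing_inv _ hdet
  have hA : Aᵀ = A := by rw [hAdef, transpose_nonsing_inv, hR₁s]
  have hRK : R * K = 1 := mul_eq_one_comm.1 hKR
  have hAK : A - K = τ ^ 2 • (A * K) := by
    have h : A * (R - R₁) * K = A - K := by
      rw [mul_sub, sub_mul, hAR, mul_assoc, hRK, mul_one, one_mul]
    rw [← h, hR₁, sub_sub_cancel]; simp
  have hKA : A - K = τ ^ 2 • (K * A) := by
    have h : K * (R - R₁) * A = A - K := by
      rw [mul_sub, sub_mul, hKR, mul_assoc, hRA, mul_one, one_mul]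
    rw [← h, hR₁, sub_sub_cancel]; simp
  have hApos : ∀ x, 0 ≤ quad A x := fun x => by
    have := hPD.inv.posSemidef.dotProduct_mulVec_nonneg x
    simpa [quad] using this
  set c := (τ ^ 2)⁻¹ with hc
  have hcpos : 0 < c := by positivity
  have hcτ : c * τ ^ 2 = 1 := inv_mul_cancel₀ (by positivity)
  -- This is the inverse of `c I + A`, written with `K` instead of a further matrix inverse; that it
  -- works rests on `A - K = τ² A K`.
  set R' := τ ^ 2 • (1 : Matrix κ κ ℝ) - (τ ^ 2 * τ ^ 2) • K with hR'
  have hK' : (c • (1 : Matrix κ κ ℝ) + (1 : Matrix κ κ ℝ)ᵀ * A * 1) * R' = 1 := by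
    have : (c • (1 : Matrix κ κ ℝ) + (1 : Matrix κ κ ℝ)ᵀ * A * 1) * R' =
        (c * τ ^ 2) • 1 - (c * τ ^ 2 * τ ^ 2) • K + τ ^ 2 • A - τ ^ 2 • (τ ^ 2 • (A * K)) := by
      simp only [hR', transpose_one, one_mul, mul_one, add_mul, mul_sub, smul_mul_assoc,
        mul_smul_comm]
      module
    rw [this, ← hAK, hcτ, smul_sub, one_smul, one_mul]; abel
  have hS' : A - A * 1 * R' * (1 : Matrix κ κ ℝ)ᵀ * A = K := by
    have : A * 1 * R' * (1 : Matrix κ κ ℝ)ᵀ * A = τ ^ 2 • (A * A) - τ ^ 2 • ((τ ^ 2 • (A * K)) * A) := by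
      simp only [hR', transpose_one, mul_one, mul_sub, sub_mul, smul_mul_assoc, mul_smul_comm, smul_smul]
    rw [this, ← hAK, sub_mul, smul_sub, sub_sub_cancel, ← hKA]; abel
  set K' := c • (1 : Matrix κ κ ℝ) + (1 : Matrix κ κ ℝ)ᵀ * A * 1 with hK'def
  set J := ∫⁻ w : κ → ℝ, ENNReal.ofReal (Real.exp (-Real.pi * quad K' w)) with hJ
  have hmeas : ∀ B : Matrix κ κ ℝ, Measurable fun w : κ → ℝ =>
      ENNReal.ofReal (Real.exp (-Real.pi * quad B w)) := fun B =>
    (ENNReal.measurable_ofReal.comp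
      (Real.continuous_exp.comp ((continuous_quad B).const_mul _)).measurable :)
  have hJtop : J ≠ ⊤ := by
    refine ne_top_of_le_ne_top (gaussian_lintegral_ne_top (ι := κ) hcpos)
      (MeasureTheory.lintegral_mono fun w => ENNReal.ofReal_le_ofReal (Real.exp_le_exp.2 ?_))
    have : c * (w ⬝ᵥ w) ≤ quad K' w := by
      rw [hK'def, quad_add, quad_smul_one, quad_conj]
      linarith [hApos ((1 : Matrix κ κ ℝ) *ᵥ w)]
    nlinarith [Real.pi_pos]
  have hJ0 : J ≠ 0 := by
    rw [hJ]
    refine (MeasureTheory.lintegral_pos_iff_support (hmeas K')).2 ?_ |>.ne'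
    have : (Function.support fun w : κ → ℝ => ENNReal.ofReal (Real.exp (-Real.pi * quad K' w))) =
        Set.univ := by
      refine Set.eq_univ_of_forall fun w => ?_
      rw [Function.mem_support]
      exact (ENNReal.ofReal_pos.2 (Real.exp_pos _)).ne'
    rw [this]
    exact isOpen_univ.measure_pos _ Set.univ_nonempty
  -- Completing the square in `w` leaves a Gaussian integral `J` that does not depend on `z`, by
  -- translation invariance of Lebesgue measure.
  have hmix : ∀ z : κ → ℝ, ENNReal.ofReal (Real.exp (-Real.pi * quad K z)) * J =
      ∫⁻ w : κ → ℝ, ENNReal.ofReal (Real.exp (-Real.pi * quad A w)) *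
        ENNReal.ofReal (Real.exp (-Real.pi * (c * ((z - w) ⬝ᵥ (z - w))))) := by
    intro z
    have h1 : ∀ w : κ → ℝ, ENNReal.ofReal (Real.exp (-Real.pi * quad A w)) *
        ENNReal.ofReal (Real.exp (-Real.pi * (c * ((z - w) ⬝ᵥ (z - w))))) =
        ENNReal.ofReal (Real.exp (-Real.pi * quad K z)) *
          ENNReal.ofReal (Real.exp (-Real.pi *
            quad K' ((z - R' *ᵥ ((1 : Matrix κ κ ℝ)ᵀ *ᵥ (A *ᵥ z))) - w))) := by
      intro w
      rw [← ENNReal.ofReal_mul (Real.exp_pos _).le, ← ENNReal.ofReal_mul (Real.exp_pos _).le,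
        ← Real.exp_add, ← Real.exp_add, ← mul_add, ← mul_add]
      have := quad_complete hA (1 : Matrix κ κ ℝ) hK' z (z - w)
      rw [hS', one_mulVec, sub_sub_cancel] at this
      rw [this, sub_right_comm]
    simp_rw [h1]
    rw [MeasureTheory.lintegral_const_mul' _ _ ENNReal.ofReal_ne_top,
      MeasureTheory.lintegral_sub_left_eq_self
        (fun w => ENNReal.ofReal (Real.exp (-Real.pi * quad K' w)))]
  have hsum : ∀ v : κ → ℝ,
      (∑' x : κ → ℤ, ENNReal.ofReal (Real.exp (-Real.pi * quad K ((fun i => (x i : ℝ)) - v)))) * J =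
      ∫⁻ w : κ → ℝ, ENNReal.ofReal (Real.exp (-Real.pi * quad A w)) *
        ∑' x : κ → ℤ, ENNReal.ofReal (Real.exp (-Real.pi * (c * ∑ i, ((x i : ℝ) - (v + w) i) ^ 2))) := by
    intro v
    rw [← ENNReal.tsum_mul_right]
    simp_rw [hmix, ← ENNReal.tsum_mul_left]
    rw [MeasureTheory.lintegral_tsum]
    · refine tsum_congr fun x => MeasureTheory.lintegral_congr fun w => ?_
      rw [← sum_sq_eq_dot]
      simp only [Pi.sub_apply, Pi.add_apply, sub_sub]
    · intro x
      refine ((hmeas A).mul ?_).aemeasurable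
      refine ENNReal.measurable_ofReal.comp (Continuous.measurable ?_)
      simp only [Pi.add_apply]
      fun_prop
  rw [← ENNReal.mul_le_mul_iff_left hJ0 hJtop, mul_assoc, hsum, hsum,
    ← MeasureTheory.lintegral_const_mul' _ _ ENNReal.ofReal_ne_top]
  refine MeasureTheory.lintegral_mono fun w => ?_
  simp only
  rw [mul_left_comm]
  gcongr
  exact tsum_isotropic_le hτ hy _ _

end Quad

/-! ### The covariance of the perturbation -/

section Covariance
open Matrix
variable {ι κ : Type} [Fintype ι] [DecidableEq ι] [Fintype κ] [DecidableEq κ]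

theorem dot_self_nonneg (x : ι → ℝ) : 0 ≤ x ⬝ᵥ x := by rw [← sum_sq_eq_dot]; positivity

theorem dot_self_pos {x : ι → ℝ} (hx : x ≠ 0) : 0 < x ⬝ᵥ x :=
  lt_of_le_of_ne (dot_self_nonneg x) fun h => hx (dotProduct_self_eq_zero.1 h.symm)

theorem dot_sq_le (x y : ι → ℝ) : (x ⬝ᵥ y) ^ 2 ≤ (x ⬝ᵥ x) * (y ⬝ᵥ y) := by
  rw [← sum_sq_eq_dot, ← sum_sq_eq_dot]
  exact Finset.sum_mul_sq_le_sq_mul_sq _ _ _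

/-- The covariance of the perturbation. -/
noncomputable def pertCov (r s : ℝ) (T : Matrix ι κ ℝ) : Matrix ι ι ℝ :=
  s ^ 2 • (1 : Matrix ι ι ℝ) - r ^ 2 • (T * Tᵀ)

theorem pertCov_transpose (r s : ℝ) (T : Matrix ι κ ℝ) : (pertCov r s T)ᵀ = pertCov r s T := by
  simp [pertCov]

theorem quad_pertCov (r s : ℝ) (T : Matrix ι κ ℝ) (y : ι → ℝ) :
    quad (pertCov r s T) y = s ^ 2 * (y ⬝ᵥ y) - r ^ 2 * (Tᵀ *ᵥ y ⬝ᵥ Tᵀ *ᵥ y) := by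
  rw [pertCov, quad_sub, quad_smul_one, quad_smul, quad, ← mulVec_mulVec, dotProduct_mulVec,
    ← mulVec_transpose]

/-- A matrix and its transpose have the same operator norm. With `u = Tᵀ y` one has `u·u = y·(T u)`,
and Cauchy–Schwarz allows one factor `u·u` to be cancelled. -/
theorem transpose_bound {T : Matrix ι κ ℝ} {t : ℝ} (ht : 0 ≤ t)
    (hT : ∀ x : κ → ℝ, T *ᵥ x ⬝ᵥ T *ᵥ x ≤ t * (x ⬝ᵥ x)) (y : ι → ℝ) :
    Tᵀ *ᵥ y ⬝ᵥ Tᵀ *ᵥ y ≤ t * (y ⬝ᵥ y) := by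
  set u := Tᵀ *ᵥ y with hu
  have h1 : u ⬝ᵥ u = y ⬝ᵥ T *ᵥ u := by
    rw [dotProduct_mulVec y, ← mulVec_transpose]
  have h2 := dot_sq_le y (T *ᵥ u)
  rw [← h1] at h2
  have h3 := hT u
  by_cases h0 : u = 0
  · rw [h0, dotProduct_zero]
    exact mul_nonneg ht (dot_self_nonneg y)
  · have hpos := dot_self_pos h0
    have : (u ⬝ᵥ u) * (u ⬝ᵥ u) ≤ (u ⬝ᵥ u) * (t * (y ⬝ᵥ y)) := by
      nlinarith [dot_self_nonneg y]
    exact le_of_mul_le_mul_left this hpos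

/-- The inequalities between the widths under which the perturbation is sampled. -/
structure WidthBounds (T : Matrix ι κ ℝ) (r s η : ℝ) : Prop where
  r_pos : 0 < r
  s_pos : 0 < s
  η_pos : 0 < η
  η_le : η ≤ r
  bound : ∃ t, 0 ≤ t ∧ (∀ x : κ → ℝ, T *ᵥ x ⬝ᵥ T *ᵥ x ≤ t * (x ⬝ᵥ x)) ∧
    (r ^ 2 + η ^ 2) * (t + 1) ≤ s ^ 2

namespace WidthBounds
variable {T : Matrix ι κ ℝ} {r s η : ℝ}

/-- The summand 1 in `t + 1` leaves room: `s² - r² t ≥ r²`. -/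
theorem le_quad (h : WidthBounds T r s η) (y : ι → ℝ) : r ^ 2 * (y ⬝ᵥ y) ≤ quad (pertCov r s T) y := by
  obtain ⟨t, ht, hT, hs⟩ := h.bound
  rw [quad_pertCov]
  have h1 := transpose_bound ht hT y
  have h2 := dot_self_nonneg y
  have h3 : r ^ 2 * (Tᵀ *ᵥ y ⬝ᵥ Tᵀ *ᵥ y) ≤ r ^ 2 * (t * (y ⬝ᵥ y)) := by gcongr
  have h4 : (r ^ 2 + η ^ 2) * (t + 1) * (y ⬝ᵥ y) ≤ s ^ 2 * (y ⬝ᵥ y) := by gcongr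
  have h5 : 0 ≤ η ^ 2 * (t + 1) * (y ⬝ᵥ y) := by positivity
  nlinarith

theorem quad_le (y : ι → ℝ) : quad (pertCov r s T) y ≤ s ^ 2 * (y ⬝ᵥ y) := by
  rw [quad_pertCov]
  have := dot_self_nonneg (Tᵀ *ᵥ y)
  nlinarith [sq_nonneg r, mul_nonneg (sq_nonneg r) this]

theorem posDef (h : WidthBounds T r s η) : (pertCov r s T).PosDef := by
  refine PosDef.of_dotProduct_mulVec_pos ?_ fun x hx => ?_
  · rw [IsHermitian, conjTranspose_eq_transpose_of_trivial, pertCov_transpose]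
  · have e : star x ⬝ᵥ pertCov r s T *ᵥ x = quad (pertCov r s T) x := by simp [quad]
    rw [e]
    exact lt_of_lt_of_le (mul_pos (pow_pos h.r_pos 2) (dot_self_pos hx)) (h.le_quad x)

theorem inv_mul (h : WidthBounds T r s η) : (pertCov r s T)⁻¹ * pertCov r s T = 1 :=
  nonsing_inv_mul _ ((isUnit_iff_isUnit_det _).1 h.posDef.isUnit)

theorem mul_inv (h : WidthBounds T r s η) : pertCov r s T * (pertCov r s T)⁻¹ = 1 :=
  mul_nonsing_inv _ ((isUnit_iff_isUnit_det _).1 h.posDef.isUnit)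

omit [Fintype ι] in
theorem inv_transpose [Fintype ι] : ((pertCov r s T)⁻¹)ᵀ = (pertCov r s T)⁻¹ := by
  rw [transpose_nonsing_inv, pertCov_transpose]

/-- Inverting the order between `S` and `s² I` needs no spectral theory: with `y = S⁻¹ x`, the form
of `S` is nonnegative at `y - s⁻² x`, and expanding it gives the claim. -/
theorem le_quad_inv (h : WidthBounds T r s η) (x : ι → ℝ) :
    (s ^ 2)⁻¹ * (x ⬝ᵥ x) ≤ quad (pertCov r s T)⁻¹ x := by
  set S := pertCov r s T
  set y := S⁻¹ *ᵥ x with hy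
  have hSy : S *ᵥ y = x := by rw [hy, mulVec_mulVec, h.mul_inv, one_mulVec]
  have hS : Sᵀ = S := pertCov_transpose r s T
  have h1 : quad S⁻¹ x = quad S y := by
    rw [quad, quad, hSy, ← hy, dotProduct_comm]
  have h2 : 0 ≤ quad S (y - (s ^ 2)⁻¹ • x) :=
    le_trans (mul_nonneg (sq_nonneg _) (dot_self_nonneg _)) (h.le_quad _)
  rw [quad_sub_vec hS, dot_mulVec_comm hS, hSy] at h2
  have h3 : quad S ((s ^ 2)⁻¹ • x) = (s ^ 2)⁻¹ * (s ^ 2)⁻¹ * quad S x := by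
    simp only [quad, mulVec_smul, smul_dotProduct, dotProduct_smul, smul_eq_mul]; ring
  rw [h3, smul_dotProduct, smul_eq_mul] at h2
  have h4 : (s ^ 2)⁻¹ * (s ^ 2)⁻¹ * quad S x ≤ (s ^ 2)⁻¹ * (s ^ 2)⁻¹ * (s ^ 2 * (x ⬝ᵥ x)) := by
    gcongr; exact quad_le x
  have h5 : (s ^ 2)⁻¹ * (s ^ 2)⁻¹ * (s ^ 2 * (x ⬝ᵥ x)) = (s ^ 2)⁻¹ * (x ⬝ᵥ x) := by
    have := h.s_pos.ne'
    field_simp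
  rw [h1]; linarith

theorem quad_inv_le (h : WidthBounds T r s η) (x : ι → ℝ) :
    quad (pertCov r s T)⁻¹ x ≤ (r ^ 2)⁻¹ * (x ⬝ᵥ x) := by
  set S := pertCov r s T
  set y := S⁻¹ *ᵥ x with hy
  have hSy : S *ᵥ y = x := by rw [hy, mulVec_mulVec, h.mul_inv, one_mulVec]
  have h1 : quad S⁻¹ x = x ⬝ᵥ y := rfl
  have h1' : quad S y = x ⬝ᵥ y := by rw [quad, hSy, dotProduct_comm]
  have h2 := h.le_quad y
  rw [h1'] at h2
  have h3 := dot_sq_le x y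
  have hr : 0 < r ^ 2 := pow_pos h.r_pos 2
  rw [h1, inv_mul_eq_div, le_div_iff₀ hr]
  rcases (dot_self_nonneg y).lt_or_eq with h0 | h0
  · have h4 : 0 < x ⬝ᵥ y := lt_of_lt_of_le (mul_pos hr h0) h2
    have h6 : r ^ 2 * (x ⬝ᵥ y) ^ 2 ≤ (x ⬝ᵥ x) * (x ⬝ᵥ y) := by
      calc r ^ 2 * (x ⬝ᵥ y) ^ 2 ≤ r ^ 2 * ((x ⬝ᵥ x) * (y ⬝ᵥ y)) := by gcongr
        _ = (x ⬝ᵥ x) * (r ^ 2 * (y ⬝ᵥ y)) := by ring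
        _ ≤ _ := by gcongr; exact dot_self_nonneg x
    nlinarith
  · rw [dotProduct_self_eq_zero.1 h0.symm, dotProduct_zero, zero_mul]
    exact dot_self_nonneg x

/-- The covariance of the gadget sample given the preimage. -/
noncomputable def condCov (r s : ℝ) (T : Matrix ι κ ℝ) : Matrix κ κ ℝ :=
  r ^ 2 • (1 : Matrix κ κ ℝ) - (r ^ 2 * r ^ 2 * (s ^ 2)⁻¹) • (Tᵀ * T)

omit [DecidableEq ι] in
theorem condCov_transpose : (condCov r s T)ᵀ = condCov r s T := by simp [condCov]

/-- A Woodbury identity. The perturbation and `T x` have total covariance `s² I`, so the conditional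
covariance of `x` given the preimage has the closed form `r² I - r⁴ s⁻² Tᵀ T`. -/
theorem precision_mul_condCov (h : WidthBounds T r s η) :
    ((r ^ 2)⁻¹ • (1 : Matrix κ κ ℝ) + Tᵀ * (pertCov r s T)⁻¹ * T) * condCov r s T = 1 := by
  have hr : (r ^ 2)⁻¹ * r ^ 2 = 1 := inv_mul_cancel₀ (pow_pos h.r_pos 2).ne'
  have hs : (s ^ 2)⁻¹ * s ^ 2 = 1 := inv_mul_cancel₀ (pow_pos h.s_pos 2).ne'
  set A := (pertCov r s T)⁻¹
  have hA : r ^ 2 • (A * (T * Tᵀ)) = s ^ 2 • A - 1 := by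
    have h1 : A * pertCov r s T = 1 := h.inv_mul
    rw [pertCov, mul_sub, mul_smul_comm, mul_one, mul_smul_comm] at h1
    rw [← h1]; abel
  have h2 : Tᵀ * A * T * (Tᵀ * T) = Tᵀ * (A * (T * Tᵀ)) * T := by
    simp only [Matrix.mul_assoc]
  have h3 : r ^ 2 • (Tᵀ * (A * (T * Tᵀ)) * T) = s ^ 2 • (Tᵀ * A * T) - Tᵀ * T := by
    rw [← Matrix.smul_mul, ← Matrix.mul_smul, hA, Matrix.mul_sub, Matrix.sub_mul, Matrix.mul_smul,
      Matrix.smul_mul, Matrix.mul_one]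
  have h4 : (r ^ 2 * r ^ 2 * (s ^ 2)⁻¹) • (Tᵀ * A * T * (Tᵀ * T)) =
      (r ^ 2 * (s ^ 2)⁻¹) • (s ^ 2 • (Tᵀ * A * T) - Tᵀ * T) := by
    rw [h2, ← h3, smul_smul]; congr 1; ring
  rw [condCov, add_mul, mul_sub, mul_sub]
  simp only [smul_mul_assoc, mul_smul_comm, one_mul, mul_one, smul_smul, h4, smul_sub]
  rw [mul_comm (r ^ 2) (r ^ 2)⁻¹, hr,
    show r ^ 2 * r ^ 2 * (s ^ 2)⁻¹ * (r ^ 2)⁻¹ = (r ^ 2)⁻¹ * r ^ 2 * (r ^ 2 * (s ^ 2)⁻¹) by ring, hr,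
    show r ^ 2 * (s ^ 2)⁻¹ * s ^ 2 = r ^ 2 * ((s ^ 2)⁻¹ * s ^ 2) by ring, hs]
  module

/-- The quadratic form that remains after `x` is eliminated is spherical: the covariance of the
perturbation was chosen to cancel the contribution of `T`. -/
theorem schur_eq (h : WidthBounds T r s η) :
    (pertCov r s T)⁻¹ - (pertCov r s T)⁻¹ * T * condCov r s T * Tᵀ * (pertCov r s T)⁻¹ =
      (s ^ 2)⁻¹ • (1 : Matrix ι ι ℝ) := by
  have hs : (s ^ 2)⁻¹ * s ^ 2 = 1 := inv_mul_cancel₀ (pow_pos h.s_pos 2).ne'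
  set A := (pertCov r s T)⁻¹ with hAdef
  set S := pertCov r s T with hS
  have hAS : A * S = 1 := h.inv_mul
  have hSA : S * A = 1 := h.mul_inv
  have hP : r ^ 2 • (T * Tᵀ) = s ^ 2 • 1 - S := by rw [hS, pertCov]; abel
  have h1 : T * condCov r s T * Tᵀ = (s ^ 2)⁻¹ • ((s ^ 2 • 1 - S) * S) := by
    have e : T * condCov r s T * Tᵀ = r ^ 2 • (T * Tᵀ) -
        (s ^ 2)⁻¹ • ((r ^ 2 • (T * Tᵀ)) * (r ^ 2 • (T * Tᵀ))) := by
      simp only [condCov, Matrix.mul_sub, Matrix.sub_mul, Matrix.mul_smul, Matrix.smul_mul, Matrix.one_mul,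
        smul_smul, Matrix.mul_assoc]
      congr 2; ring
    rw [e, hP]
    simp only [sub_mul, mul_sub, smul_mul_assoc, mul_smul_comm, one_mul, mul_one, smul_sub, smul_smul, hs]
    have : (s ^ 2)⁻¹ * (s ^ 2 * s ^ 2) = s ^ 2 := by rw [← mul_assoc, hs, one_mul]
    rw [this]
    module
  have h2 : A * T * condCov r s T * Tᵀ * A = A * (T * condCov r s T * Tᵀ) * A := by
    simp only [Matrix.mul_assoc]
  have h3 : A * ((s ^ 2 • 1 - S) * S) * A = s ^ 2 • A - 1 := by
    rw [mul_assoc, mul_assoc, hSA, mul_one, mul_sub, hAS, mul_smul_comm, mul_one]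
  rw [h2, h1, mul_smul_comm, smul_mul_assoc, h3, smul_sub, smul_smul, hs, one_smul]
  abel

/-- The conditional covariance exceeds `r² - r⁴ / (r² + η²) = r² η² / (r² + η²)`, which is at least
`η² / 2` because `η ≤ r`. This is where the width `η / √2` comes from; strictness comes from `t < t
+ 1`. -/
theorem lt_quad_condCov (h : WidthBounds T r s η) {x : κ → ℝ} (hx : x ≠ 0) :
    (η / Real.sqrt 2) ^ 2 * (x ⬝ᵥ x) < quad (condCov r s T) x := by
  obtain ⟨t, ht, hT, hs⟩ := h.bound
  have hr := h.r_pos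
  have hη := h.η_pos
  have hηr : η ^ 2 ≤ r ^ 2 := by have := h.η_le; gcongr
  have hxx := dot_self_pos hx
  have e1 : quad (condCov r s T) x =
      r ^ 2 * (x ⬝ᵥ x) - r ^ 2 * r ^ 2 * (s ^ 2)⁻¹ * (T *ᵥ x ⬝ᵥ T *ᵥ x) := by
    rw [condCov, quad_sub, quad_smul_one, quad_smul, ← Matrix.mul_one Tᵀ, quad_conj, quad, one_mulVec]
  have hsp : 0 < s ^ 2 := pow_pos h.s_pos 2
  have h1 : r ^ 2 * r ^ 2 * (s ^ 2)⁻¹ * (T *ᵥ x ⬝ᵥ T *ᵥ x) ≤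
      r ^ 2 * r ^ 2 * (s ^ 2)⁻¹ * (t * (x ⬝ᵥ x)) := by gcongr; exact hT x
  have h2 : η ^ 2 / 2 < r ^ 2 - r ^ 2 * r ^ 2 * (s ^ 2)⁻¹ * t := by
    rw [← div_eq_mul_inv, div_mul_eq_mul_div, lt_sub_comm, div_lt_iff₀ hsp]
    have h3 : (r ^ 2 - η ^ 2 / 2) * ((r ^ 2 + η ^ 2) * (t + 1)) ≤ (r ^ 2 - η ^ 2 / 2) * s ^ 2 := by
      gcongr; nlinarith
    have hr2 : 0 < r ^ 2 := by positivity
    have hη2 : 0 < η ^ 2 := by positivity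
    refine lt_of_lt_of_le ?_ h3
    have e : (r ^ 2 - η ^ 2 / 2) * ((r ^ 2 + η ^ 2) * (t + 1)) =
      r ^ 2 * r ^ 2 * (t + 1) + η ^ 2 * (r ^ 2 - η ^ 2) / 2 * (t + 1) := by ring
    rw [e]
    have : 0 ≤ η ^ 2 * (r ^ 2 - η ^ 2) / 2 * (t + 1) := by
      have : 0 ≤ r ^ 2 - η ^ 2 := by linarith
      positivity
    nlinarith [mul_pos hr2 hr2]
  have e2 : (η / Real.sqrt 2) ^ 2 = η ^ 2 / 2 := by rw [div_pow, Real.sq_sqrt (by norm_num)]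
  rw [e1, e2]
  have := mul_lt_mul_of_pos_right h2 hxx
  nlinarith

end WidthBounds
end Covariance

/-! ### Discrete Gaussian distributions -/

section DiscreteGaussian
open Matrix
variable {ι κ : Type} [Fintype ι] [DecidableEq ι] [Fintype κ] [DecidableEq κ]

/-- The real vector of an integer vector. -/
def toReal (x : ι → ℤ) : ι → ℝ := fun i => (x i : ℝ)

theorem toReal_add (x y : ι → ℤ) : toReal (x + y) = toReal x + toReal y := by funext i; simp [toReal]

theorem toReal_sub (x y : ι → ℤ) : toReal (x - y) = toReal x - toReal y := by funext i; simp [toReal]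

theorem toReal_mulVec (T : Matrix ι κ ℤ) (x : κ → ℤ) :
    toReal (T *ᵥ x) = T.map (fun t => (t : ℝ)) *ᵥ toReal x := by
  funext i; simp [toReal, mulVec, dotProduct]

theorem gaussianWeight_eq (S : Matrix ι ι ℝ) (x : ι → ℤ) :
    gaussianWeight S x = Real.exp (-Real.pi * quad S⁻¹ (toReal x)) := rfl

theorem inv_smul_one {c : ℝ} (hc : c ≠ 0) : (c • (1 : Matrix ι ι ℝ))⁻¹ = c⁻¹ • 1 := by
  refine inv_eq_left_inv ?_
  rw [smul_mul_smul_comm, inv_mul_cancel₀ hc, one_smul, mul_one]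

theorem gaussianWeight_smul_one {c : ℝ} (hc : c ≠ 0) (x : ι → ℤ) :
    gaussianWeight (c • (1 : Matrix ι ι ℝ)) x = Real.exp (-Real.pi * (c⁻¹ * ∑ i, (x i : ℝ) ^ 2)) := by
  rw [gaussianWeight_eq, inv_smul_one hc, quad_smul_one, ← sum_sq_eq_dot]
  rfl

theorem gaussianWeight_pos (S : Matrix ι ι ℝ) (x : ι → ℤ) : 0 < gaussianWeight S x := Real.exp_pos _

/-- The weights of a discrete Gaussian on a set. -/
noncomputable def gaussianMass (L : Set (ι → ℤ)) (S : Matrix ι ι ℝ) (x : ι → ℤ) : ℝ≥0∞ :=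
  L.indicator (fun x => ENNReal.ofReal (gaussianWeight S x)) x

theorem discreteGaussian_apply {L : Set (ι → ℤ)} {S : Matrix ι ι ℝ}
    (h0 : ∑' x, gaussianMass L S x ≠ 0) (h1 : ∑' x, gaussianMass L S x ≠ ⊤) (x : ι → ℤ) :
    discreteGaussian L S x = gaussianMass L S x * (∑' x, gaussianMass L S x)⁻¹ := by
  have h : (∑' x, L.indicator (fun x => ENNReal.ofReal (gaussianWeight S x)) x) ≠ 0 ∧
      (∑' x, L.indicator (fun x => ENNReal.ofReal (gaussianWeight S x)) x) ≠ ⊤ := ⟨h0, h1⟩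
  unfold discreteGaussian
  simp only
  rw [dif_pos h, PMF.normalize_apply]
  rfl

theorem gaussianMass_sum_ne_zero {L : Set (ι → ℤ)} {S : Matrix ι ι ℝ} {x : ι → ℤ} (hx : x ∈ L) :
    ∑' x, gaussianMass L S x ≠ 0 := by
  intro h
  have := ENNReal.tsum_eq_zero.1 h x
  rw [gaussianMass, Set.indicator_of_mem hx] at this
  exact (ENNReal.ofReal_pos.2 (gaussianWeight_pos S x)).ne' this

theorem gaussianMass_sum_ne_top (L : Set (ι → ℤ)) {S : Matrix ι ι ℝ} {c : ℝ} (hc : 0 < c)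
    (h : ∀ x : ι → ℝ, c * (x ⬝ᵥ x) ≤ quad S⁻¹ x) : ∑' x, gaussianMass L S x ≠ ⊤ := by
  refine ne_top_of_le_ne_top (tsum_isotropic_ne_top (ι := ι) hc 0) (ENNReal.tsum_le_tsum fun x => ?_)
  refine (Set.indicator_le_self' (fun _ _ => zero_le) x).trans (ENNReal.ofReal_le_ofReal ?_)
  rw [gaussianWeight_eq]
  refine Real.exp_le_exp.2 ?_
  have := h (toReal x)
  rw [← sum_sq_eq_dot] at this
  simp only [toReal, Pi.zero_apply, sub_zero] at this ⊢
  nlinarith [Real.pi_pos]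

theorem quad_inv_smul_one {c : ℝ} (hc : c ≠ 0) (x : ι → ℝ) :
    quad (c • (1 : Matrix ι ι ℝ))⁻¹ x = c⁻¹ * (x ⬝ᵥ x) := by rw [inv_smul_one hc, quad_smul_one]

theorem gaussianMass_sum_smul_one_ne_top (L : Set (ι → ℤ)) {c : ℝ} (hc : 0 < c) :
    ∑' x, gaussianMass L (c • (1 : Matrix ι ι ℝ)) x ≠ ⊤ :=
  gaussianMass_sum_ne_top L (inv_pos.2 hc) fun x => (quad_inv_smul_one hc.ne' x).ge

theorem gaussianMass_univ (S : Matrix ι ι ℝ) (x : ι → ℤ) :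
    gaussianMass Set.univ S x = ENNReal.ofReal (gaussianWeight S x) := by simp [gaussianMass]

/-- The coset `q ℤⁿ + c`. -/
def coset (q : ℕ) (c : κ → ZMod q) : Set (κ → ℤ) := {x | modQ q x = c}

/-- The total Gaussian mass of a coset of `q ℤⁿ` as a shifted isotropic sum. -/
theorem coset_mass_eq {q : ℕ} (hq : 0 < q) {r : ℝ} (hr : 0 < r) (c : κ → ZMod q) :
    ∃ v : κ → ℝ, ∑' x, gaussianMass (coset q c) (r ^ 2 • (1 : Matrix κ κ ℝ)) x =
      ∑' x : κ → ℤ, ENNReal.ofReal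
        (Real.exp (-Real.pi * (((r / q) ^ 2)⁻¹ * ∑ i, ((x i : ℝ) - v i) ^ 2))) := by
  have : NeZero q := ⟨hq.ne'⟩
  have hq' : (q : ℝ) ≠ 0 := by exact_mod_cast hq.ne'
  refine ⟨fun i => -(((c i).val : ℝ) / q), ?_⟩
  have hinj : Function.Injective fun x : κ → ℤ => fun i => (q : ℤ) * x i + (c i).val := by
    intro x y h
    funext i
    have := congrFun h i
    simp only [add_left_inj] at this
    exact mul_left_cancel₀ (by exact_mod_cast hq.ne') this
  rw [← hinj.tsum_eq]
  · refine tsum_congr fun x => ?_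
    have hmem : (fun i => (q : ℤ) * x i + (c i).val) ∈ coset q c := by
      funext i; simp [modQ]
    rw [gaussianMass, Set.indicator_of_mem hmem, gaussianWeight_smul_one (by positivity)]
    congr 3
    rw [Finset.mul_sum, Finset.mul_sum]
    refine Finset.sum_congr rfl fun i _ => ?_
    push_cast
    field_simp
    ring
  · intro x hx
    have hx' : x ∈ coset q c := by
      by_contra h
      exact hx (by simp [gaussianMass, h])
    refine ⟨fun i => (x i - (c i).val) / q, ?_⟩
    funext i
    have : (q : ℤ) ∣ x i - (c i).val := by
      rw [← ZMod.intCast_zmod_eq_zero_iff_dvd]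
      have := congrFun hx' i
      simp only [modQ] at this
      push_cast
      rw [this]; simp
    simp only
    rw [Int.mul_ediv_cancel' this]; ring

theorem coset_mass_le {q : ℕ} (hq : 0 < q) {r : ℝ} (hr : 0 < r) (hy : dualTail (r / q) ≤ 1 / 2)
    (c c' : κ → ZMod q) : ∑' x, gaussianMass (coset q c) (r ^ 2 • (1 : Matrix κ κ ℝ)) x ≤
      ENNReal.ofReal (Real.exp (3 * (Fintype.card κ * dualTail (r / q)))) *
        ∑' x, gaussianMass (coset q c') (r ^ 2 • (1 : Matrix κ κ ℝ)) x := by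
  obtain ⟨v, hv⟩ := coset_mass_eq hq hr c
  obtain ⟨v', hv'⟩ := coset_mass_eq hq hr c'
  have : (0 : ℝ) < q := by exact_mod_cast hq
  rw [hv, hv']
  exact tsum_isotropic_le (by positivity) hy v v'

theorem coset_nonempty {q : ℕ} (c : κ → ZMod q) : ∃ x, x ∈ coset q c := by
  choose x hx using fun i => ZMod.intCast_surjective (c i)
  exact ⟨x, funext hx⟩

/-- The law of `y + T x` for a perturbation `y` and an integer vector `x` that is Gaussian on a
uniformly random coset of `q ℤⁿ`. -/
noncomputable def realLaw (q : ℕ) [NeZero q] (r s : ℝ) (T : Matrix ι κ ℤ) : PMF (ι → ℤ) := do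
  let c ← PMF.uniformOfFintype (κ → ZMod q)
  let x ← discreteGaussian (coset q c) (r ^ 2 • (1 : Matrix κ κ ℝ))
  let y ← discreteGaussian Set.univ (pertCov r s (T.map fun t => (t : ℝ)))
  pure (y + T.mulVec x)

theorem apply_eq_ex {α : Type} (μ : PMF α) (z : α) [DecidablePred fun x => x = z] :
    μ z = ex μ fun x => if x = z then 1 else 0 := by
  unfold ex
  rw [tsum_eq_single z]
  · simp
  · intro x hx; simp [hx]

/-- The law of the approximate preimages is close to the discrete Gaussian of width `s`. -/
theorem realLaw_le {q : ℕ} [NeZero q] {r s η : ℝ} {T : Matrix ι κ ℤ}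
    (h : WidthBounds (T.map fun t => (t : ℝ)) r s η)
    (hy₁ : dualTail (r / q) ≤ 1 / 2) (hy₂ : dualTail (η / Real.sqrt 2) ≤ 1 / 2) (z : ι → ℤ) :
    realLaw q r s T z ≤ ENNReal.ofReal (Real.exp (6 * (Fintype.card κ * dualTail (r / q)) +
      3 * (Fintype.card κ * dualTail (η / Real.sqrt 2)))) *
      discreteGaussian Set.univ (s ^ 2 • (1 : Matrix ι ι ℝ)) z := by
  classical
  have hq : 0 < q := Nat.pos_of_ne_zero (NeZero.ne q)
  set TR : Matrix ι κ ℝ := T.map fun t => (t : ℝ) with hTR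
  set S := pertCov r s TR with hS
  set κ₁ := ENNReal.ofReal (Real.exp (3 * (Fintype.card κ * dualTail (r / q)))) with hκ₁
  set κ₂ := ENNReal.ofReal (Real.exp (3 * (Fintype.card κ * dualTail (η / Real.sqrt 2)))) with hκ₂
  have hκ₁0 : κ₁ ≠ 0 := (ENNReal.ofReal_pos.2 (Real.exp_pos _)).ne'
  have hκ₁t : κ₁ ≠ ⊤ := ENNReal.ofReal_ne_top
  have hκ : ENNReal.ofReal (Real.exp (6 * (Fintype.card κ * dualTail (r / q)) +
      3 * (Fintype.card κ * dualTail (η / Real.sqrt 2)))) = κ₁ * κ₁ * κ₂ := by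
    rw [hκ₁, hκ₂, ← ENNReal.ofReal_mul (Real.exp_pos _).le, ← Real.exp_add,
      ← ENNReal.ofReal_mul (Real.exp_pos _).le, ← Real.exp_add]
    congr 2; ring
  -- the masses
  let m : (κ → ZMod q) → ℝ≥0∞ := fun c => ∑' x, gaussianMass (coset q c) (r ^ 2 • (1 : Matrix κ κ ℝ)) x
  have hm0 : ∀ c, m c ≠ 0 := fun c => gaussianMass_sum_ne_zero (coset_nonempty c).choose_spec
  have hmt : ∀ c, m c ≠ ⊤ := fun c => gaussianMass_sum_smul_one_ne_top _ (pow_pos h.r_pos 2)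
  have hmle : ∀ c c', m c ≤ κ₁ * m c' := fun c c' => coset_mass_le hq h.r_pos hy₁ c c'
  let W := ∑' y, gaussianMass Set.univ S y
  have hW0 : W ≠ 0 := gaussianMass_sum_ne_zero (x := 0) (Set.mem_univ _)
  have hWt : W ≠ ⊤ := gaussianMass_sum_ne_top _ (inv_pos.2 (pow_pos h.s_pos 2)) h.le_quad_inv
  let V := ∑' y, gaussianMass Set.univ (s ^ 2 • (1 : Matrix ι ι ℝ)) y
  have hV0 : V ≠ 0 := gaussianMass_sum_ne_zero (x := 0) (Set.mem_univ _)
  have hVt : V ≠ ⊤ := gaussianMass_sum_smul_one_ne_top _ (pow_pos h.s_pos 2)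
  let g : (κ → ℤ) → ℝ≥0∞ := fun x => ENNReal.ofReal (gaussianWeight (r ^ 2 • (1 : Matrix κ κ ℝ)) x)
  let w : (ι → ℤ) → ℝ≥0∞ := fun y => ENNReal.ofReal (gaussianWeight S y)
  let ρ : (ι → ℤ) → ℝ≥0∞ := fun y => ENNReal.ofReal (gaussianWeight (s ^ 2 • (1 : Matrix ι ι ℝ)) y)
  let U : ℝ≥0∞ := (Fintype.card (κ → ZMod q) : ℝ≥0∞)⁻¹
  -- An integer vector `x` belongs to exactly one coset, so the sum over cosets disappears and only
  -- the mass of the coset of `x` remains as a normalization.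
  have hform : ∀ z, realLaw q r s T z = ∑' x, (U * g x * (m (modQ q x))⁻¹) * (w (z - T *ᵥ x) * W⁻¹) := by
    intro z
    have h1 : realLaw q r s T z = ex (PMF.uniformOfFintype (κ → ZMod q)) fun c =>
        ex (discreteGaussian (coset q c) (r ^ 2 • (1 : Matrix κ κ ℝ))) fun x => w (z - T *ᵥ x) * W⁻¹ := by
      rw [apply_eq_ex, realLaw, ex_bind]
      congr 1; funext c
      rw [ex_bind]
      congr 1; funext x
      rw [ex_map]
      simp_rw [← eq_sub_iff_add_eq]
      rw [← apply_eq_ex, discreteGaussian_apply hW0 hWt, gaussianMass_univ]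
    rw [h1, ex_uniformOfFintype]
    unfold ex
    have h2 : ∀ c x, discreteGaussian (coset q c) (r ^ 2 • (1 : Matrix κ κ ℝ)) x =
        if c = modQ q x then g x * (m c)⁻¹ else 0 := by
      intro c x
      rw [discreteGaussian_apply (hm0 c) (hmt c)]
      by_cases hc : c = modQ q x
      · rw [if_pos hc, gaussianMass, Set.indicator_of_mem (show x ∈ coset q c from hc.symm)]
      · rw [if_neg hc, gaussianMass, Set.indicator_of_notMem (show x ∉ coset q c from fun hx => hc (Eq.symm hx)), zero_mul]
    simp_rw [h2]
    rw [← tsum_fintype (L := SummationFilter.unconditional _), ENNReal.tsum_comm, ← ENNReal.tsum_mul_left]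
    refine tsum_congr fun x => ?_
    rw [tsum_eq_single (modQ q x)]
    · rw [if_pos rfl]; ring
    · intro c hc; rw [if_neg hc, zero_mul]
  -- completing the square
  let K := (r ^ 2)⁻¹ • (1 : Matrix κ κ ℝ) + TRᵀ * S⁻¹ * TR
  let M : (ι → ℝ) → (κ → ℝ) := fun z => WidthBounds.condCov r s TR *ᵥ (TRᵀ *ᵥ (S⁻¹ *ᵥ z))
  let k : (ι → ℤ) → ℝ≥0∞ := fun z =>
    ∑' x : κ → ℤ, ENNReal.ofReal (Real.exp (-Real.pi * quad K ((fun i => (x i : ℝ)) - M (toReal z))))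
  have hsq : ∀ z, ∑' x, g x * w (z - T *ᵥ x) = ρ z * k z := by
    intro z
    rw [← ENNReal.tsum_mul_left]
    refine tsum_congr fun x => ?_
    simp only [g, w, ρ, gaussianWeight_eq]
    rw [← ENNReal.ofReal_mul (Real.exp_pos _).le, ← ENNReal.ofReal_mul (Real.exp_pos _).le,
      ← Real.exp_add, ← Real.exp_add, ← mul_add, ← mul_add,
      quad_inv_smul_one (pow_pos h.s_pos 2).ne', quad_inv_smul_one (pow_pos h.r_pos 2).ne',
      toReal_sub, toReal_mulVec]
    have := quad_complete (WidthBounds.inv_transpose (T := TR) (r := r) (s := s)) TR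
      h.precision_mul_condCov (toReal z) (toReal x)
    rw [h.schur_eq, quad_smul_one] at this
    rw [add_comm (_ * _) (quad _ _), this]
    rfl
  have hk : ∀ z z', k z ≤ κ₂ * k z' := fun z z' =>
    tsum_quad_le WidthBounds.condCov_transpose h.precision_mul_condCov
      (div_pos h.η_pos (Real.sqrt_pos.2 two_pos)) (fun x hx => h.lt_quad_condCov hx) hy₂ _ _
  -- Replacing the mass of the coset of `x` by that of the zero coset costs a factor `κ₁`. The upper
  -- and the lower bound each use it once, which gives `κ₁²` in the end.
  have hup : ∀ z, realLaw q r s T z ≤ U * (κ₁ * (m 0)⁻¹) * W⁻¹ * (ρ z * k z) := by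
    intro z
    rw [hform, ← hsq, ← ENNReal.tsum_mul_left]
    refine ENNReal.tsum_le_tsum fun x => ?_
    have hle : (m (modQ q x))⁻¹ ≤ κ₁ * (m 0)⁻¹ := by
      rw [ENNReal.inv_le_iff_inv_le, ENNReal.mul_inv (Or.inl hκ₁0) (Or.inl hκ₁t), inv_inv,
        mul_comm, ← div_eq_mul_inv]
      exact ENNReal.div_le_of_le_mul' (hmle _ _)
    calc _ ≤ (U * g x * (κ₁ * (m 0)⁻¹)) * (w (z - T *ᵥ x) * W⁻¹) := by gcongr
      _ = _ := by ring
  have hlow : ∀ z, U * (m 0)⁻¹ * W⁻¹ * (ρ z * k z) ≤ κ₁ * realLaw q r s T z := by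
    intro z
    rw [hform, ← hsq, ← ENNReal.tsum_mul_left, ← ENNReal.tsum_mul_left]
    refine ENNReal.tsum_le_tsum fun x => ?_
    have hle : (m 0)⁻¹ ≤ κ₁ * (m (modQ q x))⁻¹ := by
      rw [ENNReal.inv_le_iff_inv_le, ENNReal.mul_inv (Or.inl hκ₁0) (Or.inl hκ₁t), inv_inv,
        mul_comm, ← div_eq_mul_inv]
      exact ENNReal.div_le_of_le_mul' (hmle _ _)
    calc _ ≤ U * (κ₁ * (m (modQ q x))⁻¹) * W⁻¹ * (g x * w (z - T *ᵥ x)) := by gcongr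
      _ = _ := by ring
  -- Only the ratio of the values at `z` and `z'` is compared with that of the spherical weights, so
  -- the unknown constants cancel. Summing over `z'` then supplies the normalization.
  have hcross : ∀ z', realLaw q r s T z * ρ z' ≤ κ₁ * κ₁ * κ₂ * ρ z * realLaw q r s T z' := by
    intro z'
    calc realLaw q r s T z * ρ z' ≤ U * (κ₁ * (m 0)⁻¹) * W⁻¹ * (ρ z * k z) * ρ z' := by
          gcongr; exact hup z
      _ ≤ U * (κ₁ * (m 0)⁻¹) * W⁻¹ * (ρ z * (κ₂ * k z')) * ρ z' := by gcongr; exact hk z z'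
      _ = κ₁ * κ₂ * ρ z * (U * (m 0)⁻¹ * W⁻¹ * (ρ z' * k z')) := by ring
      _ ≤ κ₁ * κ₂ * ρ z * (κ₁ * realLaw q r s T z') := mul_le_mul_right (hlow z') _
      _ = _ := by ring
  have hV : V = ∑' z', ρ z' := tsum_congr fun y => gaussianMass_univ _ _
  have hsum : realLaw q r s T z * V ≤ κ₁ * κ₁ * κ₂ * ρ z := by
    rw [hV, ← ENNReal.tsum_mul_left]
    refine (ENNReal.tsum_le_tsum hcross).trans_eq ?_
    rw [ENNReal.tsum_mul_left, (realLaw q r s T).tsum_coe, mul_one]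
  rw [hκ, discreteGaussian_apply hV0 hVt, gaussianMass_univ, ← mul_assoc, ← div_eq_mul_inv,
    ENNReal.le_div_iff_mul_le (Or.inl hV0) (Or.inl hVt)]
  exact hsum

end DiscreteGaussian

/-! ### The joint law of targets and approximate preimages -/

section Joint
open Matrix
variable {ι : Type} [Fintype ι] [DecidableEq ι] {n : ℕ}

/-- Decoding of a residue modulo `p q` into a residue modulo `q` and an error modulo `p`. -/
def decodeResidue (p q : ℕ) (u : ZMod (p * q)) : ZMod q × ZMod p :=
  ((((u.val : ℤ) - Int.bmod u.val p) / p : ℤ), (u.val : ZMod p))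

theorem mul_decode (p : ℕ) (x : ℤ) : (p : ℤ) * ((x - Int.bmod x p) / p) = x - Int.bmod x p := by
  refine Int.mul_ediv_cancel' ?_
  exact (Int.emod_eq_emod_iff_emod_sub_eq_zero.1 (Int.bmod_emod (x := x) (m := p)).symm) |>
    Int.dvd_of_emod_eq_zero

/-- A uniform residue modulo `p q` therefore decodes into a uniform coset modulo `q` and an
independent uniform error modulo `p`, even if `p` and `q` are not coprime. -/
theorem decodeResidue_bijective (p q : ℕ) [NeZero p] [NeZero q] :
    Function.Bijective (decodeResidue p q) := by
  refine (Fintype.bijective_iff_injective_and_card _).2 ⟨fun u v h => ?_, ?_⟩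
  · obtain ⟨h1, h2⟩ := Prod.ext_iff.1 h
    simp only [decodeResidue] at h1 h2
    have hb : Int.bmod (u.val : ℤ) p = Int.bmod (v.val : ℤ) p := by
      rw [ZMod.natCast_eq_natCast_iff'] at h2
      rw [← Int.emod_bmod (u.val : ℤ), ← Int.emod_bmod (v.val : ℤ)]
      congr 1
      exact_mod_cast h2
    rw [ZMod.intCast_eq_intCast_iff_dvd_sub] at h1
    have h3 : ((p * q : ℕ) : ℤ) ∣ (v.val : ℤ) - u.val := by
      have := mul_dvd_mul_left (p : ℤ) h1
      rw [mul_sub, mul_decode, mul_decode, hb] at this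
      push_cast
      simpa using this
    have h4 : ((u.val : ℤ) : ZMod (p * q)) = ((v.val : ℤ) : ZMod (p * q)) :=
      (ZMod.intCast_eq_intCast_iff_dvd_sub _ _ _).2 h3
    simpa using h4
  · rw [Fintype.card_prod, ZMod.card, ZMod.card, ZMod.card, mul_comm]

/-- Decoding of a vector of residues. -/
noncomputable def decodeEquiv (κ : Type) (p q : ℕ) [NeZero p] [NeZero q] :
    (κ → ZMod (p * q)) ≃ (κ → ZMod q) × (κ → ZMod p) :=
  (Equiv.arrowCongr (Equiv.refl κ) (Equiv.ofBijective _ (decodeResidue_bijective p q))).trans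
    (Equiv.arrowProdEquivProdArrow _ _ _)

theorem gadgetSample_eq (p q : ℕ) [NeZero p] [NeZero q] (r : ℝ) (u : Fin n → ZMod (p * q)) :
    gadgetSample p q r u = discreteGaussian (coset q (decodeEquiv (Fin n) p q u).1)
      (r ^ 2 • (1 : Matrix (Fin n) (Fin n) ℝ)) := by
  unfold gadgetSample
  simp only
  congr 1
  ext x
  simp only [coset, Set.mem_ofPred_eq, funext_iff, modQ]
  refine forall_congr' fun i => ?_
  rw [← ZMod.intCast_zmod_eq_zero_iff_dvd, Int.cast_sub, sub_eq_zero]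
  rfl

theorem centered_decode (p q : ℕ) [NeZero p] [NeZero q] (u : Fin n → ZMod (p * q)) :
    centered (decodeEquiv (Fin n) p q u).2 = gadgetError p u := by
  funext i
  show Int.bmod (((u i).val : ZMod p).val : ℤ) p = Int.bmod ((u i).val : ℤ) p
  rw [ZMod.val_natCast, Int.natCast_mod, Int.emod_bmod]

/-- The product `p x` modulo `p q` depends only on `x` modulo `q`, so every sample from the decoded
coset reproduces the target up to the decoding error. -/
theorem decode_eq (p q : ℕ) [NeZero p] [NeZero q] (u : Fin n → ZMod (p * q)) {x : Fin n → ℤ}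
    (hx : x ∈ coset q (decodeEquiv (Fin n) p q u).1) :
    (p : ZMod (p * q)) • modQ (p * q) x + modQ (p * q) (centered (decodeEquiv (Fin n) p q u).2) = u := by
  rw [centered_decode]
  funext i
  have h1 : ((x i : ℤ) : ZMod q) = ((((u i).val : ℤ) - Int.bmod (u i).val p) / p : ℤ) := congrFun hx i
  rw [ZMod.intCast_eq_intCast_iff_dvd_sub] at h1
  have h2 := mul_dvd_mul_left (p : ℤ) h1
  rw [mul_sub, mul_decode] at h2
  have h3 : ((p * q : ℕ) : ℤ) ∣ ((u i).val : ℤ) - (p * x i + Int.bmod (u i).val p) := by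
    push_cast
    rwa [← sub_sub, sub_right_comm]
  have h4 := (ZMod.intCast_eq_intCast_iff_dvd_sub _ _ _).2 h3
  simp only [Pi.add_apply, Pi.smul_apply, modQ, gadgetError, smul_eq_mul]
  push_cast at h4
  rw [h4]
  simp

/-- A uniform target together with an approximate preimage of it has the same law as a preimage
together with the target determined by an independent uniform error. -/
theorem ex_preSample (p q : ℕ) [NeZero p] [NeZero q] {r : ℝ} (hr : 0 < r) (s : ℝ)
    (A : Matrix (Fin n) ι (ZMod (p * q))) (T : Matrix ι (Fin n) ℤ)
    (hAT : A * T.map (Int.cast : ℤ → ZMod (p * q)) = (p : ZMod (p * q)) • 1)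
    (f : (Fin n → ZMod (p * q)) → (ι → ℤ) → ℝ≥0∞) :
    ex (PMF.uniformOfFintype (Fin n → ZMod (p * q))) (fun u => ex (preSample p q r s A T u) (f u)) =
      ex (realLaw q r s T) fun z => ex (PMF.uniformOfFintype (Fin n → ZMod p)) fun t =>
        f (A *ᵥ modQ (p * q) z + modQ (p * q) (centered t)) z := by
  set D := discreteGaussian Set.univ (pertCov r s (T.map fun t => (t : ℝ))) with hD
  have h1 : ∀ u, ex (preSample p q r s A T u) (f u) = ex D fun y =>
      ex (gadgetSample p q r (u - A *ᵥ modQ (p * q) y)) fun x => f u (y + T *ᵥ x) := by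
    intro u
    unfold preSample
    simp only
    rw [ex_bind]
    simp_rw [ex_map]
    rfl
  simp_rw [h1]
  rw [ex_comm]
  have h2 : ∀ y, ex (PMF.uniformOfFintype (Fin n → ZMod (p * q))) (fun u =>
      ex (gadgetSample p q r (u - A *ᵥ modQ (p * q) y)) fun x => f u (y + T *ᵥ x)) =
      ex (PMF.uniformOfFintype (Fin n → ZMod q)) fun c =>
        ex (discreteGaussian (coset q c) (r ^ 2 • (1 : Matrix (Fin n) (Fin n) ℝ))) fun x =>
          ex (PMF.uniformOfFintype (Fin n → ZMod p)) fun t =>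
            f (A *ᵥ modQ (p * q) (y + T *ᵥ x) + modQ (p * q) (centered t)) (y + T *ᵥ x) := by
    intro y
    -- For a fixed perturbation `y` the shifted target `u - A y` is again uniform.
    rw [← uniformOfFintype_map_equiv (Equiv.addRight (A *ᵥ modQ (p * q) y))]
    simp only [Equiv.coe_addRight, add_sub_cancel_right, gadgetSample_eq]
    let Φ : (Fin n → ZMod q) × (Fin n → ZMod p) → ℝ≥0∞ := fun d =>
          ex (discreteGaussian (coset q d.1) (r ^ 2 • (1 : Matrix (Fin n) (Fin n) ℝ))) fun x =>
            f (A *ᵥ modQ (p * q) (y + T *ᵥ x) + modQ (p * q) (centered d.2)) (y + T *ᵥ x)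
    have h3 : ∀ u : Fin n → ZMod (p * q),
        ex (discreteGaussian (coset q (decodeEquiv (Fin n) p q u).1)
          (r ^ 2 • (1 : Matrix (Fin n) (Fin n) ℝ))) (fun x =>
            f (u + A *ᵥ modQ (p * q) y) (y + T *ᵥ x)) =
        Φ (decodeEquiv (Fin n) p q u) := by
      intro u
      refine ex_congr_support _ fun x hx => ?_
      have hx' : x ∈ coset q (decodeEquiv (Fin n) p q u).1 := by
        by_contra hn
        rw [PMF.mem_support_iff, discreteGaussian_apply
          (gaussianMass_sum_ne_zero (coset_nonempty _).choose_spec)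
          (gaussianMass_sum_smul_one_ne_top _ (pow_pos hr 2)), gaussianMass,
          Set.indicator_of_notMem hn, zero_mul] at hx
        exact hx rfl
      have h4 : A *ᵥ modQ (p * q) (T *ᵥ x) = (p : ZMod (p * q)) • modQ (p * q) x := by
        rw [modQ_mulVec, mulVec_mulVec, hAT, smul_mulVec, one_mulVec]
      congr 1
      conv_lhs => rw [← decode_eq p q u hx']
      rw [modQ_add, mulVec_add, h4]
      abel
    refine (congrArg (ex _) (funext h3)).trans ?_
    -- After the substitution the integrand depends on the target only through its decoding, so the
    -- coset and the error become independent uniform variables.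
    rw [uniformOfFintype_map_equiv (decodeEquiv (Fin n) p q) Φ, ex_uniform_prod]
    congr 1; funext c
    simp only [Φ]
    exact ex_comm _ _ _
  simp_rw [h2]
  rw [realLaw, ex_bind, ex_comm]
  congr 1; funext c
  rw [ex_bind, ex_comm]
  congr 1; funext x
  rw [ex_map]

/-- The law of `(z₀ + e, z₁, …)` for `z` with a given law and an independent uniform error `e`. -/
noncomputable def errLaw (p : ℕ) [NeZero p] (μ : PMF (Fin 3 × Fin n → ℤ)) : PMF (Fin 3 × Fin n → ℤ) := do
  let z ← μ
  let t ← PMF.uniformOfFintype (Fin n → ZMod p)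
  pure fun c => if c.1 = 0 then z c + centered t c.2 else z c

theorem ex_errLaw (p : ℕ) [NeZero p] (μ : PMF (Fin 3 × Fin n → ℤ)) (f : (Fin 3 × Fin n → ℤ) → ℝ≥0∞) :
    ex (errLaw p μ) f = ex μ fun z => ex (PMF.uniformOfFintype (Fin n → ZMod p)) fun t =>
      f fun c => if c.1 = 0 then z c + centered t c.2 else z c := by
  unfold errLaw
  rw [ex_bind]
  simp_rw [ex_map]

theorem ex_le_of_apply_le {α : Type} {μ ν : PMF α} {κ : ℝ≥0∞} (h : ∀ x, μ x ≤ κ * ν x)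
    (f : α → ℝ≥0∞) : ex μ f ≤ κ * ex ν f := by
  unfold ex
  rw [← ENNReal.tsum_mul_left]
  refine ENNReal.tsum_le_tsum fun x => ?_
  rw [← mul_assoc]
  gcongr
  exact h x

end Joint

/-! ### Unpredictability of preimages -/

section Entropy
open Matrix
variable {n : ℕ}

/-- The vector with middle block `d`. -/
def middle (d : Fin n → ℤ) : Fin 3 × Fin n → ℤ := fun c => if c.1 = 1 then d c.2 else 0

/-- A Gaussian vector satisfies an equation that determines its middle block with small
probability. -/
theorem gaussian_middle_le {B : Matrix (Fin 3 × Fin n) (Fin 3 × Fin n) ℝ} (hB : Bᵀ = B) {σ : ℝ}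
    (hσ : 0 < σ) (hle : ∀ x, quad B x ≤ (σ ^ 2)⁻¹ * (x ⬝ᵥ x))
    (E : Set (Fin 3 × Fin n → ℤ)) (hE : ∀ y ∈ E, ∀ y' ∈ E, ∀ d d', y + middle d = y' + middle d' → d = d') :
    ENNReal.ofReal ((σ / 60) ^ n) *
      ∑' y, E.indicator (fun y => ENNReal.ofReal (Real.exp (-Real.pi * quad B (toReal y)))) y ≤
      ∑' y, ENNReal.ofReal (Real.exp (-Real.pi * quad B (toReal y))) := by
  set w : (Fin 3 × Fin n → ℤ) → ℝ≥0∞ := fun y => ENNReal.ofReal (Real.exp (-Real.pi * quad B (toReal y)))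
  set e : (Fin n → ℤ) → ℝ≥0∞ := fun d =>
    ENNReal.ofReal (Real.exp (-Real.pi * ((σ ^ 2)⁻¹ * ∑ i, (d i : ℝ) ^ 2)))
  have hmid : ∀ d : Fin n → ℤ, toReal (middle d) ⬝ᵥ toReal (middle d) = ∑ i, (d i : ℝ) ^ 2 := by
    intro d
    rw [← sum_sq_eq_dot, Fintype.sum_prod_type, Fin.sum_univ_three]
    simp [toReal, middle]
  have hneg : ∀ d : Fin n → ℤ, middle (-d) = -middle d := by
    intro d; funext c; simp only [middle, Pi.neg_apply]; split_ifs <;> simp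
  -- In the average over `d` and `-d` the linear term of the form becomes a hyperbolic cosine, which
  -- is at least one. So translates of `y` carry at least the weight of `y` times a centred Gaussian
  -- weight of `d`.
  have hpair : ∀ y d, 2 * (w y * e d) ≤ w (y + middle d) + w (y + middle (-d)) := by
    intro y d
    simp only [w, e]
    rw [← ENNReal.ofReal_mul (Real.exp_pos _).le, ← ENNReal.ofReal_add (Real.exp_pos _).le (Real.exp_pos _).le,
      ← ENNReal.ofReal_ofNat 2, ← ENNReal.ofReal_mul zero_le_two, ← Real.exp_add]
    refine ENNReal.ofReal_le_ofReal ?_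
    rw [hneg, ← sub_eq_add_neg, toReal_add, toReal_sub, quad_add_vec hB, quad_sub_vec hB]
    set a := quad B (toReal y)
    set b := toReal y ⬝ᵥ B *ᵥ toReal (middle d)
    have h1 : quad B (toReal (middle d)) ≤ (σ ^ 2)⁻¹ * ∑ i, (d i : ℝ) ^ 2 := by
      rw [← hmid]; exact hle _
    set q := quad B (toReal (middle d))
    have h2 : 2 * Real.exp (-Real.pi * (a + q)) ≤
        Real.exp (-Real.pi * (a + 2 * b + q)) + Real.exp (-Real.pi * (a - 2 * b + q)) := by
      have e1 : -Real.pi * (a + 2 * b + q) = -Real.pi * (a + q) + -(2 * Real.pi * b) := by ring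
      have e2 : -Real.pi * (a - 2 * b + q) = -Real.pi * (a + q) + (2 * Real.pi * b) := by ring
      rw [e1, e2, Real.exp_add, Real.exp_add, ← mul_add]
      have := Real.one_le_cosh (2 * Real.pi * b)
      rw [Real.cosh_eq] at this
      nlinarith [Real.exp_pos (-Real.pi * (a + q))]
    refine le_trans ?_ h2
    gcongr
    nlinarith [Real.pi_pos]
  have hline : ∀ y, w y * ∑' d, e d ≤ ∑' d, w (y + middle d) := by
    intro y
    have h1 : 2 * (w y * ∑' d, e d) ≤ 2 * ∑' d, w (y + middle d) := by
      rw [← ENNReal.tsum_mul_left, ← ENNReal.tsum_mul_left, two_mul (∑' d, w (y + middle d))]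
      nth_rewrite 3 [← (Equiv.neg (Fin n → ℤ)).tsum_eq]
      rw [← ENNReal.tsum_add]
      exact ENNReal.tsum_le_tsum fun d => hpair y d
    exact (ENNReal.mul_le_mul_iff_right two_ne_zero ENNReal.ofNat_ne_top).1 h1
  have hsum : ENNReal.ofReal ((σ / 60) ^ n) ≤ ∑' d, e d := by
    have := le_tsum_isotropic (ι := Fin n) hσ
    rwa [Fintype.card_fin] at this
  calc _ ≤ (∑' d, e d) * ∑' y, E.indicator w y := by gcongr
    _ = ∑' y : E, w y * ∑' d, e d := by
        rw [← tsum_subtype, ENNReal.tsum_mul_right, mul_comm]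
    _ ≤ ∑' y : E, ∑' d, w ((y : Fin 3 × Fin n → ℤ) + middle d) := ENNReal.tsum_le_tsum fun y => hline y
    _ = ∑' x : E × (Fin n → ℤ), w ((x.1 : Fin 3 × Fin n → ℤ) + middle x.2) := ENNReal.tsum_prod.symm
    -- By the assumption on `E` the translates `y + middle d` with `y ∈ E` are pairwise distinct, so
    -- their total weight is part of the full mass.
    _ ≤ ∑' y, w y := by
        refine ENNReal.tsum_comp_le_tsum_of_injective (f := fun x : E × (Fin n → ℤ) => (x.1 : Fin 3 × Fin n → ℤ) + middle x.2) ?_ w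
        rintro ⟨⟨y, hy⟩, d⟩ ⟨⟨y', hy'⟩, d'⟩ h
        have hd := hE y hy y' hy' d d' h
        subst hd
        simpa using h

end Entropy

/-! ### The trapdoor -/

namespace Params
open Matrix
variable (P : Params)

/-- The first, middle and last block of a vector of three ring elements. -/
def block (i : Fin 3) (h : Fin 3 × Fin P.n → ℤ) : P.R := fun j => h (i, j)

variable {P}

theorem pubMatrix_mulVec (a b : P.RQ) (x : Fin 3 × Fin P.n → ℤ) : P.pubMatrix a b *ᵥ modQ P.Q x =
      modQ P.Q (P.block 0 x) + ringMul a (modQ P.Q (P.block 1 x)) +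
        ringMul b (modQ P.Q (P.block 2 x)) := by
  funext i
  simp only [mulVec, dotProduct, pubMatrix, of_apply, Fintype.sum_prod_type, Fin.sum_univ_three,
    Pi.add_apply, ringMul]
  change ((1 : Matrix (Fin P.n) (Fin P.n) (ZMod P.Q)) *ᵥ modQ P.Q (P.block 0 x)) i + _ + _ = _
  rw [one_mulVec]
  rfl

/-- The blocks multiply to `g + a f + b`, and `b` was chosen so that this is `p`. -/
theorem pubMatrix_mul_trapdoor (a b : P.RQ) (f g : P.R)
    (hb : b = modQ P.Q (fun i : Fin P.n => if (i : ℕ) = 0 then (P.p : ℤ) else 0) -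
      (ringMul a (modQ P.Q f) + modQ P.Q g)) :
    P.pubMatrix a b * (P.trapdoor f g).map (Int.cast : ℤ → ZMod P.Q) = (P.p : ZMod P.Q) • 1 := by
  have h1 : P.pubMatrix a b * (P.trapdoor f g).map (Int.cast : ℤ → ZMod P.Q) =
      anticirculant (modQ P.Q g) + anticirculant a * anticirculant (modQ P.Q f) + anticirculant b := by
    rw [modQ_anticirculant, modQ_anticirculant]
    have h : P.pubMatrix a b * (P.trapdoor f g).map (Int.cast : ℤ → ZMod P.Q) =
        1 * (anticirculant g).map Int.cast + anticirculant a * (anticirculant f).map Int.cast +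
          anticirculant b * (1 : Matrix (Fin P.n) (Fin P.n) ℤ).map Int.cast := by
      ext i j
      simp only [mul_apply, Matrix.add_apply, Fintype.sum_prod_type, Fin.sum_univ_three]
      rfl
    rw [h, Matrix.one_mul, Matrix.map_one _ Int.cast_zero Int.cast_one, Matrix.mul_one]
  have h2 : modQ P.Q (fun i : Fin P.n => if (i : ℕ) = 0 then (P.p : ℤ) else 0) =
      Pi.single (0 : Fin P.n) (P.p : ZMod P.Q) := by
    funext i
    simp only [modQ, Pi.single_apply]
    by_cases h : i = 0
    · simp [h]
    · rw [if_neg h, if_neg (show ¬ (i : ℕ) = 0 from fun h' => h (Fin.ext h')), Int.cast_zero]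
  rw [h1, ← anticirculant_ringMul, ← anticirculant_add, ← anticirculant_add, ← anticirculant_single_zero,
    ← h2, hb]
  congr 1; abel

theorem dot_mulVec_le_s1 {n : ℕ} (M : Matrix (Fin n) (Fin n) ℤ) (x : Fin n → ℝ) :
    x ⬝ᵥ M.map (fun t => (t : ℝ)) *ᵥ x ≤ s1 M * (x ⬝ᵥ x) := by
  set L := Matrix.toEuclideanCLM (𝕜 := ℝ) (M.map fun t => (t : ℝ)) with hL
  set v : EuclideanSpace ℝ (Fin n) := WithLp.toLp 2 x with hv
  have h1 : inner ℝ v (L v) = x ⬝ᵥ M.map (fun t => (t : ℝ)) *ᵥ x := by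
    rw [EuclideanSpace.inner_eq_star_dotProduct, hL, hv, Matrix.toEuclideanCLM_toLp]
    simp [dotProduct_comm]
  have h2 : ‖v‖ * ‖v‖ = x ⬝ᵥ x := by
    rw [← sq, EuclideanSpace.norm_sq_eq]
    simp [hv, dotProduct, sq]
  rw [← h1, ← h2]
  calc inner ℝ v (L v) ≤ ‖v‖ * ‖L v‖ := real_inner_le_norm _ _
    _ ≤ ‖v‖ * (‖L‖ * ‖v‖) := by gcongr; exact L.le_opNorm v
    _ = s1 M * (‖v‖ * ‖v‖) := by rw [s1]; ring

/-- The first two blocks contribute the form of `Fᵀ F + Gᵀ G`, whose norm is the quality; the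
identity block contributes the summand 1. -/
theorem trapdoor_dot (f g : P.R) (x : Fin P.n → ℝ) :
    (P.trapdoor f g).map (fun t => (t : ℝ)) *ᵥ x ⬝ᵥ (P.trapdoor f g).map (fun t => (t : ℝ)) *ᵥ x ≤
      (P.quality f g + 1) * (x ⬝ᵥ x) := by
  let F := (anticirculant f).map fun t => (t : ℝ)
  let G := (anticirculant g).map fun t => (t : ℝ)
  have h1 : (P.trapdoor f g).map (fun t => (t : ℝ)) *ᵥ x ⬝ᵥ (P.trapdoor f g).map (fun t => (t : ℝ)) *ᵥ x =
      G *ᵥ x ⬝ᵥ G *ᵥ x + F *ᵥ x ⬝ᵥ F *ᵥ x + x ⬝ᵥ x := by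
    simp only [dotProduct, Fintype.sum_prod_type, Fin.sum_univ_three]
    congr 1
    refine Finset.sum_congr rfl fun i _ => ?_
    have h : ((P.trapdoor f g).map (fun t => (t : ℝ)) *ᵥ x) (2, i) = x i := by
      change (((1 : Matrix (Fin P.n) (Fin P.n) ℤ).map (fun t => (t : ℝ))) *ᵥ x) i = x i
      rw [Matrix.map_one _ Int.cast_zero Int.cast_one, one_mulVec]
    rw [h]
  have hM : (anticirculant (ringMul f (conj f) + ringMul g (conj g))).map (fun t => (t : ℝ)) =
      Fᵀ * F + Gᵀ * G := by
    rw [ringMul_comm f, ringMul_comm g, anticirculant_add, anticirculant_ringMul, anticirculant_ringMul,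
      conj_anticirculant, conj_anticirculant]
    ext i j
    simp [F, G, mul_apply]
  have h2 := dot_mulVec_le_s1 (anticirculant (ringMul f (conj f) + ringMul g (conj g))) x
  rw [hM, add_mulVec, dotProduct_add, ← mulVec_mulVec, ← mulVec_mulVec, dotProduct_mulVec x Fᵀ,
    dotProduct_mulVec x Gᵀ, vecMul_transpose, vecMul_transpose] at h2
  rw [h1, quality]
  linarith

/-- The quality test makes the perturbation covariance large enough. -/
theorem widthBounds_trapdoor {f g : P.R} {η : ℝ} (hη : 0 < η) (hr : P.q * η ≤ P.r) (hs : 0 < P.s)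
    (hs2 : (P.r ^ 2 + η ^ 2) * (2 * P.α ^ 2 * (P.a + P.b) + 2) ≤ P.s ^ 2)
    (hfg : Real.sqrt (P.quality f g) ≤ P.α * Real.sqrt (2 * (P.a + P.b))) :
    WidthBounds ((P.trapdoor f g).map fun t => (t : ℝ)) P.r P.s η := by
  have hq : (1 : ℝ) ≤ P.q := by exact_mod_cast P.q_pos
  have hηr : η ≤ P.r := le_trans (by nlinarith) hr
  have hq0 : 0 ≤ P.quality f g := norm_nonneg _
  have hqual : P.quality f g ≤ 2 * P.α ^ 2 * (P.a + P.b) := by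
    have h := pow_le_pow_left₀ (Real.sqrt_nonneg _) hfg 2
    rw [Real.sq_sqrt hq0, mul_pow, Real.sq_sqrt (by positivity)] at h
    linarith
  refine ⟨lt_of_lt_of_le hη hηr, hs, hη, hηr, P.quality f g + 1, by linarith, trapdoor_dot f g, ?_⟩
  refine le_trans (mul_le_mul_of_nonneg_left ?_ (by positivity)) hs2
  linarith

/-- The combination `z₁ - f z₂` annihilates the image of the trapdoor. Evaluated on `y + T x` it
depends on `y` only, so the perturbation alone yields unpredictability, whatever the gadget sampler
does. -/
theorem trapdoor_mulVec_block (f g : P.R) (x : Fin P.n → ℤ) :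
    P.block 1 (P.trapdoor f g *ᵥ x) - ringMul f (P.block 2 (P.trapdoor f g *ᵥ x)) = 0 := by
  have h1 : P.block 1 (P.trapdoor f g *ᵥ x) = ringMul f x := by
    rfl
  have h2 : P.block 2 (P.trapdoor f g *ᵥ x) = x := by
    change (1 : Matrix (Fin P.n) (Fin P.n) ℤ) *ᵥ x = x
    exact one_mulVec x
  rw [h1, h2, sub_self]

theorem block_add (i : Fin 3) (x y : Fin 3 × Fin P.n → ℤ) :
    P.block i (x + y) = P.block i x + P.block i y := rfl

open Classical in
/-- A relation between the last two blocks that determines the middle block is unlikely to hold. -/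
theorem ex_block_eq_le {S : Matrix (Fin 3 × Fin P.n) (Fin 3 × Fin P.n) ℝ} (hS : (S⁻¹)ᵀ = S⁻¹) {σ τ : ℝ}
    (hσ : 0 < σ) (hle : ∀ x, quad S⁻¹ x ≤ (σ ^ 2)⁻¹ * (x ⬝ᵥ x)) (hτ : 0 < τ)
    (hge : ∀ x, τ * (x ⬝ᵥ x) ≤ quad S⁻¹ x) (f d : P.R) :
    ex (discreteGaussian Set.univ S)
      (fun y => if P.block 1 y - ringMul f (P.block 2 y) = d then 1 else 0) ≤
      ENNReal.ofReal ((60 / σ) ^ P.n) := by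
  have hW0 : ∑' y, gaussianMass Set.univ S y ≠ 0 :=
    gaussianMass_sum_ne_zero (x := 0) (Set.mem_univ _)
  have hWt : ∑' y, gaussianMass Set.univ S y ≠ ⊤ := gaussianMass_sum_ne_top _ hτ hge
  set E : Set (Fin 3 × Fin P.n → ℤ) := {y | P.block 1 y - ringMul f (P.block 2 y) = d} with hE
  have hm1 : ∀ v : Fin P.n → ℤ, P.block 1 (middle v) = v := fun v => by funext j; simp [block, middle]
  have hm2 : ∀ v : Fin P.n → ℤ, P.block 2 (middle v) = 0 := fun v => by funext j; simp [block, middle]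
  -- A shift of the middle block leaves the last block alone, the last block determines the middle
  -- block within `E`, and so the shift can be read off from the sum.
  have h := gaussian_middle_le hS hσ hle E (by
    intro y hy y' hy' v v' hv
    have e1 := congrArg (P.block 1) hv
    have e2 := congrArg (P.block 2) hv
    simp only [block_add, hm1, hm2, add_zero] at e1 e2
    have hy1 : P.block 1 y - ringMul f (P.block 2 y) = d := hy
    have hy2 : P.block 1 y' - ringMul f (P.block 2 y') = d := hy'
    rw [e2] at hy1
    have e3 : P.block 1 y = P.block 1 y' := by
      have := hy1.trans hy2.symm
      simpa using this
    rw [e3] at e1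
    simpa using e1)
  have hex : ex (discreteGaussian Set.univ S)
      (fun y => if P.block 1 y - ringMul f (P.block 2 y) = d then 1 else 0) =
      (∑' y, E.indicator (fun y => ENNReal.ofReal (Real.exp (-Real.pi * quad S⁻¹ (toReal y)))) y) *
        (∑' y, gaussianMass Set.univ S y)⁻¹ := by
    unfold ex
    rw [← ENNReal.tsum_mul_right]
    refine tsum_congr fun y => ?_
    rw [discreteGaussian_apply hW0 hWt, gaussianMass_univ, gaussianWeight_eq]
    beta_reduce
    by_cases hy : y ∈ E
    · rw [Set.indicator_of_mem hy, if_pos (show _ = d from hy), mul_one]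
    · rw [Set.indicator_of_notMem hy, if_neg (show ¬ _ = d from hy), mul_zero, zero_mul]
  have hW : ∑' y, gaussianMass Set.univ S y =
      ∑' y, ENNReal.ofReal (Real.exp (-Real.pi * quad S⁻¹ (toReal y))) :=
    tsum_congr fun y => by rw [gaussianMass_univ, gaussianWeight_eq]
  rw [hex, ← div_eq_mul_inv]
  refine ENNReal.div_le_of_le_mul ?_
  rw [hW]
  refine le_trans (le_of_eq ?_) (mul_le_mul_right h (ENNReal.ofReal ((60 / σ) ^ P.n)))
  rw [← mul_assoc, ← ENNReal.ofReal_mul (by positivity), ← mul_pow]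
  have : 60 / σ * (σ / 60) = 1 := by field_simp
  rw [this, one_pow, ENNReal.ofReal_one, one_mul]

open Classical in
/-- Approximate preimages are unpredictable. -/
theorem ex_preSample_block_le {f g : P.R} {η : ℝ}
    (h : WidthBounds ((P.trapdoor f g).map fun t => (t : ℝ)) P.r P.s η) (a b u : P.RQ) (c : P.R × P.R) :
    ex (preSample P.p P.q P.r P.s (P.pubMatrix a b) (P.trapdoor f g) u)
      (fun z => if (P.block 1 z, P.block 2 z) = c then 1 else 0) ≤
      ENNReal.ofReal ((60 / P.r) ^ P.n) := by
  unfold preSample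
  simp only
  rw [ex_bind]
  refine le_trans (ex_mono _ fun y => ?_) (ex_block_eq_le (P := P) WidthBounds.inv_transpose h.r_pos
    h.quad_inv_le (inv_pos.2 (pow_pos h.s_pos 2)) h.le_quad_inv f (c.1 - ringMul f c.2))
  rw [ex_map]
  refine ex_le_of_le _ fun x => ?_
  by_cases hc : (P.block 1 (y + P.trapdoor f g *ᵥ x), P.block 2 (y + P.trapdoor f g *ᵥ x)) = c
  · rw [if_pos hc, if_pos]
    rw [← hc]
    have := trapdoor_mulVec_block f g x
    simp only [block_add, ringMul_add]
    rw [add_sub_add_comm, this, add_zero]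
  · rw [if_neg hc]; exact zero_le

end Params

/-! ### The simulated experiment -/

namespace Params
open Matrix
variable {P : Params}

/-- The value of a vector of three ring elements under the public row. -/
def target (a b : P.RQ) (h : Fin 3 × Fin P.n → ℤ) : P.RQ :=
  modQ P.Q (P.block 0 h) + ringMul a (modQ P.Q (P.block 1 h)) + ringMul b (modQ P.Q (P.block 2 h))

/-- An approximate preimage together with its error. -/
def withError (z : Fin 3 × Fin P.n → ℤ) (e : P.R) : Fin 3 × Fin P.n → ℤ :=
  fun c => if c.1 = 0 then z c + e c.2 else z c

theorem block_one_withError (z : Fin 3 × Fin P.n → ℤ) (e : P.R) :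
    P.block 1 (withError z e) = P.block 1 z := by funext j; simp [block, withError]

theorem block_two_withError (z : Fin 3 × Fin P.n → ℤ) (e : P.R) :
    P.block 2 (withError z e) = P.block 2 z := by funext j; simp [block, withError]

theorem block_zero_withError (z : Fin 3 × Fin P.n → ℤ) (e : P.R) :
    P.block 0 (withError z e) = P.block 0 z + e := by funext j; simp [block, withError]

theorem target_withError (a b : P.RQ) (z : Fin 3 × Fin P.n → ℤ) (e : P.R) :
    target a b (withError z e) = P.pubMatrix a b *ᵥ modQ P.Q z + modQ P.Q e := by
  rw [pubMatrix_mulVec, target, block_zero_withError, block_one_withError, block_two_withError, modQ_add]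
  abel

instance : NeZero P.q := ⟨P.q_pos.ne'⟩

/-- The law of `(z₀ + e, z₁, z₂)` for honest signatures. -/
noncomputable def honestLaw (P : Params) (f g : P.R) : PMF (Fin 3 × Fin P.n → ℤ) :=
  errLaw P.p (realLaw P.q P.r P.s (P.trapdoor f g))

/-- Centred representatives modulo `p` lie in the centred range modulo `Q`, because `p ≤ Q`. Hence
the error recomputed modulo `Q` is the decoding error itself. -/
theorem centered_modQ_centered (t : Fin P.n → ZMod P.p) :
    centered (modQ P.Q (centered t)) = centered t := by
  have h1 : P.p ≤ P.Q := Nat.le_mul_of_pos_right _ P.q_pos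
  refine centered_modQ (fun i => ?_) fun i => ?_
  · have := (bmod_bounds ((t i).val) P.p_pos).1
    simp only [centered]; omega
  · have := (bmod_bounds ((t i).val) P.p_pos).2
    simp only [centered]; omega

/-- This identity permits the simulation: the short vector is drawn first and the hash value is its
image, without any loss. The norm test of the signer is a function of that vector. -/
theorem ex_target {f g : P.R} {a b : P.RQ} (hr : 0 < P.r)
    (hb : b = modQ P.Q (fun i : Fin P.n => if (i : ℕ) = 0 then (P.p : ℤ) else 0) -
      (ringMul a (modQ P.Q f) + modQ P.Q g))
    (F : P.RQ → (Fin 3 × Fin P.n → ℤ) → ℝ≥0∞) :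
    ex (PMF.uniformOfFintype P.RQ) (fun u =>
      ex (preSample P.p P.q P.r P.s (P.pubMatrix a b) (P.trapdoor f g) u) fun z =>
        F u (withError z (centered (u - P.pubMatrix a b *ᵥ modQ P.Q z)))) =
      ex (honestLaw P f g) fun h => F (target a b h) h := by
  rw [ex_preSample P.p P.q hr P.s _ _ (pubMatrix_mul_trapdoor a b f g hb)
    (fun u z => F u (withError z (centered (u - P.pubMatrix a b *ᵥ modQ P.Q z)))), honestLaw, ex_errLaw]
  congr 1; funext z; congr 1; funext t
  have h : (fun c : Fin 3 × Fin P.n => if c.1 = 0 then z c + centered t c.2 else z c) =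
      withError z (centered t) := rfl
  rw [h, add_sub_cancel_left, centered_modQ_centered, target_withError]

theorem ex_target_fst {f g : P.R} {a b : P.RQ} (hr : 0 < P.r)
    (hb : b = modQ P.Q (fun i : Fin P.n => if (i : ℕ) = 0 then (P.p : ℤ) else 0) -
      (ringMul a (modQ P.Q f) + modQ P.Q g)) (F : P.RQ → ℝ≥0∞) :
    ex (PMF.uniformOfFintype P.RQ) F = ex (honestLaw P f g) fun h => F (target a b h) := by
  rw [← ex_target hr hb fun u _ => F u]
  simp_rw [ex_const]

variable (P) in
/-- The randomness of one step of the simulated experiment. -/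
structure Entry where
  coin : Bool
  fresh : P.RQ
  salt : BitVec P.saltLen
  pre : Fin 3 × Fin P.n → ℤ

variable (P) in
/-- The law of the randomness of one step. -/
noncomputable def entryLaw (μ : PMF (Fin 3 × Fin P.n → ℤ)) : PMF P.Entry := do
  let c ← PMF.uniformOfFintype Bool
  let v ← PMF.uniformOfFintype P.RQ
  let s ← PMF.uniformOfFintype (BitVec P.saltLen)
  let h ← μ
  pure ⟨c, v, s, h⟩

theorem ex_entryLaw (μ : PMF (Fin 3 × Fin P.n → ℤ)) (F : P.Entry → ℝ≥0∞) :
    ex (P.entryLaw μ) F = ex (PMF.uniformOfFintype Bool) fun c => ex (PMF.uniformOfFintype P.RQ) fun v =>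
      ex (PMF.uniformOfFintype (BitVec P.saltLen)) fun s => ex μ fun h => F ⟨c, v, s, h⟩ := by
  unfold entryLaw
  rw [ex_bind]; congr 1; funext c
  rw [ex_bind]; congr 1; funext v
  rw [ex_bind]; congr 1; funext s
  rw [ex_map]

theorem ex_entryLaw_le {μ ν : PMF (Fin 3 × Fin P.n → ℤ)} {κ : ℝ≥0∞}
    (h : ∀ F, ex μ F ≤ κ * ex ν F) (F : P.Entry → ℝ≥0∞) :
    ex (P.entryLaw μ) F ≤ κ * ex (P.entryLaw ν) F := by
  simp_rw [ex_entryLaw, ← ex_mul_left]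
  exact ex_mono _ fun c => ex_mono _ fun v => ex_mono _ fun s => (h _).trans_eq (ex_mul_left _ _ _).symm

variable (P) in
/-- The state of the simulated experiment: the memory of the adversary, the preimages that program the
oracle `H`, and the values of `Expand`. -/
structure Sim where
  mem : List ℤ
  htbl : List ((Msg × BitVec P.saltLen) × (Fin 3 × Fin P.n → ℤ))
  etbl : List (BitVec P.seedLen × P.RQ)

/-- The preimage that programs `H` at a point. -/
def Sim.pre (σ : P.Sim) (k : Msg × BitVec P.saltLen) (h : Fin 3 × Fin P.n → ℤ) : Fin 3 × Fin P.n → ℤ :=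
  (σ.htbl.lookup k).getD h

/-- The value of `Expand` at a point. -/
def Sim.expand (σ : P.Sim) (k : BitVec P.seedLen) (v : P.RQ) : P.RQ := (σ.etbl.lookup k).getD v

/-- The point of `H` in a list of arguments. -/
def hashKey (P : Params) (args : List ℤ) : Msg × BitVec P.saltLen :=
  (args.getD 0 0, BitVec.ofInt P.saltLen (args.getD 1 0))

/-- One step of the simulation: the answer and the new tables. -/
def simEval (a b : P.RQ) (e : P.Entry) (σ : P.Sim) : Instr Oracle → List ℤ × P.Sim
  | .const c => ([c], σ)
  | .plus i j => ([σ.mem.getD i 0 + σ.mem.getD j 0], σ)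
  | .minus i j => ([σ.mem.getD i 0 - σ.mem.getD j 0], σ)
  | .times i j => ([σ.mem.getD i 0 * σ.mem.getD j 0], σ)
  | .quot i j => ([σ.mem.getD i 0 / σ.mem.getD j 0], σ)
  | .rem i j => ([σ.mem.getD i 0 % σ.mem.getD j 0], σ)
  | .less i j => ([if σ.mem.getD i 0 < σ.mem.getD j 0 then 1 else 0], σ)
  | .coin => ([if e.coin then 1 else 0], σ)
  | .query .hash args =>
    let k := P.hashKey (args.map fun i => σ.mem.getD i 0)
    (words (target a b (σ.pre k e.pre)), { σ with htbl := (k, σ.pre k e.pre) :: σ.htbl })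
  | .query .expand args =>
    let k := BitVec.ofInt P.seedLen ((args.map fun i => σ.mem.getD i 0).getD 0 0)
    (words (σ.expand k e.fresh), { σ with etbl := (k, σ.expand k e.fresh) :: σ.etbl })
  -- The signature is taken from the tape unconditionally. Its entry shadows an older one with the
  -- same message and salt, since `lookup` returns the first match; such collisions are charged to
  -- `signLoss`.
  | .query .sign args =>
    ((e.salt.toNat : ℤ) :: (List.ofFn (P.block 1 e.pre) ++ List.ofFn (P.block 2 e.pre)),
      { σ with htbl := (((args.map fun i => σ.mem.getD i 0).getD 0 0, e.salt), e.pre) :: σ.htbl })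

/-- One step of the simulation. -/
def simStep (w : ℕ) (a b : P.RQ) (e : P.Entry) (σ : P.Sim) (i : Instr Oracle) : P.Sim :=
  { (simEval a b e σ i).2 with mem := σ.mem ++ (simEval a b e σ i).1.map (fit w) }

/-- The simulation on a tape of randomness. -/
def simRun (w : ℕ) (a b : P.RQ) : List (Instr Oracle) → List P.Entry → P.Sim → P.Sim
  | i :: is, e :: t, σ => simRun w a b is t (simStep w a b e σ i)
  | _, _, σ => σ

/-- The forgery in a list of output words. -/
def forgery (P : Params) (out : List ℤ) : Msg × P.Sig :=
  (out.getD 0 0, (BitVec.ofInt P.saltLen (out.getD 1 0),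
    (fun i => out.getD (2 + i) 0), fun i => out.getD (2 + P.n + i) 0))

/-- The first component of a signature, recovered by the verifier. -/
noncomputable def residual (a b u : P.RQ) (z : P.R × P.R) : P.R :=
  centered (u - ringMul a (modQ P.Q z.1) - ringMul b (modQ P.Q z.2))

/-- The vector with given blocks. -/
def blocks (x y z : P.R) : Fin 3 × Fin P.n → ℤ := fun c => (![x, y, z] c.1) c.2

/-- The forgery is valid and differs from the preimage that programs `H`. -/
def Forges (a b : P.RQ) (e : P.Entry) (σ : P.Sim) (x : Msg × P.Sig) : Prop :=
  let h := σ.pre (x.1, x.2.1) e.pre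
  twistedNorm P.γ (blocks (residual a b (target a b h) x.2.2) x.2.2.1 x.2.2.2) ≤ P.β ∧
    x.2.2 ≠ (P.block 1 h, P.block 2 h)

/-! ### The oracles of the experiment -/

section Oracles
variable {α : Type} (st : P.State)

theorem ex_hash (k : Msg × BitVec P.saltLen) (F : P.RQ × P.State → ℝ≥0∞) :
    ex ((P.hash k.1 k.2).run st) F = match st.hash k with
      | some u => F (u, st)
      | none => ex (PMF.uniformOfFintype P.RQ) fun u =>
          F (u, { st with hash := Function.update st.hash k (some u) }) := by
  unfold hash
  rw [StateT.run_bind, StateT.run_get, pure_bind]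
  simp only
  cases h : st.hash k with
  | some u => simp only [StateT.run_pure]; exact ex_pure _ _
  | none =>
    simp only [StateT.run_bind, StateT.run_monadLift, bind_assoc, ex_bind]
    simp [StateT.run_set, ex_pure]

theorem ex_expand (k : BitVec P.seedLen) (F : P.RQ × P.State → ℝ≥0∞) :
    ex ((P.expand k).run st) F = match st.expand k with
      | some u => F (u, st)
      | none => ex (PMF.uniformOfFintype P.RQ) fun u =>
          F (u, { st with expand := Function.update st.expand k (some u) }) := by
  unfold expand
  rw [StateT.run_bind, StateT.run_get, pure_bind]
  simp only
  cases h : st.expand k with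
  | some u => simp only [StateT.run_pure]; exact ex_pure _ _
  | none =>
    simp only [StateT.run_bind, StateT.run_monadLift, bind_assoc, ex_bind]
    simp [StateT.run_set, ex_pure]

end Oracles

end Params

namespace Params
open Matrix
variable {P : Params}

/-! ### Bounds for the signing oracle -/

section Sign
variable {f g : P.R} {a b : P.RQ} {seed : BitVec P.seedLen} {st : P.State}

open Classical in
theorem ex_signAttempt (hst : st.expand seed = some a) (m : Msg)
    (F : Option P.Sig × P.State → ℝ≥0∞) : ex ((P.signAttempt seed b f g m).run st) F =
      ex (PMF.uniformOfFintype (BitVec P.saltLen)) fun s => ex ((P.hash m s).run st) fun p =>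
        ex (preSample P.p P.q P.r P.s (P.pubMatrix a b) (P.trapdoor f g) p.1) fun z =>
          if twistedNorm P.γ (withError z (centered (p.1 - P.pubMatrix a b *ᵥ modQ P.Q z))) ≤ P.β then
            F (some (s, (P.block 1 z, P.block 2 z)), p.2) else F (none, p.2) := by
  unfold signAttempt
  rw [StateT.run_bind, ex_bind, ex_expand]
  simp only [hst]
  rw [StateT.run_bind, ex_bind]
  simp only [StateT.run_monadLift, bind_assoc, ex_bind, pure_bind, ex_pure,
    StateT.run_bind]
  congr 1; funext s
  congr 1; funext p
  congr 1; funext z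
  by_cases h : twistedNorm P.γ (withError z (centered (p.1 - P.pubMatrix a b *ᵥ modQ P.Q z))) ≤ P.β
  · rw [if_pos h]
    have h' : twistedNorm P.γ (fun c : Fin 3 × Fin P.n => if c.1 = 0 then
      z c + (centered (p.1 - P.pubMatrix a b *ᵥ modQ P.Q z) : P.R) c.2 else z c) ≤ P.β := h
    rw [if_pos h', StateT.run_pure, ex_pure]
    rfl
  · rw [if_neg h]
    have h' : ¬ twistedNorm P.γ (fun c : Fin 3 × Fin P.n => if c.1 = 0 then
      z c + (centered (p.1 - P.pubMatrix a b *ᵥ modQ P.Q z) : P.R) c.2 else z c) ≤ P.β := h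
    rw [if_neg h', StateT.run_pure, ex_pure]

theorem ex_sign_succ (m : Msg) (fuel : ℕ) (F : Option P.Sig × P.State → ℝ≥0∞) :
    ex ((P.sign seed b f g m (fuel + 1)).run st) F =
      ex ((P.signAttempt seed b f g m).run st) fun p => match p.1 with
        | some sig => F (some sig, p.2)
        | none => ex ((P.sign seed b f g m fuel).run p.2) F := by
  rw [sign, StateT.run_bind, ex_bind]
  congr 1; funext p
  rcases p with ⟨_ | sig, st'⟩
  · rfl
  · simp only [StateT.run_pure]; exact ex_pure _ _

/-- The words of an issued signature. -/
def sigWords (sig : P.Sig) : List ℤ := (sig.1.toNat : ℤ) :: (List.ofFn sig.2.1 ++ List.ofFn sig.2.2)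

theorem ex_answer_sign (fuel : ℕ) (args : List ℤ) (F : List ℤ × P.State → ℝ≥0∞) :
    ex ((P.answer seed b f g fuel .sign args).run st) F =
      ex ((P.sign seed b f g (args.getD 0 0) fuel).run st) fun p => match p.1 with
        | some sig => F (sigWords sig, { p.2 with signed := (args.getD 0 0, sig) :: p.2.signed })
        | none => F ([], { p.2 with stuck := true }) := by
  unfold answer
  simp only
  rw [StateT.run_bind, ex_bind]
  congr 1; funext p
  rcases p with ⟨_ | sig, st'⟩
  · simp only [StateT.run_bind, StateT.run_pure, StateT.run_modify, pure_bind]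
    exact ex_pure _ _
  · simp only [StateT.run_bind, StateT.run_pure, StateT.run_modify, pure_bind]
    exact ex_pure _ _

/-- The state after a fresh signature. -/
def State.sign (st : P.State) (a b : P.RQ) (m : Msg) (s : BitVec P.saltLen)
    (h : Fin 3 × Fin P.n → ℤ) : P.State :=
  { st with
    hash := Function.update st.hash (m, s) (some (target a b h))
    signed := (m, (s, (P.block 1 h, P.block 2 h))) :: st.signed }

open Classical in
/-- The contribution of signatures that are issued at the first attempt with a fresh salt. -/
noncomputable def signCore (f g : P.R) (st : P.State) (m : Msg)
    (F : BitVec P.saltLen → (Fin 3 × Fin P.n → ℤ) → ℝ≥0∞) : ℝ≥0∞ :=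
  ex (PMF.uniformOfFintype (BitVec P.saltLen)) fun s =>
    if (st.hash (m, s)).isSome then 0 else ex (honestLaw P f g) fun h =>
      if twistedNorm P.γ h ≤ P.β then F s h else 0

open Classical in
/-- The probability that a signing query does not succeed at the first attempt with a fresh salt. -/
noncomputable def signLoss (f g : P.R) (st : P.State) (m : Msg) : ℝ≥0∞ :=
  (ex (PMF.uniformOfFintype (BitVec P.saltLen)) fun s => if (st.hash (m, s)).isSome then 1 else 0) +
    ex (honestLaw P f g) fun h => if twistedNorm P.γ h ≤ P.β then 0 else 1

theorem signCore_mono (m : Msg) {F G : BitVec P.saltLen → (Fin 3 × Fin P.n → ℤ) → ℝ≥0∞}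
    (h : ∀ s h, F s h ≤ G s h) : signCore f g st m F ≤ signCore f g st m G := by
  unfold signCore
  refine ex_mono _ fun s => ?_
  split_ifs with hs
  · exact le_rfl
  · refine ex_mono _ fun x => ?_
    split_ifs
    · exact h s x
    · exact le_rfl

theorem signCore_add (m : Msg) (F G : BitVec P.saltLen → (Fin 3 × Fin P.n → ℤ) → ℝ≥0∞) :
    signCore f g st m (fun s h => F s h + G s h) = signCore f g st m F + signCore f g st m G := by
  unfold signCore
  rw [← ex_add]
  congr 1; funext s
  split_ifs
  · simp
  · rw [← ex_add]
    congr 1; funext x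
    split_ifs <;> simp

theorem signCore_list_sum {ι : Type} (m : Msg) (l : List ι)
    (F : ι → BitVec P.saltLen → (Fin 3 × Fin P.n → ℤ) → ℝ≥0∞) :
    signCore f g st m (fun s h => (l.map fun i => F i s h).sum) =
      (l.map fun i => signCore f g st m (F i)).sum := by
  induction l with
  | nil =>
    simp only [List.map_nil, List.sum_nil, signCore]
    simp [ex_const]
  | cons i l ih => simp only [List.map_cons, List.sum_cons]; rw [signCore_add, ih]

theorem signCore_le (m : Msg) (F : BitVec P.saltLen → (Fin 3 × Fin P.n → ℤ) → ℝ≥0∞) :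
    signCore f g st m F ≤ ex (PMF.uniformOfFintype (BitVec P.saltLen)) fun s =>
      ex (honestLaw P f g) fun h => F s h := by
  unfold signCore
  refine ex_mono _ fun s => ?_
  split_ifs
  · exact zero_le
  · refine ex_mono _ fun h => ?_
    split_ifs
    · exact le_rfl
    · exact zero_le

variable (hst : st.expand seed = some a) (hr : 0 < P.r)
  (hb : b = modQ P.Q (fun i : Fin P.n => if (i : ℕ) = 0 then (P.p : ℤ) else 0) -
      (ringMul a (modQ P.Q f) + modQ P.Q g))
include hst hr hb

-- Everything after a rejected first attempt is hidden in `R`, about which only the bound by one is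
-- used. This makes all estimates uniform in the number of attempts.
open Classical in
theorem ex_answer_sign_succ (fuel : ℕ) (args : List ℤ) (F : List ℤ × P.State → ℝ≥0∞) :
    ∃ R : (BitVec P.saltLen) → P.RQ × P.State → ℝ≥0∞, ((∀ p, F p ≤ 1) → ∀ s p, R s p ≤ 1) ∧
    ex ((P.answer seed b f g (fuel + 1) .sign args).run st) F =
      ex (PMF.uniformOfFintype (BitVec P.saltLen)) fun s =>
        ex ((P.hash (args.getD 0 0) s).run st) fun p =>
        ex (preSample P.p P.q P.r P.s (P.pubMatrix a b) (P.trapdoor f g) p.1) fun z =>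
          if twistedNorm P.γ (withError z (centered (p.1 - P.pubMatrix a b *ᵥ modQ P.Q z))) ≤ P.β then
            F (sigWords (s, (P.block 1 z, P.block 2 z)),
              { p.2 with signed := (args.getD 0 0, (s, (P.block 1 z, P.block 2 z))) :: p.2.signed })
          else R s p := by
  refine ⟨fun s p => ex ((P.sign seed b f g (args.getD 0 0) fuel).run p.2) fun p => match p.1 with
        | some sig => F (sigWords sig, { p.2 with signed := (args.getD 0 0, sig) :: p.2.signed })
        | none => F ([], { p.2 with stuck := true }), fun hF s p => ex_le_of_le _ fun x => ?_, ?_⟩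
  · split <;> exact hF _
  · rw [ex_answer_sign, ex_sign_succ, ex_signAttempt hst]

-- The lower bound is needed besides the upper one: the hybrid argument carries real probabilities
-- of hitting a given preimage, and after a simulated signature these must be folded back into the
-- real experiment.
open Classical in
theorem signCore_le_ex_answer (fuel : ℕ) (args : List ℤ) (F : List ℤ × P.State → ℝ≥0∞) :
    signCore f g st (args.getD 0 0) (fun s h =>
        F (sigWords (s, (P.block 1 h, P.block 2 h)), st.sign a b (args.getD 0 0) s h)) ≤
      ex ((P.answer seed b f g (fuel + 1) .sign args).run st) F := by
  obtain ⟨R, -, hR⟩ := ex_answer_sign_succ hst hr hb fuel args F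
  rw [hR, signCore]
  refine ex_mono _ fun s => ?_
  cases hs : st.hash (args.getD 0 0, s) with
  | some u => simp
  | none =>
    rw [if_neg (by simp), ex_hash st (args.getD 0 0, s)]
    simp only [hs]
    refine (ex_target hr hb fun u h => if twistedNorm P.γ h ≤ P.β then
        F (sigWords (s, (P.block 1 h, P.block 2 h)),
          { st with
            hash := Function.update st.hash (args.getD 0 0, s) (some u)
            signed := (args.getD 0 0, (s, (P.block 1 h, P.block 2 h))) :: st.signed }) else 0).symm.trans_le ?_
    refine ex_mono _ fun u => ex_mono _ fun z => ?_
    rw [block_one_withError, block_two_withError]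
    split_ifs
    · exact le_rfl
    · exact zero_le

-- A repeated salt or a rejection is simply counted as a loss of at most one. For a fresh salt the
-- hash value is uniform, and `ex_target` replaces the signer.
open Classical in
theorem ex_answer_le_signCore (fuel : ℕ) (args : List ℤ) {F : List ℤ × P.State → ℝ≥0∞}
    (hF : ∀ p, F p ≤ 1) : ex ((P.answer seed b f g (fuel + 1) .sign args).run st) F ≤
      signCore f g st (args.getD 0 0) (fun s h =>
        F (sigWords (s, (P.block 1 h, P.block 2 h)), st.sign a b (args.getD 0 0) s h)) + signLoss f g st (args.getD 0 0) := by
  obtain ⟨R, hR1, hR⟩ := ex_answer_sign_succ hst hr hb fuel args F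
  rw [hR, signCore, signLoss, add_comm (ex (PMF.uniformOfFintype (BitVec P.saltLen)) _) (ex (honestLaw P f g) _),
    ← add_assoc, ← ex_const (PMF.uniformOfFintype (BitVec P.saltLen)) (ex (honestLaw P f g) _),
    ← ex_add, ← ex_add]
  refine ex_mono _ fun s => ?_
  cases hs : st.hash (args.getD 0 0, s) with
  | some u =>
    refine le_add_left ?_
    simp only [Option.isSome_some, if_true]
    refine ex_le_of_le _ fun p => ex_le_of_le _ fun z => ?_
    split_ifs
    · exact hF _
    · exact hR1 hF _ _
  | none =>
    rw [if_neg (by simp), if_neg (by simp), add_zero, ex_hash st (args.getD 0 0, s)]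
    simp only [hs]
    rw [← ex_add]
    refine le_of_le_of_eq ?_ (ex_target hr hb fun u h => (if twistedNorm P.γ h ≤ P.β then
        F (sigWords (s, (P.block 1 h, P.block 2 h)),
          { st with
            hash := Function.update st.hash (args.getD 0 0, s) (some u)
            signed := (args.getD 0 0, (s, (P.block 1 h, P.block 2 h))) :: st.signed }) else 0) +
              if twistedNorm P.γ h ≤ P.β then 0 else 1)
    refine ex_mono _ fun u => ex_mono _ fun z => ?_
    rw [block_one_withError, block_two_withError]
    split_ifs
    · simp
    · simpa using hR1 hF _ _

end Sign

end Params

theorem lookup_cons_ite {κ υ : Type} [BEq κ] [LawfulBEq κ] [DecidableEq κ] (k k' : κ) (v : υ)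
    (l : List (κ × υ)) : ((k', v) :: l).lookup k = if k = k' then some v else l.lookup k := by
  rw [List.lookup_cons]
  by_cases h : k = k'
  · simp [h]
  · rw [if_neg h, beq_eq_false_iff_ne.2 h]

theorem lookup_isSome_mem {κ υ : Type} [BEq κ] [LawfulBEq κ] [DecidableEq κ] {k : κ}
    {l : List (κ × υ)} (h : (l.lookup k).isSome) : k ∈ l.map Prod.fst := by
  induction l with
  | nil => simp at h
  | cons x l ih =>
    obtain ⟨k', v⟩ := x
    rw [lookup_cons_ite] at h
    by_cases hk : k = k'
    · simp [hk]
    · rw [if_neg hk] at h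
      exact List.mem_cons_of_mem _ (ih h)

namespace Params
open Matrix
variable {P : Params}

/-! ### The simulated experiment bounds the real one -/

/-- The state of the experiment corresponds to the state of the simulation. -/
structure Matches (a b : P.RQ) (seed : BitVec P.seedLen) (σ : P.Sim) (st : P.State)
    (C : List (P.R × P.R)) : Prop where
  hash : ∀ k, st.hash k = (σ.htbl.lookup k).map (target a b)
  expand : ∀ k, st.expand k = σ.etbl.lookup k
  seed : st.expand seed = some a
  -- Every programmed preimage was either issued as a signature or belongs to the list `C` of
  -- preimages behind direct hash queries. Hitting a member of `C` is the event that has to be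
  -- bounded.
  covered : ∀ k h, σ.htbl.lookup k = some h →
    (k.1, (k.2, (P.block 1 h, P.block 2 h))) ∈ st.signed ∨ (P.block 1 h, P.block 2 h) ∈ C

/-- The output words of a program. -/
def outWords (out : List ℕ) (mem : List ℤ) : List ℤ := out.map fun i => mem.getD i 0

section Game
variable (f g : P.R) (a b : P.RQ) (seed : BitVec P.seedLen) (fuel w : ℕ) (out : List ℕ)

open Classical in
/-- The success probability of the final check. -/
noncomputable def finalProb (p : List ℤ × P.State) : ℝ≥0∞ :=
  ex ((P.verify seed b (P.forgery (outWords out p.1)).1 (P.forgery (outWords out p.1)).2).run p.2) fun q =>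
    if q.1 = true ∧ P.forgery (outWords out p.1) ∉ q.2.signed ∧ q.2.stuck = false then 1 else 0

open Classical in
/-- Whether the forgery has a given preimage. -/
noncomputable def guess (c : P.R × P.R) (p : List ℤ × P.State) : ℝ≥0∞ :=
  if (P.forgery (outWords out p.1)).2.2 = c then 1 else 0

open Classical in
/-- The success probability of the simulated experiment. -/
noncomputable def simProb (μ : PMF (Fin 3 × Fin P.n → ℤ)) (code : List (Instr Oracle)) (σ : P.Sim) :
    ℝ≥0∞ :=
  ex (P.entryLaw μ) fun e => ex (iid (P.entryLaw μ) code.length) fun t =>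
    if Forges a b e (simRun w a b code t σ) (P.forgery (outWords out (simRun w a b code t σ).mem))
    then 1 else 0

theorem finalProb_le_one (p : List ℤ × P.State) : finalProb b seed out p ≤ 1 :=
  ex_le_of_le _ fun q => by split_ifs <;> simp

theorem simProb_cons (μ : PMF (Fin 3 × Fin P.n → ℤ)) (i : Instr Oracle) (code : List (Instr Oracle))
    (σ : P.Sim) : simProb a b w out μ (i :: code) σ =
      ex (P.entryLaw μ) fun e => simProb a b w out μ code (simStep w a b e σ i) := by
  unfold simProb
  simp only [List.length_cons, ex_iid_succ]
  rw [ex_comm]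
  rfl

theorem ex_answer_hash (st : P.State) (args : List ℤ) (F : List ℤ × P.State → ℝ≥0∞) :
    ex ((P.answer seed b f g fuel .hash args).run st) F =
      ex ((P.hash (P.hashKey args).1 (P.hashKey args).2).run st) fun p => F (words p.1, p.2) := by
  unfold answer
  simp only
  rw [StateT.run_bind, ex_bind]
  congr 1; funext p
  rw [StateT.run_pure, ex_pure]

theorem ex_answer_expand (st : P.State) (args : List ℤ) (F : List ℤ × P.State → ℝ≥0∞) :
    ex ((P.answer seed b f g fuel .expand args).run st) F =
      ex ((P.expand (BitVec.ofInt P.seedLen (args.getD 0 0))).run st) fun p => F (words p.1, p.2) := by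
  unfold answer
  simp only
  rw [StateT.run_bind, ex_bind]
  congr 1; funext p
  rw [StateT.run_pure, ex_pure]

open Classical in
theorem finalProb_eq {st : P.State} (hst : st.expand seed = some a) (mem : List ℤ) :
    finalProb b seed out (mem, st) =
      ex ((P.hash (P.forgery (outWords out mem)).1 (P.forgery (outWords out mem)).2.1).run st) fun q =>
        if twistedNorm P.γ (blocks (residual a b q.1 (P.forgery (outWords out mem)).2.2)
            (P.forgery (outWords out mem)).2.2.1 (P.forgery (outWords out mem)).2.2.2) ≤ P.β ∧
          P.forgery (outWords out mem) ∉ st.signed ∧ st.stuck = false then 1 else 0 := by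
  unfold finalProb verify
  simp only
  set x := P.forgery (outWords out mem)
  rw [StateT.run_bind, ex_bind, ex_hash st (x.1, x.2.1), ex_hash st (x.1, x.2.1)]
  cases st.hash (x.1, x.2.1) with
  | some u =>
    simp only
    rw [StateT.run_bind, ex_bind, ex_expand]
    simp only [hst, StateT.run_pure, ex_pure, decide_eq_true_eq]
    rfl
  | none =>
    simp only
    congr 1; funext u
    rw [StateT.run_bind, ex_bind, ex_expand]
    simp only [hst, StateT.run_pure, ex_pure, decide_eq_true_eq]
    rfl

theorem ex_hash_stuck {st : P.State} (hst : st.stuck = true) (k : Msg × BitVec P.saltLen)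
    {F : P.RQ × P.State → ℝ≥0∞} (hF : ∀ q, q.2.stuck = true → F q = 0) :
    ex ((P.hash k.1 k.2).run st) F = 0 := by
  rw [ex_hash]
  split
  · exact hF _ hst
  · refine (congrArg (ex _) (funext fun u => ?_)).trans (ex_const _ 0)
    exact hF _ hst

theorem ex_expand_stuck {st : P.State} (hst : st.stuck = true) (k : BitVec P.seedLen)
    {F : P.RQ × P.State → ℝ≥0∞} (hF : ∀ q, q.2.stuck = true → F q = 0) :
    ex ((P.expand k).run st) F = 0 := by
  rw [ex_expand]
  split
  · exact hF _ hst
  · refine (congrArg (ex _) (funext fun u => ?_)).trans (ex_const _ 0)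
    exact hF _ hst

theorem exec_cons (i : Instr Oracle) (code : List (Instr Oracle)) (mem : List ℤ) (st : P.State)
    (F : List ℤ × P.State → ℝ≥0∞) : ex ((exec w (P.answer seed b f g fuel) (i :: code) mem).run st) F =
      ex ((i.eval (P.answer seed b f g fuel) mem).run st) fun p =>
        ex ((exec w (P.answer seed b f g fuel) code (mem ++ p.1.map (fit w))).run p.2) F := by
  rw [exec, StateT.run_bind, ex_bind]

theorem ex_answer_sign_zero (st : P.State) (args : List ℤ) (F : List ℤ × P.State → ℝ≥0∞) :
    ex ((P.answer seed b f g 0 .sign args).run st) F = F ([], { st with stuck := true }) := by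
  rw [ex_answer_sign, sign, StateT.run_pure, ex_pure]

/-- A signing query that does not terminate is never undone. -/
theorem ex_exec_stuck (code : List (Instr Oracle)) (mem : List ℤ) {st : P.State}
    (hst : st.stuck = true) :
    ex ((exec w (P.answer seed b f g 0) code mem).run st) (finalProb b seed out) = 0 := by
  induction code generalizing mem st with
  | nil =>
    rw [exec, StateT.run_pure, ex_pure]
    unfold finalProb verify
    simp only
    set x := P.forgery (outWords out mem)
    rw [StateT.run_bind, ex_bind]
    refine ex_hash_stuck hst (x.1, x.2.1) fun q hq => ?_
    rw [StateT.run_bind, ex_bind]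
    refine ex_expand_stuck hq _ fun q' hq' => ?_
    rw [StateT.run_pure, ex_pure]
    simp [hq']
  | cons i code ih =>
    rw [exec_cons]
    cases i with
    | query o args =>
      simp only [Instr.eval]
      cases o with
      | hash =>
        rw [ex_answer_hash]
        exact ex_hash_stuck hst _ fun q hq => ih _ hq
      | expand =>
        rw [ex_answer_expand]
        exact ex_expand_stuck hst _ fun q hq => ih _ hq
      | sign =>
        rw [ex_answer_sign_zero]
        exact ih _ rfl
    | coin =>
      simp only [Instr.eval, StateT.run_bind, StateT.run_monadLift, bind_assoc, pure_bind,
        StateT.run_pure, ex_bind, ex_pure]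
      exact (congrArg (ex _) (funext fun u => ih _ hst)).trans (ex_const _ 0)
    | _ =>
      simp only [Instr.eval, StateT.run_pure, ex_pure]
      exact ih _ hst

section Main
variable {f g a b seed fuel w out} {μ L : ℝ≥0∞} {N : ℕ}

-- Conditionally on the target `u`, the guess and the preimage of `u` are independent. For every
-- fixed guess the preimage hits it with probability at most `μ`.
open Classical in
theorem ex_honest_block_le (hr : 0 < P.r)
    (hb : b = modQ P.Q (fun i : Fin P.n => if (i : ℕ) = 0 then (P.p : ℤ) else 0) -
      (ringMul a (modQ P.Q f) + modQ P.Q g))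
    (hμ : ∀ u c, ex (preSample P.p P.q P.r P.s (P.pubMatrix a b) (P.trapdoor f g) u)
      (fun z => if (P.block 1 z, P.block 2 z) = c then 1 else 0) ≤ μ) (F : P.RQ → P.R × P.R → ℝ≥0∞)
    (hF : ∀ u, ∃ ν : PMF (P.R × P.R), ∀ c, F u c = ex ν fun d => if c = d then 1 else 0) :
    ex (honestLaw P f g) (fun h => F (target a b h) (P.block 1 h, P.block 2 h)) ≤ μ := by
  rw [← ex_target hr hb fun u h => F u (P.block 1 h, P.block 2 h)]
  refine ex_le_of_le _ fun u => ?_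
  obtain ⟨ν, hν⟩ := hF u
  simp only [block_one_withError, block_two_withError, hν]
  rw [ex_comm]
  exact ex_le_of_le _ fun d => hμ u d

/-- The hash points defined so far all come from the table, so they involve at most `N` salts. -/
theorem signLoss_le (hL : N * (2 ^ P.saltLen : ℝ≥0∞)⁻¹ +
      (open Classical in ex (honestLaw P f g) fun h => if twistedNorm P.γ h ≤ P.β then 0 else 1) + μ ≤ L)
    {σ : P.Sim} {st : P.State} {C : List (P.R × P.R)} (hm : Matches a b seed σ st C)
    (hlen : σ.htbl.length ≤ N) (m : Msg) : signLoss f g st m ≤ L := by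
  classical
  refine le_trans ?_ hL
  refine le_trans ?_ le_self_add
  unfold signLoss
  refine add_le_add ?_ (le_of_eq ?_)
  · rw [ex_uniformOfFintype, mul_comm, Finset.sum_boole]
    have hc : Fintype.card (BitVec P.saltLen) = 2 ^ P.saltLen := by
      rw [← Fintype.card_fin (2 ^ P.saltLen)]
      exact Fintype.card_congr ⟨BitVec.toFin, BitVec.ofFin, fun _ => rfl, fun _ => rfl⟩
    rw [hc]
    push_cast
    gcongr
    refine le_trans ?_ hlen
    refine le_trans (Finset.card_le_card (t := (σ.htbl.map fun x => x.1.2).toFinset) fun s hs => ?_)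
      ((List.toFinset_card_le _).trans_eq (List.length_map _))
    simp only [Finset.mem_filter, Finset.mem_univ, true_and, hm.hash, Option.isSome_map] at hs
    have := lookup_isSome_mem hs
    simp only [List.mem_map, List.mem_toFinset] at this ⊢
    obtain ⟨x, hx, hx'⟩ := this
    exact ⟨x, hx, by rw [hx']⟩
  · congr

/-- If the point of the forgery is programmed, the forgery either differs from the stored preimage,
or repeats an issued signature and does not count, or hits a member of `C`. If the point is new, a
fresh preimage is drawn and coincides with the forgery with probability at most `μ`. -/
theorem finalProb_le (hr : 0 < P.r)
    (hb : b = modQ P.Q (fun i : Fin P.n => if (i : ℕ) = 0 then (P.p : ℤ) else 0) -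
      (ringMul a (modQ P.Q f) + modQ P.Q g))
    (hμ : ∀ u c, ex (preSample P.p P.q P.r P.s (P.pubMatrix a b) (P.trapdoor f g) u)
      (open Classical in fun z => if (P.block 1 z, P.block 2 z) = c then 1 else 0) ≤ μ)
    {σ : P.Sim} {st : P.State} {C : List (P.R × P.R)} (hm : Matches a b seed σ st C) :
    finalProb b seed out (σ.mem, st) ≤ simProb a b w out (honestLaw P f g) [] σ +
      (C.map fun c => guess out c (σ.mem, st)).sum + μ := by
  classical
  rw [finalProb_eq a b seed out hm.seed]
  set x := P.forgery (outWords out σ.mem) with hx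
  rw [ex_hash st (x.1, x.2.1)]
  have hsim : simProb a b w out (honestLaw P f g) [] σ =
      ex (P.entryLaw (honestLaw P f g)) fun e => if Forges a b e σ x then 1 else 0 := by
    unfold simProb
    congr 1; funext e
    exact ex_iid_zero _ _
  have hhash := hm.hash (x.1, x.2.1)
  cases hl : σ.htbl.lookup (x.1, x.2.1) with
  | some h =>
    rw [hl, Option.map_some] at hhash
    rw [hhash]
    simp only
    refine le_add_right ?_
    have hpre : ∀ e : P.Entry, Forges a b e σ x ↔
        twistedNorm P.γ (blocks (residual a b (target a b h) x.2.2) x.2.2.1 x.2.2.2) ≤ P.β ∧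
          x.2.2 ≠ (P.block 1 h, P.block 2 h) := by
      intro e
      unfold Forges Sim.pre
      rw [hl]
      rfl
    rw [hsim]
    simp only [hpre, ex_const]
    by_cases h2 : x.2.2 = (P.block 1 h, P.block 2 h)
    · rcases hm.covered _ _ hl with h3 | h3
      · rw [if_neg]
        · exact zero_le
        · rintro ⟨-, h4, -⟩
          refine h4 ?_
          rw [← h2] at h3
          exact h3
      · refine le_add_left (le_trans ?_ (List.single_le_sum (fun _ _ => zero_le) _
          (List.mem_map_of_mem h3)))
        unfold guess
        rw [← hx, if_pos h2]
        split_ifs <;> simp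
    · refine le_add_right ?_
      split_ifs with h4 h5
      · exact le_rfl
      · exact absurd ⟨h4.1, h2⟩ h5
      · exact zero_le
      · exact zero_le
  | none =>
    rw [hl, Option.map_none] at hhash
    rw [hhash]
    simp only
    have hpre : ∀ e : P.Entry, Forges a b e σ x ↔
        twistedNorm P.γ (blocks (residual a b (target a b e.pre) x.2.2) x.2.2.1 x.2.2.2) ≤ P.β ∧
          x.2.2 ≠ (P.block 1 e.pre, P.block 2 e.pre) := by
      intro e
      unfold Forges Sim.pre
      rw [hl]
      rfl
    rw [ex_target_fst hr hb, hsim, ex_entryLaw]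
    simp only [hpre, ex_const]
    rw [add_right_comm]
    refine le_add_right ?_
    have hblk := ex_honest_block_le hr hb hμ (fun _ c => if x.2.2 = c then 1 else 0)
      (fun u => ⟨pure x.2.2, fun c => by rw [ex_pure]; simp [eq_comm]⟩)
    refine le_trans ?_ (add_le_add le_rfl hblk)
    rw [← ex_add]
    refine ex_mono _ fun h => ?_
    by_cases h2 : x.2.2 = (P.block 1 h, P.block 2 h)
    · rw [if_pos h2]
      refine le_add_left ?_
      split_ifs <;> simp
    · refine le_add_right ?_
      split_ifs with h4 h5
      · exact le_rfl
      · exact absurd ⟨h4.1, h2⟩ h5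
      · exact zero_le
      · exact zero_le

end Main

end Game

end Params

/-! ### The hybrid argument: replacing the real oracles by the simulation, one instruction at a
time. -/

namespace Params
open Matrix
variable {P : Params}

section Hop
variable {f g : P.R} {a b : P.RQ} {seed : BitVec P.seedLen} {fuel w : ℕ} {out : List ℕ}
  {μ L : ℝ≥0∞} {N : ℕ}

/-- A repeated query stores a second copy of the entry that is found anyway; this spares the
simulation a case distinction. -/
theorem Matches.push_hash {σ : P.Sim} {st : P.State} {C : List (P.R × P.R)}
    (hm : Matches a b seed σ st C) {k : Msg × BitVec P.saltLen} {h : Fin 3 × Fin P.n → ℤ}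
    (hl : σ.htbl.lookup k = some h) (mem : List ℤ) :
    Matches a b seed { σ with mem := mem, htbl := (k, h) :: σ.htbl } st C := by
  have hlook : ∀ k', ((k, h) :: σ.htbl).lookup k' = σ.htbl.lookup k' := by
    intro k'
    rw [lookup_cons_ite]
    by_cases hk : k' = k
    · rw [if_pos hk, hk, hl]
    · rw [if_neg hk]
  refine ⟨fun k' => ?_, hm.expand, hm.seed, fun k' h' hk' => hm.covered k' h' ?_⟩
  · rw [hm.hash, hlook]
  · rwa [hlook] at hk'

theorem Matches.new_hash {σ : P.Sim} {st : P.State} {C : List (P.R × P.R)}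
    (hm : Matches a b seed σ st C) (k : Msg × BitVec P.saltLen) (h : Fin 3 × Fin P.n → ℤ)
    (mem : List ℤ) :
    Matches a b seed { σ with mem := mem, htbl := (k, h) :: σ.htbl }
      { st with hash := Function.update st.hash k (some (target a b h)) }
      ((P.block 1 h, P.block 2 h) :: C) := by
  refine ⟨fun k' => ?_, hm.expand, hm.seed, fun k' h' hk' => ?_⟩
  · simp only [lookup_cons_ite]
    by_cases hk : k' = k
    · subst hk; simp
    · rw [if_neg hk, Function.update_of_ne hk, hm.hash]
  · simp only [lookup_cons_ite] at hk'
    by_cases hk : k' = k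
    · rw [if_pos hk] at hk'
      cases hk'
      exact Or.inr List.mem_cons_self
    · rw [if_neg hk] at hk'
      exact (hm.covered k' h' hk').imp id fun h => List.mem_cons_of_mem _ h

theorem Matches.sign {σ : P.Sim} {st : P.State} {C : List (P.R × P.R)}
    (hm : Matches a b seed σ st C) (m : Msg) (s : BitVec P.saltLen) (h : Fin 3 × Fin P.n → ℤ)
    (mem : List ℤ) :
    Matches a b seed { σ with mem := mem, htbl := ((m, s), h) :: σ.htbl } (st.sign a b m s h) C := by
  refine ⟨fun k' => ?_, hm.expand, hm.seed, fun k' h' hk' => ?_⟩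
  · simp only [lookup_cons_ite, State.sign]
    by_cases hk : k' = (m, s)
    · subst hk; simp
    · rw [if_neg hk, Function.update_of_ne hk, hm.hash]
  · simp only [lookup_cons_ite] at hk'
    by_cases hk : k' = (m, s)
    · rw [if_pos hk] at hk'
      cases hk'
      subst hk
      exact Or.inl List.mem_cons_self
    · rw [if_neg hk] at hk'
      exact (hm.covered k' h' hk').imp (fun h => List.mem_cons_of_mem _ h) id

theorem Matches.push_expand {σ : P.Sim} {st : P.State} {C : List (P.R × P.R)}
    (hm : Matches a b seed σ st C) {k : BitVec P.seedLen} {v : P.RQ}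
    (hl : σ.etbl.lookup k = some v) (mem : List ℤ) :
    Matches a b seed { σ with mem := mem, etbl := (k, v) :: σ.etbl } st C := by
  refine ⟨hm.hash, fun k' => ?_, hm.seed, hm.covered⟩
  simp only [lookup_cons_ite]
  by_cases hk : k' = k
  · rw [if_pos hk, hk, hm.expand, hl]
  · rw [if_neg hk, hm.expand]

theorem Matches.new_expand {σ : P.Sim} {st : P.State} {C : List (P.R × P.R)}
    (hm : Matches a b seed σ st C) {k : BitVec P.seedLen} (hl : σ.etbl.lookup k = none) (v : P.RQ)
    (mem : List ℤ) :
    Matches a b seed { σ with mem := mem, etbl := (k, v) :: σ.etbl }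
      { st with expand := Function.update st.expand k (some v) } C := by
  refine ⟨hm.hash, fun k' => ?_, ?_, hm.covered⟩
  · simp only [lookup_cons_ite]
    by_cases hk : k' = k
    · subst hk; simp
    · rw [if_neg hk, Function.update_of_ne hk, hm.expand]
  · simp only
    have hne : seed ≠ k := by
      rintro rfl
      have := hm.seed
      rw [hm.expand, hl] at this
      cases this
    rw [Function.update_of_ne hne, hm.seed]

theorem list_sum_map_mono {ι : Type} {l : List ι} {F G : ι → ℝ≥0∞} (h : ∀ i ∈ l, F i ≤ G i) :
    (l.map F).sum ≤ (l.map G).sum := List.sum_le_sum h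

/-- The real experiment is bounded by the simulated one. -/
theorem ex_exec_le (hr : 0 < P.r)
    (hb : b = modQ P.Q (fun i : Fin P.n => if (i : ℕ) = 0 then (P.p : ℤ) else 0) -
      (ringMul a (modQ P.Q f) + modQ P.Q g))
    (hμ : ∀ u c, ex (preSample P.p P.q P.r P.s (P.pubMatrix a b) (P.trapdoor f g) u)
      (open Classical in fun z => if (P.block 1 z, P.block 2 z) = c then 1 else 0) ≤ μ)
    (hL : N * (2 ^ P.saltLen : ℝ≥0∞)⁻¹ +
      (open Classical in ex (honestLaw P f g) fun h => if twistedNorm P.γ h ≤ P.β then 0 else 1) + μ ≤ L)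
    (code : List (Instr Oracle)) {σ : P.Sim} {st : P.State} {C : List (P.R × P.R)}
    (hm : Matches a b seed σ st C) (hlen : σ.htbl.length + code.length ≤ N) :
    ex ((exec w (P.answer seed b f g fuel) code σ.mem).run st) (finalProb b seed out) ≤
      simProb a b w out (honestLaw P f g) code σ +
        (C.map fun c => ex ((exec w (P.answer seed b f g fuel) code σ.mem).run st) (guess out c)).sum +
        (code.length + 1) * L := by
  have hμL : μ ≤ L := le_trans le_add_self hL
  induction code generalizing σ st C with
  | nil =>
    simp only [exec, StateT.run_pure, ex_pure, List.length_nil, Nat.cast_zero, zero_add, one_mul]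
    exact (finalProb_le hr hb hμ hm).trans (add_le_add le_rfl hμL)
  | cons i code ih =>
    have hcost : ((i :: code).length + 1 : ℝ≥0∞) * L = (code.length + 1) * L + L := by
      rw [List.length_cons]; push_cast; ring
    rw [simProb_cons, hcost]
    have hlen' : σ.htbl.length + 1 + code.length ≤ N := by
      rw [List.length_cons] at hlen; omega
    simp only [exec_cons]
    cases i with
    | query o args =>
      simp only [Instr.eval]
      cases o with
      | hash =>
        simp only [ex_answer_hash]
        set k := P.hashKey (args.map fun i => σ.mem.getD i 0) with hk
        simp only [ex_hash st k]
        have hhash := hm.hash k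
        cases hl : σ.htbl.lookup k with
        | some h =>
          rw [hl, Option.map_some] at hhash
          simp only [hhash]
          have hstep : ∀ e : P.Entry, simStep w a b e σ (.query .hash args) =
              { σ with mem := σ.mem ++ (words (target a b h)).map (fit w), htbl := (k, h) :: σ.htbl } := by
            intro e
            simp only [simStep, simEval, ← hk, Sim.pre, hl, Option.getD_some]
          simp only [hstep, ex_const]
          have := ih (hm.push_hash hl (σ.mem ++ (words (target a b h)).map (fit w))) (by simpa using hlen')
          exact this.trans (by rw [← add_assoc]; exact le_self_add)
        | none =>
          rw [hl, Option.map_none] at hhash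
          simp only [hhash]
          have hstep : ∀ e : P.Entry, simStep w a b e σ (.query .hash args) =
              { σ with
                mem := σ.mem ++ (words (target a b e.pre)).map (fit w), htbl := (k, e.pre) :: σ.htbl } := by
            intro e
            simp only [simStep, simEval, ← hk, Sim.pre, hl, Option.getD_none]
          simp only [hstep]
          rw [ex_entryLaw]
          simp only [ex_const, ex_target_fst hr hb]
          -- The rest of the run sees the new preimage only through its image `u`, so given `u` the
          -- final forgery is a guess independent of it. This pays for the new member of `C`.
          have hblk := ex_honest_block_le hr hb hμ (fun u c =>
            ex ((exec w (P.answer seed b f g fuel) code (σ.mem ++ (words u).map (fit w))).run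
              { st with hash := Function.update st.hash k (some u) }) (guess out c))
            (fun u => ⟨(exec w (P.answer seed b f g fuel) code (σ.mem ++ (words u).map (fit w))).run
              { st with hash := Function.update st.hash k (some u) } >>= fun p =>
                pure (P.forgery (outWords out p.1)).2.2, fun c => by
                  rw [ex_map]; unfold guess; simp only [eq_comm]⟩)
          have hih := fun h => ih (hm.new_hash k h (σ.mem ++ (words (target a b h)).map (fit w)))
            (by simpa using hlen')
          refine (ex_mono _ hih).trans ?_
          simp only [List.map_cons, List.sum_cons]
          rw [ex_add, ex_add, ex_add, ex_const, ex_list_sum]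
          refine le_trans (add_le_add (add_le_add le_rfl (add_le_add (hblk.trans hμL) le_rfl)) le_rfl) ?_
          rw [add_comm L, ← add_assoc, ← add_assoc, add_right_comm]
      | expand =>
        simp only [ex_answer_expand]
        set k := BitVec.ofInt P.seedLen ((args.map fun i => σ.mem.getD i 0).getD 0 0) with hk
        simp only [ex_expand st k]
        have hexp := hm.expand k
        cases hl : σ.etbl.lookup k with
        | some v =>
          rw [hl] at hexp
          simp only [hexp]
          have hstep : ∀ e : P.Entry, simStep w a b e σ (.query .expand args) =
              { σ with mem := σ.mem ++ (words v).map (fit w), etbl := (k, v) :: σ.etbl } := by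
            intro e
            simp only [simStep, simEval, ← hk, Sim.expand, hl, Option.getD_some]
          simp only [hstep, ex_const]
          have := ih (hm.push_expand hl (σ.mem ++ (words v).map (fit w))) (by simp only; omega)
          exact this.trans (by rw [← add_assoc]; exact le_self_add)
        | none =>
          rw [hl] at hexp
          simp only [hexp]
          have hstep : ∀ e : P.Entry, simStep w a b e σ (.query .expand args) =
              { σ with
                mem := σ.mem ++ (words e.fresh).map (fit w), etbl := (k, e.fresh) :: σ.etbl } := by
            intro e
            simp only [simStep, simEval, ← hk, Sim.expand, hl, Option.getD_none]
          simp only [hstep]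
          rw [ex_entryLaw]
          simp only [ex_const]
          have hih := fun v => ih (hm.new_expand hl v (σ.mem ++ (words v).map (fit w)))
            (by simp only; omega)
          refine (ex_mono _ hih).trans ?_
          rw [ex_add, ex_add, ex_const, ex_list_sum, ← add_assoc]
          exact le_self_add
      | sign =>
        set m := (args.map fun i => σ.mem.getD i 0).getD 0 0 with hmdef
        cases fuel with
        | zero =>
          -- Without attempts the signing query sets the flag `stuck`, which is never reset, and the
          -- adversary loses.
          rw [ex_answer_sign_zero, ex_exec_stuck _ _ _ _ _ _ _ _ rfl]
          exact zero_le
        | succ fuel =>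
          refine (ex_answer_le_signCore hm.seed hr hb fuel _ fun p => ex_le_of_le _ fun p' =>
            finalProb_le_one b seed out p').trans ?_
          have hloss := signLoss_le (f := f) (g := g) hL hm (by omega) m
          rw [← add_assoc]
          refine add_le_add ?_ hloss
          have hih := fun s h => ih (hm.sign m s h
            (σ.mem ++ (sigWords (s, (P.block 1 h, P.block 2 h))).map (fit w))) (by simpa using hlen')
          refine (signCore_mono m hih).trans ?_
          rw [signCore_add, signCore_add, signCore_list_sum]
          refine add_le_add (add_le_add ?_ ?_) ?_
          · rw [ex_entryLaw]
            refine (signCore_le m _).trans_eq ?_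
            exact ((ex_const _ _).trans (ex_const _ _)).symm
          -- Here the lower bound for the signing oracle turns the guessing terms of the induction
          -- hypothesis back into guessing terms of the real run.
          · refine list_sum_map_mono fun c _ => ?_
            exact signCore_le_ex_answer hm.seed hr hb fuel (args.map fun i => σ.mem.getD i 0)
              fun p => ex ((exec w (P.answer seed b f g (fuel + 1)) code (σ.mem ++ p.1.map (fit w))).run p.2)
                (guess out c)
          · refine (signCore_le m _).trans_eq ?_
            simp only [ex_const]
    | coin =>
      simp only [Instr.eval, StateT.run_bind, StateT.run_monadLift, bind_assoc, pure_bind,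
        StateT.run_pure, ex_bind, ex_pure]
      rw [ex_entryLaw]
      have hih := fun c : Bool => ih (σ := { σ with mem := σ.mem ++ [if c then 1 else 0].map (fit w) })
        ⟨hm.hash, hm.expand, hm.seed, hm.covered⟩ (by simp only; omega)
      refine (ex_mono _ hih).trans ?_
      have hsim : ∀ c, (ex (PMF.uniformOfFintype P.RQ) fun v =>
          ex (PMF.uniformOfFintype (BitVec P.saltLen)) fun s => ex (P.honestLaw f g) fun h =>
            simProb a b w out (P.honestLaw f g) code (simStep w a b ⟨c, v, s, h⟩ σ .coin)) =
          simProb a b w out (P.honestLaw f g) code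
            { σ with mem := σ.mem ++ [if c then 1 else 0].map (fit w) } := by
        intro c
        have hstep : ∀ v s h, simStep w a b (⟨c, v, s, h⟩ : P.Entry) σ .coin =
          { σ with mem := σ.mem ++ [if c then 1 else 0].map (fit w) } := fun _ _ _ => rfl
        simp only [hstep, ex_const]
      simp only [hsim]
      rw [ex_add, ex_add, ex_const, ex_list_sum, ← add_assoc]
      exact le_self_add
    | _ =>
      simp only [Instr.eval, StateT.run_pure, ex_pure, simStep, simEval, ex_const]
      refine (ih (σ := { σ with mem := σ.mem ++ _ })
        ⟨hm.hash, hm.expand, hm.seed, hm.covered⟩ (by simp only; omega)).trans ?_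
      rw [← add_assoc]
      exact le_self_add

end Hop
end Params

namespace Params
open Matrix
variable {P : Params}

/-! ### From honest to ideal signatures -/

variable (P) in
/-- The law of `(z₀ + e, z₁, z₂)` for ideal signatures. -/
noncomputable def idealLaw : PMF (Fin 3 × Fin P.n → ℤ) :=
  errLaw P.p (discreteGaussian Set.univ (P.s ^ 2 • 1))

variable (P) in
/-- The error of the ring element `b` of the public key. -/
def gadget : P.RQ := modQ P.Q (fun i : Fin P.n => if (i : ℕ) = 0 then (P.p : ℤ) else 0)

/-- The ring element `b` of the public key. -/
def pubKey (a : P.RQ) (fg : P.R × P.R) : P.RQ :=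
  gadget P - (ringMul a (modQ P.Q fg.1) + modQ P.Q fg.2)

/-- The simulation starts with the public key in memory. -/
def simStart (w : ℕ) (a b : P.RQ) (seed : BitVec P.seedLen) : P.Sim :=
  ⟨(((seed.toNat : ℤ) :: words b).map (fit w)), [], [(seed, a)]⟩

/-- The adversary wins the simulated experiment on a tape of short vectors. -/
def SimWins (A : Program Oracle) (seed : BitVec P.seedLen) (a b : P.RQ) : List P.Entry → Prop
  | [] => False
  | e :: t =>
    let σ := simRun A.word a b A.code t (simStart A.word a b seed)
    Forges a b e σ (P.forgery (outWords A.out σ.mem)) ∧ ∀ e' ∈ e :: t, twistedNorm P.γ e'.pre ≤ P.β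

open Classical in
theorem ex_ideal_restart :
    ex (P.idealLaw) (fun h => if twistedNorm P.γ h ≤ P.β then 0 else 1) = ENNReal.ofReal P.restartProb := by
  unfold restartProb
  rw [ENNReal.ofReal_toReal (PMF.apply_ne_top _ _), idealLaw, ex_errLaw, prob_true_eq_ex, ex_bind]
  congr 1; funext z
  rw [ex_bind]
  congr 1; funext t
  rw [ex_pure]
  simp only [decide_eq_true_eq]
  by_cases h : P.β < twistedNorm P.γ fun c : Fin 3 × Fin P.n => if c.1 = 0 then z c + centered t c.2 else z c
  · rw [if_pos h, if_neg (not_le.2 h)]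
  · rw [if_neg h, if_pos (not_lt.1 h)]

theorem ex_honest_le {κ : ℝ≥0∞} {f g : P.R}
    (h : ∀ z, realLaw P.q P.r P.s (P.trapdoor f g) z ≤ κ * discreteGaussian Set.univ (P.s ^ 2 • 1) z)
    (F : (Fin 3 × Fin P.n → ℤ) → ℝ≥0∞) : ex (honestLaw P f g) F ≤ κ * ex P.idealLaw F := by
  rw [honestLaw, idealLaw, ex_errLaw, ex_errLaw]
  exact ex_le_of_apply_le h _

open Classical in
theorem simProb_honest_le {κ : ℝ≥0∞} {f g : P.R}
    (h : ∀ z, realLaw P.q P.r P.s (P.trapdoor f g) z ≤ κ * discreteGaussian Set.univ (P.s ^ 2 • 1) z)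
    (A : Program Oracle) (seed : BitVec P.seedLen) (a b : P.RQ) :
    simProb a b A.word A.out (honestLaw P f g) A.code (simStart A.word a b seed) ≤
      κ ^ (A.code.length + 1) * (ex (iid (P.entryLaw P.idealLaw) (A.code.length + 1))
        (fun t => if SimWins A seed a b t then 1 else 0) +
          (A.code.length + 1) * ENNReal.ofReal P.restartProb) := by
  set D : List P.Entry → ℝ≥0∞ := fun l => match l with
    | [] => 0
    | e :: t => if Forges a b e (simRun A.word a b A.code t (simStart A.word a b seed))
        (P.forgery (outWords A.out (simRun A.word a b A.code t (simStart A.word a b seed)).mem))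
        then 1 else 0 with hD
  have h1 : simProb a b A.word A.out (honestLaw P f g) A.code (simStart A.word a b seed) =
      ex (iid (P.entryLaw (honestLaw P f g)) (A.code.length + 1)) D := by
    rw [ex_iid_succ]; rfl
  rw [h1]
  -- The tape has one entry per instruction and one for the hash point of the forgery. Changing the
  -- law of the entire tape multiplies the probability by at most `κ` per entry.
  refine (ex_iid_le _ (P.entryLaw P.idealLaw) κ (ex_entryLaw_le (ex_honest_le h)) _ _).trans ?_
  gcongr
  obtain ⟨bad, hbad⟩ : ∃ p : P.Entry → Prop, ∀ e, p e ↔ ¬ twistedNorm P.γ e.pre ≤ P.β :=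
    ⟨_, fun _ => Iff.rfl⟩
  have h2 := ex_iid_exists (P.entryLaw P.idealLaw) bad (A.code.length + 1)
  have h3 : ex (P.entryLaw P.idealLaw) (fun e => if bad e then 1 else 0) =
      ENNReal.ofReal P.restartProb := by
    have hb : ∀ c v s h, (if bad ⟨c, v, s, h⟩ then (1 : ℝ≥0∞) else 0) =
        if twistedNorm P.γ h ≤ P.β then 0 else 1 := by
      intro c v s h
      have := hbad ⟨c, v, s, h⟩
      by_cases hh : twistedNorm P.γ h ≤ P.β
      · rw [if_pos hh, if_neg fun h' => this.1 h' hh]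
      · rw [if_neg hh, if_pos (this.2 hh)]
    rw [ex_entryLaw]
    simp only [hb, ex_const]
    exact ex_ideal_restart
  have h4 : ∀ l, D l ≤ (if SimWins A seed a b l then 1 else 0) + (if ∃ e ∈ l, bad e then 1 else 0) := by
    rintro (_ | ⟨e, t⟩)
    · exact zero_le
    · by_cases hg : ∃ e' ∈ e :: t, bad e'
      · rw [if_pos hg]
        refine le_add_left ?_
        simp only [hD]
        split_ifs <;> simp
      · refine le_add_right ?_
        have hg' : ∀ e' ∈ e :: t, twistedNorm P.γ e'.pre ≤ P.β := fun e' he' =>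
          not_not.1 fun h' => hg ⟨e', he', (hbad e').2 h'⟩
        simp only [hD]
        split_ifs with h5 h6
        · exact le_rfl
        · exact absurd ⟨h5, hg'⟩ h6
        · exact zero_le
        · exact zero_le
  refine (ex_mono _ h4).trans ?_
  rw [ex_add]
  refine add_le_add le_rfl (h2.trans ?_)
  rw [h3]
  push_cast
  exact le_rfl

/-! ### The success probability of the adversary -/

open Classical in
theorem forgeExperiment_eq (A : Program Oracle) (fuel : ℕ) :
    P.forgeExperiment A fuel true = ex (PMF.uniformOfFintype (BitVec P.seedLen)) fun seed =>
      ex (PMF.uniformOfFintype P.RQ) fun a => ex P.secretKey fun fg =>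
        ex ((exec A.word (P.answer seed (pubKey a fg) fg.1 fg.2 fuel) A.code
          (simStart A.word a (pubKey a fg) seed).mem).run
            { State.start P with expand := Function.update (State.start P).expand seed (some a) })
          (finalProb (pubKey a fg) seed A.out) := by
  unfold forgeExperiment
  rw [prob_true_eq_ex, ex_map]
  simp only [StateT.run_bind, StateT.run_monadLift, ex_bind, bind_assoc, pure_bind, Program.run,
    StateT.run_pure, ex_pure]
  congr 1; funext seed
  rw [ex_expand]
  simp only [State.start, StateT.run_get, decide_eq_true_eq, ex_pure]
  rfl

/-- Initially no hash point is programmed and `C` is empty, so the guessing terms of the hybrid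
bound vanish at the start. -/
theorem matches_start (w : ℕ) (a b : P.RQ) (seed : BitVec P.seedLen) :
    Matches a b seed (simStart w a b seed)
      { State.start P with expand := Function.update (State.start P).expand seed (some a) } [] := by
  refine ⟨fun k => rfl, fun k => ?_, by simp, fun k h hk => by simp [simStart] at hk⟩
  simp only [simStart, lookup_cons_ite, State.start]
  by_cases hk : k = seed
  · subst hk; simp
  · rw [if_neg hk, Function.update_of_ne hk]; rfl

theorem keyTrial_eq_some {F G : Fin 5 → P.R} {fg : P.R × P.R} (h : P.keyTrial F G = some fg) :
    ∃ i j, fg = (F i, galois (P.bestIndex (F i) (G j)) (G j)) ∧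
      Real.sqrt (P.quality fg.1 fg.2) ≤ P.α * Real.sqrt (2 * (P.a + P.b)) := by
  unfold keyTrial at h
  obtain ⟨t, -, ht⟩ := List.exists_of_findSome?_eq_some h
  simp only at ht
  split_ifs at ht with hq
  cases ht
  exact ⟨t.1, t.2, rfl, hq⟩

theorem goodTrials_nonempty (h : 0 < P.trialProb) : P.goodTrials.Nonempty := by
  rw [Finset.nonempty_iff_ne_empty]
  rintro h'
  simp [trialProb, h'] at h

theorem mem_support_secretKey (h : 0 < P.trialProb) {fg : P.R × P.R} (hfg : fg ∈ P.secretKey.support) :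
    Real.sqrt (P.quality fg.1 fg.2) ≤ P.α * Real.sqrt (2 * (P.a + P.b)) := by
  have hfg' : fg ∈ ((uniformOn P.goodTrials).bind fun t =>
    PMF.pure ((P.keyTrial t.1 t.2).getD (0, 0))).support := hfg
  simp only [PMF.mem_support_bind_iff, PMF.mem_support_pure_iff] at hfg'
  obtain ⟨t, ht, rfl⟩ := hfg'
  rw [uniformOn, dif_pos (goodTrials_nonempty h), PMF.mem_support_uniformOfFinset_iff, goodTrials,
    Finset.mem_filter, Option.isSome_iff_exists] at ht
  obtain ⟨-, fg, hfg⟩ := ht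
  obtain ⟨i, j, -, hq⟩ := keyTrial_eq_some hfg
  rwa [hfg]

/-- The parameters satisfy the assumptions on the widths with respect to `η_ε(ℤⁿ)`. -/
structure Admissible (P : Params) (ε : ℝ) : Prop where
  ε_pos : 0 < ε
  ε_le : ε ≤ 1 / 2
  n_ε_le : Real.sqrt (8 * P.n * ε) ≤ 1 / 2
  r_ge : P.q * smoothing P.n ε ≤ P.r
  s_pos : 0 < P.s
  s_ge : (P.r ^ 2 + smoothing P.n ε ^ 2) * (2 * P.α ^ 2 * (P.a + P.b) + 2) ≤ P.s ^ 2
  trial_pos : 0 < P.trialProb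

variable (P) in
/-- The factor between the laws of honest and ideal signatures. -/
noncomputable def lawRatio (ε : ℝ) : ℝ := Real.exp (6 * ε + 3 * Real.sqrt (8 * P.n * ε))

namespace Admissible
variable {ε : ℝ} (h : Admissible P ε)
include h

theorem η_pos : 0 < smoothing P.n ε := (smoothing_spec h.ε_pos).1

theorem r_pos : 0 < P.r :=
  lt_of_lt_of_le (mul_pos (by exact_mod_cast P.q_pos) h.η_pos) h.r_ge

theorem widthBounds {fg : P.R × P.R} (hfg : fg ∈ P.secretKey.support) :
    WidthBounds ((P.trapdoor fg.1 fg.2).map fun t => (t : ℝ)) P.r P.s (smoothing P.n ε) :=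
  widthBounds_trapdoor h.η_pos h.r_ge h.s_pos h.s_ge (mem_support_secretKey h.trial_pos hfg)

theorem realLaw_le {fg : P.R × P.R} (hfg : fg ∈ P.secretKey.support) (z : Fin 3 × Fin P.n → ℤ) :
    realLaw P.q P.r P.s (P.trapdoor fg.1 fg.2) z ≤
      ENNReal.ofReal (P.lawRatio ε) * discreteGaussian Set.univ (P.s ^ 2 • 1) z := by
  obtain ⟨h1, h2⟩ := smoothing_spec (n := P.n) h.ε_pos
  have h3 := dualTail_smoothing_div_sqrt_two (n := P.n) h.ε_pos h.ε_le
  have hn : (1 : ℝ) ≤ P.n := by exact_mod_cast Nat.one_le_two_pow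
  have hq : (0 : ℝ) < P.q := by exact_mod_cast P.q_pos
  have hη2 : 0 < smoothing P.n ε / Real.sqrt 2 := by positivity
  have hrq : smoothing P.n ε ≤ P.r / P.q := by
    rw [le_div_iff₀ hq, mul_comm]; exact h.r_ge
  have h4 : dualTail (P.r / P.q) ≤ dualTail (smoothing P.n ε) := dualTail_anti h1 hrq
  have h5 := dualTail_nonneg h1
  have h6 := dualTail_nonneg hη2
  have h7 : dualTail (smoothing P.n ε) ≤ P.n * dualTail (smoothing P.n ε) := le_mul_of_one_le_left h5 hn
  have h8 : dualTail (smoothing P.n ε / Real.sqrt 2) ≤ P.n * dualTail (smoothing P.n ε / Real.sqrt 2) :=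
    le_mul_of_one_le_left h6 hn
  refine (Eagle.realLaw_le (h.widthBounds hfg) (by linarith [h.ε_le]) (by linarith [h.n_ε_le]) z).trans ?_
  gcongr
  refine Real.exp_le_exp.2 ?_
  rw [Fintype.card_fin]
  have h9 : (P.n : ℝ) * dualTail (P.r / P.q) ≤ P.n * dualTail (smoothing P.n ε) := by gcongr
  linarith

open Classical in
/-- The success probability of the adversary is bounded in terms of the simulation. -/
theorem forgeExperiment_le (A : Program Oracle) (fuel : ℕ) : P.forgeExperiment A fuel true ≤
      ENNReal.ofReal (P.lawRatio ε) ^ (A.code.length + 1) *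
        ((ex (PMF.uniformOfFintype (BitVec P.seedLen)) fun seed => ex (PMF.uniformOfFintype P.RQ) fun a =>
          ex P.secretKey fun fg => ex (iid (P.entryLaw P.idealLaw) (A.code.length + 1)) fun t =>
            if SimWins A seed a (pubKey a fg) t then 1 else 0) +
          (A.code.length + 1) * ENNReal.ofReal P.restartProb) +
      (A.code.length + 1) * (A.code.length * (2 ^ P.saltLen : ℝ≥0∞)⁻¹ +
        ENNReal.ofReal (P.lawRatio ε) * ENNReal.ofReal P.restartProb +
        ENNReal.ofReal ((60 / P.r) ^ P.n)) := by
  set κ := ENNReal.ofReal (P.lawRatio ε)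
  set N := A.code.length
  have key : ∀ seed a, ∀ fg ∈ P.secretKey.support,
      ex ((exec A.word (P.answer seed (pubKey a fg) fg.1 fg.2 fuel) A.code
          (simStart A.word a (pubKey a fg) seed).mem).run
            { State.start P with expand := Function.update (State.start P).expand seed (some a) })
          (finalProb (pubKey a fg) seed A.out) ≤
      κ ^ (N + 1) * ((ex (iid (P.entryLaw P.idealLaw) (N + 1)) fun t =>
        if SimWins A seed a (pubKey a fg) t then 1 else 0) + (N + 1) * ENNReal.ofReal P.restartProb) +
      (N + 1) * (N * (2 ^ P.saltLen : ℝ≥0∞)⁻¹ + κ * ENNReal.ofReal P.restartProb +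
        ENNReal.ofReal ((60 / P.r) ^ P.n)) := by
    intro seed a fg hfg
    have hlaw := h.realLaw_le hfg
    have h1 := ex_exec_le (fuel := fuel) (w := A.word) (out := A.out) (N := N) h.r_pos
      (show pubKey a fg = _ from rfl)
      (fun u c => ex_preSample_block_le (h.widthBounds hfg) a (pubKey a fg) u c)
      (L := N * (2 ^ P.saltLen : ℝ≥0∞)⁻¹ + κ * ENNReal.ofReal P.restartProb +
        ENNReal.ofReal ((60 / P.r) ^ P.n))
      (by
        refine add_le_add (add_le_add le_rfl ?_) le_rfl
        rw [← ex_ideal_restart]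
        exact ex_honest_le hlaw _)
      A.code (matches_start A.word a (pubKey a fg) seed) (by simp [simStart, N])
    rw [List.map_nil, List.sum_nil, add_zero] at h1
    exact h1.trans (add_le_add (simProb_honest_le hlaw A seed a _) le_rfl)
  rw [forgeExperiment_eq]
  refine (ex_mono _ fun seed => ex_mono _ fun a => ex_mono_support _ (key seed a)).trans (le_of_eq ?_)
  simp only [ex_add, ex_const, ex_mul_left]

end Admissible

end Params

namespace Params
open Matrix
variable {P : Params}

/-! ### From key generation to Ring-LWE samples -/

theorem bestIndex_coprime (f g : P.R) : Nat.Coprime (P.bestIndex f g) P.n := by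
  unfold bestIndex
  cases h : List.argmin (fun k => P.quality f (galois k g))
      ((List.range P.n).filter fun k => Nat.Coprime k P.n) with
  | none => simp
  | some k =>
    have := List.argmin_mem h
    simp only [List.mem_filter, decide_eq_true_eq] at this
    exact this.2

/-- Rotated ternary vectors cover the images of ternary vectors under automorphisms. -/
theorem sum_galois_le (hab : P.a ≤ P.b + 1) (hba : P.b ≤ P.a + 1) {k : ℕ} (hk : Nat.Coprime k P.n)
    (φ : P.R → ℝ≥0∞) : ∑ g ∈ ternary P.n P.a P.b, φ (galois k g) ≤
      ∑ t : Fin P.n × Bool, ∑ h ∈ ternary P.n P.a P.b, φ (ringMul (monomialUnit t) h) := by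
  classical
  have hex : ∀ g : ternary P.n P.a P.b, ∃ x : (Fin P.n × Bool) × P.R,
      x.2 ∈ ternary P.n P.a P.b ∧ galois k g.1 = ringMul (monomialUnit x.1) x.2 := by
    rintro ⟨g, hg⟩
    obtain ⟨h1, h2⟩ := galois_ternary hk hg
    obtain ⟨t, h, hh, he⟩ := exists_monomialUnit_ringMul hab hba h1 h2
    exact ⟨(t, h), hh, he⟩
  choose ξ hξ1 hξ2 using hex
  -- Distinct `g` have distinct images under the automorphism, and the pair of rotation and balanced
  -- vector determines the image. So the left sum is part of the right one.
  have hinj : Function.Injective ξ := by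
    intro g g' hgg
    have : galois k g.1 = galois k g'.1 := by rw [hξ2, hξ2, hgg]
    exact Subtype.ext (galois_injective hk this)
  rw [← Finset.sum_product', ← Finset.sum_coe_sort]
  simp_rw [hξ2]
  rw [← Finset.sum_image (f := fun x : (Fin P.n × Bool) × P.R => φ (ringMul (monomialUnit x.1) x.2))
    (g := ξ) fun _ _ _ _ h => hinj h]
  refine Finset.sum_le_sum_of_subset fun x hx => ?_
  obtain ⟨g, -, rfl⟩ := Finset.mem_image.1 hx
  exact Finset.mem_product.2 ⟨Finset.mem_univ _, hξ1 g⟩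

theorem bestIndex_le (f g : P.R) : P.bestIndex f g ≤ P.n := by
  unfold bestIndex
  cases h : List.argmin (fun k => P.quality f (galois k g))
      ((List.range P.n).filter fun k => Nat.Coprime k P.n) with
  | none => exact Nat.one_le_two_pow
  | some k =>
    have := List.argmin_mem h
    simp only [List.mem_filter, List.mem_range] at this
    exact this.1.le

/-- The best index depends on both polynomials. Summing over all admissible indices removes this
dependence at the price of a factor `n + 1`. -/
theorem sum_bestIndex_le (hab : P.a ≤ P.b + 1) (hba : P.b ≤ P.a + 1) (φ : P.R → ℝ≥0∞) (f : P.R) :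
    ∑ g ∈ ternary P.n P.a P.b, φ (galois (P.bestIndex f g) g) ≤
      (P.n + 1 : ℕ) * ∑ t : Fin P.n × Bool, ∑ h ∈ ternary P.n P.a P.b, φ (ringMul (monomialUnit t) h) := by
  classical
  set K := (Finset.range (P.n + 1)).filter fun k => Nat.Coprime k P.n with hK
  have h1 : ∀ g ∈ ternary P.n P.a P.b, φ (galois (P.bestIndex f g) g) ≤ ∑ k ∈ K, φ (galois k g) := by
    intro g _
    refine Finset.single_le_sum (f := fun k => φ (galois k g)) (fun _ _ => zero_le) ?_
    rw [hK, Finset.mem_filter, Finset.mem_range]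
    exact ⟨Nat.lt_succ_of_le (bestIndex_le f g), bestIndex_coprime f g⟩
  refine (Finset.sum_le_sum h1).trans ?_
  rw [Finset.sum_comm]
  refine (Finset.sum_le_card_nsmul _ _ _ fun k hk => sum_galois_le hab hba (Finset.mem_filter.1 hk).2 φ).trans ?_
  rw [nsmul_eq_mul]
  gcongr
  exact (Finset.card_filter_le _ _).trans_eq (Finset.card_range _)

/-- The eight polynomials that are not selected are summed out. -/
theorem sum_trials (F : P.R → P.R → ℝ≥0∞) (i j : Fin 5) :
    ∑ t ∈ P.trials, F (t.1 i) (t.2 j) = ((ternary P.n P.a P.b).card ^ 8 : ℕ) *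
      ∑ f ∈ ternary P.n P.a P.b, ∑ g ∈ ternary P.n P.a P.b, F f g := by
  rw [trials, Finset.sum_product]
  have h1 : ∀ f : Fin 5 → P.R, ∑ G ∈ Fintype.piFinset fun _ : Fin 5 => ternary P.n P.a P.b, F (f i) (G j) =
      (ternary P.n P.a P.b).card ^ 4 • ∑ g ∈ ternary P.n P.a P.b, F (f i) g := by
    intro f
    have := Fintype.sum_piFinset_apply (fun g => F (f i) g) (ternary P.n P.a P.b) j
    simpa using this
  simp_rw [h1]
  have := Fintype.sum_piFinset_apply (fun f =>
    (ternary P.n P.a P.b).card ^ 4 • ∑ g ∈ ternary P.n P.a P.b, F f g) (ternary P.n P.a P.b) i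
  rw [this]
  simp only [Fintype.card_fin, nsmul_eq_mul, ← Finset.mul_sum]
  push_cast
  ring

/-- A bound for the law of the secret key by independent ternary vectors, one of them rotated. -/
theorem ex_secretKey_le (hab : P.a ≤ P.b + 1) (hba : P.b ≤ P.a + 1) (hpos : 0 < P.trialProb)
    (φ : P.R × P.R → ℝ≥0∞) : ex P.secretKey φ ≤ ENNReal.ofReal (25 * (P.n + 1) / P.trialProb) *
      ∑ t : Fin P.n × Bool, ex P.χ fun f => ex P.χ fun h => φ (f, ringMul (monomialUnit t) h) := by
  classical
  set T := ternary P.n P.a P.b with hT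
  have hgood := goodTrials_nonempty hpos
  have hTne : T.Nonempty := by
    obtain ⟨t, ht⟩ := hgood
    have := (Finset.mem_product.1 (Finset.mem_filter.1 ht).1).1
    exact ⟨t.1 0, Fintype.mem_piFinset.1 this 0⟩
  have hcard : P.trials.card = T.card ^ 10 := by
    rw [trials, Finset.card_product, Fintype.card_piFinset_const, ← pow_add, hT]
  have hTpos : 0 < T.card := Finset.card_pos.2 hTne
  -- Which pair passes the test first is irrelevant for an upper bound: the selected one is among
  -- the 25, so the sum over all pairs dominates. Enlarging the good trials to all trials then costs
  -- the factor `1 / trialProb`.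
  have hkey : ∀ t ∈ P.goodTrials, φ ((P.keyTrial t.1 t.2).getD (0, 0)) ≤
      ∑ i : Fin 5, ∑ j : Fin 5, φ (t.1 i, galois (P.bestIndex (t.1 i) (t.2 j)) (t.2 j)) := by
    intro t ht
    obtain ⟨fg, hfg⟩ := Option.isSome_iff_exists.1 (Finset.mem_filter.1 ht).2
    obtain ⟨i, j, hij, -⟩ := keyTrial_eq_some hfg
    rw [hfg, Option.getD_some, hij]
    exact (Finset.single_le_sum (f := fun j => φ (t.1 i, galois (P.bestIndex (t.1 i) (t.2 j)) (t.2 j)))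
      (fun _ _ => zero_le) (Finset.mem_univ j)).trans
      (Finset.single_le_sum (f := fun i => ∑ j : Fin 5,
        φ (t.1 i, galois (P.bestIndex (t.1 i) (t.2 j)) (t.2 j))) (fun _ _ => zero_le) (Finset.mem_univ i))
  set S := ∑ t : Fin P.n × Bool, ∑ f ∈ T, ∑ h ∈ T, φ (f, ringMul (monomialUnit t) h) with hS
  have hsum : ∑ t ∈ P.goodTrials, φ ((P.keyTrial t.1 t.2).getD (0, 0)) ≤
      25 * (P.n + 1 : ℕ) * (T.card ^ 8 : ℕ) * S := by
    calc _ ≤ ∑ t ∈ P.goodTrials, ∑ i : Fin 5, ∑ j : Fin 5,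
          φ (t.1 i, galois (P.bestIndex (t.1 i) (t.2 j)) (t.2 j)) := Finset.sum_le_sum hkey
      _ ≤ ∑ t ∈ P.trials, ∑ i : Fin 5, ∑ j : Fin 5,
          φ (t.1 i, galois (P.bestIndex (t.1 i) (t.2 j)) (t.2 j)) :=
        Finset.sum_le_sum_of_subset (Finset.filter_subset _ _)
      _ = ∑ i : Fin 5, ∑ j : Fin 5, (T.card ^ 8 : ℕ) *
          ∑ f ∈ T, ∑ g ∈ T, φ (f, galois (P.bestIndex f g) g) := by
        rw [Finset.sum_comm]
        refine Finset.sum_congr rfl fun i _ => ?_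
        rw [Finset.sum_comm]
        exact Finset.sum_congr rfl fun j _ =>
          sum_trials (fun f g => φ (f, galois (P.bestIndex f g) g)) i j
      _ = 25 * ((T.card ^ 8 : ℕ) * ∑ f ∈ T, ∑ g ∈ T, φ (f, galois (P.bestIndex f g) g)) := by
        simp only [Finset.sum_const, Finset.card_univ, Fintype.card_fin, nsmul_eq_mul]
        rw [← mul_assoc]; norm_num
      _ ≤ 25 * ((T.card ^ 8 : ℕ) * ∑ f ∈ T, ((P.n + 1 : ℕ) *
          ∑ t : Fin P.n × Bool, ∑ h ∈ T, φ (f, ringMul (monomialUnit t) h))) := by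
        gcongr with f _
        exact sum_bestIndex_le hab hba (fun g => φ (f, g)) f
      _ = _ := by
        rw [← Finset.mul_sum, Finset.sum_comm, hS]
        ring
  have hex : ex P.secretKey φ = (P.goodTrials.card : ℝ≥0∞)⁻¹ *
      ∑ t ∈ P.goodTrials, φ ((P.keyTrial t.1 t.2).getD (0, 0)) := by
    rw [secretKey, ex_map, ex_uniformOn hgood]
  have hχ : ∀ F : P.R → ℝ≥0∞, ∑ f ∈ T, F f = T.card * ex P.χ F := by
    intro F
    rw [χ, ex_uniformOn hTne, ← mul_assoc, ENNReal.mul_inv_cancel (by exact_mod_cast hTpos.ne')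
      (ENNReal.natCast_ne_top _), one_mul]
  have hS' : S = (T.card ^ 2 : ℕ) * ∑ t : Fin P.n × Bool, ex P.χ fun f => ex P.χ fun h =>
      φ (f, ringMul (monomialUnit t) h) := by
    rw [hS, Finset.mul_sum]
    refine Finset.sum_congr rfl fun t _ => ?_
    simp_rw [hχ, ex_mul_left]
    push_cast
    ring
  rw [hex]
  refine (mul_le_mul_right hsum _).trans (le_of_eq ?_)
  rw [hS', trialProb, hcard]
  have hg : (0 : ℝ) < P.goodTrials.card := by exact_mod_cast Finset.card_pos.2 hgood
  have hc : ENNReal.ofReal (25 * (P.n + 1) / (P.goodTrials.card / (T.card ^ 10 : ℕ))) =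
      (P.goodTrials.card : ℝ≥0∞)⁻¹ * (25 * (P.n + 1 : ℕ) * (T.card ^ 10 : ℕ)) := by
    rw [div_div_eq_mul_div, ENNReal.ofReal_div_of_pos hg, ENNReal.ofReal_natCast, div_eq_mul_inv, mul_comm]
    congr 1
    rw [ENNReal.ofReal_mul (by positivity), ENNReal.ofReal_natCast, ENNReal.ofReal_mul (by norm_num)]
    congr 2
    · simp
    · rw [← Nat.cast_add_one, ENNReal.ofReal_natCast]
  have hc' := hc
  push_cast at hc' ⊢
  rw [hc']
  ring

open Classical in
/-- A function of an honest public key is bounded by functions of rotated Ring-LWE samples. -/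
theorem ex_pubKey_le (hab : P.a ≤ P.b + 1) (hba : P.b ≤ P.a + 1) (hpos : 0 < P.trialProb)
    (ψ : P.RQ → P.RQ → ℝ≥0∞) :
    (ex (PMF.uniformOfFintype P.RQ) fun a => ex P.secretKey fun fg => ψ a (pubKey a fg)) ≤
      ENNReal.ofReal (25 * (P.n + 1) / P.trialProb) *
        ∑ t : Fin P.n × Bool, ex P.χ fun f => ex (PMF.uniformOfFintype P.RQ) fun a => ex P.χ fun h =>
          ψ (ringMul (monomialUnit t) a)
            (gadget P - ringMul (monomialUnit t) (ringMul a (modQ P.Q f) + modQ P.Q h)) := by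
  refine (ex_mono _ fun a => ex_secretKey_le hab hba hpos fun fg => ψ a (pubKey a fg)).trans ?_
  rw [ex_mul_left, ex_finset_sum]
  refine mul_le_mul_right (Finset.sum_le_sum fun t _ => le_of_eq ?_) _
  rw [ex_comm]
  refine congrArg (ex _) (funext fun f => ?_)
  -- With `a` replaced by `υ a` for the unit `υ = ± x ^ t`, which keeps it uniform, `(υ a) f + υ h =
  -- υ (a f + h)`: the unit comes out of a genuine Ring-LWE sample.
  rw [← uniformOfFintype_map_equiv (Equiv.ofBijective _ (monomialUnit_bijective (S := ZMod P.Q) t))]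
  refine congrArg (ex _) (funext fun a => congrArg (ex _) (funext fun h => ?_))
  rw [Equiv.ofBijective_apply, pubKey]
  congr 2
  rw [modQ_ringMul, modQ_monomialUnit, ringMul_add, ringMul_assoc]

end Params

/-! ### Circuits -/

section Circuits
variable {X : Type}

/-- The execution of a program without oracle. -/
noncomputable abbrev plainExec (w : ℕ) (code : List (Instr Empty)) (mem : List ℤ) :
    StateT Unit PMF (List ℤ) :=
  exec w (fun o _ => o.elim) code mem

theorem plainExec_append (w : ℕ) (c₁ c₂ : List (Instr Empty)) (mem : List ℤ) :
    plainExec w (c₁ ++ c₂) mem = plainExec w c₁ mem >>= plainExec w c₂ := by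
  induction c₁ generalizing mem with
  | nil => simp [plainExec, exec]
  | cons i c₁ ih =>
    simp only [plainExec, List.cons_append, exec, bind_assoc] at ih ⊢
    congr 1; funext ans
    exact ih _

/-- With the values `I` in memory, the values `F` can be computed at cost `c` on words of length `w`.
Values are functions of the input. -/
def Gen (w c : ℕ) (I F : Set (X → ℤ)) : Prop :=
  ∀ ws : List (X → ℤ), (∀ f ∈ I, f ∈ ws) → ∃ (ws' : List (X → ℤ)) (code : List (Instr Empty)),
    (∀ f ∈ ws, f ∈ ws') ∧ (∀ f ∈ F, f ∈ ws') ∧ (code.map Instr.cost).sum ≤ c ∧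
      ∀ x, plainExec w code (ws.map (· x)) = pure (ws'.map (· x))

namespace Gen
variable {w c c₁ c₂ : ℕ} {I J F G : Set (X → ℤ)}

theorem of_subset (h : F ⊆ I) : Gen w 0 I F := fun ws hws =>
  ⟨ws, [], fun _ hf => hf, fun f hf => hws f (h hf), by simp, fun x => rfl⟩

theorem mono (h : Gen w c₁ I F) (hI : I ⊆ J) (hF : G ⊆ F) (hc : c₁ ≤ c₂) : Gen w c₂ J G := by
  intro ws hws
  obtain ⟨ws', code, h1, h2, h3, h4⟩ := h ws fun f hf => hws f (hI hf)
  exact ⟨ws', code, h1, fun f hf => h2 f (hF hf), h3.trans hc, h4⟩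

theorem mono_cost (h : Gen w c₁ I F) (hc : c₁ ≤ c₂) : Gen w c₂ I F := h.mono subset_rfl subset_rfl hc

theorem comp (h₁ : Gen w c₁ I F) (h₂ : Gen w c₂ (I ∪ F) G) : Gen w (c₁ + c₂) I (F ∪ G) := by
  intro ws hws
  obtain ⟨ws₁, code₁, a1, a2, a3, a4⟩ := h₁ ws hws
  obtain ⟨ws₂, code₂, b1, b2, b3, b4⟩ := h₂ ws₁ fun f hf => hf.elim (fun h => a1 f (hws f h)) (a2 f)
  refine ⟨ws₂, code₁ ++ code₂, fun f hf => b1 f (a1 f hf), fun f hf => hf.elim (fun h => b1 f (a2 f h)) (b2 f), ?_, ?_⟩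
  · rw [List.map_append, List.sum_append]; omega
  · intro x
    rw [plainExec_append, a4, pure_bind, b4]

theorem trans (h₁ : Gen w c₁ I F) (h₂ : Gen w c₂ (I ∪ F) G) : Gen w (c₁ + c₂) I G :=
  (h₁.comp h₂).mono subset_rfl Set.subset_union_right le_rfl

theorem union (h₁ : Gen w c₁ I F) (h₂ : Gen w c₂ I G) : Gen w (c₁ + c₂) I (F ∪ G) :=
  h₁.comp (h₂.mono Set.subset_union_left subset_rfl le_rfl)

theorem finset_biUnion {ι : Type} (s : Finset ι) {f : ι → Set (X → ℤ)} (h : ∀ i ∈ s, Gen w c I (f i)) :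
    Gen w (s.card * c) I (⋃ i ∈ s, f i) := by
  classical
  induction s using Finset.induction_on with
  | empty => simpa using of_subset (Set.empty_subset I)
  | insert i s hi ih =>
    rw [Finset.card_insert_of_notMem hi, Finset.set_biUnion_insert, Nat.succ_mul, add_comm]
    exact (h i (Finset.mem_insert_self _ _)).union (ih fun j hj => h j (Finset.mem_insert_of_mem hj))

theorem range {ι : Type} [Fintype ι] {f : ι → X → ℤ} (h : ∀ i, Gen w c I {f i}) :
    Gen w (Fintype.card ι * c) I (Set.range f) := by
  refine (finset_biUnion Finset.univ fun i _ => h i).mono subset_rfl ?_ (by simp)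
  rintro _ ⟨i, rfl⟩
  simp


end Gen

theorem exists_getD {ws : List (X → ℤ)} {f : X → ℤ} (h : f ∈ ws) :
    ∃ i, ∀ x, (ws.map (· x)).getD i 0 = f x := by
  obtain ⟨i, hi, rfl⟩ := List.getElem_of_mem h
  exact ⟨i, fun x => by simp [List.getD_eq_getElem?_getD, hi]⟩

theorem fit_of_lt {w : ℕ} {v : ℤ} (h : |v| < 2 ^ w) : fit w v = v := if_pos h

namespace Gen
variable {w c c₁ c₂ : ℕ} {I J F G : Set (X → ℤ)} {f g : X → ℤ}

/-- The size bound on `f` ensures that `fit` does not replace the new word by zero. -/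
theorem of_instr (hf : ∀ x, |f x| < 2 ^ w) (h : ∀ ws : List (X → ℤ), (∀ f ∈ I, f ∈ ws) →
    ∃ i : Instr Empty, i.cost = 1 ∧
      ∀ x, i.eval (σ := Unit) (fun o _ => o.elim) (ws.map (· x)) = pure [f x]) : Gen w 1 I {f} := by
  intro ws hws
  obtain ⟨i, hi, hx⟩ := h ws hws
  refine ⟨ws ++ [f], [i], fun f hf => List.mem_append_left _ hf, ?_, by simp [hi], fun x => ?_⟩
  · rintro _ rfl; simp
  · simp [plainExec, exec, hx, fit_of_lt (hf x)]

theorem const (v : ℤ) (hv : |v| < 2 ^ w) : Gen w 1 I {fun _ => v} :=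
  of_instr (fun _ => hv) fun _ _ => ⟨.const v, rfl, fun _ => rfl⟩

theorem binary {op : ℤ → ℤ → ℤ} (i : ℕ → ℕ → Instr Empty) (hi : ∀ a b, (i a b).cost = 1)
    (heval : ∀ a b mem, (i a b).eval (σ := Unit) (fun o _ => o.elim) mem =
      pure [op (mem.getD a 0) (mem.getD b 0)])
    (h₁ : Gen w c₁ I {f}) (h₂ : Gen w c₂ I {g}) (hfg : ∀ x, |op (f x) (g x)| < 2 ^ w) :
    Gen w (c₁ + c₂ + 1) I {fun x => op (f x) (g x)} := by
  refine (h₁.union h₂).trans (of_instr hfg fun ws hws => ?_)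
  obtain ⟨a, ha⟩ := exists_getD (hws f (Or.inr (Or.inl rfl)))
  obtain ⟨b, hb⟩ := exists_getD (hws g (Or.inr (Or.inr rfl)))
  exact ⟨i a b, hi a b, fun x => by rw [heval, ha, hb]⟩

theorem add (h₁ : Gen w c₁ I {f}) (h₂ : Gen w c₂ I {g}) (h : ∀ x, |f x + g x| < 2 ^ w) :
    Gen w (c₁ + c₂ + 1) I {fun x => f x + g x} :=
  binary .plus (fun _ _ => rfl) (fun _ _ _ => rfl) h₁ h₂ h

theorem sub (h₁ : Gen w c₁ I {f}) (h₂ : Gen w c₂ I {g}) (h : ∀ x, |f x - g x| < 2 ^ w) :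
    Gen w (c₁ + c₂ + 1) I {fun x => f x - g x} :=
  binary .minus (fun _ _ => rfl) (fun _ _ _ => rfl) h₁ h₂ h

theorem mul (h₁ : Gen w c₁ I {f}) (h₂ : Gen w c₂ I {g}) (h : ∀ x, |f x * g x| < 2 ^ w) :
    Gen w (c₁ + c₂ + 1) I {fun x => f x * g x} :=
  binary .times (fun _ _ => rfl) (fun _ _ _ => rfl) h₁ h₂ h

theorem div (h₁ : Gen w c₁ I {f}) (h₂ : Gen w c₂ I {g}) (h : ∀ x, |f x / g x| < 2 ^ w) :
    Gen w (c₁ + c₂ + 1) I {fun x => f x / g x} :=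
  binary .quot (fun _ _ => rfl) (fun _ _ _ => rfl) h₁ h₂ h

theorem mod (h₁ : Gen w c₁ I {f}) (h₂ : Gen w c₂ I {g}) (h : ∀ x, |f x % g x| < 2 ^ w) :
    Gen w (c₁ + c₂ + 1) I {fun x => f x % g x} :=
  binary .rem (fun _ _ => rfl) (fun _ _ _ => rfl) h₁ h₂ h

theorem less (h₁ : Gen w c₁ I {f}) (h₂ : Gen w c₂ I {g}) (hw : 1 < 2 ^ w) :
    Gen w (c₁ + c₂ + 1) I {fun x => if f x < g x then 1 else 0} :=
  binary (op := fun a b => if a < b then 1 else 0) .less (fun _ _ => rfl) (fun _ _ _ => rfl) h₁ h₂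
    fun x => by
      have : (1 : ℤ) < 2 ^ w := by exact_mod_cast hw
      split_ifs
      · simpa using this
      · simp

end Gen

/-- A circuit is a program. -/
theorem exists_program {w c : ℕ} (ins outs : List (X → ℤ)) (hins : ∀ f ∈ ins, ∀ x, |f x| < 2 ^ w)
    (h : Gen w c {f | f ∈ ins} {f | f ∈ outs}) : ∃ S : Program Empty, S.size ≤ w + c + outs.length ∧
      ∀ x, S.runPlain (ins.map (· x)) = pure (outs.map (· x)) := by
  obtain ⟨ws', code, -, h2, h3, h4⟩ := h ins fun f hf => hf
  choose! idx hidx using fun f (hf : f ∈ outs) => exists_getD (h2 f hf)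
  refine ⟨⟨w, code, outs.map idx⟩, ?_, fun x => ?_⟩
  · simp only [Program.size, List.length_map]; omega
  · have hfit : (ins.map (· x)).map (fit w) = ins.map (· x) := by
      rw [List.map_map]
      exact List.map_congr_left fun f hf => fit_of_lt (hins f hf x)
    have hout : (outs.map idx).map (fun i => (ws'.map (· x)).getD i 0) = outs.map (· x) := by
      rw [List.map_map]
      exact List.map_congr_left fun f hf => hidx f hf x
    have h5 := h4 x
    simp only [plainExec] at h5
    simp only [Program.runPlain, Program.run, hfit, h5, pure_bind, StateT.run_pure, hout]

/-! ### Circuits with bounded values -/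

/-- The word length leaves room for the powers of a base `K` that occur. -/
structure Room (w : ℕ) (K : ℤ) : Prop where
  two_le : 2 ≤ K
  lt : K ^ 60 < 2 ^ w

/-- The value `f`, of size at most `K ^ e`, can be computed at cost `c`. -/
def Comp (w : ℕ) (K : ℤ) (c : ℕ) (I : Set (X → ℤ)) (e : ℕ) (f : X → ℤ) : Prop :=
  Gen w c I {f} ∧ ∀ x, |f x| ≤ K ^ e

namespace Room
variable {w : ℕ} {K : ℤ} (h : Room w K)
include h

theorem one_le : 1 ≤ K := by linarith [h.two_le]

theorem pow_le {e e' : ℕ} (he : e ≤ e') : K ^ e ≤ K ^ e' := pow_le_pow_right₀ h.one_le he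

theorem lt_of_le {e : ℕ} (he : e ≤ 60) {v : ℤ} (hv : |v| ≤ K ^ e) : |v| < 2 ^ w :=
  (hv.trans (h.pow_le he)).trans_lt h.lt

theorem one_lt : 1 < 2 ^ w := by
  have h1 : (1 : ℤ) < 2 ^ w := (one_le_pow₀ h.one_le).trans_lt h.lt
  exact_mod_cast h1

theorem double (e : ℕ) : K ^ e + K ^ e ≤ K ^ (e + 1) := by
  rw [pow_succ]; nlinarith [h.two_le, pow_pos (show 0 < K by linarith [h.two_le]) e]

end Room

namespace Comp
variable {w : ℕ} {K : ℤ} {c c₁ c₂ e e₁ e₂ : ℕ} {I J : Set (X → ℤ)} {f g : X → ℤ}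

theorem mono (h : Comp w K c₁ I e f) (hI : I ⊆ J) (hc : c₁ ≤ c₂) : Comp w K c₂ J e f :=
  ⟨h.1.mono hI subset_rfl hc, h.2⟩

theorem mono_exp (hR : Room w K) (h : Comp w K c I e₁ f) (he : e₁ ≤ e₂) : Comp w K c I e₂ f :=
  ⟨h.1, fun x => (h.2 x).trans (hR.pow_le he)⟩

theorem of_mem (hf : f ∈ I) (hb : ∀ x, |f x| ≤ K ^ e) : Comp w K 0 I e f :=
  ⟨Gen.of_subset (Set.singleton_subset_iff.2 hf), hb⟩

theorem const (hR : Room w K) {v : ℤ} (hv : |v| ≤ K ^ e) (he : e ≤ 60) : Comp w K 1 I e fun _ => v :=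
  ⟨Gen.const v (hR.lt_of_le he hv), fun _ => hv⟩

theorem bit {v : ℤ} (hv : v = 0 ∨ v = 1) : |v| ≤ K ^ 0 := by rcases hv with rfl | rfl <;> simp

theorem add (hR : Room w K) (h₁ : Comp w K c₁ I e f) (h₂ : Comp w K c₂ I e g) (he : e < 60) :
    Comp w K (c₁ + c₂ + 1) I (e + 1) fun x => f x + g x := by
  have hb : ∀ x, |f x + g x| ≤ K ^ (e + 1) := fun x =>
    ((abs_add_le _ _).trans (add_le_add (h₁.2 x) (h₂.2 x))).trans (hR.double e)
  exact ⟨h₁.1.add h₂.1 fun x => hR.lt_of_le he (hb x), hb⟩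

theorem sub (hR : Room w K) (h₁ : Comp w K c₁ I e f) (h₂ : Comp w K c₂ I e g) (he : e < 60) :
    Comp w K (c₁ + c₂ + 1) I (e + 1) fun x => f x - g x := by
  have hb : ∀ x, |f x - g x| ≤ K ^ (e + 1) := fun x =>
    ((abs_sub _ _).trans (add_le_add (h₁.2 x) (h₂.2 x))).trans (hR.double e)
  exact ⟨h₁.1.sub h₂.1 fun x => hR.lt_of_le he (hb x), hb⟩

theorem mul (hR : Room w K) (h₁ : Comp w K c₁ I e₁ f) (h₂ : Comp w K c₂ I e₂ g) (he : e₁ + e₂ ≤ 60) :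
    Comp w K (c₁ + c₂ + 1) I (e₁ + e₂) fun x => f x * g x := by
  have hb : ∀ x, |f x * g x| ≤ K ^ (e₁ + e₂) := fun x => by
    rw [abs_mul, pow_add]
    exact mul_le_mul (h₁.2 x) (h₂.2 x) (abs_nonneg _) ((abs_nonneg _).trans (h₁.2 x))
  exact ⟨h₁.1.mul h₂.1 fun x => hR.lt_of_le he (hb x), hb⟩

theorem div (hR : Room w K) (h₁ : Comp w K c₁ I e f) (h₂ : Comp w K c₂ I e₂ g) (he : e ≤ 60) :
    Comp w K (c₁ + c₂ + 1) I e fun x => f x / g x := by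
  have hb : ∀ x, |f x / g x| ≤ K ^ e := fun x => (Int.abs_ediv_le_abs _ _).trans (h₁.2 x)
  exact ⟨h₁.1.div h₂.1 fun x => hR.lt_of_le he (hb x), hb⟩

theorem mod (hR : Room w K) (h₁ : Comp w K c₁ I e f) (h₂ : Comp w K c₂ I e g) (he : e ≤ 60) :
    Comp w K (c₁ + c₂ + 1) I e fun x => f x % g x := by
  have hb : ∀ x, |f x % g x| ≤ K ^ e := fun x => by
    by_cases hg : g x = 0
    · rw [hg, Int.emod_zero]; exact h₁.2 x
    · rw [abs_of_nonneg (Int.emod_nonneg _ hg)]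
      exact (Int.emod_lt_abs _ hg).le.trans (h₂.2 x)
  exact ⟨h₁.1.mod h₂.1 fun x => hR.lt_of_le he (hb x), hb⟩

theorem less (hR : Room w K) (h₁ : Comp w K c₁ I e₁ f) (h₂ : Comp w K c₂ I e₂ g) :
    Comp w K (c₁ + c₂ + 1) I 0 fun x => if f x < g x then 1 else 0 :=
  ⟨h₁.1.less h₂.1 hR.one_lt, fun x => bit (by dsimp only; split_ifs <;> simp)⟩

theorem congr (h : Comp w K c I e f) (hfg : ∀ x, f x = g x) : Comp w K c I e g := by rwa [← funext hfg]

/-- The test for zero. -/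
theorem isZero (hR : Room w K) (h : Comp w K c I e f) :
    Comp w K (2 * c + 5) I 0 fun x => if f x = 0 then 1 else 0 := by
  have h1 := (h.less hR (const hR (v := 1) (e := 0) (by simp) (by norm_num)))
  have h2 := (h.less hR (const hR (v := 0) (e := 0) (by simp) (by norm_num)))
  have h3 := (h1.sub hR h2 (by norm_num)).congr (g := fun x => if f x = 0 then 1 else 0) fun x => by
    split_ifs <;> omega
  exact ⟨h3.1.mono_cost (by omega), fun x => bit (by dsimp only; split_ifs <;> simp)⟩

/-- Selection by a bit. -/
theorem select (hR : Room w K) {p : X → Prop} [∀ x, Decidable (p x)]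
    (h : Comp w K c I 0 fun x => if p x then 1 else 0) (h₁ : Comp w K c₁ I e f) (h₂ : Comp w K c₂ I e g)
    (he : e ≤ 60) : Comp w K (2 * c + c₁ + c₂ + 5) I e fun x => if p x then f x else g x := by
  have h3 := ((const hR (v := 1) (e := 0) (by simp) (by norm_num)).sub hR h (by norm_num)).congr
    (g := fun x => if p x then 0 else 1) fun x => by split_ifs <;> simp
  have h4 : Comp w K _ I 0 fun x => if p x then 0 else 1 :=
    ⟨h3.1, fun x => bit (by dsimp only; split_ifs <;> simp)⟩
  have h5 : ∀ x, |if p x then f x else g x| ≤ K ^ e := fun x => by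
    split_ifs
    · exact h₁.2 x
    · exact h₂.2 x
  -- The value is `p f + (1 - p) g`. One summand always vanishes, so the bound `K ^ e` is kept and
  -- long chains of selections do not enlarge the words.
  have h6 := (h.mul hR h₁ (by omega)).1.add (h4.mul hR h₂ (by omega)).1
    (f := fun x => (if p x then 1 else 0) * f x) (g := fun x => (if p x then 0 else 1) * g x) fun x => by
      refine hR.lt_of_le he ?_
      have := h5 x
      split_ifs at this ⊢ <;> simpa using this
  have h7 : (fun x => (if p x then 1 else 0) * f x + (if p x then 0 else 1) * g x) =
      fun x => if p x then f x else g x := by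
    funext x; split_ifs <;> ring
  rw [h7] at h6
  exact ⟨h6.mono_cost (by omega), h5⟩

/-- Sums. -/
theorem sum (hR : Room w K) {ι : Type} (s : Finset ι) {f : ι → X → ℤ} (h : ∀ i ∈ s, Comp w K c I e (f i))
    (hs : (s.card : ℤ) ≤ K) (he : e < 60) :
    Comp w K (s.card * (c + 1) + 1) I (e + 1) fun x => ∑ i ∈ s, f i x := by
  classical
  -- At most `K` summands raise the exponent by one. All partial sums are bounded, because they
  -- occur as intermediate words.
  have hbound : ∀ t ⊆ s, ∀ x, |∑ i ∈ t, f i x| ≤ K ^ (e + 1) := by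
    intro t ht x
    calc |∑ i ∈ t, f i x| ≤ ∑ i ∈ t, |f i x| := Finset.abs_sum_le_sum_abs _ _
      _ ≤ ∑ i ∈ t, K ^ e := Finset.sum_le_sum fun i hi => (h i (ht hi)).2 x
      _ = t.card * K ^ e := by rw [Finset.sum_const, nsmul_eq_mul]
      _ ≤ K * K ^ e := by
        have : (t.card : ℤ) ≤ K := le_trans (by exact_mod_cast Finset.card_le_card ht) hs
        have := pow_pos (show 0 < K by linarith [hR.two_le]) e
        gcongr
      _ = K ^ (e + 1) := by ring
  refine ⟨?_, hbound s subset_rfl⟩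
  have key : ∀ t ⊆ s, Gen w (t.card * (c + 1) + 1) I {fun x => ∑ i ∈ t, f i x} := by
    intro t
    induction t using Finset.induction_on with
    | empty => intro _; simpa using Gen.const 0 (by simp)
    | insert i t hi ih =>
      intro ht
      have h1 := (h i (ht (Finset.mem_insert_self _ _))).1.add
        (ih fun j hj => ht (Finset.mem_insert_of_mem hj)) fun x => hR.lt_of_le he (by
          have := hbound _ ht x
          rwa [Finset.sum_insert hi] at this)
      simp only [Finset.sum_insert hi, Finset.card_insert_of_notMem hi]
      exact h1.mono_cost (by ring_nf; omega)
  exact key s subset_rfl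

end Comp

end Circuits

/-! ### Circuits for ring arithmetic -/

section RingPow
variable {S : Type} [CommRing S] {n : ℕ} [NeZero n]

/-- Powers in `S[x] / (xⁿ + 1)`. -/
def ringPow (u : Fin n → S) : ℕ → Fin n → S
  | 0 => Pi.single 0 1
  | k + 1 => ringMul u (ringPow u k)

theorem ringPow_add (u : Fin n → S) (k l : ℕ) :
    ringPow u (k + l) = ringMul (ringPow u k) (ringPow u l) := by
  induction k with
  | zero => rw [Nat.zero_add, ringPow, one_ringMul]
  | succ k ih => rw [Nat.succ_add, ringPow, ih, ringPow, ringMul_assoc]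

end RingPow

section RingCircuits
variable {X : Type} {w : ℕ} {K : ℤ} {n Q : ℕ} [NeZero Q] {c c₁ c₂ e : ℕ} {I J : Set (X → ℤ)}

theorem Comp.residue (hR : Room w K) (hQ : (Q : ℤ) ≤ K) {f : X → ℤ} (h : Comp w K c I e f)
    {v : X → ZMod Q} (hv : ∀ x, (f x : ZMod Q) = v x) (he : 1 ≤ e) (he' : e ≤ 60) :
    Comp w K (c + 2) I 1 fun x => ((v x).val : ℤ) := by
  have hQ0 : (0 : ℤ) ≤ Q := Int.natCast_nonneg Q
  have hQc : Comp w K 1 I e fun _ => (Q : ℤ) :=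
    (Comp.const hR (e := 1) (by rwa [abs_of_nonneg hQ0, pow_one]) (by norm_num)).mono_exp hR he
  have h1 := (h.mod hR hQc he').congr (g := fun x => ((v x).val : ℤ)) fun x => by
    rw [← hv, ZMod.val_intCast]
  refine ⟨h1.1.mono_cost (by omega), fun x => ?_⟩
  rw [abs_of_nonneg (Int.natCast_nonneg _), pow_one]
  exact le_trans (by exact_mod_cast (ZMod.val_lt (v x)).le) hQ

/-- The coefficients of a ring element modulo `Q`. -/
def ringWires (u : X → Fin n → ZMod Q) : Set (X → ℤ) := Set.range fun i x => ((u x i).val : ℤ)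

/-- The ring element `u` can be computed at cost `c`. -/
def RComp (w c : ℕ) (I : Set (X → ℤ)) (u : X → Fin n → ZMod Q) : Prop := Gen w c I (ringWires u)

namespace RComp
variable {u v : X → Fin n → ZMod Q}

theorem mono (h : RComp w c₁ I u) (hI : I ⊆ J) (hc : c₁ ≤ c₂) : RComp w c₂ J u :=
  Gen.mono h hI subset_rfl hc

theorem of_subset (h : ringWires u ⊆ I) : RComp w 0 I u := Gen.of_subset h

theorem coord (hQ : (Q : ℤ) ≤ K) (h : RComp w c I u) (i : Fin n) :
    Comp w K c I 1 fun x => ((u x i).val : ℤ) := by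
  refine ⟨Gen.mono h subset_rfl (Set.singleton_subset_iff.2 ⟨i, rfl⟩) le_rfl, fun x => ?_⟩
  rw [abs_of_nonneg (Int.natCast_nonneg _), pow_one]
  exact le_trans (by exact_mod_cast (ZMod.val_lt (u x i)).le) hQ

theorem of_coords (h : ∀ i, Comp w K c I e fun x => ((u x i).val : ℤ)) : RComp w (n * c) I u := by
  have := Gen.range fun i => (h i).1
  rwa [Fintype.card_fin] at this

theorem const (hR : Room w K) (hQ : (Q : ℤ) ≤ K) (u : Fin n → ZMod Q) : RComp w n I fun _ : X => u := by
  have h : ∀ i, Comp w K 1 I 1 fun _ : X => ((u i).val : ℤ) := fun i =>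
    Comp.const hR (by
      rw [abs_of_nonneg (Int.natCast_nonneg _), pow_one]
      exact le_trans (by exact_mod_cast (ZMod.val_lt (u i)).le) hQ) (by norm_num)
  exact (of_coords h).mono subset_rfl (by omega)

theorem reduce (hR : Room w K) (hQ : (Q : ℤ) ≤ K) {f : X → Fin n → ℤ}
    (h : ∀ i, Comp w K c I e fun x => f x i) (he : 1 ≤ e) (he' : e ≤ 60) :
    RComp w (n * (c + 2)) I fun x => modQ Q (f x) :=
  of_coords fun i => (h i).residue hR hQ (fun _ => rfl) he he'

variable (hR : Room w K) (hQ : (Q : ℤ) ≤ K)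
include hR hQ

theorem add (h₁ : RComp w c₁ I u) (h₂ : RComp w c₂ I v) :
    RComp w (c₁ + c₂ + n * 3) I fun x => u x + v x := by
  refine Gen.trans (h₁.union h₂) (of_coords (K := K) (e := 1) fun i => ?_)
  have a1 := coord hQ (of_subset (w := w) (I := I ∪ (ringWires u ∪ ringWires v)) (u := u)
    (Set.subset_union_left.trans Set.subset_union_right)) i
  have a2 := coord hQ (of_subset (w := w) (I := I ∪ (ringWires u ∪ ringWires v)) (u := v)
    (Set.subset_union_right.trans Set.subset_union_right)) i
  exact (a1.add hR a2 (by norm_num)).residue hR hQ (fun x => by simp) (by norm_num) (by norm_num)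

theorem sub (h₁ : RComp w c₁ I u) (h₂ : RComp w c₂ I v) :
    RComp w (c₁ + c₂ + n * 3) I fun x => u x - v x := by
  refine Gen.trans (h₁.union h₂) (of_coords (K := K) (e := 1) fun i => ?_)
  have a1 := coord hQ (of_subset (w := w) (I := I ∪ (ringWires u ∪ ringWires v)) (u := u)
    (Set.subset_union_left.trans Set.subset_union_right)) i
  have a2 := coord hQ (of_subset (w := w) (I := I ∪ (ringWires u ∪ ringWires v)) (u := v)
    (Set.subset_union_right.trans Set.subset_union_right)) i
  exact (a1.sub hR a2 (by norm_num)).residue hR hQ (fun x => by simp) (by norm_num) (by norm_num)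

theorem mul (hn : (n : ℤ) ≤ K) (h₁ : RComp w c₁ I u) (h₂ : RComp w c₂ I v) :
    RComp w (c₁ + c₂ + n * (n * 4 + 3)) I fun x => ringMul (u x) (v x) := by
  refine Gen.trans (h₁.union h₂) (of_coords (K := K) (e := 1) fun i => ?_)
  have a1 := coord hQ (of_subset (w := w) (I := I ∪ (ringWires u ∪ ringWires v)) (u := u)
    (Set.subset_union_left.trans Set.subset_union_right))
  have a2 := coord hQ (of_subset (w := w) (I := I ∪ (ringWires u ∪ ringWires v)) (u := v)
    (Set.subset_union_right.trans Set.subset_union_right))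
  have hterm : ∀ j ∈ (Finset.univ : Finset (Fin n)),
      Comp w K 3 (I ∪ (ringWires u ∪ ringWires v)) 2 fun x =>
        (if j ≤ i then 1 else -1) * (((u x (i - j)).val : ℤ) * ((v x j).val : ℤ)) := by
    intro j _
    have := (Comp.const (X := X) (I := I ∪ (ringWires u ∪ ringWires v)) hR
      (v := if j ≤ i then 1 else -1) (e := 0) (by split_ifs <;> simp)
      (by norm_num)).mul hR ((a1 (i - j)).mul hR (a2 j) (by norm_num)) (by norm_num)
    simpa using this
  have hsum := Comp.sum hR Finset.univ hterm (by simpa using hn) (by norm_num)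
  refine (hsum.residue hR hQ (v := fun x => ringMul (u x) (v x) i) (fun x => ?_) (by norm_num)
    (by norm_num)).mono subset_rfl (by simp)
  push_cast
  simp only [ringMul, Matrix.mulVec, dotProduct, anticirculant, Matrix.of_apply]
  refine Finset.sum_congr rfl fun j _ => ?_
  split_ifs <;> simp

/-- Square and multiply: one round for each binary digit of the exponent, with at most two products
per round. -/
theorem pow [NeZero n] (hn : (n : ℤ) ≤ K) (h : ringWires u ⊆ I) (k : ℕ) :
    RComp w (n + k.size * (2 * (n * (n * 4 + 3)))) I fun x => ringPow (u x) k := by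
  induction k using Nat.binaryRec' with
  | zero => exact (const hR hQ (Pi.single 0 1)).mono subset_rfl (by omega)
  | bit b k hb ih =>
    have hne : Nat.bit b k ≠ 0 := by
      cases b
      · intro h'
        have hk : k = 0 := by simpa [Nat.bit] using h'
        simp [hk] at hb
      · simp [Nat.bit]
    have h1 : RComp w 0 (I ∪ ringWires fun x => ringPow (u x) k) fun x => ringPow (u x) k :=
      of_subset Set.subset_union_right
    have h2 : RComp w 0 (I ∪ ringWires fun x => ringPow (u x) k) u :=
      of_subset (h.trans Set.subset_union_left)
    have hsq := mul hR hQ hn h1 h1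
    rw [Nat.size_bit hne, Nat.succ_mul, ← add_assoc]
    refine Gen.trans ih ?_
    cases b with
    | false =>
      have : (fun x => ringPow (u x) (Nat.bit false k)) = fun x => ringMul (ringPow (u x) k) (ringPow (u x) k) := by
        funext x
        rw [← ringPow_add]
        congr 1
        simp [Nat.bit, two_mul]
      show RComp w _ _ _
      rw [this]
      exact hsq.mono subset_rfl (by omega)
    | true =>
      have : (fun x => ringPow (u x) (Nat.bit true k)) =
          fun x => ringMul (u x) (ringMul (ringPow (u x) k) (ringPow (u x) k)) := by
        funext x
        rw [← ringPow_add, ← ringPow]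
        congr 1
        simp [Nat.bit, two_mul]
      show RComp w _ _ _
      rw [this]
      exact (mul hR hQ hn h2 hsq).mono subset_rfl (by omega)

/-- The centered representative. -/
theorem centered (h : RComp w c I u) (i : Fin n) :
    Comp w K (4 * c + 11) I 1 fun x => centered (u x) i := by
  have h1 := coord hQ h i
  have hQ0 : (0 : ℤ) ≤ Q := Int.natCast_nonneg Q
  have hQ1 : |(Q : ℤ)| ≤ K ^ 1 := by rwa [abs_of_nonneg hQ0, pow_one]
  have hhalf : |((Q : ℤ) + 1) / 2| ≤ K ^ 1 := by
    rw [abs_of_nonneg (by omega), pow_one]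
    have : 0 < Q := Nat.pos_of_ne_zero (NeZero.ne Q)
    omega
  have hlt := h1.less hR (Comp.const hR hhalf (by norm_num))
  have h2 := Comp.select hR hlt (h1.mono_exp hR (e₂ := 2) (by norm_num))
    (h1.sub hR (Comp.const hR hQ1 (by norm_num)) (by norm_num)) (by norm_num)
  have h3 : ∀ x, (if ((u x i).val : ℤ) < ((Q : ℤ) + 1) / 2 then ((u x i).val : ℤ) else (u x i).val - Q) =
      Eagle.centered (u x) i := by
    intro x
    have hv : ((u x i).val : ℤ) % Q = (u x i).val :=
      Int.emod_eq_of_lt (Int.natCast_nonneg _) (by exact_mod_cast ZMod.val_lt (u x i))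
    simp only [Eagle.centered, Int.bmod, hv]
  refine ⟨(h2.congr h3).1.mono_cost (by omega), fun x => ?_⟩
  have hb := bmod_bounds ((u x i).val : ℤ) (Nat.pos_of_ne_zero (NeZero.ne Q))
  simp only [Eagle.centered]
  rw [pow_one, abs_le]
  constructor <;> omega

end RComp

end RingCircuits

/-! ### Bit strings as words -/

/-- The words of length `w` that code the bit string `s` form the residue class of `κ`. -/
def IsRep (w : ℕ) {L : ℕ} (s : BitVec L) (κ : ℤ) : Prop :=
  ∀ v : ℤ, |v| < 2 ^ w → (BitVec.ofInt L v = s ↔ (2 ^ min L (w + 1) : ℤ) ∣ v - κ)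

theorem ofInt_eq_ofInt_iff (L : ℕ) (v v' : ℤ) :
    BitVec.ofInt L v = BitVec.ofInt L v' ↔ (2 ^ L : ℤ) ∣ v - v' := by
  rw [← BitVec.toNat_inj, BitVec.toNat_ofInt, BitVec.toNat_ofInt]
  have h2 : (0 : ℤ) < 2 ^ L := by positivity
  have hc : ((2 ^ L : ℕ) : ℤ) = 2 ^ L := by push_cast; rfl
  rw [hc]
  have e1 := Int.emod_nonneg v h2.ne'
  have e2 := Int.emod_nonneg v' h2.ne'
  rw [← Int.ofNat_inj, Int.toNat_of_nonneg e1, Int.toNat_of_nonneg e2, Int.emod_eq_emod_iff_emod_sub_eq_zero]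
  exact ⟨Int.dvd_of_emod_eq_zero, Int.emod_eq_zero_of_dvd⟩

/-- Bit strings may be longer than words. Two words differ by less than `2 ^ (w + 1)`, so a larger
power of two divides the difference only if it is zero, and the modulus can be capped. -/
theorem isRep_ofInt {w : ℕ} (L : ℕ) {v' : ℤ} (hv' : |v'| < 2 ^ w) : IsRep w (BitVec.ofInt L v') v' := by
  intro v hv
  rw [ofInt_eq_ofInt_iff]
  rcases le_total L (w + 1) with h | h
  · rw [min_eq_left h]
  · rw [min_eq_right h]
    have hsmall : |v - v'| < 2 ^ (w + 1) := by
      rw [pow_succ]; linarith [abs_sub v v']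
    constructor
    · intro hd
      exact (pow_dvd_pow 2 h).trans hd
    · intro hd
      rw [Int.eq_zero_of_abs_lt_dvd hd hsmall]
      exact dvd_zero _

/-- A word that represents a bit string; `2 ^ w` for bit strings that no word codes. -/
def wordRep (w : ℕ) {L : ℕ} (s : BitVec L) : ℤ := if |s.toInt| < 2 ^ w then s.toInt else 2 ^ w

theorem abs_wordRep_le (w : ℕ) {L : ℕ} (s : BitVec L) : |wordRep w s| ≤ 2 ^ w := by
  unfold wordRep
  split_ifs with h
  · exact h.le
  · simp

/-- If no word codes the string, then `L ≥ w + 1`, and every word minus `2 ^ w` lies strictly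
between `-2 ^ (w + 1)` and `0`. So the divisibility test against `2 ^ w` always fails, as it should.
-/
theorem isRep_wordRep (w : ℕ) {L : ℕ} (s : BitVec L) : IsRep w s (wordRep w s) := by
  unfold wordRep
  split_ifs with h
  · have := isRep_ofInt L h
    rwa [BitVec.ofInt_toInt] at this
  · intro v hv
    obtain ⟨v1, v2⟩ := abs_lt.1 hv
    have hpos : (0 : ℤ) < 2 ^ w := by positivity
    rcases lt_or_ge L (w + 1) with hL | hL
    · exfalso
      apply h
      rcases L with _ | L
      · have : s = 0#0 := Subsingleton.elim _ _
        subst this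
        simp
      · have h1 := BitVec.two_mul_toInt_lt (x := s)
        have h2 := BitVec.le_two_mul_toInt (x := s)
        have h3 : (2 : ℤ) ^ (L + 1) ≤ 2 ^ w := pow_le_pow_right₀ (by norm_num) (by omega)
        rw [abs_lt]
        constructor <;> omega
    · rw [min_eq_right hL]
      constructor
      · rintro rfl
        rcases hL.lt_or_eq with hL' | hL'
        · exfalso
          apply h
          have hL2 : (2 : ℤ) ^ (w + 1) ≤ 2 ^ (L - 1) := pow_le_pow_right₀ (by norm_num) (by omega)
          rw [pow_succ] at hL2
          have hLL : (2 : ℤ) ^ L = 2 ^ (L - 1) * 2 := by rw [← pow_succ]; congr 1; omega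
          rw [BitVec.toInt_ofInt, Int.bmod_eq_of_le]
          · exact hv
          · push_cast; omega
          · push_cast; omega
        · exfalso
          apply h
          subst hL'
          rw [BitVec.toInt_ofInt, Int.bmod_eq_of_le]
          · exact hv
          · push_cast; rw [pow_succ]; omega
          · push_cast; rw [pow_succ]; omega
      · rintro ⟨t, ht⟩
        exfalso
        rw [pow_succ] at ht
        have h1 : t < 0 := by nlinarith
        have h2 : -1 < t := by nlinarith
        omega

/-! ### Look-ups in tables -/

section Lookup
variable {X : Type} {w : ℕ} {K : ℤ} {c c₁ c₂ e : ℕ} {I J : Set (X → ℤ)}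

theorem Gen.list {l : List (X → ℤ)} (h : ∀ f ∈ l, Gen w c I {f}) : Gen w (l.length * c) I {f | f ∈ l} := by
  induction l with
  | nil => exact (Gen.of_subset (Set.empty_subset I)).mono subset_rfl (by simp) (by simp)
  | cons f l ih =>
    have := (h f List.mem_cons_self).union (ih fun g hg => h g (List.mem_cons_of_mem _ hg))
    refine this.mono subset_rfl (fun g hg => ?_) (by rw [List.length_cons, Nat.succ_mul, add_comm])
    rcases List.mem_cons.1 hg with rfl | hg
    · exact Or.inl rfl
    · exact Or.inr hg

/-- A look-up is a chain of selections with the newest entry outermost, a form that a circuit can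
evaluate. -/
theorem apply_lookup_getD {ι κ υ τ : Type} [BEq κ] [LawfulBEq κ] [DecidableEq κ] (l : List ι)
    (key : ι → κ) (val : ι → υ) (k : κ) (d : υ) (g : υ → τ) :
    g (((l.map fun j => (key j, val j)).lookup k).getD d) =
      l.foldr (fun j acc => if k = key j then g (val j) else acc) (g d) := by
  induction l with
  | nil => rfl
  | cons j l ih =>
    rw [List.map_cons, lookup_cons_ite, List.foldr_cons, ← ih]
    split_ifs <;> rfl

theorem Comp.foldr_select (hR : Room w K) {ι : Type} (l : List ι) {p : ι → X → Prop}
    [∀ j x, Decidable (p j x)] {f : ι → X → ℤ} {d : X → ℤ}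
    (hp : ∀ j ∈ l, Comp w K c I 0 fun x => if p j x then 1 else 0)
    (hf : ∀ j ∈ l, Comp w K c₁ I e (f j)) (hd : Comp w K c₂ I e d) (he : e ≤ 60) :
    Comp w K (l.length * (2 * c + c₁ + 5) + c₂) I e fun x =>
      l.foldr (fun j acc => if p j x then f j x else acc) (d x) := by
  induction l with
  | nil => simpa using hd
  | cons j l ih =>
    have := (hp j List.mem_cons_self).select hR (hf j List.mem_cons_self)
      (ih (fun i hi => hp i (List.mem_cons_of_mem _ hi)) fun i hi => hf i (List.mem_cons_of_mem _ hi)) he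
    simp only [List.foldr_cons, List.length_cons]
    exact this.mono subset_rfl (by ring_nf; omega)

/-- The test whether a word codes a bit string. -/
theorem Comp.ofInt_eq (hR : Room w K) {w' L : ℕ} (hw' : 2 ^ w' ≤ K) {v κ : X → ℤ} {s : X → BitVec L}
    [∀ x, Decidable (BitVec.ofInt L (v x) = s x)]
    (hv : Comp w K c₁ I 1 v) (hv' : ∀ x, |v x| < 2 ^ w') (hκ : Comp w K c₂ I 1 κ)
    (hs : ∀ x, IsRep w' (s x) (κ x)) :
    Comp w K (2 * (c₁ + c₂ + 3) + 5) I 0 fun x => if BitVec.ofInt L (v x) = s x then 1 else 0 := by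
  have hM : |(2 ^ min L (w' + 1) : ℤ)| ≤ K ^ 2 := by
    rw [abs_of_nonneg (by positivity)]
    calc (2 ^ min L (w' + 1) : ℤ) ≤ 2 ^ (w' + 1) := pow_le_pow_right₀ (by norm_num) (min_le_right _ _)
      _ = 2 ^ w' * 2 := pow_succ _ _
      _ ≤ K * K := mul_le_mul hw' hR.two_le (by norm_num) (by linarith [hR.two_le])
      _ = K ^ 2 := (sq K).symm
  have h1 := ((hv.sub hR hκ (by norm_num)).mod hR (Comp.const hR hM (by norm_num)) (by norm_num)).isZero hR
  refine (h1.mono subset_rfl (by omega)).congr fun x => ?_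
  congr 1
  rw [eq_iff_iff, (hs x) (v x) (hv' x)]
  exact ⟨Int.dvd_of_emod_eq_zero, Int.emod_eq_zero_of_dvd⟩

theorem Comp.and (hR : Room w K) {p q : X → Prop} [∀ x, Decidable (p x)] [∀ x, Decidable (q x)]
    [∀ x, Decidable (p x ∧ q x)]
    (h₁ : Comp w K c₁ I 0 fun x => if p x then 1 else 0) (h₂ : Comp w K c₂ I 0 fun x => if q x then 1 else 0) :
    Comp w K (c₁ + c₂ + 1) I 0 fun x => if p x ∧ q x then 1 else 0 :=
  (h₁.mul hR h₂ (by norm_num)).congr fun x => by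
    by_cases hp : p x <;> by_cases hq : q x <;> simp [hp, hq]

theorem Comp.fit (hR : Room w K) {w' : ℕ} (hw' : 2 ^ w' ≤ K) {f : X → ℤ} (h : Comp w K c I e f)
    (he : e ≤ 60) : Comp w K (3 * c + 6) I 1 fun x => Eagle.fit w' (f x) := by
  have hb : |(2 ^ w' : ℤ)| ≤ K ^ 1 := by rw [abs_of_nonneg (by positivity), pow_one]; exact hw'
  have h1 := h.less hR (Comp.const hR hb (by norm_num))
  have h2 := (Comp.const hR (v := -2 ^ w') (by rwa [abs_neg]) (by norm_num)).less hR h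
  have h3 := ((h1.mul hR h2 (by norm_num)).mul hR h (by omega)).congr
    (g := fun x => Eagle.fit w' (f x)) fun x => by
      unfold Eagle.fit
      by_cases hx : |f x| < 2 ^ w'
      · rw [if_pos hx, if_pos (abs_lt.1 hx).2, if_pos (abs_lt.1 hx).1]; ring
      · rw [if_neg hx]
        by_cases h4 : f x < 2 ^ w'
        · rw [if_neg fun h5 => hx (abs_lt.2 ⟨h5, h4⟩)]; ring
        · rw [if_neg h4]; ring
  refine ⟨h3.1.mono_cost (by omega), fun x => ?_⟩
  unfold Eagle.fit
  dsimp only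
  rw [pow_one]
  split_ifs with hx
  · exact hx.le.trans hw'
  · rw [abs_zero]; linarith [hR.two_le]

end Lookup

namespace Params
variable {P : Params} {X : Type}

/-! ### Circuits for the simulation -/

variable (P X) in
/-- An entry of the table of `H` in dependence on the input. -/
structure HashWire where
  msg : X → ℤ
  salt : X → BitVec P.saltLen
  rep : X → ℤ
  pre : X → Fin 3 × Fin P.n → ℤ

variable (P X) in
/-- An entry of the table of `Expand` in dependence on the input. -/
structure ExpandWire where
  key : X → BitVec P.seedLen
  rep : X → ℤ
  val : X → P.RQ

/-- The data of an entry are in memory. -/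
structure HashWire.Ok (K : ℤ) (wA : ℕ) (I : Set (X → ℤ)) (h : HashWire P X) : Prop where
  msg : h.msg ∈ I
  msg_lt : ∀ x, |h.msg x| < 2 ^ wA
  rep : h.rep ∈ I
  rep_le : ∀ x, |h.rep x| ≤ 2 ^ wA
  isRep : ∀ x, IsRep wA (h.salt x) (h.rep x)
  pre : ∀ c, (fun x => h.pre x c) ∈ I
  pre_le : ∀ c x, |h.pre x c| ≤ K

/-- The data of an entry are in memory. -/
structure ExpandWire.Ok (wA : ℕ) (I : Set (X → ℤ)) (v : ExpandWire P X) : Prop where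
  rep : v.rep ∈ I
  rep_le : ∀ x, |v.rep x| ≤ 2 ^ wA
  isRep : ∀ x, IsRep wA (v.key x) (v.rep x)
  val : ringWires v.val ⊆ I

theorem HashWire.Ok.mono {K : ℤ} {wA : ℕ} {I J : Set (X → ℤ)} {h : HashWire P X} (ho : h.Ok K wA I)
    (hI : I ⊆ J) : h.Ok K wA J :=
  ⟨hI ho.msg, ho.msg_lt, hI ho.rep, ho.rep_le, ho.isRep, fun c => hI (ho.pre c), ho.pre_le⟩

theorem ExpandWire.Ok.mono {wA : ℕ} {I J : Set (X → ℤ)} {v : ExpandWire P X} (ho : v.Ok wA I)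
    (hI : I ⊆ J) : v.Ok wA J :=
  ⟨hI ho.rep, ho.rep_le, ho.isRep, ho.val.trans hI⟩

/-- The state of the simulation in dependence on the input. -/
def wireState (ms : List (X → ℤ)) (hs : List (HashWire P X)) (es : List (ExpandWire P X)) (x : X) :
    P.Sim :=
  ⟨ms.map (· x), hs.map fun h => ((h.msg x, h.salt x), h.pre x), es.map fun v => (v.key x, v.val x)⟩

/-- The state `σ` of the simulation after at most `t` steps is in memory. -/
def Avail (K : ℤ) (wA : ℕ) (I : Set (X → ℤ)) (t : ℕ) (σ : X → P.Sim) : Prop :=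
  ∃ (ms : List (X → ℤ)) (hs : List (HashWire P X)) (es : List (ExpandWire P X)),
    (∀ f ∈ ms, f ∈ I ∧ ∀ x, |f x| < 2 ^ wA) ∧ (∀ h ∈ hs, h.Ok K wA I) ∧ (∀ v ∈ es, v.Ok wA I) ∧
      hs.length ≤ t ∧ es.length ≤ t + 1 ∧ σ = wireState ms hs es

theorem abs_fit_lt (wA : ℕ) (v : ℤ) : |fit wA v| < 2 ^ wA := by
  unfold fit
  split_ifs with h
  · exact h
  · simp

theorem fit_fit (wA : ℕ) (v : ℤ) : fit wA (fit wA v) = fit wA v := fit_of_lt (abs_fit_lt wA v)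

/-- A bound for the cost of one step of the simulation. -/
def stepCost (n t : ℕ) : ℕ := 129 * n * t + 8 * n * n + 60 * n + 60

section Step
variable {w wA : ℕ} {K : ℤ} {I J G : Set (X → ℤ)} {c c₀ t e : ℕ}
variable (hR : Room w K) (hA : 2 ^ wA ≤ K)
include hR hA

theorem comp_of_lt {f : X → ℤ} (hf : f ∈ I) (hb : ∀ x, |f x| < 2 ^ wA) : Comp w K 0 I 1 f :=
  Comp.of_mem hf fun x => by rw [pow_one]; exact (hb x).le.trans hA

theorem comp_of_le {f : X → ℤ} (hf : f ∈ I) (hb : ∀ x, |f x| ≤ 2 ^ wA) : Comp w K 0 I 1 f :=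
  Comp.of_mem hf fun x => by rw [pow_one]; exact (hb x).trans hA

theorem exists_read {ms : List (X → ℤ)} (hms : ∀ f ∈ ms, f ∈ I ∧ ∀ x, |f x| < 2 ^ wA) (i : ℕ) :
    ∃ g : X → ℤ, Comp w K 1 I 1 g ∧ (∀ x, |g x| < 2 ^ wA) ∧ ∀ x, (ms.map (· x)).getD i 0 = g x := by
  by_cases hi : i < ms.length
  · obtain ⟨h1, h2⟩ := hms ms[i] (List.getElem_mem hi)
    exact ⟨ms[i], (comp_of_lt hR hA h1 h2).mono subset_rfl (by norm_num), h2, fun x => by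
      simp [List.getD_eq_getElem?_getD, hi]⟩
  · refine ⟨fun _ => 0, Comp.const hR (by simp; linarith [hR.two_le]) (by norm_num), by simp, fun x => ?_⟩
    rw [List.getD_eq_getElem?_getD, List.getElem?_eq_none (by simpa using hi)]
    rfl

theorem exists_read_map {ms : List (X → ℤ)} (hms : ∀ f ∈ ms, f ∈ I ∧ ∀ x, |f x| < 2 ^ wA)
    (args : List ℕ) (j : ℕ) : ∃ g : X → ℤ, Comp w K 1 I 1 g ∧ (∀ x, |g x| < 2 ^ wA) ∧
      ∀ x, (args.map fun i => (ms.map (· x)).getD i 0).getD j 0 = g x := by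
  by_cases hj : j < args.length
  · obtain ⟨g, h1, h2, h3⟩ := exists_read hR hA hms args[j]
    exact ⟨g, h1, h2, fun x => by rw [← h3]; simp [List.getD_eq_getElem?_getD, hj]⟩
  · refine ⟨fun _ => 0, Comp.const hR (by simp; linarith [hR.two_le]) (by norm_num), by simp, fun x => ?_⟩
    rw [List.getD_eq_getElem?_getD, List.getElem?_eq_none (by simpa using hj)]
    rfl

/-- Answers are appended to the memory. -/
theorem exists_avail {ms fs : List (X → ℤ)} {hs : List (HashWire P X)} {es : List (ExpandWire P X)}
    {σ : X → P.Sim} (hG : Gen w c₀ I G) (hms : ∀ f ∈ ms, f ∈ I ∧ ∀ x, |f x| < 2 ^ wA)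
    (hhs : ∀ h ∈ hs, h.Ok K wA (I ∪ G)) (hes : ∀ v ∈ es, v.Ok wA (I ∪ G))
    (hfs : ∀ f ∈ fs, Comp w K c (I ∪ G) e f) (he : e ≤ 60) (ht : hs.length ≤ t) (ht' : es.length ≤ t + 1)
    (hσ : ∀ x, σ x = { wireState ms hs es x with mem := ms.map (· x) ++ (fs.map (· x)).map (fit wA) })
    {C : ℕ} (hC : c₀ + fs.length * (3 * c + 6) ≤ C) :
    ∃ F, Gen w C I F ∧ Avail K wA (I ∪ F) t σ := by
  set fs' := fs.map fun f x => fit wA (f x) with hfs'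
  have h1 : Gen w (fs'.length * (3 * c + 6)) (I ∪ G) {f | f ∈ fs'} := by
    refine Gen.list fun f hf => ?_
    obtain ⟨g, hg, rfl⟩ := List.mem_map.1 hf
    exact ((hfs g hg).fit hR hA he).1
  refine ⟨G ∪ {f | f ∈ fs'}, (hG.comp h1).mono_cost (by rw [hfs', List.length_map]; exact hC), ?_⟩
  have hsub : I ∪ G ⊆ I ∪ (G ∪ {f | f ∈ fs'}) := Set.union_subset_union_right _ Set.subset_union_left
  refine ⟨ms ++ fs', hs, es, fun f hf => ?_, fun h hh => (hhs h hh).mono hsub,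
    fun v hv => (hes v hv).mono hsub, ht, ht', funext fun x => ?_⟩
  · rcases List.mem_append.1 hf with hf | hf
    · exact ⟨Or.inl (hms f hf).1, (hms f hf).2⟩
    · refine ⟨Or.inr (Or.inr hf), ?_⟩
      obtain ⟨g, -, rfl⟩ := List.mem_map.1 hf
      exact fun x => abs_fit_lt _ _
  · rw [hσ, wireState, wireState, List.map_append, hfs', List.map_map, List.map_map]
    rfl

variable (hQ : (P.Q : ℤ) ≤ K) (hn : (P.n : ℤ) ≤ K)

/-- The preimage that programs `H`. -/
theorem comp_pre {hs : List (HashWire P X)} (hhs : ∀ h ∈ hs, h.Ok K wA I) {m v : X → ℤ}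
    (hm : m ∈ I) (hm' : ∀ x, |m x| < 2 ^ wA) (hv : v ∈ I) (hv' : ∀ x, |v x| < 2 ^ wA)
    {ms : List (X → ℤ)} {es : List (ExpandWire P X)} {d : Fin 3 × Fin P.n → ℤ} (hd : ∀ c, |d c| ≤ K)
    (i : Fin 3 × Fin P.n) :
    Comp w K (hs.length * 43 + 1) I 1 fun x =>
      (wireState ms hs es x).pre (m x, BitVec.ofInt P.saltLen (v x)) d i := by
  have hp : ∀ h ∈ hs, Comp w K 19 I 0 fun x =>
      if (m x, BitVec.ofInt P.saltLen (v x)) = (h.msg x, h.salt x) then 1 else 0 := by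
    intro h hh
    have ho := hhs h hh
    have h1 := ((comp_of_lt hR hA hm hm').sub hR (comp_of_lt hR hA ho.msg ho.msg_lt) (by norm_num)).isZero hR
    have h2 := Comp.ofInt_eq hR hA (comp_of_lt hR hA hv hv') hv' (comp_of_le hR hA ho.rep ho.rep_le) ho.isRep
    refine ((h1.and hR h2).mono subset_rfl (by norm_num)).congr fun x => ?_
    simp only [Prod.mk.injEq, sub_eq_zero]
  -- Comparing a key costs 19, and one selection then costs `2 * 19 + 5 = 43` per entry.
  have h3 := Comp.foldr_select hR hs hp (f := fun h x => h.pre x i)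
    (fun h hh => Comp.of_mem (e := 1) ((hhs h hh).pre i) fun x => by
      rw [pow_one]; exact (hhs h hh).pre_le i x)
    (Comp.const hR (v := d i) (e := 1) (by rw [pow_one]; exact hd i) (by norm_num)) (by norm_num)
  refine (h3.mono subset_rfl (by norm_num)).congr fun x => ?_
  exact (apply_lookup_getD hs (fun h => (h.msg x, h.salt x)) (fun h => h.pre x)
    (m x, BitVec.ofInt P.saltLen (v x)) d (fun z => z i)).symm

include hQ hn in
/-- The values of the public row. -/
theorem rcomp_target {a b : X → P.RQ} (ha : ringWires a ⊆ I) (hb : ringWires b ⊆ I)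
    {h : X → Fin 3 × Fin P.n → ℤ} (hh : ∀ i, Comp w K 0 I 1 fun x => h x i) :
    RComp w (8 * P.n * P.n + 18 * P.n) I fun x => target (a x) (b x) (h x) := by
  have hblk : ∀ i, RComp w (P.n * 2) I fun x => modQ P.Q (P.block i (h x)) := fun i =>
    (RComp.reduce hR hQ (f := fun x => P.block i (h x)) (fun j => hh (i, j)) le_rfl (by norm_num)).mono
      subset_rfl (by norm_num)
  have h1 := RComp.mul hR hQ hn (RComp.of_subset ha) (hblk 1)
  have h2 := RComp.mul hR hQ hn (RComp.of_subset hb) (hblk 2)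
  refine (RComp.add hR hQ (RComp.add hR hQ (hblk 0) h1) h2).mono subset_rfl ?_
  ring_nf; omega

end Step

end Params

theorem mem_ofFn_wires {X : Type} {n Q : ℕ} {u : X → Fin n → ZMod Q} {f : X → ℤ}
    (h : f ∈ List.ofFn fun i x => ((u x i).val : ℤ)) : f ∈ ringWires u := by
  rw [List.mem_ofFn] at h
  exact h

theorem map_words {X : Type} {n Q : ℕ} (u : X → Fin n → ZMod Q) (x : X) :
    (List.ofFn fun (i : Fin n) (x : X) => ((u x i).val : ℤ)).map (· x) = words (u x) := by
  rw [List.map_ofFn]; rfl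

namespace Params
variable {P : Params} {X : Type}

section Step
variable {w wA : ℕ} {K : ℤ} {I J G : Set (X → ℤ)} {c c₀ t : ℕ} {a b : X → P.RQ}
variable (hR : Room w K) (hA : 2 ^ wA ≤ K) (hQ : (P.Q : ℤ) ≤ K) (hn : (P.n : ℤ) ≤ K)
include hR hA hQ

theorem comp_val {u : X → P.RQ} (hu : ringWires u ⊆ I) {f : X → ℤ}
    (hf : f ∈ List.ofFn fun i x => ((u x i).val : ℤ)) : Comp w K 0 I 1 f := by
  obtain ⟨i, rfl⟩ := mem_ofFn_wires hf
  exact (RComp.of_subset hu).coord hQ i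

include hn

/-- One step of the simulation. -/
theorem exists_avail_step (ha : ringWires a ⊆ I) (hb : ringWires b ⊆ I) {σ : X → P.Sim}
    (hσ : Avail K wA I t σ) (ε : P.Entry) (hε : ∀ c, |ε.pre c| ≤ K) (i : Instr Oracle) :
    ∃ F, Gen w (stepCost P.n t) I F ∧
      Avail K wA (I ∪ F) (t + 1) fun x => simStep wA (a x) (b x) ε (σ x) i := by
  obtain ⟨ms, hs, es, hms, hhs, hes, ht, ht', rfl⟩ := hσ
  have hI : I ⊆ I ∪ ∅ := Set.subset_union_left
  have h0 : Gen w 0 I (∅ : Set (X → ℤ)) := Gen.of_subset (Set.empty_subset _)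
  have hread := exists_read hR hA hms
  have hC : ∀ d, d ≤ 60 → d ≤ stepCost P.n t := fun d hd => by unfold stepCost; omega
  -- All instructions except oracle queries leave the tables alone and append a single word.
  have honly : ∀ {f : X → ℤ} {k e : ℕ}, Comp w K k I e f → e ≤ 60 → k ≤ 10 →
      (∀ x, simStep wA (a x) (b x) ε (wireState ms hs es x) i =
        { wireState ms hs es x with mem := ms.map (· x) ++ [fit wA (f x)] }) →
      ∃ F, Gen w (stepCost P.n t) I F ∧
        Avail K wA (I ∪ F) (t + 1) fun x => simStep wA (a x) (b x) ε (wireState ms hs es x) i := by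
    intro f k e hf he hk hx
    refine exists_avail hR hA (fs := [f]) h0 hms (fun h hh => (hhs h hh).mono hI) (fun v hv => (hes v hv).mono hI)
      (fun g hg => by
        rw [List.mem_singleton] at hg; subst hg; exact hf.mono hI le_rfl) he (by omega) (by omega) hx
        (hC _ (by simp; omega))
  have hfit : ∀ v : ℤ, Comp w K 1 I 1 fun _ => fit wA v := fun v =>
    Comp.const hR (by rw [pow_one]; exact (abs_fit_lt wA v).le.trans hA) (by norm_num)
  cases i with
  | const v =>
    exact honly (hfit v) (by norm_num) (by norm_num) fun x => by
      rw [fit_fit]; rfl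
  | plus i j =>
    obtain ⟨f, hf, -, hf'⟩ := hread i
    obtain ⟨g, hg, -, hg'⟩ := hread j
    exact honly (hf.add hR hg (by norm_num)) (by norm_num) (by norm_num) fun x => by
      rw [← hf', ← hg']; rfl
  | minus i j =>
    obtain ⟨f, hf, -, hf'⟩ := hread i
    obtain ⟨g, hg, -, hg'⟩ := hread j
    exact honly (hf.sub hR hg (by norm_num)) (by norm_num) (by norm_num) fun x => by
      rw [← hf', ← hg']; rfl
  | times i j =>
    obtain ⟨f, hf, -, hf'⟩ := hread i
    obtain ⟨g, hg, -, hg'⟩ := hread j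
    exact honly (hf.mul hR hg (by norm_num)) (by norm_num) (by norm_num) fun x => by
      rw [← hf', ← hg']; rfl
  | quot i j =>
    obtain ⟨f, hf, -, hf'⟩ := hread i
    obtain ⟨g, hg, -, hg'⟩ := hread j
    exact honly (hf.div hR hg (by norm_num)) (by norm_num) (by norm_num) fun x => by
      rw [← hf', ← hg']; rfl
  | rem i j =>
    obtain ⟨f, hf, -, hf'⟩ := hread i
    obtain ⟨g, hg, -, hg'⟩ := hread j
    exact honly (hf.mod hR hg (by norm_num)) (by norm_num) (by norm_num) fun x => by
      rw [← hf', ← hg']; rfl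
  | less i j =>
    obtain ⟨f, hf, -, hf'⟩ := hread i
    obtain ⟨g, hg, -, hg'⟩ := hread j
    exact honly (hf.less hR hg) (by norm_num) (by norm_num) fun x => by
      rw [← hf', ← hg']; rfl
  | coin =>
    exact honly (hfit (if ε.coin then 1 else 0)) (by norm_num) (by norm_num) fun x => by
      rw [fit_fit]; rfl
  | query o args =>
    cases o with
    | hash =>
      obtain ⟨m, hm, hm', hmx⟩ := exists_read_map hR hA hms args 0
      obtain ⟨v, hv, hv', hvx⟩ := exists_read_map hR hA hms args 1
      set G₀ : Set (X → ℤ) := {m} ∪ {v}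
      have g0 : Gen w (1 + 1) I G₀ := hm.1.union hv.1
      set pre : X → Fin 3 × Fin P.n → ℤ := fun x =>
        (wireState ms hs es x).pre (m x, BitVec.ofInt P.saltLen (v x)) ε.pre with hpre
      have hpc : ∀ i, Comp w K (t * 43 + 1) (I ∪ G₀) 1 fun x => pre x i := fun i =>
        (comp_pre hR hA (fun h hh => (hhs h hh).mono Set.subset_union_left) (Or.inr (Or.inl rfl)) hm'
          (Or.inr (Or.inr rfl)) hv' hε i).mono subset_rfl (by gcongr)
      set G₁ : Set (X → ℤ) := Set.range fun i x => pre x i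
      have g1 : Gen w (3 * P.n * (t * 43 + 1)) (I ∪ G₀) G₁ := by
        have := Gen.range fun i => (hpc i).1
        rwa [Fintype.card_prod, Fintype.card_fin, Fintype.card_fin] at this
      set u : X → P.RQ := fun x => target (a x) (b x) (pre x) with hu
      have g2 : Gen w (8 * P.n * P.n + 18 * P.n) (I ∪ G₀ ∪ G₁) (ringWires u) :=
        rcomp_target hR hA hQ hn (ha.trans (Set.subset_union_left.trans Set.subset_union_left))
          (hb.trans (Set.subset_union_left.trans Set.subset_union_left)) fun i =>
            Comp.of_mem (Or.inr ⟨i, rfl⟩) (hpc i).2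
      have gall := g0.comp (g1.comp g2)
      refine exists_avail hR hA (hs := ⟨m, fun x => BitVec.ofInt P.saltLen (v x), v, pre⟩ :: hs)
        (fs := List.ofFn fun i x => ((u x i).val : ℤ)) (c := 0) (e := 1) gall hms (fun h hh => ?_)
        (fun v hv => (hes v hv).mono Set.subset_union_left) (fun f hf => ?_) (by norm_num)
        (by simpa using ht) (by omega) (fun x => ?_) ?_
      · rcases List.mem_cons.1 hh with rfl | hh
        · exact ⟨Or.inr (Or.inl (Or.inl rfl)), hm', Or.inr (Or.inl (Or.inr rfl)), fun x => (hv' x).le,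
            fun x => isRep_ofInt _ (hv' x), fun i => Or.inr (Or.inr (Or.inl ⟨i, rfl⟩)), fun i x => by
              have := (hpc i).2 x
              rwa [pow_one] at this⟩
        · exact (hhs h hh).mono Set.subset_union_left
      · exact comp_val hR hA hQ (u := u) (fun g hg => Or.inr (Or.inr (Or.inr hg))) hf
      · have hk : P.hashKey (args.map fun i => (wireState ms hs es x).mem.getD i 0) =
            (m x, BitVec.ofInt P.saltLen (v x)) := by
          rw [hashKey, ← hmx, ← hvx]; rfl
        rw [map_words]
        simp only [simStep, simEval, hk]
        rfl
      · rw [List.length_ofFn]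
        unfold stepCost
        ring_nf; omega
    | expand =>
      obtain ⟨v, hv, hv', hvx⟩ := exists_read_map hR hA hms args 0
      set u : X → P.RQ := fun x => (wireState ms hs es x).expand (BitVec.ofInt P.seedLen (v x)) ε.fresh with hu
      have g0 : Gen w 1 I {v} := hv.1
      have g1 : Gen w (P.n * (t * 27 + 28)) (I ∪ {v}) (ringWires u) := by
        refine RComp.of_coords (K := K) (e := 1) fun i => ?_
        have hp : ∀ h ∈ es, Comp w K 11 (I ∪ {v}) 0 fun x =>
            if BitVec.ofInt P.seedLen (v x) = h.key x then 1 else 0 := by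
          intro h hh
          have ho := (hes h hh).mono (J := I ∪ {v}) Set.subset_union_left
          exact (Comp.ofInt_eq hR hA (comp_of_lt hR hA (Or.inr rfl) hv') hv'
            (comp_of_le hR hA ho.rep ho.rep_le) ho.isRep).mono subset_rfl (by norm_num)
        have h3 := Comp.foldr_select hR es hp (f := fun h x => ((h.val x i).val : ℤ)) (e := 1) (c₁ := 0)
          (fun h hh => (RComp.of_subset (((hes h hh).val).trans Set.subset_union_left)).coord hQ i)
          (d := fun _ => ((ε.fresh i).val : ℤ)) (c₂ := 1) (Comp.const hR (by
            rw [pow_one, abs_of_nonneg (Int.natCast_nonneg _)]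
            exact le_trans (by exact_mod_cast (ZMod.val_lt _).le) hQ) (by norm_num)) (by norm_num)
        refine (h3.mono subset_rfl ?_).congr fun x => ?_
        · have : es.length * 27 ≤ (t + 1) * 27 := Nat.mul_le_mul_right _ ht'
          omega
        · exact (apply_lookup_getD es (fun h => h.key x) (fun h => h.val x)
            (BitVec.ofInt P.seedLen (v x)) ε.fresh (fun z => ((z i).val : ℤ))).symm
      refine exists_avail hR hA (es := ⟨fun x => BitVec.ofInt P.seedLen (v x), v, u⟩ :: es)
        (fs := List.ofFn fun i x => ((u x i).val : ℤ)) (c := 0) (e := 1) (g0.comp g1) hms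
        (fun h hh => (hhs h hh).mono Set.subset_union_left) (fun h hh => ?_) (fun f hf => ?_) (by norm_num)
        (by omega) (by simpa using ht') (fun x => ?_) ?_
      · rcases List.mem_cons.1 hh with rfl | hh
        · exact ⟨Or.inr (Or.inl rfl), fun x => (hv' x).le, fun x => isRep_ofInt _ (hv' x),
            fun g hg => Or.inr (Or.inr hg)⟩
        · exact (hes h hh).mono Set.subset_union_left
      · exact comp_val hR hA hQ (u := u) (fun g hg => Or.inr (Or.inr hg)) hf
      · have hk : (args.map fun i => (wireState ms hs es x).mem.getD i 0).getD 0 0 = v x := by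
          rw [← hvx]; rfl
        rw [map_words]
        simp only [simStep, simEval, hk]
        rfl
      · rw [List.length_ofFn]
        unfold stepCost
        ring_nf; omega
    | sign =>
      obtain ⟨m, hm, hm', hmx⟩ := exists_read_map hR hA hms args 0
      have hpc : ∀ i, Comp w K 1 I 1 fun _ : X => ε.pre i := fun i =>
        Comp.const hR (by rw [pow_one]; exact hε i) (by norm_num)
      -- The salt is a constant of the circuit but may be too long for a word; what is stored is a
      -- representative that answers comparisons with words correctly.
      have hrep : Comp w K 1 I 1 fun _ : X => wordRep wA ε.salt :=
        Comp.const hR (by rw [pow_one]; exact (abs_wordRep_le _ _).trans hA) (by norm_num)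
      have g1 : Gen w (3 * P.n * 1) I (Set.range fun i (_ : X) => ε.pre i) := by
        have := Gen.range fun i => (hpc i).1
        rwa [Fintype.card_prod, Fintype.card_fin, Fintype.card_fin] at this
      have gall := (hm.1.union hrep.1).union g1
      refine exists_avail hR hA
        (hs := ⟨m, fun _ => ε.salt, fun _ => wordRep wA ε.salt, fun _ => ε.pre⟩ :: hs)
        (fs := (fun _ => fit wA (ε.salt.toNat : ℤ)) ::
          ((List.ofFn fun i (_ : X) => P.block 1 ε.pre i) ++ (List.ofFn fun i (_ : X) => P.block 2 ε.pre i)))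
        (c := 1) (e := 1) gall hms (fun h hh => ?_)
        (fun v hv => (hes v hv).mono Set.subset_union_left) (fun f hf => ?_) (by norm_num)
        (by simpa using ht) (by omega) (fun x => ?_) ?_
      · rcases List.mem_cons.1 hh with rfl | hh
        · exact ⟨Or.inr (Or.inl (Or.inl rfl)), hm', Or.inr (Or.inl (Or.inr rfl)),
            fun x => abs_wordRep_le _ _, fun x => isRep_wordRep _ _, fun i => Or.inr (Or.inr ⟨i, rfl⟩),
            fun i x => hε i⟩
        · exact (hhs h hh).mono Set.subset_union_left
      · rcases List.mem_cons.1 hf with rfl | hf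
        · exact (hfit _).mono Set.subset_union_left le_rfl
        · rcases List.mem_append.1 hf with hf | hf
          · obtain ⟨i, rfl⟩ := List.mem_ofFn.1 hf
            exact (hpc (1, i)).mono Set.subset_union_left le_rfl
          · obtain ⟨i, rfl⟩ := List.mem_ofFn.1 hf
            exact (hpc (2, i)).mono Set.subset_union_left le_rfl
      · have hk : (args.map fun i => (wireState ms hs es x).mem.getD i 0).getD 0 0 = m x := by
          rw [← hmx]; rfl
        simp only [simStep, simEval, hk, List.map_cons, List.map_append, fit_fit, List.map_ofFn]
        rfl
      · simp only [List.length_cons, List.length_append, List.length_ofFn]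
        unfold stepCost
        ring_nf; omega

/-- The simulation. -/
theorem exists_avail_run {T : ℕ} (code : List (Instr Oracle)) (tape : List P.Entry)
    (htape : ∀ ε ∈ tape, ∀ c, |ε.pre c| ≤ K) {I : Set (X → ℤ)} (ha : ringWires a ⊆ I)
    (hb : ringWires b ⊆ I) {t : ℕ} {σ : X → P.Sim} (hσ : Avail K wA I t σ) (hT : t + code.length ≤ T) :
    ∃ F, Gen w (code.length * stepCost P.n T) I F ∧
      Avail K wA (I ∪ F) T fun x => simRun wA (a x) (b x) code tape (σ x) := by
  have hmono : ∀ {I : Set (X → ℤ)} {t : ℕ} {σ : X → P.Sim}, Avail K wA I t σ → t ≤ T → Avail K wA I T σ := by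
    rintro I t σ ⟨ms, hs, es, h1, h2, h3, h4, h5, h6⟩ h
    exact ⟨ms, hs, es, h1, h2, h3, h4.trans h, by omega, h6⟩
  induction code generalizing tape I t σ with
  | nil =>
    refine ⟨∅, (Gen.of_subset (Set.empty_subset _)).mono_cost (Nat.zero_le _), ?_⟩
    rw [Set.union_empty]
    exact hmono hσ (by simpa using hT)
  | cons i code ih =>
    rw [List.length_cons] at hT
    cases tape with
    | nil =>
      refine ⟨∅, (Gen.of_subset (Set.empty_subset _)).mono_cost (Nat.zero_le _), ?_⟩
      rw [Set.union_empty]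
      exact hmono hσ (by omega)
    | cons ε tape =>
      obtain ⟨F₁, h1, h2⟩ := exists_avail_step hR hA hQ hn ha hb hσ ε (htape ε List.mem_cons_self) i
      obtain ⟨F₂, h3, h4⟩ := ih tape (fun ε' h => htape ε' (List.mem_cons_of_mem _ h))
        (ha.trans Set.subset_union_left) (hb.trans Set.subset_union_left) h2 (by omega)
      refine ⟨F₁ ∪ F₂, (h1.comp h3).mono_cost ?_, ?_⟩
      · have : stepCost P.n t ≤ stepCost P.n T := by
          unfold stepCost
          have : t ≤ T := by omega
          gcongr
        rw [List.length_cons, Nat.succ_mul]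
        omega
      · rw [← Set.union_assoc]
        exact h4

end Step

end Params

/-! ### The norm test -/

/-- Downward closed conditions on bounded integers are comparisons. -/
theorem exists_threshold (M : ℕ) (p : ℕ → Prop) (h0 : p 0) (hp : ∀ y y', y ≤ y' → p y' → p y) :
    ∃ y₀ ≤ M, ∀ y ≤ M, p y ↔ y ≤ y₀ := by
  classical
  refine ⟨Nat.findGreatest p M, Nat.findGreatest_le M, fun y hy => ⟨fun h => Nat.le_findGreatest hy h, fun h => ?_⟩⟩
  exact hp _ _ h (Nat.findGreatest_spec (P := p) (Nat.zero_le M) h0)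

/-- A half plane meets a box of integer points in a half plane with small integral coefficients. -/
theorem exists_integral_halfPlane {c B : ℝ} {M C D : ℕ} (hM : 0 < M) (hc : 0 ≤ c) (hcC : c ≤ C)
    (hB : 0 ≤ B) (hBD : B ≤ D) :
    ∃ α δ θ : ℤ, |α| ≤ M * (M + 1) ∧ |δ| ≤ (M * C + 1) * (M + 1) + 1 ∧ |θ| ≤ (M * D + 2) * (M + 1) ∧
      ∀ X Y : ℕ, X ≤ M → Y ≤ M → ((X : ℝ) + c * Y ≤ B ↔ α * X + δ * Y ≤ θ) := by
  -- Dirichlet approximation of `c` by `j / k`. Multiplied by `k`, the condition compares the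
  -- integer `k X + j Y`, up to an error `t Y` of absolute value below one, with `k B`; so only one
  -- value of that integer leaves the answer open.
  obtain ⟨j, k, hk, hkM, hjk⟩ := Real.exists_int_int_abs_mul_sub_le c hM
  set t : ℝ := k * c - j with ht
  set b₀ : ℤ := ⌊k * B⌋ with hb₀
  have hkR : (0 : ℝ) < k := by exact_mod_cast hk
  have hkMR : (k : ℝ) ≤ M := by exact_mod_cast hkM
  have hMR : (0 : ℝ) < M := by exact_mod_cast hM
  have htY : ∀ Y : ℕ, Y ≤ M → |t * Y| < 1 := by
    intro Y hY
    rw [abs_mul, Nat.abs_cast]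
    have hY' : (Y : ℝ) ≤ M := by exact_mod_cast hY
    calc |t| * Y ≤ 1 / (M + 1) * M := mul_le_mul hjk hY' (Nat.cast_nonneg _) (by positivity)
      _ < 1 := by rw [one_div, inv_mul_lt_iff₀ (by positivity)]; linarith
  have hfl1 : (b₀ : ℝ) ≤ k * B := Int.floor_le _
  have hfl2 : (k : ℝ) * B < b₀ + 1 := Int.lt_floor_add_one _
  have hb₀0 : 0 ≤ b₀ := Int.floor_nonneg.2 (by positivity)
  have hb₀M : b₀ ≤ M * D := by
    have : (b₀ : ℝ) ≤ M * D := hfl1.trans (mul_le_mul hkMR hBD hB hMR.le)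
    exact_mod_cast this
  have ht1 : |t| ≤ 1 := hjk.trans (by rw [div_le_one (by positivity)]; linarith)
  have hj1 : -1 ≤ j := by
    have h1 := (abs_le.1 ht1).2
    have h2 : (-1 : ℝ) ≤ j := by nlinarith [mul_nonneg hkR.le hc]
    exact_mod_cast h2
  have hj2 : j ≤ M * C + 1 := by
    have h1 := (abs_le.1 ht1).1
    have h3 : (k : ℝ) * c ≤ M * C := mul_le_mul hkMR hcC hc hMR.le
    have h2 : (j : ℝ) ≤ M * C + 1 := by linarith
    exact_mod_cast h2
  have hjabs : |j| ≤ M * C + 1 := abs_le.2 ⟨by have : (0 : ℤ) ≤ M * C := by positivity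
                                               linarith, hj2⟩
  have hMpos : (0 : ℤ) < M := by exact_mod_cast hM
  have hkey : ∀ X Y : ℕ, (X : ℝ) + c * Y ≤ B ↔ ((k * X + j * Y : ℤ) : ℝ) + t * Y ≤ k * B := by
    intro X Y
    rw [← mul_le_mul_iff_right₀ hkR, ht]
    push_cast
    ring_nf
  have hα : |k * ((M : ℤ) + 1)| ≤ M * (M + 1) := by
    rw [abs_of_nonneg (by positivity)]
    exact mul_le_mul_of_nonneg_right hkM (by positivity)
  have hjM : |j * ((M : ℤ) + 1)| ≤ (M * C + 1) * (M + 1) := by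
    rw [abs_mul, abs_of_nonneg (show (0 : ℤ) ≤ (M : ℤ) + 1 by positivity)]
    exact mul_le_mul_of_nonneg_right hjabs (by positivity)
  rcases le_or_gt 0 t with h0 | h0
  -- For `t ≥ 0` the open case is `k X + j Y = ⌊k B⌋`, where the condition is a threshold on `Y`.
  -- The factor `M + 1` exceeds every `Y` and encodes the lexicographic comparison in one
  -- inequality.
  · obtain ⟨y₀, hy₀, hy⟩ := exists_threshold M (fun y => t * y ≤ k * B - b₀) (by simpa using hfl1)
      fun y y' h h' => (mul_le_mul_of_nonneg_left (by exact_mod_cast h) h0).trans h'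
    refine ⟨k * (M + 1), j * (M + 1) + 1, b₀ * (M + 1) + y₀, hα, ?_, ?_, fun X Y hX hY => ?_⟩
    · exact (abs_add_le _ _).trans (by simpa using hjM)
    · rw [abs_of_nonneg (by positivity)]
      have : (y₀ : ℤ) ≤ M := by exact_mod_cast hy₀
      nlinarith
    · rw [hkey]
      set N : ℤ := k * X + j * Y with hN
      have hYM : (Y : ℤ) ≤ M := by exact_mod_cast hY
      have hy₀M : (y₀ : ℤ) ≤ M := by exact_mod_cast hy₀
      have htp : 0 ≤ t * Y := mul_nonneg h0 (Nat.cast_nonneg _)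
      have htl := (abs_lt.1 (htY Y hY)).2
      have e : k * ((M : ℤ) + 1) * X + (j * (M + 1) + 1) * Y = N * (M + 1) + Y := by rw [hN]; ring
      rw [e]
      rcases lt_trichotomy N b₀ with h | h | h
      · have h' : (N : ℝ) + 1 ≤ b₀ := by exact_mod_cast h
        refine iff_of_true (by linarith) ?_
        nlinarith
      · rw [h]
        have := hy Y hY
        constructor
        · intro h2
          have h3 : (Y : ℤ) ≤ y₀ := by exact_mod_cast this.1 (by linarith)
          linarith
        · intro h2
          have h3 : Y ≤ y₀ := by
            have : (Y : ℤ) ≤ y₀ := by linarith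
            exact_mod_cast this
          linarith [this.2 h3]
      · have h' : (b₀ : ℝ) + 1 ≤ N := by exact_mod_cast h
        refine iff_of_false (by linarith) ?_
        nlinarith
  -- For `t < 0` the open case is `⌊k B⌋ + 1`, and there `Y` has to exceed the threshold.
  · obtain ⟨y₀, hy₀, hy⟩ := exists_threshold M (fun y => -t * y < b₀ + 1 - k * B) (by simpa using hfl2)
      fun y y' h h' => (mul_le_mul_of_nonneg_left (by exact_mod_cast h) (by linarith)).trans_lt h'
    refine ⟨k * (M + 1), j * (M + 1) - 1, (b₀ + 1) * (M + 1) - (y₀ + 1), hα, ?_, ?_, fun X Y hX hY => ?_⟩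
    · exact (abs_sub _ _).trans (by simpa using hjM)
    · have : (y₀ : ℤ) ≤ M := by exact_mod_cast hy₀
      rw [abs_of_nonneg (by nlinarith)]
      nlinarith
    · rw [hkey]
      set N : ℤ := k * X + j * Y with hN
      have hYM : (Y : ℤ) ≤ M := by exact_mod_cast hY
      have hy₀M : (y₀ : ℤ) ≤ M := by exact_mod_cast hy₀
      have htp : t * Y ≤ 0 := mul_nonpos_of_nonpos_of_nonneg h0.le (Nat.cast_nonneg _)
      have htl := (abs_lt.1 (htY Y hY)).1
      have e : k * ((M : ℤ) + 1) * X + (j * (M + 1) - 1) * Y = N * (M + 1) - Y := by rw [hN]; ring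
      rw [e]
      rcases lt_trichotomy N (b₀ + 1) with h | h | h
      · have h' : (N : ℝ) ≤ b₀ := by exact_mod_cast (Int.lt_add_one_iff.1 h)
        refine iff_of_true (by linarith) ?_
        nlinarith
      · rw [h]
        have := (not_congr (hy Y hY))
        push_cast
        constructor
        · intro h2
          have h3 : (y₀ : ℤ) < Y := by exact_mod_cast not_le.1 (this.1 (by linarith))
          linarith
        · intro h2
          have h3 : y₀ < Y := by
            have : (y₀ : ℤ) < Y := by linarith
            exact_mod_cast this
          linarith [not_lt.1 (this.2 (not_le.2 h3))]
      · have h' : (b₀ : ℝ) + 1 + 1 ≤ N := by exact_mod_cast h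
        refine iff_of_false (by linarith) ?_
        nlinarith


namespace Params
variable {P : Params} {X : Type}

/-! ### The outcome of the simulation as a circuit -/

/-- The final state of the simulation. -/
def simEnd (A : Program Oracle) (seed : BitVec P.seedLen) (t : List P.Entry) (a b : P.RQ) : P.Sim :=
  simRun A.word a b A.code t (simStart A.word a b seed)

/-- The forgery in the simulation. -/
def simForgery (A : Program Oracle) (seed : BitVec P.seedLen) (t : List P.Entry) (a b : P.RQ) :
    Msg × P.Sig :=
  P.forgery (outWords A.out (simEnd A seed t a b).mem)

/-- The preimage that programs `H` at the point of the forgery. -/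
def simPre (A : Program Oracle) (seed : BitVec P.seedLen) (e : P.Entry) (t : List P.Entry) (a b : P.RQ) :
    Fin 3 × Fin P.n → ℤ :=
  (simEnd A seed t a b).pre ((simForgery A seed t a b).1, (simForgery A seed t a b).2.1) e.pre

/-- The preimage contained in the forgery. -/
noncomputable def simVec (A : Program Oracle) (seed : BitVec P.seedLen) (e : P.Entry) (t : List P.Entry)
    (a b : P.RQ) : Fin 3 × Fin P.n → ℤ :=
  blocks (residual a b (target a b (simPre A seed e t a b)) (simForgery A seed t a b).2.2)
    (simForgery A seed t a b).2.2.1 (simForgery A seed t a b).2.2.2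

/-- The cost of the simulation. -/
def simCost (n N : ℕ) : ℕ := N * stepCost n N + 129 * n * N + 30 * n * n + 100 * n + 100

theorem forges_sim_iff (A : Program Oracle) (seed : BitVec P.seedLen) (e : P.Entry) (t : List P.Entry)
    (a b : P.RQ) : Forges a b e (simEnd A seed t a b) (simForgery A seed t a b) ↔
      twistedNorm P.γ (simVec A seed e t a b) ≤ P.β ∧
        ∃ c : Fin 3 × Fin P.n, c.1 ≠ 0 ∧ simVec A seed e t a b c ≠ simPre A seed e t a b c := by
  unfold Forges
  refine and_congr Iff.rfl ?_
  rw [not_iff_comm]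
  push Not
  constructor
  · intro h
    refine Prod.ext (funext fun i => h (1, i) (by simp)) (funext fun i => h (2, i) (by simp))
  · rintro h ⟨c, i⟩ hc
    have h1 := congrFun (congrArg Prod.fst h) i
    have h2 := congrFun (congrArg Prod.snd h) i
    fin_cases c
    · exact absurd rfl hc
    · exact h1
    · exact h2

section Step
variable {w wA : ℕ} {K : ℤ} {I J G : Set (X → ℤ)} {c c₀ t : ℕ} {a b : X → P.RQ}
variable (hR : Room w K) (hA : 2 ^ wA ≤ K) (hQ : (P.Q : ℤ) ≤ K) (hn : (P.n : ℤ) ≤ K)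
include hR hA hQ

theorem exists_avail_start (ha : ringWires a ⊆ I) (hb : ringWires b ⊆ I) (seed : BitVec P.seedLen) (T : ℕ) :
    ∃ F, Gen w (1 + (P.n + 1) * 9) I F ∧ Avail K wA (I ∪ F) T fun x => simStart wA (a x) (b x) seed := by
  have hrep : Comp w K 1 I 1 fun _ : X => wordRep wA seed :=
    Comp.const hR (by rw [pow_one]; exact (abs_wordRep_le _ _).trans hA) (by norm_num)
  refine exists_avail hR hA (ms := []) (hs := []) (es := [⟨fun _ => seed, fun _ => wordRep wA seed, a⟩])
    (fs := (fun _ => fit wA (seed.toNat : ℤ)) :: List.ofFn fun i x => ((b x i).val : ℤ))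
    (c := 1) (e := 1) (G := {fun _ => wordRep wA seed}) hrep.1 (by simp) (by simp) (fun v hv => ?_)
    (fun f hf => ?_) (by norm_num) (by simp) (by simp) (fun x => ?_) (by simp)
  · rw [List.mem_singleton] at hv
    subst hv
    exact ⟨Or.inr rfl, fun x => abs_wordRep_le _ _, fun x => isRep_wordRep _ _,
      ha.trans Set.subset_union_left⟩
  · rcases List.mem_cons.1 hf with rfl | hf
    · exact Comp.const hR (by rw [pow_one]; exact (abs_fit_lt wA _).le.trans hA) (by norm_num)
    · exact (comp_val hR hA hQ (hb.trans Set.subset_union_left) hf).mono subset_rfl (by norm_num)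
  · rw [List.map_cons, map_words, List.map_cons, fit_fit]
    rfl

include hn

/-- The circuit for the outcome of the simulation. -/
theorem exists_comp_sim (ha : ringWires a ⊆ I) (hb : ringWires b ⊆ I) (seed : BitVec P.seedLen)
    (A : Program Oracle) (hwA : A.word = wA) (e : P.Entry) (t : List P.Entry)
    (ht : ∀ e' ∈ e :: t, ∀ c, |e'.pre c| ≤ K) :
    ∃ F, Gen w (simCost P.n A.code.length) I F ∧
      (∀ c, Comp w K 0 (I ∪ F) 1 fun x => simPre A seed e t (a x) (b x) c) ∧
      ∀ c, Comp w K 0 (I ∪ F) 1 fun x => simVec A seed e t (a x) (b x) c := by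
  subst hwA
  obtain ⟨F₀, g0, h0⟩ := exists_avail_start hR hA hQ ha hb seed 0
  obtain ⟨F₁, g1, h1⟩ := exists_avail_run hR hA hQ hn A.code t
    (fun e' he' => ht e' (List.mem_cons_of_mem _ he')) (ha.trans Set.subset_union_left)
    (hb.trans Set.subset_union_left) h0 (Nat.zero_add _).le
  obtain ⟨ms, hs, es, hms, hhs, hes, hl, -, hσ⟩ := h1
  rw [Set.union_assoc] at hms hhs hes
  set I₁ := I ∪ (F₀ ∪ F₁) with hI₁
  have g01 : Gen w (1 + (P.n + 1) * 9 + A.code.length * stepCost P.n A.code.length) I (F₀ ∪ F₁) := g0.comp g1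
  have hend : ∀ x, simEnd A seed t (a x) (b x) = wireState ms hs es x := fun x => congrFun hσ x
  choose rd hrd hrd' hrdx using exists_read_map hR hA hms A.out
  have hout : ∀ x j, (outWords A.out (simEnd A seed t (a x) (b x)).mem).getD j 0 = rd j x := fun x j => by
    rw [hend, ← hrdx]; rfl
  have hm : ∀ x, (simForgery A seed t (a x) (b x)).1 = rd 0 x := fun x => hout x 0
  have hsalt : ∀ x, (simForgery A seed t (a x) (b x)).2.1 = BitVec.ofInt P.saltLen (rd 1 x) := fun x => by
    rw [← hout]; rfl
  have hz1 : ∀ x i, (simForgery A seed t (a x) (b x)).2.2.1 i = rd (2 + i) x := fun x i => hout x _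
  have hz2 : ∀ x i, (simForgery A seed t (a x) (b x)).2.2.2 i = rd (2 + P.n + i) x := fun x i => hout x _
  set F₂ : Set (X → ℤ) := Set.range fun j : Fin (2 + P.n + P.n) => rd j with hF₂
  have g2 : Gen w ((2 + P.n + P.n) * 1) I₁ F₂ := by
    have := Gen.range fun j : Fin (2 + P.n + P.n) => (hrd j).1
    rwa [Fintype.card_fin] at this
  have hrdF : ∀ j, j < 2 + P.n + P.n → rd j ∈ F₂ := fun j hj => ⟨⟨j, hj⟩, rfl⟩
  have hrdC : ∀ {J : Set (X → ℤ)}, F₂ ⊆ J → ∀ j, j < 2 + P.n + P.n → Comp w K 0 J 1 (rd j) :=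
    fun hJ j hj => comp_of_lt hR hA (hJ (hrdF j hj)) (hrd' j)
  have hpc : ∀ i, Comp w K (A.code.length * 43 + 1) (I₁ ∪ F₂) 1 fun x => simPre A seed e t (a x) (b x) i := by
    intro i
    refine ((comp_pre hR hA (fun h hh => (hhs h hh).mono Set.subset_union_left)
      (Or.inr (hrdF 0 (by omega))) (hrd' 0) (Or.inr (hrdF 1 (by omega))) (hrd' 1) (ms := ms) (es := es)
      (d := e.pre) (ht e List.mem_cons_self) i).mono subset_rfl (by gcongr)).congr fun x => ?_
    rw [simPre, hm, hsalt, hend]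
  set F₃ : Set (X → ℤ) := Set.range fun i x => simPre A seed e t (a x) (b x) i with hF₃
  have g3 : Gen w (3 * P.n * (A.code.length * 43 + 1)) (I₁ ∪ F₂) F₃ := by
    have := Gen.range fun i => (hpc i).1
    rwa [Fintype.card_prod, Fintype.card_fin, Fintype.card_fin] at this
  set I₃ := I₁ ∪ F₂ ∪ F₃ with hI₃
  have haI : ringWires a ⊆ I₃ := fun g hg => Or.inl (Or.inl (Or.inl (ha hg)))
  have hbI : ringWires b ⊆ I₃ := fun g hg => Or.inl (Or.inl (Or.inl (hb hg)))
  have hFI : F₂ ⊆ I₃ := Set.subset_union_right.trans Set.subset_union_left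
  have hu := rcomp_target hR hA hQ hn haI hbI fun i =>
    Comp.of_mem (w := w) (I := I₃) (K := K) (e := 1) (Or.inr ⟨i, rfl⟩) (hpc i).2
  have hy : RComp w (P.n * 2) I₃ fun x => modQ P.Q (simForgery A seed t (a x) (b x)).2.2.1 :=
    (RComp.reduce hR hQ (fun i => (hrdC hFI (2 + i) (by omega)).congr fun x => (hz1 x i).symm)
      le_rfl (by norm_num)).mono subset_rfl (by norm_num)
  have hz : RComp w (P.n * 2) I₃ fun x => modQ P.Q (simForgery A seed t (a x) (b x)).2.2.2 :=
    (RComp.reduce hR hQ (fun i => (hrdC hFI (2 + P.n + i) (by omega)).congr fun x => (hz2 x i).symm)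
      le_rfl (by norm_num)).mono subset_rfl (by norm_num)
  have hres := RComp.sub hR hQ (RComp.sub hR hQ hu (RComp.mul hR hQ hn (RComp.of_subset haI) hy))
    (RComp.mul hR hQ hn (RComp.of_subset hbI) hz)
  set v : X → P.RQ := fun x => target (a x) (b x) (simPre A seed e t (a x) (b x)) -
    ringMul (a x) (modQ P.Q (simForgery A seed t (a x) (b x)).2.2.1) -
    ringMul (b x) (modQ P.Q (simForgery A seed t (a x) (b x)).2.2.2) with hv
  have g4 : Gen w _ I₃ (ringWires v) := hres
  have hcen : ∀ i, Comp w K 11 (I₃ ∪ ringWires v) 1 fun x => centered (v x) i := fun i =>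
    (RComp.centered hR hQ (RComp.of_subset Set.subset_union_right) i).mono subset_rfl (by norm_num)
  set F₅ : Set (X → ℤ) := Set.range fun i x => centered (v x) i with hF₅
  have g5 : Gen w (P.n * 11) (I₃ ∪ ringWires v) F₅ := by
    have := Gen.range fun i => (hcen i).1
    rwa [Fintype.card_fin] at this
  have gall := g01.comp (g2.comp (g3.comp (g4.comp g5)))
  refine ⟨_, gall.mono_cost ?_, fun i => Comp.of_mem ?_ (hpc i).2, fun ⟨j, i⟩ => ?_⟩
  · unfold simCost
    ring_nf
    omega
  · exact Or.inr (Or.inr (Or.inr (Or.inl ⟨i, rfl⟩)))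
  · fin_cases j
    · exact Comp.of_mem (Or.inr (Or.inr (Or.inr (Or.inr (Or.inr ⟨i, rfl⟩))))) (hcen i).2
    · exact (hrdC (fun g hg => Or.inr (Or.inr (Or.inl hg))) (2 + i) (by omega)).congr fun x => (hz1 x i).symm
    · exact (hrdC (fun g hg => Or.inr (Or.inr (Or.inl hg))) (2 + P.n + i) (by omega)).congr fun x =>
        (hz2 x i).symm

end Step
end Params

/-! ### The norm test as a circuit. -/

theorem twistedNorm_le_iff {m n : ℕ} {γ β : ℝ} (hβ : 0 ≤ β) (x : Fin m × Fin n → ℤ) :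
    twistedNorm γ x ≤ β ↔
      ((∑ c with (c.1 : ℕ) = 0, x c ^ 2 : ℤ) : ℝ) + γ ^ 2 * (∑ c with ¬ (c.1 : ℕ) = 0, x c ^ 2 : ℤ) ≤ β ^ 2 := by
  unfold twistedNorm
  rw [Real.sqrt_le_left hβ]
  refine iff_of_eq (congrArg (· ≤ β ^ 2) ?_)
  rw [← Finset.sum_filter_add_sum_filter_not Finset.univ fun c : Fin m × Fin n => (c.1 : ℕ) = 0]
  push_cast
  rw [Finset.mul_sum]
  congr 1
  · refine Finset.sum_congr rfl fun c hc => ?_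
    rw [if_pos (Finset.mem_filter.1 hc).2, one_mul]
  · refine Finset.sum_congr rfl fun c hc => ?_
    rw [if_neg (Finset.mem_filter.1 hc).2, mul_pow]

/-- The coordinates of short vectors are small. -/
theorem abs_le_twistedNorm {m n : ℕ} {γ : ℝ} (hγ : 1 ≤ γ) (x : Fin m × Fin n → ℤ) (c : Fin m × Fin n) :
    |(x c : ℝ)| ≤ twistedNorm γ x := by
  unfold twistedNorm
  refine Real.le_sqrt_of_sq_le ?_
  rw [sq_abs]
  refine le_trans ?_ (Finset.single_le_sum
    (f := fun c : Fin m × Fin n => ((if (c.1 : ℕ) = 0 then 1 else γ) * (x c : ℝ)) ^ 2)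
    (fun _ _ => sq_nonneg _) (Finset.mem_univ c))
  rw [mul_pow]
  refine le_mul_of_one_le_left (sq_nonneg _) (one_le_pow₀ ?_)
  split_ifs
  · exact le_rfl
  · exact hγ

section NormTest
variable {X : Type} {w : ℕ} {K : ℤ} {I : Set (X → ℤ)} {m n : ℕ}

theorem Comp.sum_sq (hR : Room w K) {c e : ℕ} {ι : Type} [Fintype ι] (hι : (Fintype.card ι : ℤ) ≤ K) (s : Finset ι)
    {v : X → ι → ℤ} (hv : ∀ i, Comp w K c I e fun x => v x i) (he : 2 * e < 60) :
    Comp w K (Fintype.card ι * (2 * c + 2) + 1) I (2 * e + 1) fun x => ∑ i ∈ s, v x i ^ 2 := by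
  have h1 : ∀ i ∈ s, Comp w K (2 * c + 1) I (2 * e) fun x => v x i ^ 2 := fun i _ => by
    have := ((hv i).mul hR (hv i) (by omega)).congr (g := fun x => v x i ^ 2) fun x => (sq _).symm
    rw [two_mul, two_mul]
    exact this
  have hcard : s.card ≤ Fintype.card ι := Finset.card_le_univ s
  exact (Comp.sum hR s h1 (le_trans (by exact_mod_cast hcard) hι) he).mono subset_rfl
    (Nat.add_le_add_right (Nat.mul_le_mul_right _ hcard) 1)

open Classical in
/-- The test whether a vector is short. -/
theorem Comp.twistedNorm_le (hR : Room w K) (hmn : ((m * n : ℕ) : ℤ) ≤ K) {γ β : ℝ} (hγ : γ ^ 2 ≤ (K : ℝ) ^ 3)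
    (hβ : 0 ≤ β) (hβK : β ≤ K) {v : X → Fin m × Fin n → ℤ} (hv : ∀ c, Comp w K 0 I 1 fun x => v x c) :
    Comp w K (4 * (m * n) + 20) I 0 fun x => if twistedNorm γ (v x) ≤ β then 1 else 0 := by
  have hK := hR.two_le
  lift K to ℕ using by linarith
  have hcard : Fintype.card (Fin m × Fin n) = m * n := by
    rw [Fintype.card_prod, Fintype.card_fin, Fintype.card_fin]
  have hK0 : 2 ≤ K := by exact_mod_cast hK
  -- The squared norm is `X + γ² Y` with integers `X, Y ≤ K³`, since there are at most `K`
  -- coordinates of size at most `K`. The reals `γ²` and `β²` enter the program only through the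
  -- three integers obtained here.
  obtain ⟨α, δ, θ, hα, hδ, hθ, htest⟩ := exists_integral_halfPlane (c := γ ^ 2) (B := β ^ 2) (M := K ^ 3)
    (C := K ^ 3) (D := K ^ 2) (by positivity) (sq_nonneg γ) (by push_cast; exact_mod_cast hγ) (sq_nonneg β)
    (by push_cast; exact pow_le_pow_left₀ hβ (by exact_mod_cast hβK) 2)
  have hX := Comp.sum_sq hR (by rw [hcard]; exact hmn) (Finset.univ.filter fun c : Fin m × Fin n => (c.1 : ℕ) = 0) hv (by norm_num)
  have hY := Comp.sum_sq hR (by rw [hcard]; exact hmn) (Finset.univ.filter fun c : Fin m × Fin n => ¬ (c.1 : ℕ) = 0) hv (by norm_num)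
  have hM : (K : ℤ) ^ 3 + 1 ≤ K ^ 4 := by
    have : (1 : ℤ) ≤ (K : ℤ) ^ 3 := one_le_pow₀ (by linarith)
    nlinarith
  have hpos : ∀ e, (1 : ℤ) ≤ (K : ℤ) ^ e := fun e => one_le_pow₀ (by linarith)
  have hdbl : ∀ e, (K : ℤ) ^ e + K ^ e ≤ K ^ (e + 1) := hR.double
  have hα' : |α| ≤ (K : ℤ) ^ 12 := by
    refine hα.trans ?_
    push_cast
    calc (K : ℤ) ^ 3 * (K ^ 3 + 1) ≤ K ^ 3 * K ^ 4 := mul_le_mul_of_nonneg_left hM (by positivity)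
      _ = (K : ℤ) ^ 7 := by ring
      _ ≤ (K : ℤ) ^ 12 := hR.pow_le (by norm_num)
  have hδ' : |δ| ≤ (K : ℤ) ^ 12 := by
    refine hδ.trans ?_
    push_cast
    have h1 : (K : ℤ) ^ 3 * K ^ 3 + 1 ≤ K ^ 7 := by
      have h2 : (K : ℤ) ^ 6 + K ^ 6 ≤ K ^ 7 := hdbl 6
      have h3 := hpos 6
      have h4 : (K : ℤ) ^ 3 * K ^ 3 = K ^ 6 := by ring
      linarith
    calc ((K : ℤ) ^ 3 * K ^ 3 + 1) * ((K : ℤ) ^ 3 + 1) + (1 : ℤ) ≤ (K : ℤ) ^ 7 * K ^ 4 + K ^ 11 := by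
          refine add_le_add (mul_le_mul h1 hM (by positivity) (by positivity)) (hpos 11)
      _ = (K : ℤ) ^ 11 + K ^ 11 := by ring
      _ ≤ (K : ℤ) ^ 12 := hdbl 11
  have hθ' : |θ| ≤ (K : ℤ) ^ 12 := by
    refine hθ.trans ?_
    push_cast
    have h1 : (K : ℤ) ^ 3 * K ^ 2 + 2 ≤ K ^ 7 := by
      have h2 : (K : ℤ) ^ 5 + K ^ 5 ≤ K ^ 6 := hdbl 5
      have h3 := hpos 5
      have h4 : (K : ℤ) ^ 6 + K ^ 6 ≤ K ^ 7 := hdbl 6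
      have h5 : (K : ℤ) ^ 3 * K ^ 2 = K ^ 5 := by ring
      linarith
    calc ((K : ℤ) ^ 3 * K ^ 2 + 2) * ((K : ℤ) ^ 3 + 1) ≤ (K : ℤ) ^ 7 * K ^ 4 :=
          mul_le_mul h1 hM (by positivity) (by positivity)
      _ = (K : ℤ) ^ 11 := by ring
      _ ≤ (K : ℤ) ^ 12 := hR.pow_le (by norm_num)
  have h1 := (((Comp.const hR hα' (by norm_num)).mul hR hX (by norm_num)).add hR
    ((Comp.const hR hδ' (by norm_num)).mul hR hY (by norm_num)) (by norm_num))
  have h2 := (Comp.const hR hθ' (by norm_num)).less hR h1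
  have h3 := (Comp.const hR (v := 1) (e := 0) (by simp) (by norm_num)).sub hR h2 (by norm_num)
  have h4 := h3.congr (g := fun x => if twistedNorm γ (v x) ≤ β then 1 else 0) fun x => by
    have hx := hX.2 x
    have hy := hY.2 x
    dsimp only at hx hy
    rw [abs_of_nonneg (Finset.sum_nonneg fun _ _ => sq_nonneg _)] at hx hy
    set Sx := ∑ c with (c.1 : ℕ) = 0, v x c ^ 2 with hSx
    set Sy := ∑ c with ¬ (c.1 : ℕ) = 0, v x c ^ 2 with hSy
    have hx0 : 0 ≤ Sx := Finset.sum_nonneg fun _ _ => sq_nonneg _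
    have hy0 : 0 ≤ Sy := Finset.sum_nonneg fun _ _ => sq_nonneg _
    have hkey := twistedNorm_le_iff (γ := γ) hβ (v x)
    rw [← hSx, ← hSy] at hkey
    obtain ⟨Nx, hNx⟩ := Int.eq_ofNat_of_zero_le hx0
    obtain ⟨Ny, hNy⟩ := Int.eq_ofNat_of_zero_le hy0
    rw [hNx, hNy] at hkey ⊢
    rw [hNx] at hx
    rw [hNy] at hy
    have := htest Nx Ny (by exact_mod_cast hx) (by exact_mod_cast hy)
    rw [if_congr hkey rfl rfl]
    simp only [Int.cast_natCast]
    rw [if_congr this rfl rfl]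
    split_ifs <;> first | rfl | omega
  refine ⟨h4.1.mono_cost ?_, fun x => Comp.bit (by dsimp only; split_ifs <;> simp)⟩
  rw [hcard]
  omega

end NormTest

/-! ### The Ring-LWE distinguisher as a circuit. -/

namespace Params
variable {P : Params}

theorem map_append_words {n Q : ℕ} (x : (Fin n → ZMod Q) × (Fin n → ZMod Q)) :
    ((List.ofFn fun (i : Fin n) (x : (Fin n → ZMod Q) × (Fin n → ZMod Q)) => ((x.1 i).val : ℤ)) ++
      List.ofFn fun (i : Fin n) (x : (Fin n → ZMod Q) × (Fin n → ZMod Q)) => ((x.2 i).val : ℤ)).map (· x) =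
    words x.1 ++ words x.2 := by
  rw [List.map_append, List.map_ofFn, List.map_ofFn]; rfl

open Classical in
/-- The distinguisher: it tests whether the adversary forges on a given tape, if the public key is computed
from the sample. -/
theorem exists_distinguisher {w : ℕ} {K : ℤ} (hR : Room w K) (A : Program Oracle) (hA : 2 ^ A.word ≤ K)
    (hQ : (P.Q : ℤ) ≤ K) (hn : ((3 * P.n : ℕ) : ℤ) ≤ K) (hγ : P.γ ^ 2 ≤ (K : ℝ) ^ 3) (hβ : 0 ≤ P.β)
    (hβK : P.β ≤ K) (υ : P.RQ) (seed : BitVec P.seedLen) (e : P.Entry) (t : List P.Entry)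
    (ht : ∀ e' ∈ e :: t, ∀ c, |e'.pre c| ≤ K) :
    ∃ D : Program Empty, D.size ≤ w + (simCost P.n A.code.length + 50 * P.n * P.n + 100 * P.n + 100) ∧
      ∀ a b : P.RQ, D.runPlain (words a ++ words b) =
        pure [if Forges (ringMul υ a) (gadget P - ringMul υ b) e
          (simEnd A seed t (ringMul υ a) (gadget P - ringMul υ b))
          (simForgery A seed t (ringMul υ a) (gadget P - ringMul υ b)) then 1 else 0] := by
  have hn1 : (P.n : ℤ) ≤ K := le_trans (Int.ofNat_le.2 (Nat.le_mul_of_pos_left _ (by norm_num))) hn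
  set X := P.RQ × P.RQ
  set ins : List (X → ℤ) := (List.ofFn fun i x => ((x.1 i).val : ℤ)) ++ List.ofFn fun i x => ((x.2 i).val : ℤ)
    with hins
  set I : Set (X → ℤ) := {f | f ∈ ins} with hI
  have hw1 : ringWires (fun x : X => x.1) ⊆ I := by
    rintro _ ⟨i, rfl⟩
    exact List.mem_append_left _ (List.mem_ofFn.2 ⟨i, rfl⟩)
  have hw2 : ringWires (fun x : X => x.2) ⊆ I := by
    rintro _ ⟨i, rfl⟩
    exact List.mem_append_right _ (List.mem_ofFn.2 ⟨i, rfl⟩)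
  set a : X → P.RQ := fun x => ringMul υ x.1 with ha
  set b : X → P.RQ := fun x => gadget P - ringMul υ x.2 with hb
  have ga := RComp.mul hR hQ hn1 (RComp.const hR hQ υ) (RComp.of_subset hw1)
  have gb := RComp.sub hR hQ (RComp.const hR hQ (gadget P))
    (RComp.mul hR hQ hn1 (RComp.const hR hQ υ) (RComp.of_subset hw2))
  have gab : Gen w _ I (ringWires a ∪ ringWires b) := Gen.union ga gb
  obtain ⟨F, g1, hpre, hvec⟩ := exists_comp_sim hR hA hQ hn1 (I := I ∪ (ringWires a ∪ ringWires b))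
    (a := a) (b := b) (fun g hg => Or.inr (Or.inl hg)) (fun g hg => Or.inr (Or.inr hg)) seed A rfl e t ht
  have hcard : Fintype.card (Fin 3 × Fin P.n) = 3 * P.n := by
    rw [Fintype.card_prod, Fintype.card_fin, Fintype.card_fin]
  have hnorm := Comp.twistedNorm_le hR hn hγ hβ hβK hvec
  -- The forgery differs from the programmed preimage exactly if the sum of the squared differences
  -- in the last two blocks is nonzero.
  have hz := (Comp.sum_sq hR (by rw [hcard]; exact hn) (Finset.univ.filter fun c : Fin 3 × Fin P.n => c.1 ≠ 0)
    (fun c => (hvec c).sub hR (hpre c) (by norm_num)) (by norm_num)).isZero hR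
  have hz' := (Comp.const hR (v := 1) (e := 0) (by simp) (by norm_num)).sub hR hz (by norm_num)
  have hbit := (hnorm.mul hR hz' (by norm_num)).congr
    (g := fun x => if Forges (a x) (b x) e (simEnd A seed t (a x) (b x)) (simForgery A seed t (a x) (b x))
      then 1 else 0) fun x => by
    rw [if_congr (forges_sim_iff A seed e t (a x) (b x)) rfl rfl]
    have h0 : (∑ c : Fin 3 × Fin P.n with c.1 ≠ 0,
        (simVec A seed e t (a x) (b x) c - simPre A seed e t (a x) (b x) c) ^ 2) = 0 ↔
        ¬ ∃ c : Fin 3 × Fin P.n, c.1 ≠ 0 ∧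
          simVec A seed e t (a x) (b x) c ≠ simPre A seed e t (a x) (b x) c := by
      rw [Finset.sum_eq_zero_iff_of_nonneg fun _ _ => sq_nonneg _]
      push Not
      simp only [Finset.mem_filter, Finset.mem_univ, true_and, ne_eq, OfNat.ofNat_ne_zero,
        not_false_eq_true, pow_eq_zero_iff, sub_eq_zero]
    rw [if_congr h0 rfl rfl]
    by_cases h1 : twistedNorm P.γ (simVec A seed e t (a x) (b x)) ≤ P.β <;>
    by_cases h2 : ∃ c : Fin 3 × Fin P.n, c.1 ≠ 0 ∧
          simVec A seed e t (a x) (b x) c ≠ simPre A seed e t (a x) (b x) c <;> simp [h1, h2]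
  have gall := gab.trans (g1.trans hbit.1)
  have hlt : ∀ f ∈ ins, ∀ x, |f x| < 2 ^ w := by
    intro f hf x
    refine hR.lt_of_le (e := 1) (by norm_num) ?_
    rw [pow_one]
    rcases List.mem_append.1 hf with hf | hf
    all_goals
      obtain ⟨i, rfl⟩ := List.mem_ofFn.1 hf
      rw [abs_of_nonneg (Int.natCast_nonneg _)]
      exact le_trans (by exact_mod_cast (ZMod.val_lt _).le) hQ
  obtain ⟨D, hD, hrun⟩ := exists_program ins [_] hlt
    (gall.mono subset_rfl (fun f hf => List.mem_singleton.1 hf) le_rfl)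
  refine ⟨D, hD.trans ?_, fun a' b' => ?_⟩
  · rw [hcard, List.length_singleton]
    ring_nf
    omega
  · have := hrun (a', b')
    rw [hins, map_append_words] at this
    exact this

end Params

/-! ### The density of the units -/

/-- The worst case is the set `{1, …, c}`. In the induction on the maximum the largest element is at
least the cardinality, and the bound telescopes. -/
theorem prod_one_sub_inv_two_mul_ge (S : Finset ℕ) (hS : ∀ j ∈ S, 1 ≤ j) :
    1 / ((S.card : ℝ) + 1) ≤ ∏ j ∈ S, (1 - 1 / (2 * (j : ℝ))) := by
  induction S using Finset.induction_on_max with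
  | empty => simp
  | insert a s ha ih =>
    have hnot : a ∉ s := fun h => (ha a h).false
    rw [Finset.prod_insert hnot, Finset.card_insert_of_notMem hnot]
    have ih' := ih fun j hj => hS j (Finset.mem_insert_of_mem hj)
    have hcard : s.card + 1 ≤ a := by
      have : s ⊆ Finset.Ico 1 a := fun j hj =>
        Finset.mem_Ico.2 ⟨hS j (Finset.mem_insert_of_mem hj), ha j hj⟩
      have := Finset.card_le_card this
      have := hS a (Finset.mem_insert_self _ _)
      rw [Nat.card_Ico] at *
      omega
    have hcR : (s.card : ℝ) + 1 ≤ a := by exact_mod_cast hcard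
    set c : ℝ := (s.card : ℝ) with hc
    have hc0 : 0 ≤ c := Nat.cast_nonneg _
    have h1 : 1 - 1 / (2 * (c + 1)) ≤ 1 - 1 / (2 * (a : ℝ)) := by
      have : 1 / (2 * (a : ℝ)) ≤ 1 / (2 * (c + 1)) := one_div_le_one_div_of_le (by positivity) (by linarith)
      linarith
    have h2 : 0 ≤ 1 - 1 / (2 * (c + 1)) := by
      rw [sub_nonneg, div_le_one (by positivity)]
      linarith
    refine le_trans ?_ (mul_le_mul h1 ih' (by positivity) (h2.trans h1))
    push_cast
    rw [← hc]
    rw [div_le_iff₀ (by positivity)]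
    have : (1 - 1 / (2 * (c + 1))) * (1 / (c + 1)) * (c + 1 + 1) =
        (2 * c + 1) * (c + 2) / (2 * (c + 1) ^ 2) := by field_simp; ring
    rw [this, le_div_iff₀ (by positivity)]
    nlinarith

section Units
variable {R : Type} [CommRing R] [Finite R]

instance finite_quotient (I : Ideal R) : Finite (R ⧸ I) :=
  Finite.of_surjective _ Ideal.Quotient.mk_surjective

theorem isUnit_iff_forall_maximal (r : R) :
    IsUnit r ↔ ∀ m : MaximalSpectrum R, Ideal.Quotient.mk m.asIdeal r ≠ 0 := by
  constructor
  · intro h m h0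
    exact m.isMaximal.ne_top (Ideal.eq_top_of_isUnit_mem _ (Ideal.Quotient.eq_zero_iff_mem.1 h0) h)
  · intro h
    by_contra hr
    obtain ⟨I, hI, hrI⟩ := exists_max_ideal_of_mem_nonunits hr
    exact h ⟨I, hI⟩ (Ideal.Quotient.eq_zero_iff_mem.2 hrI)

theorem maximal_quotient_surjective {ι : Type} [Finite ι] (φ : ι → MaximalSpectrum R)
    (hφ : Function.Injective φ) (y : ∀ i, R ⧸ (φ i).asIdeal) :
    ∃ r : R, ∀ i, Ideal.Quotient.mk (φ i).asIdeal r = y i := by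
  refine Ideal.pi_quotient_surjective (fun i j hij => ?_) y
  have h1 := (φ i).isMaximal
  have h2 := (φ j).isMaximal
  exact Ideal.isCoprime_of_isMaximal fun h => hij (hφ (MaximalSpectrum.ext h))

variable [Fintype (MaximalSpectrum R)]

open Classical in
/-- The number of units of a finite ring. -/
theorem card_isUnit (R : Type) [CommRing R] [Fintype R] [Fintype (MaximalSpectrum R)] :
    ((Finset.univ.filter fun r : R => IsUnit r).card : ℝ) =
      Fintype.card R * ∏ m : MaximalSpectrum R, (1 - 1 / (Nat.card (R ⧸ m.asIdeal) : ℝ)) := by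
  let : ∀ m : MaximalSpectrum R, Fintype (R ⧸ m.asIdeal) := fun m => Fintype.ofFinite _
  -- By the Chinese remainder theorem `R` maps onto the product of its residue fields with fibres of
  -- equal size, and units are the elements without a zero component.
  set π : R →+ ∀ m : MaximalSpectrum R, R ⧸ m.asIdeal :=
    AddMonoidHom.mk' (fun r m => Ideal.Quotient.mk m.asIdeal r) (fun a b => funext fun m => map_add _ a b) with hπ
  have hsurj : Function.Surjective π := fun y => by
    obtain ⟨r, hr⟩ := maximal_quotient_surjective (R := R) id Function.injective_id y
    exact ⟨r, funext hr⟩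
  set κ := (Finset.univ.filter fun r : R => π r = 0).card with hκ
  have hfib : ∀ y, (Finset.univ.filter fun r : R => π r = y).card = κ := fun y =>
    AddMonoidHom.card_fiber_eq_of_mem_range π (hsurj y) (hsurj 0)
  have hcount : ∀ S : Finset (∀ m : MaximalSpectrum R, R ⧸ m.asIdeal),
      (Finset.univ.filter fun r : R => π r ∈ S).card = S.card * κ := by
    intro S
    rw [Finset.card_eq_sum_card_fiberwise (f := π) (t := S)]
    · rw [Finset.sum_congr rfl fun y hy => ?_, Finset.sum_const, smul_eq_mul]
      rw [← hfib y, Finset.filter_filter]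
      congr 1
      ext r
      simp only [Finset.mem_filter, Finset.mem_univ, true_and, and_iff_right_iff_imp]
      rintro rfl
      exact hy
    · intro r hr
      exact (Finset.mem_filter.1 hr).2
  have h1 : (Finset.univ.filter fun r : R => IsUnit r).card =
      (∏ m : MaximalSpectrum R, (Fintype.card (R ⧸ m.asIdeal) - 1)) * κ := by
    have := hcount (Fintype.piFinset fun m => Finset.univ.erase 0)
    rw [Fintype.card_piFinset] at this
    simp only [Finset.card_erase_of_mem (Finset.mem_univ _), Finset.card_univ] at this
    rw [← this]
    congr 1
    ext r
    simp only [Finset.mem_filter, Finset.mem_univ, true_and, Fintype.mem_piFinset, Finset.mem_erase, and_true]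
    exact isUnit_iff_forall_maximal r
  have h2 : Fintype.card R = (∏ m : MaximalSpectrum R, Fintype.card (R ⧸ m.asIdeal)) * κ := by
    have := hcount Finset.univ
    simp only [Finset.mem_univ, Finset.filter_true, Finset.card_univ, Fintype.card_pi] at this
    exact this
  rw [h1, h2]
  push_cast
  rw [mul_right_comm, ← Finset.prod_mul_distrib]
  congr 1
  refine Finset.prod_congr rfl fun m _ => ?_
  rw [Nat.card_eq_fintype_card]
  have hpos : 1 ≤ Fintype.card (R ⧸ m.asIdeal) := Fintype.card_pos
  have hne : (Fintype.card (R ⧸ m.asIdeal) : ℝ) ≠ 0 := by positivity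
  rw [Nat.cast_sub hpos]
  field_simp
  simp

theorem two_le_card_quotient (m : MaximalSpectrum R) : 2 ≤ Nat.card (R ⧸ m.asIdeal) := by
  have := m.isMaximal
  let := Ideal.Quotient.field m.asIdeal
  exact Finite.one_lt_card

/-- `R` maps onto a product of residue fields, each with at least two elements. -/
theorem card_maximalSpectrum_le [Fintype R] : Fintype.card (MaximalSpectrum R) ≤ Nat.log 2 (Fintype.card R) := by
  let : ∀ m : MaximalSpectrum R, Fintype (R ⧸ m.asIdeal) := fun m => Fintype.ofFinite _
  have hsurj : Function.Surjective fun (r : R) (m : MaximalSpectrum R) => Ideal.Quotient.mk m.asIdeal r := fun y => by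
    obtain ⟨r, hr⟩ := maximal_quotient_surjective (R := R) id Function.injective_id y
    exact ⟨r, funext hr⟩
  classical
  have h1 := Fintype.card_le_of_surjective _ hsurj
  rw [Fintype.card_pi] at h1
  refine Nat.le_log_of_pow_le (by norm_num) (le_trans ?_ h1)
  rw [← Finset.card_univ, ← Finset.prod_const]
  refine Finset.prod_le_prod' fun m _ => ?_
  rw [← Nat.card_eq_fintype_card]
  exact two_le_card_quotient m

variable {x : R} {n : ℕ}

/-- The maximal ideals of the same norm are few. -/
theorem card_maximal_le (hgen : ∀ r : R, ∃ a : Fin n → ℕ, r = ∑ i, (a i : R) * x ^ (i : ℕ)) (N : ℕ) :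
    (Finset.univ.filter fun m : MaximalSpectrum R => Nat.card (R ⧸ m.asIdeal) = N).card ≤ n := by
  classical
  set M := Finset.univ.filter fun m : MaximalSpectrum R => Nat.card (R ⧸ m.asIdeal) = N with hM
  rcases M.eq_empty_or_nonempty with h0 | ⟨m₀, hm₀⟩
  · rw [h0]; simp
  let : ∀ m : MaximalSpectrum R, Fintype (R ⧸ m.asIdeal) := fun m => Fintype.ofFinite _
  have hcard : ∀ m ∈ M, Nat.card (R ⧸ m.asIdeal) = N := fun m hm => (Finset.mem_filter.1 hm).2
  have hN : 2 ≤ N := hcard m₀ hm₀ ▸ two_le_card_quotient m₀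
  obtain ⟨l, d, hl, hd, hld⟩ : ∃ l d : ℕ, l.Prime ∧ d ≠ 0 ∧ N = l ^ d := by
    have := m₀.isMaximal
    let := Ideal.Quotient.field m₀.asIdeal
    obtain ⟨l, hchar⟩ := CharP.exists (R ⧸ m₀.asIdeal)
    obtain ⟨d, hl, hc⟩ := FiniteField.card (R ⧸ m₀.asIdeal) l
    exact ⟨l, d, hl, d.ne_zero, by rw [← hc, ← hcard m₀ hm₀, Nat.card_eq_fintype_card]⟩
  have hzero : ∀ m ∈ M, (l : R ⧸ m.asIdeal) = 0 := by
    intro m hm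
    have := m.isMaximal
    let := Ideal.Quotient.field m.asIdeal
    have h1 : ((Fintype.card (R ⧸ m.asIdeal) : ℕ) : R ⧸ m.asIdeal) = 0 := Nat.cast_card_eq_zero _
    rw [← Nat.card_eq_fintype_card, hcard m hm, hld, Nat.cast_pow] at h1
    exact pow_eq_zero_iff hd |>.1 h1
  have : NeZero l := ⟨hl.ne_zero⟩
  -- Residue fields of equal size share their characteristic `l`, so coefficients may be reduced
  -- modulo `l`. Then `l ^ n` coefficient vectors cover a product of at least `l ^ M.card` elements.
  have hsurj : Function.Surjective fun (v : Fin n → Fin l) (m : M) =>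
      Ideal.Quotient.mk m.1.asIdeal (∑ i, ((v i : ℕ) : R) * x ^ (i : ℕ)) := by
    intro y
    obtain ⟨r, hr⟩ := maximal_quotient_surjective (R := R) (fun m : M => m.1) Subtype.val_injective y
    obtain ⟨a, ha⟩ := hgen r
    refine ⟨fun i => Fin.ofNat l (a i), funext fun m => ?_⟩
    rw [← hr, ha]
    simp only [map_sum, map_mul, map_natCast, map_pow, Fin.ofNat]
    refine Finset.sum_congr rfl fun i _ => ?_
    congr 1
    conv_rhs => rw [← Nat.mod_add_div (a i) l]
    push_cast
    rw [hzero m.1 m.2]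
    ring
  have h1 := Fintype.card_le_of_surjective _ hsurj
  rw [Fintype.card_pi, Fintype.card_fun, Fintype.card_fin, Fintype.card_fin] at h1
  have h2 : l ^ M.card ≤ l ^ n := by
    refine le_trans ?_ h1
    rw [← Fintype.card_coe, ← Finset.card_univ, ← Finset.prod_const]
    refine Finset.prod_le_prod' fun m _ => ?_
    rw [← Nat.card_eq_fintype_card, hcard m.1 m.2, hld]
    exact Nat.le_self_pow hd l
  exact (Nat.pow_le_pow_iff_right hl.one_lt).1 h2

/-- The odd norms of maximal ideals are `1` modulo `2n`. -/
theorem two_mul_dvd_card_sub_one {k : ℕ} (hx : x ^ 2 ^ k = -1) (m : MaximalSpectrum R)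
    (h2 : (2 : R ⧸ m.asIdeal) ≠ 0) : 2 ^ (k + 1) ∣ Nat.card (R ⧸ m.asIdeal) - 1 := by
  have := m.isMaximal
  let := Ideal.Quotient.field m.asIdeal
  let : Fintype (R ⧸ m.asIdeal) := Fintype.ofFinite _
  set y := Ideal.Quotient.mk m.asIdeal x with hy
  have hy1 : y ^ 2 ^ k = -1 := by rw [hy, ← map_pow, hx, map_neg, map_one]
  have hne : y ^ 2 ^ k ≠ 1 := by
    rw [hy1]
    intro h
    apply h2
    linear_combination -h
  -- Since `y ^ n = -1 ≠ 1`, the order of `y` is exactly `2 n`, and it divides the order of the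
  -- multiplicative group of the residue field.
  have hord : orderOf y = 2 ^ (k + 1) := orderOf_eq_prime_pow hne (by rw [pow_succ, pow_mul, hy1]; norm_num)
  rw [← hord, Nat.card_eq_fintype_card]
  have hy0 : y ≠ 0 := by
    rintro h
    rw [h, zero_pow (by positivity)] at hy1
    have : (1 : R ⧸ m.asIdeal) = 0 := by linear_combination hy1
    exact one_ne_zero this
  exact orderOf_dvd_of_pow_eq_one (FiniteField.pow_card_sub_one_eq_one y hy0)

/-- There is at most one maximal ideal above `2`. -/
theorem eq_of_two_eq_zero (hgen : ∀ r : R, ∃ a : Fin n → ℕ, r = ∑ i, (a i : R) * x ^ (i : ℕ)) {k : ℕ}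
    (hx : x ^ 2 ^ k = -1) (m m' : MaximalSpectrum R) (h : (2 : R ⧸ m.asIdeal) = 0)
    (h' : (2 : R ⧸ m'.asIdeal) = 0) : m = m' := by
  have hone : ∀ m : MaximalSpectrum R, (2 : R ⧸ m.asIdeal) = 0 → Ideal.Quotient.mk m.asIdeal x = 1 := by
    intro m h
    have := m.isMaximal
    let := Ideal.Quotient.field m.asIdeal
    have hc : CharP (R ⧸ m.asIdeal) 2 := CharTwo.of_one_ne_zero_of_two_eq_zero one_ne_zero h
    -- In characteristic 2 the power is `x ^ n - 1 = -2 = 0`. So `x` becomes 1, and membership in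
    -- the ideal depends only on the parity of the coefficient sum.
    have h1 : (Ideal.Quotient.mk m.asIdeal x - 1) ^ 2 ^ k = 0 := by
      rw [sub_pow_char_pow, one_pow, ← map_pow, hx, map_neg, map_one]
      linear_combination -h
    exact sub_eq_zero.1 (pow_eq_zero_iff (by positivity) |>.1 h1)
  refine MaximalSpectrum.ext (m.isMaximal.eq_of_le m'.isMaximal.ne_top fun r hr => ?_)
  obtain ⟨a, rfl⟩ := hgen r
  rw [← Ideal.Quotient.eq_zero_iff_mem] at hr ⊢
  simp only [map_sum, map_mul, map_natCast, map_pow, hone m h, one_pow, mul_one] at hr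
  simp only [map_sum, map_mul, map_natCast, map_pow, hone m' h', one_pow, mul_one]
  rw [← Nat.cast_sum] at hr ⊢
  set s := ∑ i, a i
  rcases Nat.even_or_odd' s with ⟨c, hc | hc⟩
  · rw [hc]; push_cast; rw [h', zero_mul]
  · rw [hc] at hr
    push_cast at hr
    rw [h, zero_mul, zero_add] at hr
    have := m.isMaximal
    exact absurd hr one_ne_zero

open Classical in
/-- The units are dense. -/
theorem card_isUnit_ge [Fintype R] {k : ℕ} (hx : x ^ 2 ^ k = -1)
    (hgen : ∀ r : R, ∃ a : Fin (2 ^ k) → ℕ, r = ∑ i, (a i : R) * x ^ (i : ℕ)) : (Fintype.card R : ℝ) ≤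
      2 * (Nat.log 2 (Fintype.card R) + 1) * (Finset.univ.filter fun r : R => IsUnit r).card := by
  set N : MaximalSpectrum R → ℕ := fun m => Nat.card (R ⧸ m.asIdeal) with hN
  set J := Nat.log 2 (Fintype.card R)
  rw [card_isUnit]
  have hN2 : ∀ m, (2 : ℝ) ≤ N m := fun m => by exact_mod_cast two_le_card_quotient m
  have hfac0 : ∀ m, 0 ≤ 1 - 1 / (N m : ℝ) := fun m => by
    rw [sub_nonneg, div_le_one (by linarith [hN2 m])]; linarith [hN2 m]
  set E := Finset.univ.filter fun m : MaximalSpectrum R => (2 : R ⧸ m.asIdeal) = 0 with hE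
  set O := Finset.univ.filter fun m : MaximalSpectrum R => ¬ (2 : R ⧸ m.asIdeal) = 0 with hO
  have hEc : E.card ≤ 1 := Finset.card_le_one.2 fun m hm m' hm' =>
    eq_of_two_eq_zero hgen hx m m' (Finset.mem_filter.1 hm).2 (Finset.mem_filter.1 hm').2
  have h1 : 1 / 2 ≤ ∏ m ∈ E, (1 - 1 / (N m : ℝ)) := by
    calc (1 / 2 : ℝ) ≤ (1 / 2) ^ E.card := by
          interval_cases E.card <;> norm_num
      _ = ∏ m ∈ E, (1 / 2 : ℝ) := (Finset.prod_const _).symm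
      _ ≤ _ := Finset.prod_le_prod (fun _ _ => by norm_num) fun m _ => by
          have : 1 / (N m : ℝ) ≤ 1 / 2 := one_div_le_one_div_of_le (by norm_num) (hN2 m)
          linarith
  have hodd : ∀ m ∈ O, ∃ j, 1 ≤ j ∧ N m = 2 * 2 ^ k * j + 1 := by
    intro m hm
    obtain ⟨j, hj⟩ := two_mul_dvd_card_sub_one hx m (Finset.mem_filter.1 hm).2
    have h3 := two_le_card_quotient m
    have h4 : 2 ≤ N m := h3
    have h5 : N m - 1 = 2 * 2 ^ k * j := by rw [mul_comm 2, ← pow_succ]; exact hj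
    refine ⟨j, Nat.one_le_iff_ne_zero.2 ?_, by omega⟩
    rintro rfl
    rw [mul_zero] at h5
    omega
  have h2 : 1 / ((J : ℝ) + 1) ≤ ∏ m ∈ O, (1 - 1 / (N m : ℝ)) := by
    set S := O.image N with hS
    have hSj : ∀ y ∈ S, ∃ j, 1 ≤ j ∧ y = 2 * 2 ^ k * j + 1 := by
      intro y hy
      obtain ⟨m, hm, rfl⟩ := Finset.mem_image.1 hy
      exact hodd m hm
    choose! jj hj1 hj2 using hSj
    have hinj : Set.InjOn jj S := fun y hy y' hy' h => by rw [hj2 y hy, hj2 y' hy', h]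
    have hcard : (S.image jj).card ≤ J := Finset.card_image_le.trans
      (Finset.card_image_le.trans ((Finset.card_le_univ _).trans card_maximalSpectrum_le))
    have h3 := prod_one_sub_inv_two_mul_ge (S.image jj) fun j hj => by
      obtain ⟨y, hy, rfl⟩ := Finset.mem_image.1 hj
      exact hj1 y hy
    rw [Finset.prod_image hinj] at h3
    rw [← Finset.prod_fiberwise_of_maps_to (g := N) (t := S) fun m hm => Finset.mem_image_of_mem _ hm]
    refine (one_div_le_one_div_of_le (by positivity) (by gcongr)).trans (h3.trans ?_)
    refine Finset.prod_le_prod (fun y hy => ?_) fun y hy => ?_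
    · have : (1 : ℝ) ≤ jj y := by exact_mod_cast hj1 y hy
      rw [sub_nonneg, div_le_one (by positivity)]; linarith
    · have hy' : (y : ℝ) = 2 * 2 ^ k * jj y + 1 := by exact_mod_cast hj2 y hy
      have hjy : (1 : ℝ) ≤ jj y := by exact_mod_cast hj1 y hy
      have hp : (1 : ℝ) ≤ 2 ^ k := one_le_pow₀ (by norm_num)
      have hy1 : 1 < (y : ℝ) := by rw [hy']; nlinarith
      rw [Finset.prod_congr rfl fun m hm => by rw [(Finset.mem_filter.1 hm).2], Finset.prod_const]
      have hc : (O.filter fun m => N m = y).card ≤ 2 ^ k :=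
        le_trans (Finset.card_le_card fun m hm => Finset.mem_filter.2 ⟨Finset.mem_univ _, (Finset.mem_filter.1 hm).2⟩)
          (card_maximal_le hgen y)
      have hb0 : 0 ≤ 1 - 1 / (y : ℝ) := by rw [sub_nonneg, div_le_one (by linarith)]; linarith
      have hb1 : 1 - 1 / (y : ℝ) ≤ 1 := by
        have : 0 ≤ 1 / (y : ℝ) := by positivity
        linarith
      refine le_trans ?_ (pow_le_pow_of_le_one hb0 hb1 hc)
      -- The at most `n` ideals of norm `y = 2 n j + 1` contribute at least `1 - n / y ≥ 1 - 1 / (2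
      -- j)`. Distinct norms have distinct `j`, so the product over all norms is only
      -- logarithmically small.
      have hbern := one_add_mul_le_pow (a := -(1 / (y : ℝ))) (by linarith) (2 ^ k)
      rw [← sub_eq_add_neg] at hbern
      refine le_trans ?_ hbern
      have : ((2 ^ k : ℕ) : ℝ) * (1 / y) ≤ 1 / (2 * jj y) := by
        push_cast
        rw [mul_one_div, div_le_div_iff₀ (by linarith) (by positivity)]
        rw [hy']; nlinarith
      linarith
  have h3 : 1 / (2 * ((J : ℝ) + 1)) ≤ ∏ m, (1 - 1 / (N m : ℝ)) := by
    rw [← Finset.prod_filter_mul_prod_filter_not Finset.univ fun m : MaximalSpectrum R => (2 : R ⧸ m.asIdeal) = 0]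
    calc 1 / (2 * ((J : ℝ) + 1)) = 1 / 2 * (1 / ((J : ℝ) + 1)) := by field_simp
      _ ≤ _ := mul_le_mul h1 h2 (by positivity) (Finset.prod_nonneg fun m _ => hfac0 m)
  rw [div_le_iff₀ (by positivity)] at h3
  have hR0 : (0 : ℝ) ≤ Fintype.card R := Nat.cast_nonneg _
  calc (Fintype.card R : ℝ) = Fintype.card R * 1 := (mul_one _).symm
    _ ≤ Fintype.card R * ((∏ m, (1 - 1 / (N m : ℝ))) * (2 * (J + 1))) := mul_le_mul_of_nonneg_left h3 hR0
    _ = _ := by ring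

end Units

/-! ### Units of the ring modulo `Q` -/

section RingUnits
variable {n Q : ℕ} [NeZero n]

/-- `u` is invertible. -/
def IsRingUnit {S : Type} [CommRing S] (u : Fin n → S) : Prop := ∃ v, ringMul u v = Pi.single 0 1

theorem toQuot_one {S : Type} [CommRing S] : toQuot (Pi.single 0 1 : Fin n → S) = 1 := by
  rw [toQuot_single]; simp

theorem toQuot_ringPow {S : Type} [CommRing S] (u : Fin n → S) (k : ℕ) :
    toQuot (ringPow u k) = toQuot u ^ k := by
  induction k with
  | zero => rw [ringPow, toQuot_one, pow_zero]
  | succ k ih => rw [ringPow, toQuot_ringMul, ih, pow_succ']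

theorem isRingUnit_iff {S : Type} [CommRing S] [Nontrivial S] (u : Fin n → S) :
    IsRingUnit u ↔ IsUnit (toQuot u) := by
  rw [isUnit_iff_exists_inv]
  constructor
  · rintro ⟨v, hv⟩
    exact ⟨toQuot v, by rw [← toQuot_ringMul, hv, toQuot_one]⟩
  · rintro ⟨y, hy⟩
    obtain ⟨v, rfl⟩ := toQuot_surjective y
    exact ⟨v, toQuot_injective (by rw [toQuot_ringMul, hy, toQuot_one])⟩

theorem ringMul_bijective {S : Type} [CommRing S] {u : Fin n → S} (hu : IsRingUnit u) :
    Function.Bijective (ringMul u) := by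
  obtain ⟨v, hv⟩ := hu
  refine ⟨fun x y h => ?_, fun y => ⟨ringMul v y, ?_⟩⟩
  · have := congrArg (ringMul v) h
    rwa [← ringMul_assoc, ← ringMul_assoc, ringMul_comm v u, hv, one_ringMul, one_ringMul] at this
  · rw [← ringMul_assoc, hv, one_ringMul]

theorem lt_two_pow_size_mul (n Q : ℕ) : Q ^ n < 2 ^ (n * Q.size) ∨ n = 0 := by
  rcases eq_or_ne n 0 with h | h
  · exact Or.inr h
  · refine Or.inl ?_
    rw [mul_comm, pow_mul]
    exact Nat.pow_lt_pow_left (Nat.lt_size_self Q) h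

variable [NeZero Q]

/-- Inverses are powers. -/
theorem exists_ringPow_inv (hQ : 1 < Q) : ∃ E : ℕ, E.size ≤ n * Q.size ∧
      ∀ u : Fin n → ZMod Q, IsRingUnit u → ringMul u (ringPow u E) = Pi.single 0 1 := by
  have : Fact (1 < Q) := ⟨hQ⟩
  have : Nontrivial (ZMod Q) := ZMod.nontrivial Q
  let e : (Fin n → ZMod Q) ≃ NegaRing (ZMod Q) n := Equiv.ofBijective toQuot ⟨toQuot_injective, toQuot_surjective⟩
  have hfin : Finite (NegaRing (ZMod Q) n) := Finite.of_equiv _ e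
  -- By Lagrange's theorem `u ^ (U - 1)` inverts every unit `u`. This exponent is a constant of the
  -- circuit with at most `n * Q.size` binary digits, so no Euclidean algorithm is needed.
  set U := Nat.card (NegaRing (ZMod Q) n)ˣ with hU
  have hUpos : 0 < U := Nat.card_pos
  have hUle : U ≤ Q ^ n := by
    have h1 : U ≤ Nat.card (NegaRing (ZMod Q) n) := Nat.card_le_card_of_injective _ Units.val_injective
    rw [← Nat.card_congr e, Nat.card_eq_fintype_card, Fintype.card_fun, ZMod.card, Fintype.card_fin] at h1
    exact h1
  refine ⟨U - 1, Nat.size_le.2 ?_, fun u hu => ?_⟩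
  · have := (lt_two_pow_size_mul n Q).resolve_right (NeZero.ne n)
    omega
  · refine toQuot_injective ?_
    rw [toQuot_ringMul, toQuot_ringPow, toQuot_one, ← pow_succ', Nat.sub_add_cancel hUpos]
    obtain ⟨y, hy⟩ := (isRingUnit_iff u).1 hu
    rw [← hy, ← Units.val_pow_eq_pow_val, hU, pow_card_eq_one', Units.val_one]

open Classical in
/-- The density of the units. -/
theorem ex_isRingUnit_ge {k : ℕ} (hQ : 1 < Q) : 1 ≤ (2 * (2 ^ k * Q.size + 1) : ℕ) *
      ex (PMF.uniformOfFintype (Fin (2 ^ k) → ZMod Q)) fun u => if IsRingUnit u then 1 else 0 := by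
  have : Fact (1 < Q) := ⟨hQ⟩
  have : Nontrivial (ZMod Q) := ZMod.nontrivial Q
  let e : (Fin (2 ^ k) → ZMod Q) ≃ NegaRing (ZMod Q) (2 ^ k) :=
    Equiv.ofBijective toQuot ⟨toQuot_injective, toQuot_surjective⟩
  have hfin : Fintype (NegaRing (ZMod Q) (2 ^ k)) := Fintype.ofEquiv _ e
  have hfinm : Fintype (MaximalSpectrum (NegaRing (ZMod Q) (2 ^ k))) := Fintype.ofFinite _
  have hgen : ∀ r : NegaRing (ZMod Q) (2 ^ k), ∃ a : Fin (2 ^ k) → ℕ,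
      r = ∑ i, (a i : NegaRing (ZMod Q) (2 ^ k)) * AdjoinRoot.root _ ^ (i : ℕ) := by
    intro r
    obtain ⟨a, rfl⟩ := toQuot_surjective r
    refine ⟨fun i => (a i).val, ?_⟩
    rw [toQuot_eq_sum]
    refine Finset.sum_congr rfl fun i _ => ?_
    rw [← map_natCast (AdjoinRoot.of _), ZMod.natCast_zmod_val]
  have h := card_isUnit_ge root_pow_eq hgen
  have hcard : Fintype.card (NegaRing (ZMod Q) (2 ^ k)) = Q ^ 2 ^ k := by
    rw [← Fintype.card_congr e, Fintype.card_fun, ZMod.card, Fintype.card_fin]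
  have hlog : Nat.log 2 (Q ^ 2 ^ k) ≤ 2 ^ k * Q.size :=
    (Nat.log_lt_of_lt_pow (pow_ne_zero _ (NeZero.ne Q))
      ((lt_two_pow_size_mul _ Q).resolve_right (NeZero.ne _))).le
  have hU : (Finset.univ.filter fun r : NegaRing (ZMod Q) (2 ^ k) => IsUnit r).card =
      (Finset.univ.filter fun u : Fin (2 ^ k) → ZMod Q => IsRingUnit u).card := by
    symm
    refine Finset.card_bij (fun u _ => e u) (fun u hu => ?_) (fun _ _ _ _ h => e.injective h) fun y hy => ?_
    · exact Finset.mem_filter.2 ⟨Finset.mem_univ _, (isRingUnit_iff u).1 (Finset.mem_filter.1 hu).2⟩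
    · refine ⟨e.symm y, Finset.mem_filter.2 ⟨Finset.mem_univ _, (isRingUnit_iff _).2 ?_⟩, e.apply_symm_apply y⟩
      have : toQuot (e.symm y) = y := e.apply_symm_apply y
      rw [this]
      exact (Finset.mem_filter.1 hy).2
  rw [hcard, hU] at h
  have h' : Q ^ 2 ^ k ≤ 2 * (2 ^ k * Q.size + 1) *
      (Finset.univ.filter fun u : Fin (2 ^ k) → ZMod Q => IsRingUnit u).card := by
    have h2 : Q ^ 2 ^ k ≤ 2 * (Nat.log 2 (Q ^ 2 ^ k) + 1) *
      (Finset.univ.filter fun u : Fin (2 ^ k) → ZMod Q => IsRingUnit u).card := by exact_mod_cast h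
    refine h2.trans (Nat.mul_le_mul_right _ ?_)
    omega
  rw [ex_uniformOfFintype, Finset.sum_ite, Finset.sum_const_zero, add_zero, Finset.sum_const, nsmul_eq_mul,
    mul_one, Fintype.card_fun, ZMod.card, Fintype.card_fin]
  rw [mul_left_comm, ← ENNReal.div_eq_inv_mul, ENNReal.le_div_iff_mul_le (Or.inl (by
    simp [NeZero.ne Q])) (Or.inl (ENNReal.natCast_ne_top _)), one_mul]
  exact_mod_cast h'

end RingUnits

/-! ### Solvers for Ring-SIS as circuits -/

section Solver
variable {n m Q : ℕ} [NeZero Q]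

/-- The inputs of a solver. -/
def rowWires (m n Q : ℕ) : List ((Fin m → Fin n → ZMod Q) → ℤ) :=
  (List.ofFn fun i : Fin m => List.ofFn fun (j : Fin n) (A : Fin m → Fin n → ZMod Q) => ((A i j).val : ℤ)).flatten

theorem mem_rowWires (i : Fin m) (j : Fin n) :
    (fun A : Fin m → Fin n → ZMod Q => ((A i j).val : ℤ)) ∈ rowWires m n Q :=
  List.mem_flatten.2 ⟨_, List.mem_ofFn.2 ⟨i, rfl⟩, List.mem_ofFn.2 ⟨j, rfl⟩⟩

theorem ringWires_row_subset (i : Fin m) :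
    ringWires (fun A : Fin m → Fin n → ZMod Q => A i) ⊆ {f | f ∈ rowWires m n Q} := by
  rintro _ ⟨j, rfl⟩
  exact mem_rowWires i j

theorem map_rowWires (A : Fin m → Fin n → ZMod Q) :
    (rowWires m n Q).map (· A) = (List.ofFn fun i => words (A i)).flatten := by
  rw [rowWires, List.map_flatten, List.map_ofFn]
  congr 2
  funext i
  exact map_words (fun A : Fin m → Fin n → ZMod Q => A i) A

open Classical in
/-- A circuit for a short solution is a solver. -/
theorem exists_solver {w c : ℕ} {K : ℤ} (hR : Room w K) (hQ : (Q : ℤ) ≤ K)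
    (f : (Fin m → Fin n → ZMod Q) → Fin m × Fin n → ℤ)
    (hf : Gen w c {g | g ∈ rowWires m n Q} (Set.range fun i A => f A i)) :
    ∃ S : Program Empty, S.size ≤ w + c + m * n ∧ ∀ γ β : ℝ,
      rsisExperiment n m Q γ β S true = ex (PMF.uniformOfFintype (Fin m → Fin n → ZMod Q)) fun A =>
        if f A ≠ 0 ∧ applyRow A (f A) = 0 ∧ twistedNorm γ (f A) ≤ β then 1 else 0 := by
  set outs : List ((Fin m → Fin n → ZMod Q) → ℤ) :=
    List.ofFn fun k : Fin (m * n) => fun A => f A (finProdFinEquiv.symm k) with houts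
  have hlt : ∀ g ∈ rowWires m n Q, ∀ x, |g x| < 2 ^ w := by
    intro g hg x
    obtain ⟨l, hl, hgl⟩ := List.mem_flatten.1 hg
    obtain ⟨i, rfl⟩ := List.mem_ofFn.1 hl
    obtain ⟨j, rfl⟩ := List.mem_ofFn.1 hgl
    refine hR.lt_of_le (e := 1) (by norm_num) ?_
    rw [pow_one, abs_of_nonneg (Int.natCast_nonneg _)]
    exact le_trans (by exact_mod_cast (ZMod.val_lt _).le) hQ
  obtain ⟨S, hS, hrun⟩ := exists_program (rowWires m n Q) outs hlt (hf.mono subset_rfl (fun g hg => by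
    obtain ⟨k, rfl⟩ := List.mem_ofFn.1 hg
    exact ⟨_, rfl⟩) le_rfl)
  refine ⟨S, by rwa [houts, List.length_ofFn] at hS, fun γ β => ?_⟩
  have hout : ∀ A, (fun c : Fin m × Fin n => (outs.map (· A)).getD (c.1 * n + c.2) 0) = f A := by
    intro A
    funext c
    have hk : (c.1 : ℕ) * n + c.2 = (finProdFinEquiv c : ℕ) := by
      rw [finProdFinEquiv_apply_val]; ring
    rw [hk, houts, List.map_ofFn, List.getD_eq_getElem?_getD, List.getElem?_ofFn, dif_pos (Fin.is_lt _)]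
    exact congrArg (f A) (finProdFinEquiv.symm_apply_apply c)
  unfold rsisExperiment
  rw [prob_true_eq_ex, ex_bind]
  congr 1; funext A
  rw [← map_rowWires, hrun, ex_bind, ex_pure, ex_pure]
  simp only [hout, decide_eq_true_eq]

theorem ex_uniform_three {α : Type} [Fintype α] [Nonempty α] (F : (Fin 3 → α) → ℝ≥0∞) :
    ex (PMF.uniformOfFintype (Fin 3 → α)) F = ex (PMF.uniformOfFintype α) fun x =>
      ex (PMF.uniformOfFintype α) fun y => ex (PMF.uniformOfFintype α) fun z => F ![x, y, z] := by
  let e : α × α × α ≃ (Fin 3 → α) :=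
    ⟨fun t => ![t.1, t.2.1, t.2.2], fun f => (f 0, f 1, f 2), fun t => rfl, fun f => by
      funext i; fin_cases i <;> rfl⟩
  rw [← uniformOfFintype_map_equiv e, ex_uniform_prod]
  congr 1; funext x
  rw [ex_uniform_prod]
  rfl

end Solver

/-! ### From forgeries to solutions of Ring-SIS. -/

theorem twistedNorm_eq_norm {m n : ℕ} (γ : ℝ) (x : Fin m × Fin n → ℤ) :
    twistedNorm γ x = ‖(WithLp.toLp 2 fun c : Fin m × Fin n => (if (c.1 : ℕ) = 0 then 1 else γ) * (x c : ℝ) :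
      EuclideanSpace ℝ (Fin m × Fin n))‖ := by
  rw [EuclideanSpace.norm_eq, twistedNorm]
  simp only [Real.norm_eq_abs, sq_abs]

theorem twistedNorm_sub_le {m n : ℕ} (γ : ℝ) (x y : Fin m × Fin n → ℤ) :
    twistedNorm γ (x - y) ≤ twistedNorm γ x + twistedNorm γ y := by
  rw [twistedNorm_eq_norm, twistedNorm_eq_norm, twistedNorm_eq_norm]
  refine le_trans (le_of_eq ?_) (norm_sub_le _ _)
  congr 1
  ext c
  simp [mul_sub]

namespace Params
variable {P : Params}

/-- The simulation creates no preimages of its own: every vector in the table comes from the tape,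
so shortness of the tape is inherited. -/
theorem mem_htbl_simRun {p : (Fin 3 × Fin P.n → ℤ) → Prop} {w : ℕ} {a b : P.RQ} (code : List (Instr Oracle))
    (t : List P.Entry) (σ : P.Sim) (hσ : ∀ y ∈ σ.htbl, p y.2) (ht : ∀ e ∈ t, p e.pre) :
    ∀ y ∈ (simRun w a b code t σ).htbl, p y.2 := by
  induction code generalizing t σ with
  | nil => exact hσ
  | cons i code ih =>
    cases t with
    | nil => exact hσ
    | cons e t =>
      refine ih t _ ?_ fun e' he' => ht e' (List.mem_cons_of_mem _ he')
      have he := ht e List.mem_cons_self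
      have hpre : ∀ k, p (σ.pre k e.pre) := fun k => by
        unfold Sim.pre
        cases h : σ.htbl.lookup k with
        | none => exact he
        | some z =>
          obtain ⟨l₁, l₂, hl, -⟩ := List.lookup_eq_some_iff.1 h
          exact hσ (k, z) (by rw [hl]; simp)
      cases i with
      | query o args =>
        cases o with
        | hash =>
          intro y hy
          rcases List.mem_cons.1 hy with rfl | hy
          · exact hpre _
          · exact hσ y hy
        | expand => exact hσ
        | sign =>
          intro y hy
          rcases List.mem_cons.1 hy with rfl | hy
          · exact he
          · exact hσ y hy
      | _ => exact hσ

theorem simPre_of_forall {p : (Fin 3 × Fin P.n → ℤ) → Prop} (A : Program Oracle) (seed : BitVec P.seedLen)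
    (e : P.Entry) (t : List P.Entry) (a b : P.RQ) (h : ∀ e' ∈ e :: t, p e'.pre) : p (simPre A seed e t a b) := by
  have h1 : ∀ y ∈ (simEnd A seed t a b).htbl, p y.2 :=
    mem_htbl_simRun A.code t _ (by simp [simStart]) fun e' he' => h e' (List.mem_cons_of_mem _ he')
  unfold simPre Sim.pre
  cases hl : (simEnd A seed t a b).htbl.lookup ((simForgery A seed t a b).1, (simForgery A seed t a b).2.1) with
  | none => exact h e List.mem_cons_self
  | some z =>
    obtain ⟨l₁, l₂, hl', -⟩ := List.lookup_eq_some_iff.1 hl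
    exact h1 _ (hl' ▸ List.mem_append_right l₁ List.mem_cons_self)

/-- The verifier's residual is a representative of what is missing to the target, hence the
completed forgery has the same image as the programmed preimage. -/
theorem target_simVec (A : Program Oracle) (seed : BitVec P.seedLen) (e : P.Entry) (t : List P.Entry)
    (a b : P.RQ) : target a b (simVec A seed e t a b) = target a b (simPre A seed e t a b) := by
  set u := target a b (simPre A seed e t a b) with hu
  have h0 : P.block 0 (simVec A seed e t a b) = residual a b u (simForgery A seed t a b).2.2 := rfl
  have h1 : P.block 1 (simVec A seed e t a b) = (simForgery A seed t a b).2.2.1 := rfl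
  have h2 : P.block 2 (simVec A seed e t a b) = (simForgery A seed t a b).2.2.2 := rfl
  rw [target, h0, h1, h2, residual, modQ_centered]
  abel

theorem target_sub (a b : P.RQ) (x y : Fin 3 × Fin P.n → ℤ) :
    target a b (x - y) = target a b x - target a b y := by
  have h : ∀ i, P.block i (x - y) = P.block i x - P.block i y := fun i => rfl
  simp only [target, h, modQ_sub, ringMul_sub]
  abel

/-- With an invertible first entry the row is `x 0` times `(1, x 1 / x 0, x 2 / x 0)`. -/
theorem applyRow_eq (x : Fin 3 → P.RQ) {v : P.RQ} (hv : ringMul (x 0) v = Pi.single 0 1)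
    (d : Fin 3 × Fin P.n → ℤ) :
    applyRow x d = ringMul (x 0) (target (ringMul v (x 1)) (ringMul v (x 2)) d) := by
  have h : ∀ i, modQ P.Q (fun j => d (i, j)) = modQ P.Q (P.block i d) := fun i => rfl
  rw [applyRow, Fin.sum_univ_three, target, ringMul_add, ringMul_add, h, h, h]
  rw [← ringMul_assoc (x 0) (ringMul v (x 1)), ← ringMul_assoc (x 0) v, hv, one_ringMul,
    ← ringMul_assoc (x 0) (ringMul v (x 2)), ← ringMul_assoc (x 0) v, hv, one_ringMul]

/-- A forgery yields a solution of Ring-SIS. -/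
theorem Forges.solution {A : Program Oracle} {seed : BitVec P.seedLen} {e : P.Entry} {t : List P.Entry}
    {a b : P.RQ} (h : Forges a b e (simEnd A seed t a b) (simForgery A seed t a b))
    (ht : ∀ e' ∈ e :: t, twistedNorm P.γ e'.pre ≤ P.β) {d : Fin 3 × Fin P.n → ℤ}
    (hd : d = simVec A seed e t a b - simPre A seed e t a b) :
    d ≠ 0 ∧ target a b d = 0 ∧ twistedNorm P.γ d ≤ 2 * P.β := by
  obtain ⟨h1, c, -, h2⟩ := (forges_sim_iff A seed e t a b).1 h
  refine ⟨?_, ?_, ?_⟩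
  · rintro h0
    rw [h0] at hd
    exact h2 (sub_eq_zero.1 (congrFun hd c).symm)
  · rw [hd, target_sub, target_simVec, sub_self]
  · have h3 := simPre_of_forall (p := fun z => twistedNorm P.γ z ≤ P.β) A seed e t a b ht
    rw [hd]
    refine (twistedNorm_sub_le _ _ _).trans ?_
    linarith

/-- A bound for the cost of the solver. -/
def solverCost (n s N : ℕ) : ℕ := simCost n N + n * s * (2 * (n * (n * 4 + 3))) + 20 * n * n + 20 * n + 100

open Classical in
/-- The solver for Ring-SIS runs the simulation on the public key `(a, b) = (A₁ / A₀, A₂ / A₀)`. -/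
theorem exists_forge_solver {w : ℕ} {K : ℤ} (hR : Room w K) (A : Program Oracle) (hA : 2 ^ A.word ≤ K)
    (hQ : (P.Q : ℤ) ≤ K) (hn : (P.n : ℤ) ≤ K) (hQ1 : 1 < P.Q) (seed : BitVec P.seedLen) (e : P.Entry)
    (t : List P.Entry) (ht : ∀ e' ∈ e :: t, ∀ c, |e'.pre c| ≤ K)
    (htβ : ∀ e' ∈ e :: t, twistedNorm P.γ e'.pre ≤ P.β) :
    ∃ S : Program Empty, S.size ≤ w + solverCost P.n P.Q.size A.code.length ∧
      (ex (PMF.uniformOfFintype P.RQ) fun a => ex (PMF.uniformOfFintype P.RQ) fun b =>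
        if Forges a b e (simEnd A seed t a b) (simForgery A seed t a b) then 1 else 0) ≤
      (2 * (P.n * P.Q.size + 1) : ℕ) * rsisExperiment P.n 3 P.Q P.γ (2 * P.β) S true := by
  obtain ⟨E, hE, hinv⟩ := exists_ringPow_inv (n := P.n) hQ1
  set I : Set ((Fin 3 → P.RQ) → ℤ) := {g | g ∈ rowWires 3 P.n P.Q} with hI
  set v : (Fin 3 → P.RQ) → P.RQ := fun x => ringPow (x 0) E with hv
  set a : (Fin 3 → P.RQ) → P.RQ := fun x => ringMul (v x) (x 1) with ha
  set b : (Fin 3 → P.RQ) → P.RQ := fun x => ringMul (v x) (x 2) with hb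
  have gv : Gen w _ I (ringWires v) := RComp.pow hR hQ hn (ringWires_row_subset (m := 3) (n := P.n) (Q := P.Q) 0) E
  have ga := RComp.mul (w := w) hR hQ hn (RComp.of_subset (I := I ∪ ringWires v) (u := v) Set.subset_union_right)
    (RComp.of_subset ((ringWires_row_subset (m := 3) (n := P.n) (Q := P.Q) 1).trans Set.subset_union_left))
  have gb := RComp.mul (w := w) hR hQ hn (RComp.of_subset (I := I ∪ ringWires v) (u := v) Set.subset_union_right)
    (RComp.of_subset ((ringWires_row_subset (m := 3) (n := P.n) (Q := P.Q) 2).trans Set.subset_union_left))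
  have gab : Gen w _ (I ∪ ringWires v) (ringWires a ∪ ringWires b) := Gen.union ga gb
  have gall := gv.trans gab
  obtain ⟨F, g1, hpre, hvec⟩ := exists_comp_sim hR hA hQ hn (I := I ∪ (ringWires a ∪ ringWires b))
    (a := a) (b := b) (fun g hg => Or.inr (Or.inl hg)) (fun g hg => Or.inr (Or.inr hg)) seed A rfl e t ht
  set f : (Fin 3 → P.RQ) → Fin 3 × Fin P.n → ℤ := fun x =>
    simVec A seed e t (a x) (b x) - simPre A seed e t (a x) (b x) with hf
  have g2 : Gen w (3 * P.n * 1) (I ∪ (ringWires a ∪ ringWires b) ∪ F) (Set.range fun i x => f x i) := by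
    have := Gen.range fun i => ((hvec i).sub hR (hpre i) (by norm_num)).1
    rwa [Fintype.card_prod, Fintype.card_fin, Fintype.card_fin] at this
  obtain ⟨S, hS, hrun⟩ := exists_solver hR hQ f (gall.trans (g1.trans g2))
  refine ⟨S, hS.trans ?_, ?_⟩
  · have : E.size * (2 * (P.n * (P.n * 4 + 3))) ≤ P.n * P.Q.size * (2 * (P.n * (P.n * 4 + 3))) :=
      Nat.mul_le_mul_right _ hE
    unfold solverCost
    generalize P.n * P.Q.size * (2 * (P.n * (P.n * 4 + 3))) = B at *
    generalize E.size * (2 * (P.n * (P.n * 4 + 3))) = B' at *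
    ring_nf
    omega
  set p := ex (PMF.uniformOfFintype P.RQ) fun a => ex (PMF.uniformOfFintype P.RQ) fun b =>
        if Forges a b e (simEnd A seed t a b) (simForgery A seed t a b) then (1 : ℝ≥0∞) else 0 with hp
  have h1 : (ex (PMF.uniformOfFintype P.RQ) fun u => if IsRingUnit u then 1 else 0) * p ≤
      rsisExperiment P.n 3 P.Q P.γ (2 * P.β) S true := by
    rw [hrun, ex_uniform_three, mul_comm, ← ex_mul_left]
    refine ex_mono _ fun u => ?_
    split_ifs with hu
    · have hinvu := hinv u hu
      have hvu : IsRingUnit (ringPow u E) := ⟨u, by rw [ringMul_comm, hinvu]⟩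
      -- For a fixed invertible first entry, division by it is a permutation, so the derived key is
      -- again uniform. Rows with a non-invertible first entry are given up, at a polynomial cost.
      let eqv : P.RQ ≃ P.RQ := Equiv.ofBijective _ (ringMul_bijective hvu)
      rw [mul_one, hp, ← uniformOfFintype_map_equiv eqv]
      refine ex_mono _ fun y => ?_
      rw [← uniformOfFintype_map_equiv eqv]
      refine ex_mono _ fun z => ?_
      have hx0 : eqv y = a ![u, y, z] := rfl
      have hx1 : eqv z = b ![u, y, z] := rfl
      rw [hx0, hx1]
      split_ifs with h2 h3
      · exact le_rfl
      · refine absurd ?_ h3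
        obtain ⟨h4, h5, h6⟩ := h2.solution htβ (d := f ![u, y, z]) rfl
        refine ⟨h4, ?_, h6⟩
        rw [applyRow_eq _ (v := ringPow u E) hinvu]
        have h5' : target (ringMul (ringPow u E) (![u, y, z] 1)) (ringMul (ringPow u E) (![u, y, z] 2))
          (f ![u, y, z]) = 0 := h5
        rw [h5', ringMul_zero]
      · exact zero_le
      · exact zero_le
    · rw [mul_zero]; exact zero_le
  calc p = 1 * p := (one_mul p).symm
    _ ≤ ((2 * (P.n * P.Q.size + 1) : ℕ) *
        ex (PMF.uniformOfFintype P.RQ) fun u => if IsRingUnit u then 1 else 0) * p := by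
      gcongr
      exact ex_isRingUnit_ge hQ1
    _ = (2 * (P.n * P.Q.size + 1) : ℕ) *
        ((ex (PMF.uniformOfFintype P.RQ) fun u => if IsRingUnit u then 1 else 0) * p) := mul_assoc _ _ _
    _ ≤ _ := by gcongr

end Params

/-! ### Fixing the randomness of the simulation; the two reductions. -/

theorem acceptProb_eq {n Q : ℕ} (μ : PMF (List ((Fin n → ZMod Q) × (Fin n → ZMod Q)))) (D : Program Empty) :
    ENNReal.ofReal (acceptProb μ D) = ex μ fun l =>
      ex (D.runPlain (l.map fun t => words t.1 ++ words t.2).flatten) fun out =>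
        if out.getD 0 0 = 1 then 1 else 0 := by
  unfold acceptProb
  rw [ENNReal.ofReal_toReal (PMF.apply_ne_top _ _), prob_true_eq_ex, ex_bind]
  congr 1; funext l
  rw [ex_map]
  simp only [decide_eq_true_eq]

theorem acceptProb_nonneg {n Q : ℕ} (μ : PMF (List ((Fin n → ZMod Q) × (Fin n → ZMod Q)))) (D : Program Empty) :
    0 ≤ acceptProb μ D := ENNReal.toReal_nonneg

namespace Params
variable {P : Params}

theorem SimWins.good {A : Program Oracle} {seed : BitVec P.seedLen} {a b : P.RQ} {l : List P.Entry}
    (h : SimWins A seed a b l) : ∀ e ∈ l, twistedNorm P.γ e.pre ≤ P.β := by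
  cases l with
  | nil => exact h.elim
  | cons e t => exact h.2

theorem one_le_γ (hs : 0 < P.s) : 1 ≤ P.γ := by
  have hp : (1 : ℝ) ≤ P.p := by exact_mod_cast P.p_pos
  unfold γ
  rw [le_div_iff₀ hs, one_mul]
  refine Real.le_sqrt_of_sq_le ?_
  have : (0 : ℝ) ≤ ((P.p : ℝ) ^ 2 - 1) / 12 := by
    have : (1 : ℝ) ≤ (P.p : ℝ) ^ 2 := one_le_pow₀ hp
    linarith
  linarith

variable (P) in
/-- The choices that the reductions fix: a rotation, a seed and a tape. -/
abbrev Choice : Type := (Fin P.n × Bool) × BitVec P.seedLen × List P.Entry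

variable (P) in
/-- The law of the choices. -/
noncomputable def choiceLaw (N : ℕ) : PMF P.Choice := do
  let t ← PMF.uniformOfFintype (Fin P.n × Bool)
  let seed ← PMF.uniformOfFintype (BitVec P.seedLen)
  let l ← iid (P.entryLaw P.idealLaw) N
  pure (t, seed, l)

theorem ex_choiceLaw (N : ℕ) (F : P.Choice → ℝ≥0∞) :
    ex (P.choiceLaw N) F = ex (PMF.uniformOfFintype (Fin P.n × Bool)) fun t =>
      ex (PMF.uniformOfFintype (BitVec P.seedLen)) fun seed => ex (iid (P.entryLaw P.idealLaw) N) fun l =>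
        F (t, seed, l) := by
  unfold choiceLaw
  rw [ex_bind]; congr 1; funext t
  rw [ex_bind]; congr 1; funext s
  rw [ex_map]

open Classical in
/-- The adversary wins with fixed choices on the key that is computed from a sample. -/
noncomputable def sampleWin (A : Program Oracle) (x : P.Choice) (a b : P.RQ) : ℝ≥0∞ :=
  if SimWins A x.2.1 (ringMul (monomialUnit x.1) a) (gadget P - ringMul (monomialUnit x.1) b) x.2.2 then 1 else 0

/-- The success probability on Ring-LWE samples. -/
noncomputable def rlweWin (A : Program Oracle) (x : P.Choice) : ℝ≥0∞ :=
  ex P.χ fun f => ex (PMF.uniformOfFintype P.RQ) fun a => ex P.χ fun h =>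
    sampleWin A x a (ringMul a (modQ P.Q f) + modQ P.Q h)

/-- The success probability on uniform samples. -/
noncomputable def uniformWin (A : Program Oracle) (x : P.Choice) : ℝ≥0∞ :=
  ex (PMF.uniformOfFintype P.RQ) fun a => ex (PMF.uniformOfFintype P.RQ) fun b => sampleWin A x a b

theorem sampleWin_le_one (A : Program Oracle) (x : P.Choice) (a b : P.RQ) : sampleWin A x a b ≤ 1 := by
  unfold sampleWin
  split_ifs <;> simp

theorem rlweWin_le_one (A : Program Oracle) (x : P.Choice) : rlweWin A x ≤ 1 :=
  ex_le_of_le _ fun _ => ex_le_of_le _ fun _ => ex_le_of_le _ fun _ => sampleWin_le_one _ _ _ _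

theorem uniformWin_le_one (A : Program Oracle) (x : P.Choice) : uniformWin A x ≤ 1 :=
  ex_le_of_le _ fun _ => ex_le_of_le _ fun _ => sampleWin_le_one _ _ _ _

open Classical in
/-- The simulated experiment on a real key and on Ring-LWE samples. -/
theorem ex_simWins_le (hab : P.a ≤ P.b + 1) (hba : P.b ≤ P.a + 1) (hpos : 0 < P.trialProb) (A : Program Oracle)
    (N : ℕ) :
    (ex (PMF.uniformOfFintype (BitVec P.seedLen)) fun seed => ex (PMF.uniformOfFintype P.RQ) fun a =>
      ex P.secretKey fun fg => ex (iid (P.entryLaw P.idealLaw) N) fun l =>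
        if SimWins A seed a (pubKey a fg) l then 1 else 0) ≤
      ENNReal.ofReal (25 * (P.n + 1) / P.trialProb) * ((P.n * 2 : ℕ) * ex (P.choiceLaw N) (rlweWin A)) := by
  set ψ : P.RQ → P.RQ → ℝ≥0∞ := fun a b => ex (PMF.uniformOfFintype (BitVec P.seedLen)) fun seed =>
    ex (iid (P.entryLaw P.idealLaw) N) fun l => if SimWins A seed a b l then 1 else 0 with hψ
  have h1 : (ex (PMF.uniformOfFintype (BitVec P.seedLen)) fun seed => ex (PMF.uniformOfFintype P.RQ) fun a =>
      ex P.secretKey fun fg => ex (iid (P.entryLaw P.idealLaw) N) fun l =>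
        if SimWins A seed a (pubKey a fg) l then (1 : ℝ≥0∞) else 0) =
      ex (PMF.uniformOfFintype P.RQ) fun a => ex P.secretKey fun fg => ψ a (pubKey a fg) := by
    rw [ex_comm]
    congr 1; funext a
    rw [ex_comm]
  rw [h1]
  refine (ex_pubKey_le hab hba hpos ψ).trans (mul_le_mul_right (le_of_eq ?_) _)
  rw [ex_choiceLaw, ex_uniformOfFintype, Fintype.card_prod, Fintype.card_fin, Fintype.card_bool, ← mul_assoc,
    ENNReal.mul_inv_cancel (by simp) (ENNReal.natCast_ne_top _), one_mul]
  refine Finset.sum_congr rfl fun t _ => ?_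
  simp only [hψ, rlweWin, sampleWin]
  have hcomm : ∀ {α : Type} (μ : PMF α) (F : α → BitVec P.seedLen → List P.Entry → ℝ≥0∞),
      (ex μ fun x => ex (PMF.uniformOfFintype (BitVec P.seedLen)) fun s =>
        ex (iid (P.entryLaw P.idealLaw) N) (F x s)) =
      ex (PMF.uniformOfFintype (BitVec P.seedLen)) fun s =>
        ex (iid (P.entryLaw P.idealLaw) N) fun l => ex μ fun x => F x s l := by
    intro α μ F
    rw [ex_comm]
    congr 1; funext s
    rw [ex_comm]
  simp only [hcomm]

/-- A bound for the cost of the distinguisher. -/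
def distCost (n N : ℕ) : ℕ := simCost n N + 50 * n * n + 100 * n + 100

variable {w : ℕ} {K : ℤ}

/-- The distinguisher for Ring-LWE. -/
theorem exists_rlwe_distinguisher (hR : Room w K) (A : Program Oracle) (hA : 2 ^ A.word ≤ K)
    (hQ : (P.Q : ℤ) ≤ K) (hn : ((3 * P.n : ℕ) : ℤ) ≤ K) (hs : 0 < P.s) (hγ : P.γ ^ 2 ≤ (K : ℝ) ^ 3)
    (hβK : P.β ≤ K) (N : ℕ) :
    ∃ D : Program Empty, D.size ≤ w + distCost P.n A.code.length ∧
      ex (P.choiceLaw N) (rlweWin A) ≤ ex (P.choiceLaw N) (uniformWin A) +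
        ENNReal.ofReal |acceptProb (rlweReal 1 P.Q P.χ) D - acceptProb (rlweUniform P.n 1 P.Q) D| := by
  classical
  -- Some fixed rotation, seed and tape distinguish at least as well as the average. They become
  -- constants, so the program need not sample Gaussians.
  obtain ⟨x, -, hx⟩ := exists_ex_sub_le (P.choiceLaw N) (f := rlweWin A) (g := uniformWin A)
    (ne_top_of_le_ne_top ENNReal.one_ne_top (ex_le_of_le _ fun x => rlweWin_le_one A x))
    (ne_top_of_le_ne_top ENNReal.one_ne_top (ex_le_of_le _ fun x => uniformWin_le_one A x))
  have hgood : ∀ a b, sampleWin A x a b = 0 ∨ ∀ e ∈ x.2.2, twistedNorm P.γ e.pre ≤ P.β := by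
    intro a b
    unfold sampleWin
    split_ifs with h
    · exact Or.inr h.good
    · exact Or.inl rfl
  by_cases hg : ∀ e ∈ x.2.2, twistedNorm P.γ e.pre ≤ P.β
  swap
  -- Winning includes that the tape is short. On any other tape both probabilities vanish and the
  -- empty program suffices; on short tapes the constants fit into words.
  · have h0 : ∀ a b, sampleWin A x a b = 0 := fun a b => (hgood a b).resolve_right hg
    refine ⟨⟨0, [], []⟩, by simp [Program.size], ?_⟩
    have h1 : rlweWin A x = 0 := by simp only [rlweWin, h0, ex_const]
    have h2 : uniformWin A x = 0 := by simp only [uniformWin, h0, ex_const]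
    rw [h1, h2, add_zero, add_zero] at hx
    exact hx.trans le_self_add
  obtain ⟨t, seed, l⟩ := x
  cases l with
  | nil =>
    have h0 : ∀ a b, sampleWin A (t, seed, []) a b = 0 := fun a b => if_neg fun h => h
    refine ⟨⟨0, [], []⟩, by simp [Program.size], ?_⟩
    have h1 : rlweWin A (t, seed, []) = 0 := by simp only [rlweWin, h0, ex_const]
    have h2 : uniformWin A (t, seed, []) = 0 := by simp only [uniformWin, h0, ex_const]
    rw [h1, h2, add_zero, add_zero] at hx
    exact hx.trans le_self_add
  | cons e l =>
    have hβ : 0 ≤ P.β := le_trans (Real.sqrt_nonneg _) (hg e List.mem_cons_self)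
    have hpre : ∀ e' ∈ e :: l, ∀ c, |e'.pre c| ≤ K := by
      intro e' he' c
      have h1 := ((abs_le_twistedNorm (one_le_γ hs) e'.pre c).trans (hg e' he')).trans hβK
      exact_mod_cast h1
    obtain ⟨D, hD, hrun⟩ := exists_distinguisher hR A hA hQ hn hγ hβ hβK (monomialUnit t) seed e l hpre
    have hout : ∀ a b : P.RQ, (ex (D.runPlain (words a ++ words b)) fun out =>
        if out.getD 0 0 = 1 then (1 : ℝ≥0∞) else 0) = sampleWin A (t, seed, e :: l) a b := by
      intro a b
      rw [hrun, ex_pure]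
      unfold sampleWin
      have hiff : SimWins A seed (ringMul (monomialUnit t) a) (gadget P - ringMul (monomialUnit t) b) (e :: l) ↔
          Forges (ringMul (monomialUnit t) a) (gadget P - ringMul (monomialUnit t) b) e
          (simEnd A seed l (ringMul (monomialUnit t) a) (gadget P - ringMul (monomialUnit t) b))
          (simForgery A seed l (ringMul (monomialUnit t) a) (gadget P - ringMul (monomialUnit t) b)) :=
        ⟨fun h => h.1, fun h => ⟨h, hg⟩⟩
      rw [if_congr hiff rfl rfl]
      split_ifs <;> simp_all
    have hreal : ENNReal.ofReal (acceptProb (rlweReal 1 P.Q P.χ) D) = rlweWin A (t, seed, e :: l) := by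
      rw [acceptProb_eq, rlweReal, ex_bind, rlweWin]
      congr 1; funext f
      rw [ex_iid_succ, rlweSample, ex_bind]
      congr 1; funext a
      rw [ex_map]
      congr 1; funext h
      rw [ex_iid_zero]
      simp only [List.map_cons, List.map_nil, List.flatten_cons, List.flatten_nil, List.append_nil]
      exact hout _ _
    have hunif : ENNReal.ofReal (acceptProb (rlweUniform P.n 1 P.Q) D) = uniformWin A (t, seed, e :: l) := by
      rw [acceptProb_eq, rlweUniform, ex_iid_succ, uniformWin, ex_uniform_prod]
      congr 1; funext a
      congr 1; funext b
      rw [ex_iid_zero]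
      simp only [List.map_cons, List.map_nil, List.flatten_cons, List.flatten_nil, List.append_nil]
      exact hout _ _
    refine ⟨D, hD.trans (by unfold distCost; omega), ?_⟩
    rw [← hreal, ← hunif] at hx
    set u := acceptProb (rlweUniform P.n 1 P.Q) D
    set v := acceptProb (rlweReal 1 P.Q P.χ) D
    have hu : 0 ≤ u := acceptProb_nonneg _ _
    have hv : ENNReal.ofReal v ≤ ENNReal.ofReal |v - u| + ENNReal.ofReal u := by
      rw [← ENNReal.ofReal_add (abs_nonneg _) hu]
      exact ENNReal.ofReal_le_ofReal (by linarith [le_abs_self (v - u)])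
    refine (ENNReal.add_le_add_iff_right (ENNReal.ofReal_ne_top (r := u))).1 (hx.trans ?_)
    rw [add_assoc]
    gcongr

/-- The solver for Ring-SIS. -/
theorem exists_rsis_solver (hR : Room w K) (A : Program Oracle) (hA : 2 ^ A.word ≤ K)
    (hQ : (P.Q : ℤ) ≤ K) (hn : (P.n : ℤ) ≤ K) (hs : 0 < P.s) (hβK : P.β ≤ K) (hQ1 : 1 < P.Q) (N : ℕ) :
    ∃ S : Program Empty, S.size ≤ w + solverCost P.n P.Q.size A.code.length ∧
      ex (P.choiceLaw N) (uniformWin A) ≤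
        (2 * (P.n * P.Q.size + 1) : ℕ) * rsisExperiment P.n 3 P.Q P.γ (2 * P.β) S true := by
  classical
  obtain ⟨x, -, hx⟩ := exists_ex_sub_le (P.choiceLaw N) (f := uniformWin A) (g := fun _ => 0)
    (ne_top_of_le_ne_top ENNReal.one_ne_top (ex_le_of_le _ fun x => uniformWin_le_one A x))
    (by rw [ex_const]; exact ENNReal.zero_ne_top)
  rw [ex_const, add_zero, zero_add] at hx
  obtain ⟨t, seed, l⟩ := x
  let eυ : P.RQ ≃ P.RQ := Equiv.ofBijective _ (monomialUnit_bijective t)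
  have hunif : uniformWin A (t, seed, l) = ex (PMF.uniformOfFintype P.RQ) fun a =>
      ex (PMF.uniformOfFintype P.RQ) fun b => if SimWins A seed a b l then 1 else 0 := by
    rw [← uniformOfFintype_map_equiv eυ]
    unfold uniformWin
    congr 1; funext a
    exact uniformOfFintype_map_equiv (eυ.trans (Equiv.subLeft (gadget P)))
      fun b => if SimWins A seed (eυ a) b l then 1 else 0
  by_cases hg : ∃ e l', l = e :: l' ∧ ∀ e' ∈ l, twistedNorm P.γ e'.pre ≤ P.β
  · obtain ⟨e, l', rfl, hg⟩ := hg
    have hpre : ∀ e' ∈ e :: l', ∀ c, |e'.pre c| ≤ K := by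
      intro e' he' c
      have h1 := ((abs_le_twistedNorm (one_le_γ hs) e'.pre c).trans (hg e' he')).trans hβK
      exact_mod_cast h1
    obtain ⟨S, hS, hle⟩ := exists_forge_solver hR A hA hQ hn hQ1 seed e l' hpre hg
    refine ⟨S, hS, hx.trans (le_trans (le_of_eq ?_) hle)⟩
    rw [hunif]
    congr 1; funext a
    congr 1; funext b
    exact if_congr ⟨fun h => h.1, fun h => ⟨h, hg⟩⟩ rfl rfl
  · have h0 : uniformWin A (t, seed, l) = 0 := by
      rw [hunif]
      have : ∀ a b, ¬ SimWins A seed a b l := by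
        intro a b h
        cases l with
        | nil => exact h
        | cons e l' => exact hg ⟨e, l', rfl, h.good⟩
      simp only [if_neg (this _ _), ex_const]
    exact ⟨⟨0, [], []⟩, by simp [Program.size], by rw [h0] at hx; exact hx.trans zero_le⟩

end Params

/-! ### Parameters for which Ring-SIS would be easy. -/

open Classical in
/-- If Ring-SIS has a trivial solution, then it is easy. -/
theorem exists_trivial_solver {n m Q w : ℕ} {K : ℤ} [NeZero n] [NeZero m] [NeZero Q] (hR : Room w K)
    (hQ : (Q : ℤ) ≤ K) : ∃ S : Program Empty, S.size ≤ w + 2 * (m * n) ∧ ∀ γ β : ℝ, (Q : ℝ) ≤ β →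
      rsisExperiment n m Q γ β S true = 1 := by
  set d : Fin m × Fin n → ℤ := Pi.single (0, 0) (Q : ℤ) with hd
  have hQ0 : (0 : ℤ) < Q := by exact_mod_cast Nat.pos_of_ne_zero (NeZero.ne Q)
  have hd1 : ∀ i, |d i| ≤ K ^ 1 := by
    intro i
    rw [hd, pow_one, Pi.single_apply]
    split_ifs
    · rw [abs_of_pos hQ0]; exact hQ
    · simp; linarith
  have g : Gen w (m * n * 1) {g | g ∈ rowWires m n Q} (Set.range fun i (_ : Fin m → Fin n → ZMod Q) => d i) := by
    have := Gen.range fun i => (Comp.const (X := Fin m → Fin n → ZMod Q) (I := {g | g ∈ rowWires m n Q}) hR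
      (hd1 i) (by norm_num)).1
    rwa [Fintype.card_prod, Fintype.card_fin, Fintype.card_fin] at this
  obtain ⟨S, hS, hrun⟩ := exists_solver hR hQ (fun _ => d) g
  refine ⟨S, hS.trans (by omega), fun γ β hβ => ?_⟩
  rw [hrun]
  refine Eq.trans ?_ (ex_const (PMF.uniformOfFintype (Fin m → Fin n → ZMod Q)) 1)
  congr 1; funext A
  refine if_pos ?_
  refine ⟨fun h => ?_, ?_, ?_⟩
  · have := congrFun h (0, 0)
    rw [hd, Pi.single_eq_same, Pi.zero_apply] at this
    omega
  · have h0 : ∀ i, (modQ Q fun j => d (i, j)) = 0 := by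
      intro i; funext j
      rw [modQ, hd, Pi.single_apply]
      split_ifs <;> simp
    simp only [applyRow, h0, ringMul_zero, Finset.sum_const_zero]
  · refine le_trans (le_of_eq ?_) hβ
    rw [twistedNorm, Finset.sum_eq_single (0, 0)]
    · simp [hd]
    · intro c _ hc
      rw [hd, Pi.single_eq_of_ne hc]; simp
    · simp

namespace Params
variable {P : Params}

/-- There is a vector that is often short with a uniform error. -/
theorem exists_short (hs : 0 < P.s) (hrest : P.restartProb ≤ 1 / 8) (hs' : (60 / P.s) ^ P.n ≤ 1 / 4) :
    ∃ z : Fin 3 × Fin P.n → ℤ, (∃ c, c.1 ≠ 0 ∧ z c ≠ 0) ∧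
      (1 / 2 : ℝ≥0∞) ≤ open Classical in ex (PMF.uniformOfFintype (Fin P.n → ZMod P.p)) fun t =>
        if twistedNorm P.γ (withError z (centered t)) ≤ P.β then 1 else 0 := by
  classical
  set D := discreteGaussian (ι := Fin 3 × Fin P.n) Set.univ (P.s ^ 2 • 1) with hD
  set G : (Fin 3 × Fin P.n → ℤ) → ℝ≥0∞ := fun z => ex (PMF.uniformOfFintype (Fin P.n → ZMod P.p)) fun t =>
    if twistedNorm P.γ (withError z (centered t)) ≤ P.β then 1 else 0 with hG
  set G' : (Fin 3 × Fin P.n → ℤ) → ℝ≥0∞ := fun z => ex (PMF.uniformOfFintype (Fin P.n → ZMod P.p)) fun t =>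
    if twistedNorm P.γ (withError z (centered t)) ≤ P.β then 0 else 1 with hG'
  -- The event that the middle block vanishes, written with `f = 0` so that the unpredictability
  -- bound applies. Since `1 - 1/4 - 1/8 > 1/2`, averaging gives a vector outside this event that is
  -- short for at least half of the errors.
  set B : (Fin 3 × Fin P.n → ℤ) → ℝ≥0∞ := fun z =>
    if P.block 1 z - ringMul 0 (P.block 2 z) = 0 then 1 else 0 with hB
  set F : (Fin 3 × Fin P.n → ℤ) → ℝ≥0∞ := fun z =>
    if P.block 1 z - ringMul 0 (P.block 2 z) = 0 then 0 else G z with hF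
  have hs2 : P.s ^ 2 ≠ 0 := by positivity
  have h1 : ex D G' ≤ ENNReal.ofReal (1 / 8) := by
    refine le_trans (le_of_eq ?_) (ENNReal.ofReal_le_ofReal hrest)
    rw [← ex_ideal_restart, idealLaw, ex_errLaw]
    rfl
  have h2 : ex D B ≤ ENNReal.ofReal (1 / 4) := by
    refine (ex_block_eq_le (σ := P.s) (τ := (P.s ^ 2)⁻¹) ?_ hs (fun x => ?_) (by positivity) (fun x => ?_) 0 0).trans
      (ENNReal.ofReal_le_ofReal hs')
    · rw [inv_smul_one hs2, Matrix.transpose_smul, Matrix.transpose_one]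
    · rw [inv_smul_one hs2, quad_smul_one]
    · rw [inv_smul_one hs2, quad_smul_one]
  have h3 : 1 ≤ ex D F + (ENNReal.ofReal (1 / 4) + ENNReal.ofReal (1 / 8)) := by
    have h4 : ∀ z, (1 : ℝ≥0∞) ≤ F z + (B z + G' z) := by
      intro z
      have h5 : (1 : ℝ≥0∞) = G z + G' z := by
        refine (ex_const (PMF.uniformOfFintype (Fin P.n → ZMod P.p)) 1).symm.trans ?_
        rw [hG, hG', ← ex_add]
        congr 1; funext t
        split_ifs <;> simp
      simp only [hF, hB]
      split_ifs
      · rw [zero_add]; exact le_self_add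
      · rw [zero_add]; exact h5.le
    calc (1 : ℝ≥0∞) = ex D fun _ => 1 := (ex_const _ _).symm
      _ ≤ ex D fun z => F z + (B z + G' z) := ex_mono _ h4
      _ = ex D F + (ex D B + ex D G') := by rw [ex_add, ex_add]
      _ ≤ _ := by gcongr
  have h6 : (1 / 2 : ℝ≥0∞) ≤ ex D F := by
    by_contra! h
    have h7 : (1 / 2 : ℝ≥0∞) = ENNReal.ofReal (1 / 2) := by
      rw [ENNReal.ofReal_div_of_pos (by norm_num)]; simp
    rw [h7] at h
    have h8 := ENNReal.add_lt_add_right (a := ENNReal.ofReal (1 / 4) + ENNReal.ofReal (1 / 8))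
      (ENNReal.add_ne_top.2 ⟨ENNReal.ofReal_ne_top, ENNReal.ofReal_ne_top⟩) h
    rw [← ENNReal.ofReal_add (by norm_num) (by norm_num), ← ENNReal.ofReal_add (by norm_num) (by norm_num)] at h8
    rw [← ENNReal.ofReal_add (by norm_num) (by norm_num)] at h3
    exact absurd (h3.trans_lt h8) (not_lt.2 (by
      rw [← ENNReal.ofReal_one]; exact ENNReal.ofReal_le_ofReal (by norm_num)))
  have hF1 : ∀ z, F z ≤ 1 := fun z => by
    simp only [hF]
    split_ifs
    · exact zero_le
    · exact ex_le_of_le _ fun t => by split_ifs <;> simp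
  obtain ⟨z, -, hz⟩ := exists_ex_sub_le D (f := F) (g := fun _ => 0)
    (ne_top_of_le_ne_top ENNReal.one_ne_top (ex_le_of_le _ hF1)) (by rw [ex_const]; exact ENNReal.zero_ne_top)
  rw [ex_const, add_zero, zero_add] at hz
  have hz' := h6.trans hz
  simp only [hF] at hz'
  split_ifs at hz' with h9
  · simp at hz'
  · refine ⟨z, ?_, hz'⟩
    have : ringMul 0 (P.block 2 z) = 0 := by rw [ringMul_comm, ringMul_zero]
    rw [this, sub_zero] at h9
    obtain ⟨i, hi⟩ := Function.ne_iff.1 h9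
    exact ⟨(1, i), by simp, hi⟩

/-- A nonzero pair of last blocks has squared length at least one, so it may be exchanged for `(1,
0)` without increasing the norm. -/
theorem twistedNorm_blocks_le {γ : ℝ} {z : Fin 3 × Fin P.n → ℤ} (hz : ∃ c, c.1 ≠ 0 ∧ z c ≠ 0) (v : P.R) :
    twistedNorm γ (blocks v (Pi.single 0 1) 0) ≤ twistedNorm γ (withError z (v - P.block 0 z)) := by
  set y := withError z (v - P.block 0 z) with hy
  have h0 : 0 ≤ twistedNorm γ y := Real.sqrt_nonneg _
  have h1 := (twistedNorm_le_iff (γ := γ) h0 y).1 le_rfl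
  rw [twistedNorm_le_iff h0]
  refine le_trans (add_le_add (le_of_eq ?_) (mul_le_mul_of_nonneg_left ?_ (sq_nonneg _))) h1
  · congr 1
    refine Finset.sum_congr rfl fun c hc => ?_
    obtain ⟨c, i⟩ := c
    have hc0 : c = 0 := Fin.ext (Finset.mem_filter.1 hc).2
    subst hc0
    simp [blocks, hy, withError, block]
  · obtain ⟨c, hc, hzc⟩ := hz
    have h2 : (∑ c : Fin 3 × Fin P.n with ¬ (c.1 : ℕ) = 0, (blocks v (Pi.single 0 1) 0 : Fin 3 × Fin P.n → ℤ) c ^ 2) = 1 := by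
      rw [Finset.sum_eq_single ((1 : Fin 3), (0 : Fin P.n))]
      · simp [blocks]
      · rintro ⟨c, i⟩ hc hne
        fin_cases c
        · simp at hc
        · have : i ≠ 0 := fun h => hne (by rw [h]; rfl)
          simp [blocks, this]
        · simp [blocks]
      · intro h; simp at h
    rw [h2]
    have h3 : (1 : ℤ) ≤ y c ^ 2 := by
      have : y c = z c := by rw [hy, withError, if_neg hc]
      rw [this]
      exact Int.add_one_le_iff.2 (lt_of_le_of_ne (sq_nonneg _) (pow_ne_zero 2 hzc).symm)
    have h4 : y c ^ 2 ≤ ∑ c : Fin 3 × Fin P.n with ¬ (c.1 : ℕ) = 0, y c ^ 2 :=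
      Finset.single_le_sum (f := fun c => y c ^ 2) (fun _ _ => sq_nonneg _)
        (Finset.mem_filter.2 ⟨Finset.mem_univ _, fun h => hc (Fin.ext h)⟩)
    exact_mod_cast h3.trans h4

/-- The acceptance bound is not too small. -/
theorem one_le_β (hs : 0 < P.s) (hrest : P.restartProb ≤ 1 / 8) (hs' : (60 / P.s) ^ P.n ≤ 1 / 4) : 1 ≤ P.β := by
  classical
  obtain ⟨z, ⟨c, hc0, hc⟩, h2⟩ := exists_short hs hrest hs'
  by_contra! hβ
  have h0 : ∀ t : Fin P.n → ZMod P.p, ¬ twistedNorm P.γ (withError z (centered t)) ≤ P.β := by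
    intro t ht
    have h1 := ((abs_le_twistedNorm (one_le_γ hs) (withError z (centered t)) c).trans ht).trans_lt hβ
    have h3 : withError z (centered t) c = z c := by rw [withError, if_neg hc0]
    rw [h3] at h1
    have h4 : |z c| < 1 := by exact_mod_cast h1
    exact hc (Int.abs_lt_one_iff.1 h4)
  simp only [if_neg (h0 _), ex_const] at h2
  simp at h2

open Classical in
/-- A uniform ring element is short with noticeable probability. -/
theorem ex_short_ge (hs : 0 < P.s) (hrest : P.restartProb ≤ 1 / 8) (hs' : (60 / P.s) ^ P.n ≤ 1 / 4)
    (hβQ : 2 * P.β < P.Q) : (1 / 2 : ℝ≥0∞) ≤ (P.q : ℝ≥0∞) ^ P.n * ex (PMF.uniformOfFintype P.RQ) fun u =>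
      if twistedNorm P.γ (blocks (centered u) (Pi.single 0 1) 0) ≤ P.β then 1 else 0 := by
  obtain ⟨z, hz, h2⟩ := exists_short hs hrest hs'
  refine h2.trans ?_
  rw [ex_uniformOfFintype, ex_uniformOfFintype, Finset.sum_ite, Finset.sum_ite, Finset.sum_const_zero,
    Finset.sum_const_zero, add_zero, add_zero, Finset.sum_const, Finset.sum_const, nsmul_eq_mul, nsmul_eq_mul,
    mul_one, mul_one, Fintype.card_fun, Fintype.card_fun, ZMod.card, ZMod.card, Fintype.card_fin]
  have hq0 : ((P.q : ℝ≥0∞) ^ P.n) ≠ 0 := pow_ne_zero _ (by exact_mod_cast P.q_pos.ne')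
  have hqt : ((P.q : ℝ≥0∞) ^ P.n) ≠ ⊤ := ENNReal.pow_ne_top (ENNReal.natCast_ne_top _)
  have hinv : ((P.Q ^ P.n : ℕ) : ℝ≥0∞)⁻¹ = ((P.p ^ P.n : ℕ) : ℝ≥0∞)⁻¹ * ((P.q : ℝ≥0∞) ^ P.n)⁻¹ := by
    rw [← ENNReal.mul_inv (Or.inr hqt) (Or.inr hq0)]
    push_cast
    rw [mul_pow]
  have hcancel : ∀ g : ℝ≥0∞, (P.q : ℝ≥0∞) ^ P.n * (((P.Q ^ P.n : ℕ) : ℝ≥0∞)⁻¹ * g) =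
      ((P.p ^ P.n : ℕ) : ℝ≥0∞)⁻¹ * g := by
    intro g
    rw [hinv]
    calc (P.q : ℝ≥0∞) ^ P.n * (((P.p ^ P.n : ℕ) : ℝ≥0∞)⁻¹ * ((P.q : ℝ≥0∞) ^ P.n)⁻¹ * g) =
        ((P.q : ℝ≥0∞) ^ P.n * ((P.q : ℝ≥0∞) ^ P.n)⁻¹) * (((P.p ^ P.n : ℕ) : ℝ≥0∞)⁻¹ * g) := by ring
      _ = _ := by rw [ENNReal.mul_inv_cancel hq0 hqt, one_mul]
  rw [hcancel]
  gcongr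
  -- Because `2 β < Q`, short vectors do not wrap around modulo `Q`. So the errors that are good for
  -- `z` give distinct short residues: at least half of `p ^ n`, out of `Q ^ n`.
  have hsmall : ∀ t : Fin P.n → ZMod P.p, twistedNorm P.γ (withError z (centered t)) ≤ P.β →
      centered (modQ P.Q (P.block 0 z + centered t)) = P.block 0 z + centered t := by
    intro t ht
    have hb : ∀ i, |(P.block 0 z + centered t) i| < (P.Q : ℤ) - (P.Q / 2 : ℕ) ∧
        |(P.block 0 z + centered t) i| ≤ (P.Q / 2 : ℕ) := by
      intro i
      have h3 := (abs_le_twistedNorm (one_le_γ hs) (withError z (centered t)) (0, i)).trans ht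
      have h4 : withError z (centered t) (0, i) = (P.block 0 z + centered t) i := by
        rw [withError, if_pos rfl]; rfl
      rw [h4] at h3
      have h5 : 2 * |(P.block 0 z + centered t) i| < P.Q := by
        have : 2 * |((P.block 0 z + centered t) i : ℝ)| < P.Q := by linarith
        exact_mod_cast this
      omega
    exact centered_modQ (fun i => (abs_le.1 (hb i).2).1) fun i => lt_of_le_of_lt (le_abs_self _) (hb i).1
  refine Finset.card_le_card_of_injOn (fun t => modQ P.Q (P.block 0 z + centered t)) (fun t ht => ?_) ?_
  · have ht' := (Finset.mem_filter.1 ht).2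
    refine Finset.mem_coe.2 (Finset.mem_filter.2 ⟨Finset.mem_univ _, ?_⟩)
    rw [hsmall t ht']
    refine (twistedNorm_blocks_le hz _).trans ?_
    rwa [add_sub_cancel_left]
  · intro t ht t' ht' h
    have e1 := hsmall t (Finset.mem_filter.1 ht).2
    have e2 := hsmall t' (Finset.mem_filter.1 ht').2
    have h3 : P.block 0 z + centered t = P.block 0 z + centered t' := by
      rw [← e1, ← e2]; exact congrArg centered h
    have h4 := congrArg (modQ P.p) (add_left_cancel h3)
    rwa [modQ_centered, modQ_centered] at h4

open Classical in
/-- The solver for Ring-SIS that guesses. -/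
theorem exists_guess_solver {w : ℕ} {K : ℤ} (hR : Room w K) (hQ : (P.Q : ℤ) ≤ K) (hn : (P.n : ℤ) ≤ K)
    (hs : 0 < P.s) (hrest : P.restartProb ≤ 1 / 8) (hs' : (60 / P.s) ^ P.n ≤ 1 / 4) (hβQ : 2 * P.β < P.Q) :
    ∃ S : Program Empty, S.size ≤ w + solverCost P.n P.Q.size 0 ∧
      (1 / 2 : ℝ≥0∞) ≤ (2 * (P.n * P.Q.size + 1) : ℕ) * ((P.q : ℝ≥0∞) ^ P.n *
        rsisExperiment P.n 3 P.Q P.γ (2 * P.β) S true) := by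
  have hβ1 := one_le_β hs hrest hs'
  have hQ1 : 1 < P.Q := by
    have : (1 : ℝ) < P.Q := by linarith
    exact_mod_cast this
  obtain ⟨E, hE, hinv⟩ := exists_ringPow_inv (n := P.n) hQ1
  set I : Set ((Fin 3 → P.RQ) → ℤ) := {g | g ∈ rowWires 3 P.n P.Q} with hI
  set v : (Fin 3 → P.RQ) → P.RQ := fun x => ringPow (x 0) E with hv
  -- For an invertible first entry `(-x 1 / x 0, 1, 0)` is in the kernel of the row, and its first
  -- block is uniform; the solver hopes that it is short.
  set a : (Fin 3 → P.RQ) → P.RQ := fun x => 0 - ringMul (v x) (x 1) with ha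
  have gv : Gen w _ I (ringWires v) := RComp.pow hR hQ hn (ringWires_row_subset (m := 3) (n := P.n) (Q := P.Q) 0) E
  have ga : Gen w _ (I ∪ ringWires v) (ringWires a) := RComp.sub hR hQ (RComp.const (w := w) hR hQ 0)
    (RComp.mul (w := w) hR hQ hn (RComp.of_subset (I := I ∪ ringWires v) (u := v) Set.subset_union_right)
    (RComp.of_subset ((ringWires_row_subset (m := 3) (n := P.n) (Q := P.Q) 1).trans Set.subset_union_left)))
  have gall := gv.trans ga
  set f : (Fin 3 → P.RQ) → Fin 3 × Fin P.n → ℤ := fun x => blocks (centered (a x)) (Pi.single 0 1) 0 with hf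
  have hK1 : (1 : ℤ) ≤ K ^ 1 := one_le_pow₀ hR.one_le
  have hc : ∀ i, Comp w K 11 (I ∪ ringWires a) 1 fun x => f x i := by
    rintro ⟨c, i⟩
    fin_cases c
    · exact (RComp.centered hR hQ (RComp.of_subset Set.subset_union_right) i).mono subset_rfl (by norm_num)
    · refine (Comp.const hR (v := (Pi.single 0 1 : P.R) i) (e := 1) ?_ (by norm_num)).mono subset_rfl (by norm_num)
      rw [Pi.single_apply]
      split_ifs
      · simpa using hK1
      · simpa using hR.one_le.trans' zero_le_one
    · exact (Comp.const hR (v := 0) (e := 1) (by simpa using hR.one_le.trans' zero_le_one) (by norm_num)).mono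
        subset_rfl (by norm_num)
  have g2 : Gen w (3 * P.n * 11) (I ∪ ringWires a) (Set.range fun i x => f x i) := by
    have := Gen.range fun i => (hc i).1
    rwa [Fintype.card_prod, Fintype.card_fin, Fintype.card_fin] at this
  obtain ⟨S, hS, hrun⟩ := exists_solver hR hQ f (gall.trans g2)
  refine ⟨S, hS.trans ?_, ?_⟩
  · have : E.size * (2 * (P.n * (P.n * 4 + 3))) ≤ P.n * P.Q.size * (2 * (P.n * (P.n * 4 + 3))) :=
      Nat.mul_le_mul_right _ hE
    unfold solverCost simCost
    generalize P.n * P.Q.size * (2 * (P.n * (P.n * 4 + 3))) = B at *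
    generalize E.size * (2 * (P.n * (P.n * 4 + 3))) = B' at *
    ring_nf
    omega
  set p := ex (PMF.uniformOfFintype P.RQ) fun u =>
      if twistedNorm P.γ (blocks (centered u) (Pi.single 0 1) 0) ≤ P.β then (1 : ℝ≥0∞) else 0 with hp
  have h1 : (ex (PMF.uniformOfFintype P.RQ) fun u => if IsRingUnit u then 1 else 0) * p ≤
      rsisExperiment P.n 3 P.Q P.γ (2 * P.β) S true := by
    rw [hrun, ex_uniform_three, mul_comm, ← ex_mul_left]
    refine ex_mono _ fun u => ?_
    split_ifs with hu
    · have hinvu := hinv u hu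
      have hvu : IsRingUnit (ringPow u E) := ⟨u, by rw [ringMul_comm, hinvu]⟩
      let eqv : P.RQ ≃ P.RQ := (Equiv.ofBijective _ (ringMul_bijective hvu)).trans (Equiv.subLeft 0)
      rw [mul_one, hp, ← uniformOfFintype_map_equiv eqv]
      refine ex_mono _ fun y => ?_
      rw [← ex_const (PMF.uniformOfFintype P.RQ) (ite _ _ _)]
      refine ex_mono _ fun z => ?_
      have hx0 : eqv y = a ![u, y, z] := rfl
      rw [hx0]
      split_ifs with h2 h3
      · exact le_rfl
      · refine absurd ⟨fun h0 => ?_, ?_, h2.trans (by linarith)⟩ h3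
        · have := congrFun h0 (1, 0)
          simp [hf, blocks] at this
        · rw [applyRow_eq _ (v := ringPow u E) hinvu]
          have h5 : target (ringMul (ringPow u E) (![u, y, z] 1)) (ringMul (ringPow u E) (![u, y, z] 2))
              (f ![u, y, z]) = 0 := by
            have b0 : P.block 0 (f ![u, y, z]) = centered (a ![u, y, z]) := rfl
            have b1 : P.block 1 (f ![u, y, z]) = Pi.single 0 1 := rfl
            have b2 : P.block 2 (f ![u, y, z]) = 0 := rfl
            have m1 : modQ P.Q (Pi.single 0 1 : P.R) = Pi.single 0 1 := by
              funext i
              simp only [modQ, Pi.single_apply]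
              split_ifs <;> simp
            have m2 : modQ P.Q (0 : P.R) = 0 := by funext i; simp [modQ]
            rw [target, b0, b1, b2, modQ_centered, m1, m2, ringMul_one, ringMul_zero, add_zero, ha]
            exact sub_add_cancel _ _
          rw [h5, ringMul_zero]
      · exact zero_le
      · exact zero_le
    · rw [mul_zero]; exact zero_le
  calc (1 / 2 : ℝ≥0∞) ≤ 1 * ((P.q : ℝ≥0∞) ^ P.n * p) := by
        rw [one_mul]; exact ex_short_ge hs hrest hs' hβQ
    _ ≤ ((2 * (P.n * P.Q.size + 1) : ℕ) *
        ex (PMF.uniformOfFintype P.RQ) fun u => if IsRingUnit u then 1 else 0) * ((P.q : ℝ≥0∞) ^ P.n * p) := by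
      gcongr
      exact ex_isRingUnit_ge hQ1
    _ = (2 * (P.n * P.Q.size + 1) : ℕ) * ((P.q : ℝ≥0∞) ^ P.n *
        ((ex (PMF.uniformOfFintype P.RQ) fun u => if IsRingUnit u then 1 else 0) * p)) := by ring
    _ ≤ _ := by gcongr

end Params
-- The concrete bound on the success of a forger.
namespace Params
variable {P : Params} {ε : ℝ}

/-- The word length of the reductions is `60 * logBase + 1`. -/
def logBase (P : Params) (A : Program Oracle) : ℕ := A.word + P.Q.size + P.n + 2

theorem room_logBase (A : Program Oracle) : Room (60 * P.logBase A + 1) (2 ^ P.logBase A) := by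
  refine ⟨?_, ?_⟩
  · calc (2 : ℤ) = 2 ^ 1 := by norm_num
      _ ≤ 2 ^ P.logBase A := pow_le_pow_right₀ (by norm_num) (by unfold logBase; omega)
  · rw [← pow_mul, mul_comm]
    exact pow_lt_pow_right₀ (by norm_num) (Nat.lt_succ_self _)

theorem two_pow_word_le (A : Program Oracle) : (2 : ℤ) ^ A.word ≤ 2 ^ P.logBase A :=
  pow_le_pow_right₀ (by norm_num) (by unfold logBase; omega)

theorem Q_le_base (A : Program Oracle) : (P.Q : ℤ) ≤ 2 ^ P.logBase A := by
  have h1 : P.Q ≤ 2 ^ P.logBase A :=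
    (Nat.lt_size_self P.Q).le.trans (Nat.pow_le_pow_right (by norm_num) (by unfold logBase; omega))
  exact_mod_cast h1

theorem three_mul_n_le_base (A : Program Oracle) : ((3 * P.n : ℕ) : ℤ) ≤ 2 ^ P.logBase A := by
  have h1 : P.n < 2 ^ P.n := Nat.lt_two_pow_self
  have h2 : 2 ^ (P.n + 2) ≤ 2 ^ P.logBase A := Nat.pow_le_pow_right (by norm_num) (by unfold logBase; omega)
  have h3 : 3 * P.n ≤ 2 ^ P.logBase A := by
    rw [pow_add] at h2; omega
  exact_mod_cast h3

/-- The bound on the success of a forger in terms of that of the distinguisher `D` and the solvers. -/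
noncomputable def forgeBound (P : Params) (A : Program Oracle) (D S S' : Program Empty) : ℝ :=
  3 * (25 * (P.n + 1) / P.trialProb * ((P.n * 2 : ℕ) *
        ((2 * (P.n * P.Q.size + 1) : ℕ) * (rsisExperiment P.n 3 P.Q P.γ (2 * P.β) S true).toReal +
          |acceptProb (rlweReal 1 P.Q P.χ) D - acceptProb (rlweUniform P.n 1 P.Q) D|)) +
        (A.code.length + 1 : ℕ) * P.restartProb) +
      (A.code.length + 1 : ℕ) * (A.code.length * ((2 : ℝ) ^ P.saltLen)⁻¹ + 3 * P.restartProb +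
        2 * (2 * (P.n * P.Q.size + 1) : ℕ) * (rsisExperiment P.n 3 P.Q P.γ (2 * P.β) S' true).toReal)

namespace Admissible
variable (h : Admissible P ε) (hη : 240 ≤ smoothing P.n ε)
include h hη

theorem s_ge_240 : 240 ≤ P.s := by
  have h2 : 0 ≤ P.α ^ 2 * ((P.a : ℝ) + P.b) := by positivity
  have h3 := h.s_ge
  have h4 := h.r_pos
  have h5 : smoothing P.n ε ^ 2 ≤ P.s ^ 2 := by nlinarith [sq_nonneg (smoothing P.n ε), sq_nonneg P.r]
  exact hη.trans (pow_le_pow_iff_left₀ (by linarith) h.s_pos.le two_ne_zero |>.1 h5)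

theorem pow_width_le : (60 / P.s) ^ P.n ≤ 1 / 4 := by
  have h1 := h.s_ge_240 hη
  have h2 : 60 / P.s ≤ 1 / 4 := by rw [div_le_div_iff₀ h.s_pos (by norm_num)]; linarith
  refine (pow_le_of_le_one (by have := h.s_pos; positivity) (by linarith) (NeZero.ne P.n)).trans h2

theorem γ_sq_le (A : Program Oracle) : P.γ ^ 2 ≤ (((2 : ℤ) ^ P.logBase A : ℤ) : ℝ) ^ 3 := by
  have h1 := h.s_ge_240 hη
  have hp : (1 : ℝ) ≤ P.p := by exact_mod_cast P.p_pos
  have hpK : (P.p : ℝ) ≤ ((2 : ℤ) ^ P.logBase A : ℤ) := by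
    have : (P.p : ℤ) ≤ 2 ^ P.logBase A :=
      le_trans (by exact_mod_cast Nat.le_mul_of_pos_right _ P.q_pos) (Q_le_base A)
    exact_mod_cast this
  have hK : (2 : ℝ) ≤ ((2 : ℤ) ^ P.logBase A : ℤ) := by exact_mod_cast (room_logBase (P := P) A).two_le
  set K : ℝ := (((2 : ℤ) ^ P.logBase A : ℤ) : ℝ)
  unfold γ
  rw [div_pow, Real.sq_sqrt (by nlinarith), div_le_iff₀ (by positivity)]
  nlinarith [mul_nonneg (sq_nonneg K) (show 0 ≤ P.s ^ 2 - 1 by nlinarith),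
    mul_nonneg (show 0 ≤ K - 2 by linarith) (mul_nonneg (sq_nonneg K) (sq_nonneg P.s)),
    mul_self_le_mul_self (by linarith) hpK, mul_le_mul hK hK (by norm_num) (by linarith)]

/-- Since `r ≥ q η` and `η` exceeds 60, the unpredictability error is at most `q ^ (-n)`, which is
up to polynomial factors the success probability of the guessing solver. -/
theorem inv_r_pow_le : (60 / P.r) ^ P.n ≤ ((P.q : ℝ) ^ P.n)⁻¹ := by
  have hq : (1 : ℝ) ≤ P.q := by exact_mod_cast P.q_pos
  rw [← inv_pow]
  refine pow_le_pow_left₀ (by have := h.r_pos; positivity) ?_ _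
  rw [div_le_iff₀ h.r_pos, inv_mul_eq_div, le_div_iff₀ (by linarith)]
  nlinarith [h.r_ge]

/-- The reductions from Ring-LWE and Ring-SIS. -/
theorem exists_reductions (A : Program Oracle) (hab : P.a ≤ P.b + 1) (hba : P.b ≤ P.a + 1)
    (hκ : P.lawRatio ε ^ (A.code.length + 1) ≤ 3) (hrest : P.restartProb ≤ 1 / 8) (hβQ : 2 * P.β < P.Q) :
    ∃ D S S' : Program Empty,
      D.size ≤ 60 * P.logBase A + 1 + distCost P.n A.code.length ∧
      S.size ≤ 60 * P.logBase A + 1 + solverCost P.n P.Q.size A.code.length ∧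
      S'.size ≤ 60 * P.logBase A + 1 + solverCost P.n P.Q.size 0 ∧
      P.forgeProb A ≤ P.forgeBound A D S S' := by
  have hR := room_logBase (P := P) A
  have hs' := h.pow_width_le hη
  have hβ1 := one_le_β h.s_pos hrest hs'
  have hQK := Q_le_base (P := P) A
  have hnK := three_mul_n_le_base (P := P) A
  have hnK' : (P.n : ℤ) ≤ 2 ^ P.logBase A := le_trans (Int.ofNat_le.2 (Nat.le_mul_of_pos_left _ (by norm_num))) hnK
  have hβK : P.β ≤ ((2 : ℤ) ^ P.logBase A : ℤ) := by
    have : (P.Q : ℝ) ≤ ((2 : ℤ) ^ P.logBase A : ℤ) := by exact_mod_cast hQK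
    linarith
  have hQ1 : 1 < P.Q := by
    have : (1 : ℝ) < P.Q := by linarith
    exact_mod_cast this
  obtain ⟨D, hD, h1⟩ := exists_rlwe_distinguisher hR A (two_pow_word_le A) hQK hnK h.s_pos (h.γ_sq_le hη A) hβK
    (A.code.length + 1)
  obtain ⟨S, hS, h2⟩ := exists_rsis_solver hR A (two_pow_word_le A) hQK hnK' h.s_pos hβK hQ1 (A.code.length + 1)
  obtain ⟨S', hS', h3⟩ := exists_guess_solver hR hQK hnK' h.s_pos hrest hs' hβQ
  refine ⟨D, S, S', hD, hS, hS', ?_⟩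
  set B : ℕ := 2 * (P.n * P.Q.size + 1)
  set N := A.code.length
  set adv := |acceptProb (rlweReal 1 P.Q P.χ) D - acceptProb (rlweUniform P.n 1 P.Q) D|
  have hadv : 0 ≤ adv := abs_nonneg _
  have hrest0 : 0 ≤ P.restartProb := ENNReal.toReal_nonneg
  have hfin : ∀ T : Program Empty, rsisExperiment P.n 3 P.Q P.γ (2 * P.β) T true ≠ ⊤ := fun T => PMF.apply_ne_top _ _
  set ρ := (rsisExperiment P.n 3 P.Q P.γ (2 * P.β) S true).toReal with hρ
  set ρ' := (rsisExperiment P.n 3 P.Q P.γ (2 * P.β) S' true).toReal with hρ'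
  have hρ0 : 0 ≤ ρ := ENNReal.toReal_nonneg
  have hρ0' : 0 ≤ ρ' := ENNReal.toReal_nonneg
  rw [← ENNReal.ofReal_toReal (hfin S), ← hρ] at h2
  rw [← ENNReal.ofReal_toReal (hfin S'), ← hρ'] at h3
  have hq : (0 : ℝ) < (P.q : ℝ) ^ P.n := pow_pos (by exact_mod_cast P.q_pos) _
  have hguess : (60 / P.r) ^ P.n ≤ 2 * B * ρ' := by
    refine (h.inv_r_pow_le hη).trans ?_
    have h4 : (1 / 2 : ℝ) ≤ B * (P.q ^ P.n * ρ') := by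
      have h5 := ENNReal.toReal_mono (by finiteness) h3
      simpa [ENNReal.toReal_ofReal hρ0'] using h5
    rw [inv_le_iff_one_le_mul₀ hq]
    linarith
  have hpos := h.trial_pos
  have hC : 0 ≤ 25 * ((P.n : ℝ) + 1) / P.trialProb := by positivity
  have hκ1 : 1 ≤ P.lawRatio ε := Real.one_le_exp (by have := h.ε_pos; positivity)
  have hκ2 : P.lawRatio ε ≤ 3 := (le_self_pow₀ hκ1 (Nat.succ_ne_zero _)).trans hκ
  unfold forgeProb forgeBound
  -- The bound for a single experiment does not involve the number of attempts, so it holds for the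
  -- supremum.
  refine ENNReal.toReal_le_of_le_ofReal (by positivity) (iSup_le fun fuel => ?_)
  refine (h.forgeExperiment_le A fuel).trans ?_
  rw [ENNReal.ofReal_add (by positivity) (by positivity), ENNReal.ofReal_mul (by norm_num),
    ENNReal.ofReal_mul (by positivity)]
  refine add_le_add (mul_le_mul' ?_ ?_) (mul_le_mul' ?_ ?_)
  · rw [← ENNReal.ofReal_pow (by linarith)]
    exact ENNReal.ofReal_le_ofReal hκ
  · rw [ENNReal.ofReal_add (by positivity) (by positivity), ENNReal.ofReal_mul hC]
    refine add_le_add ((ex_simWins_le hab hba hpos A (N + 1)).trans (mul_le_mul_right ?_ _)) ?_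
    · rw [ENNReal.ofReal_mul (by positivity), ENNReal.ofReal_natCast]
      refine mul_le_mul_right (h1.trans ?_) _
      rw [ENNReal.ofReal_add (by positivity) hadv, ENNReal.ofReal_mul (by positivity), ENNReal.ofReal_natCast]
      exact add_le_add h2 le_rfl
    · rw [ENNReal.ofReal_mul (by positivity), ENNReal.ofReal_natCast]
      push_cast
      exact le_rfl
  · rw [ENNReal.ofReal_natCast]
    push_cast
    exact le_rfl
  · rw [ENNReal.ofReal_add (by positivity) (by positivity), ENNReal.ofReal_add (by positivity) (by positivity)]
    refine add_le_add (add_le_add ?_ ?_) (ENNReal.ofReal_le_ofReal hguess)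
    · rw [ENNReal.ofReal_mul (by positivity), ENNReal.ofReal_natCast, ENNReal.ofReal_inv_of_pos (by positivity),
        ENNReal.ofReal_pow (by norm_num), ENNReal.ofReal_ofNat]
    · rw [ENNReal.ofReal_mul (by norm_num)]
      gcongr

end Admissible
end Params

/-! ### Asymptotics -/

namespace PolyBounded

theorem const (c : ℕ) : PolyBounded fun _ => c := ⟨Polynomial.C c, fun k => by simp⟩

variable {f g : ℕ → ℕ}

theorem add (hf : PolyBounded f) (hg : PolyBounded g) : PolyBounded fun k => f k + g k := by
  obtain ⟨B, hB⟩ := hf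
  obtain ⟨C, hC⟩ := hg
  exact ⟨B + C, fun k => by rw [Polynomial.eval_add]; exact add_le_add (hB k) (hC k)⟩

theorem mul (hf : PolyBounded f) (hg : PolyBounded g) : PolyBounded fun k => f k * g k := by
  obtain ⟨B, hB⟩ := hf
  obtain ⟨C, hC⟩ := hg
  exact ⟨B * C, fun k => by rw [Polynomial.eval_mul]; exact Nat.mul_le_mul (hB k) (hC k)⟩

theorem of_le (hf : PolyBounded f) (h : ∀ k, g k ≤ f k) : PolyBounded g := by
  obtain ⟨B, hB⟩ := hf
  exact ⟨B, fun k => (h k).trans (hB k)⟩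

end PolyBounded

namespace Negligible
open Filter Asymptotics
variable {f g : ℕ → ℝ}

theorem of_le (hf : Negligible f) (h : ∀ᶠ k in atTop, |g k| ≤ f k) : Negligible g :=
  SuperpolynomialDecay.trans_eventually_abs_le hf (h.mono fun _ hk => hk.trans (le_abs_self _))

theorem poly_mul {c : ℕ → ℕ} (hc : PolyBounded c) (hf : Negligible f) : Negligible fun k => c k * f k := by
  obtain ⟨B, hB⟩ := hc
  refine SuperpolynomialDecay.trans_abs_le (hf.polynomial_mul (B.map (Nat.castRingHom ℝ))) fun k => ?_
  have h1 : (B.map (Nat.castRingHom ℝ)).eval (k : ℝ) = (B.eval k : ℕ) := by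
    rw [Polynomial.eval_natCast_map]; rfl
  rw [abs_mul, abs_mul, h1, Nat.abs_cast, Nat.abs_cast]
  gcongr
  exact hB k

theorem add' (hf : Negligible f) (hg : Negligible g) : Negligible fun k => f k + g k :=
  SuperpolynomialDecay.add hf hg

theorem eventually_le (hf : Negligible f) {δ : ℝ} (hδ : 0 < δ) : ∀ᶠ k in atTop, f k ≤ δ := by
  have h1 := hf 0
  simp only [pow_zero, one_mul] at h1
  exact h1.eventually_le_const hδ

end Negligible
open Filter

theorem Program.length_le_size {O : Type} (A : Program O) : A.code.length ≤ A.size := by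
  have h1 : (A.code.map Instr.cost).length ≤ (A.code.map Instr.cost).sum := by
    refine List.length_le_sum_of_one_le _ fun c hc => ?_
    obtain ⟨i, -, rfl⟩ := List.mem_map.1 hc
    cases i <;> simp [Instr.cost]
  rw [List.length_map] at h1
  unfold Program.size
  omega

namespace Params

/-- The hypothesis gives `(N + 1) √(8 n ε) ≤ 1/8` and `(N + 1) ε ≤ 1/64`, so the exponent of the
power is at most `6/64 + 3/8 < 1`. -/
theorem lawRatio_pow_le (P : Params) {ε : ℝ} {N : ℕ} (hε : 0 < ε)
    (h : 8 * P.n * ε * ((N : ℝ) + 1) ^ 2 ≤ 1 / 64) :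
    ε ≤ 1 / 2 ∧ Real.sqrt (8 * P.n * ε) ≤ 1 / 2 ∧ P.lawRatio ε ^ (N + 1) ≤ 3 := by
  have hn : (1 : ℝ) ≤ P.n := by exact_mod_cast NeZero.one_le
  have hN : (1 : ℝ) ≤ (N : ℝ) + 1 := by simp
  set δ := Real.sqrt (8 * P.n * ε) with hδ
  have hδ0 : 0 ≤ δ := Real.sqrt_nonneg _
  have h1 : δ ^ 2 = 8 * P.n * ε := Real.sq_sqrt (by positivity)
  have h2 : ((N : ℝ) + 1) * δ ≤ 1 / 8 := by
    refine (pow_le_pow_iff_left₀ (by positivity) (by norm_num) two_ne_zero).1 ?_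
    rw [mul_pow, h1]
    linarith
  have h3 : ((N : ℝ) + 1) * ε ≤ 1 / 64 := by
    have h4 : ε * ((N : ℝ) + 1) ≤ 8 * P.n * ε * ((N : ℝ) + 1) ^ 2 := by
      have h5 : 0 ≤ ε * ((N : ℝ) + 1) := by positivity
      nlinarith [mul_le_mul hn hN zero_le_one (by positivity), mul_nonneg h5 (show (0 : ℝ) ≤ P.n * (N + 1) - 1 by nlinarith)]
    linarith
  refine ⟨by nlinarith, by nlinarith, ?_⟩
  rw [lawRatio, ← Real.exp_nat_mul, ← hδ]
  refine le_trans (Real.exp_le_exp.2 (?_ : _ ≤ (1 : ℝ))) Real.exp_one_lt_three.le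
  push_cast
  nlinarith

end Params

theorem polyBounded_simCost {n N : ℕ → ℕ} (hn : PolyBounded n) (hN : PolyBounded N) :
    PolyBounded fun k => Params.simCost (n k) (N k) := by
  unfold Params.simCost Params.stepCost
  repeat' first | exact PolyBounded.const _ | assumption | apply PolyBounded.add | apply PolyBounded.mul

/-- For admissible parameters the reductions are useful; they are small in any case. -/
theorem exists_reduction_families {P : ℕ → Params} {ε : ℕ → ℝ} {A : ℕ → Program Oracle}
    (hn : PolyBounded fun k => (P k).n) (hQ : PolyBounded fun k => Nat.size (P k).Q)
    (hA : PolyBounded fun k => (A k).size)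
    (hbalance : ∀ k, (P k).a ≤ (P k).b + 1 ∧ (P k).b ≤ (P k).a + 1) :
    ∃ T D S S' : ℕ → Program Empty, (PolyBounded fun k => (T k).size) ∧ (PolyBounded fun k => (D k).size) ∧
      (PolyBounded fun k => (S k).size) ∧ (PolyBounded fun k => (S' k).size) ∧
      (∀ k, (P k).Q ≤ 2 * (P k).β → (rsisExperiment (P k).n 3 (P k).Q (P k).γ (2 * (P k).β) (T k) true).toReal = 1) ∧
      ∀ k, (P k).Admissible (ε k) → 240 ≤ smoothing (P k).n (ε k) →
        (P k).lawRatio (ε k) ^ ((A k).code.length + 1) ≤ 3 → (P k).restartProb ≤ 1 / 8 → 2 * (P k).β < (P k).Q →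
        (P k).forgeProb (A k) ≤ (P k).forgeBound (A k) (D k) (S k) (S' k) := by
  have hN : PolyBounded fun k => (A k).code.length := hA.of_le fun k => (A k).length_le_size
  have hw : PolyBounded fun k => 60 * (P k).logBase (A k) + 1 := by
    have h1 : PolyBounded fun k => (A k).word :=
      hA.of_le fun k => by unfold Program.size; omega
    unfold Params.logBase
    repeat' first | exact PolyBounded.const _ | assumption | apply PolyBounded.add | apply PolyBounded.mul
  have hsim := polyBounded_simCost hn hN
  have key : ∀ k, ∃ T D S S' : Program Empty,
      T.size ≤ 60 * (P k).logBase (A k) + 1 + 2 * (3 * (P k).n) ∧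
      D.size ≤ 60 * (P k).logBase (A k) + 1 + Params.distCost (P k).n (A k).code.length ∧
      S.size ≤ 60 * (P k).logBase (A k) + 1 + Params.solverCost (P k).n (P k).Q.size (A k).code.length ∧
      S'.size ≤ 60 * (P k).logBase (A k) + 1 + Params.solverCost (P k).n (P k).Q.size 0 ∧
      ((P k).Q ≤ 2 * (P k).β → (rsisExperiment (P k).n 3 (P k).Q (P k).γ (2 * (P k).β) T true).toReal = 1) ∧
      ((P k).Admissible (ε k) → 240 ≤ smoothing (P k).n (ε k) →
        (P k).lawRatio (ε k) ^ ((A k).code.length + 1) ≤ 3 → (P k).restartProb ≤ 1 / 8 → 2 * (P k).β < (P k).Q →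
        (P k).forgeProb (A k) ≤ (P k).forgeBound (A k) D S S') := by
    intro k
    obtain ⟨T, hT, hT'⟩ := exists_trivial_solver (n := (P k).n) (m := 3) (Params.room_logBase (P := P k) (A k))
      (Params.Q_le_base (A k))
    refine ⟨T, ?_⟩
    -- Families of programs must be defined and small for every `k`, while the reductions exist only
    -- for good parameters; elsewhere empty programs are used.
    by_cases hgood : (P k).Admissible (ε k) ∧ 240 ≤ smoothing (P k).n (ε k) ∧
        (P k).lawRatio (ε k) ^ ((A k).code.length + 1) ≤ 3 ∧ (P k).restartProb ≤ 1 / 8 ∧ 2 * (P k).β < (P k).Q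
    · obtain ⟨h1, h2, h3, h4, h5⟩ := hgood
      obtain ⟨D, S, S', hD, hS, hS', h⟩ :=
        h1.exists_reductions h2 (A k) (hbalance k).1 (hbalance k).2 h3 h4 h5
      exact ⟨D, S, S', hT, hD, hS, hS', fun hβ => by rw [hT' _ _ hβ, ENNReal.toReal_one],
        fun _ _ _ _ _ => h⟩
    · refine ⟨⟨0, [], []⟩, ⟨0, [], []⟩, ⟨0, [], []⟩, hT, ?_, ?_, ?_,
        fun hβ => by rw [hT' _ _ hβ, ENNReal.toReal_one],
        fun h1 h2 h3 h4 h5 => absurd ⟨h1, h2, h3, h4, h5⟩ hgood⟩ <;> simp [Program.size]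
  choose T D S S' hT hD hS hS' h1 h2 using key
  have hc := PolyBounded.const
  have hsol : ∀ c, PolyBounded c → PolyBounded fun k => Params.solverCost (P k).n (P k).Q.size (c k) :=
    fun c hc' => ((((polyBounded_simCost hn hc').add ((hn.mul hQ).mul ((hc 2).mul (hn.mul ((hn.mul (hc 4)).add
      (hc 3)))))).add (((hc 20).mul hn).mul hn)).add ((hc 20).mul hn)).add (hc 100)
  exact ⟨T, D, S, S', .of_le (hw.add ((hc 2).mul ((hc 3).mul hn))) hT,
    .of_le (hw.add (((hsim.add (((hc 50).mul hn).mul hn)).add ((hc 100).mul hn)).add (hc 100))) hD,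
    .of_le (hw.add (hsol _ hN)) hS, .of_le (hw.add (hsol _ (hc 0))) hS', h1, h2⟩

/-- The parameters are eventually admissible. -/
theorem eventually_admissible {P : ℕ → Params} {ε : ℕ → ℝ} {N : ℕ → ℕ} (hn : PolyBounded fun k => (P k).n)
    (hN : PolyBounded N) (hε : ∀ k, 0 < ε k) (hεneg : Negligible ε)
    (hr : ∀ k, (P k).q * smoothing (P k).n (ε k) ≤ (P k).r)
    (hs : ∀ k, 0 < (P k).s ∧ ((P k).r ^ 2 + smoothing (P k).n (ε k) ^ 2) *
      (2 * (P k).α ^ 2 * ((P k).a + (P k).b) + 2) ≤ (P k).s ^ 2)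
    (hkey : ∀ k, 0 < (P k).trialProb) :
    ∀ᶠ k in atTop, (P k).Admissible (ε k) ∧ 240 ≤ smoothing (P k).n (ε k) ∧
      (P k).lawRatio (ε k) ^ (N k + 1) ≤ 3 := by
  have hc := PolyBounded.const
  have hN1 := hN.add (hc 1)
  filter_upwards [(Negligible.poly_mul (((hc 8).mul hn).mul (hN1.mul hN1)) hεneg).eventually_le
    (δ := 1 / 64) (by norm_num), hεneg.eventually_le (Real.exp_pos (-Real.pi * 240 ^ 2))] with k h1 h2
  obtain ⟨h3, h4, h5⟩ := (P k).lawRatio_pow_le (N := N k) (hε k) (by push_cast at h1 ⊢; linarith)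
  refine ⟨⟨hε k, h3, h4, hr k, (hs k).1, (hs k).2, hkey k⟩, ?_, h5⟩
  have hn1 : (1 : ℝ) ≤ (P k).n := by exact_mod_cast NeZero.one_le
  -- A small `ε` forces a large smoothing parameter. The value `240 = 4 * 60` makes `60 / s ≤ 1/4`.
  have h6 := (exp_smoothing_le (n := (P k).n) (hε k)).trans
    ((div_le_self (hε k).le (by linarith)).trans h2)
  rw [Real.exp_le_exp] at h6
  refine (pow_le_pow_iff_left₀ (by norm_num) (smoothing_spec (hε k)).1.le two_ne_zero).1 ?_
  nlinarith [Real.pi_pos]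

/-- The bound on the success of a forger is negligible. -/
theorem negligible_forgeBound {P : ℕ → Params} {A : ℕ → Program Oracle} {D S S' : ℕ → Program Empty}
    (hn : PolyBounded fun k => (P k).n) (hQ : PolyBounded fun k => Nat.size (P k).Q)
    (hN : PolyBounded fun k => (A k).code.length)
    (hsalt : Negligible fun k => ((2 : ℝ) ^ (P k).saltLen)⁻¹)
    (hkey : Noticeable fun k => (P k).trialProb) (hβ : Negligible fun k => (P k).restartProb)
    (hD : Negligible fun k => |acceptProb (rlweReal 1 (P k).Q (P k).χ) (D k) -
      acceptProb (rlweUniform (P k).n 1 (P k).Q) (D k)|)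
    (hS : Negligible fun k => (rsisExperiment (P k).n 3 (P k).Q (P k).γ (2 * (P k).β) (S k) true).toReal)
    (hS' : Negligible fun k => (rsisExperiment (P k).n 3 (P k).Q (P k).γ (2 * (P k).β) (S' k) true).toReal) :
    Negligible fun k => (P k).forgeBound (A k) (D k) (S k) (S' k) := by
  obtain ⟨B, hB⟩ := hkey
  have hc := PolyBounded.const
  have hN1 := hN.add (hc 1)
  have hBp : PolyBounded fun k => B.eval k := ⟨B, fun _ => le_rfl⟩
  have hb := (hc 2).mul ((hn.mul hQ).add (hc 1))
  have h1 := (((hS.poly_mul hb).add' hD).poly_mul (hn.mul (hc 2))).poly_mul (((hc 25).mul (hn.add (hc 1))).mul hBp)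
  have h2 := (h1.add' (hβ.poly_mul hN1)).poly_mul (hc 3)
  have h3 := (((hsalt.poly_mul hN).add' (hβ.poly_mul (hc 3))).add' (hS'.poly_mul ((hc 2).mul hb))).poly_mul hN1
  refine (h2.add' h3).of_le (.of_forall fun k => ?_)
  have hpos : 0 < (P k).trialProb := pos_of_mul_pos_right (zero_lt_one.trans_le (hB k)) (Nat.cast_nonneg _)
  -- That a trial succeeds with noticeable probability is what keeps the loss from conditioning on
  -- success polynomial.
  have hinv : 25 * (((P k).n : ℝ) + 1) / (P k).trialProb ≤ ((25 * ((P k).n + 1) * B.eval k : ℕ) : ℝ) := by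
    rw [div_le_iff₀ hpos]
    push_cast
    have := hB k
    have h4 : (0 : ℝ) ≤ 25 * (((P k).n : ℝ) + 1) := by positivity
    push_cast at this h4
    nlinarith
  have hrest0 : 0 ≤ (P k).restartProb := ENNReal.toReal_nonneg
  unfold Params.forgeBound
  rw [abs_of_nonneg (by positivity)]
  refine add_le_add ?_ (le_of_eq (by push_cast; ring))
  rw [Nat.cast_ofNat]
  gcongr

end Eagle

theorem mainTheorem5 (P : ℕ → Eagle.Params) (ε : ℕ → ℝ)
    (hn : Eagle.PolyBounded fun k => (P k).n)
    (hQ : Eagle.PolyBounded fun k => Nat.size (P k).Q)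
    (hsalt : Eagle.Negligible fun k => ((2 : ℝ) ^ (P k).saltLen)⁻¹)
    (hweight : ∀ k, 0 < (P k).a + (P k).b ∧ (P k).a + (P k).b ≤ (P k).n)
    (hbalance : ∀ k, (P k).a ≤ (P k).b + 1 ∧ (P k).b ≤ (P k).a + 1)
    (hε : ∀ k, 0 < ε k)
    (hεneg : Eagle.Negligible ε)
    (hr : ∀ k, (P k).q * Eagle.smoothing (P k).n (ε k) ≤ (P k).r)
    (hs : ∀ k, 0 < (P k).s ∧
      ((P k).r ^ 2 + Eagle.smoothing (P k).n (ε k) ^ 2) *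
        (2 * (P k).α ^ 2 * ((P k).a + (P k).b) + 2) ≤ (P k).s ^ 2)
    (hkey : Eagle.Noticeable fun k => (P k).trialProb)
    (hβ : Eagle.Negligible fun k => (P k).restartProb)
    (hRSIS : Eagle.RSISHard (fun k => (P k).n) 3 (fun k => (P k).Q) (fun k => (P k).γ)
      (fun k => 2 * (P k).β))
    (hRLWE : Eagle.RLWEHard (fun k => (P k).n) 1 (fun k => (P k).Q) (fun k => (P k).χ)) :
    Eagle.StronglyUnforgeable P := by
  intro A hA
  have hpos : ∀ k, 0 < (P k).trialProb := by
    obtain ⟨B, hB⟩ := hkey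
    exact fun k => pos_of_mul_pos_right (zero_lt_one.trans_le (hB k)) (Nat.cast_nonneg _)
  have hN : Eagle.PolyBounded fun k => (A k).code.length := hA.of_le fun k => (A k).length_le_size
  obtain ⟨T, D, S, S', hT, hD, hS, hS', hT1, hbound⟩ :=
    Eagle.exists_reduction_families (ε := ε) hn hQ hA hbalance
  refine (Eagle.negligible_forgeBound hn hQ hN hsalt hkey hβ (hRLWE D hD) (hRSIS S hS) (hRSIS S' hS')).of_le ?_
  filter_upwards [Eagle.eventually_admissible hn hN hε hεneg hr hs hpos,
    hβ.eventually_le (δ := 1 / 8) (by norm_num), (hRSIS T hT).eventually_le (δ := 1 / 2) (by norm_num)]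
    with k h1 h2 h3
  rw [abs_of_nonneg (show 0 ≤ (P k).forgeProb (A k) from ENNReal.toReal_nonneg)]
  -- If `Q ≤ 2 β`, the trivial solver would succeed with probability one, whereas its success
  -- probability is eventually at most `1/2`.
  refine hbound k h1.1 h1.2.1 h1.2.2 h2 (lt_of_not_ge fun h4 => ?_)
  rw [hT1 k h4] at h3
  norm_num at h3
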